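/- **Setting.** Let $M\in\mathbb R^{m\times n}$ have rank $r\ge 1$ and singular value decomposition $M=U\,\mathrm{diag}(\sigma_1\ge\dots\ge\sigma_r>0)\,V^\top$ ($U\in\mathbb R^{m\times r}$, $V\in\mathbb R^{n\times r}$ with orthonormal columns). Put $\kappa=\sigma_1/\sigma_r$, $\mu=\max\bigl(\sqrt{m/r}\,\|U\|_{2\to\infty},\sqrt{n/r}\,\|V\|_{2\to\infty}\bigr)$, where $\|\cdot\|_{2\to\infty}$ is the largest Euclidean norm of a row, and $\|M\|_{\max}=\max_{i,j}|M_{i,j}|$. In round $t=1,\dots,T$ a context $i_t\in[m]$ is drawn from a known distribution $\rho$ with $\rho_{\min}=\min_i\rho_i>0$ and revealed, the learner plays an arm $j_t\in[n]$ and observes $M_{i_t,j_t}+\xi_t$. The contexts are i.i.d., the noise variables $\xi_t$ are i.i.d. and $\sigma$-subgaussian ($\mathbb E e^{s\xi_t}\le e^{\sigma^2s^2/2}$ for all $s$; $\sigma>0$), and contexts, noise and the learner's randomization are independent. Put $L=\|M\|_{\max}\vee\sigma$. The (expected) regret is $R(T)=\mathbb E\sum_{t=1}^T\bigl(\max_jM_{i_t,j}-M_{i_t,j_t}\bigr)$.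 **Algorithm RS-RMIN with exploration length $T_1\le T$.** *Phase 1.* For $t\le T_1$ play $j_t$ uniformly at random; form $\widetilde M_{i,j}=\frac{n}{T_1\rho_i}\sum_{t\le T_1}\mathbf 1\{(i_t,j_t)=(i,j)\}(M_{i,j}+\xi_t)$ and compute (by any measurable routine) a full singular value decomposition of $\widetilde M$. Let $\widehat U,\widehat V$ be the matrices of the $r$ leading left and right singular vectors, and $\widehat U_\perp,\widehat V_\perp$ those of the remaining ones. Let $\phi_{i,j}\in\mathbb R^d$, $d=r(m+n)-r^2$, consist of the entries of $\widehat U^\top e_ie_j^\top\widehat V$, $\widehat U^\top e_ie_j^\top\widehat V_\perp$ and $\widehat U_\perp^\top e_ie_j^\top\widehat V$. *Phase 2.* In the remaining $T_2=T-T_1$ rounds run SupLinUCB with arm features $x_{t,a}=\phi_{i_t,a}$, $a\in[n]$, regularization $\Lambda=\frac{\sigma^2}{mn\|M\|_{\max}^2}I_d$ and threshold $\beta=\sigma\Bigl(1+\sqrt{2\log\bigl(T_2\,n\,T\cdot(1\vee\lceil\tfrac12\log(T_2/d)\rceil)\bigr)}\Bigr)$: index sets $\Psi^1,\Psi^2,\dots$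 of rounds are initially empty. In each round $t$ start with $j=1$ and $\mathcal A=[n]$ and repeat: set $V=\Lambda+\sum_{\tau\in\Psi^j}x_{\tau,a_\tau}x_{\tau,a_\tau}^\top$, $\hat\theta=V^{-1}\sum_{\tau\in\Psi^j}x_{\tau,a_\tau}y_\tau$ ($a_\tau$ being the arm played and $y_\tau$ the reward observed in round $\tau$), $w_a=\beta\|x_{t,a}\|_{V^{-1}}$, $u_a=\langle\hat\theta,x_{t,a}\rangle+w_a$. If $w_a\le\beta\sqrt{d/T_2}$ for all $a\in\mathcal A$, play an arm maximizing $u_a$ over $\mathcal A$; else, if $w_a\le\beta2^{-j}$ for all $a\in\mathcal A$, replace $\mathcal A$ by $\{a\in\mathcal A:u_a\ge\max_{a'\in\mathcal A}u_{a'}-2^{1-j}\beta\}$ and $j$ by $j+1$; else play some $a\in\mathcal A$ with $w_a>\beta2^{-j}$ and add $t$ to $\Psi^j$. Whenever several arms are eligible, one is picked by an arbitrary fixed rule depending only on the set of eligible arms. **Theorem.** Let $$\mathcal R=\mu^2\kappa^2r^{5/4}L\,\frac{(m+n)^{3/4}(mn)^{1/4}}{\sqrt{m\rho_{\min}(m\wedge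 n)}} .$$ There are universal constants $c,C>0$ and $p\in\mathbb N$ such that for all $m,n,r$, all $T\ge1$ and all instances as above, RS-RMIN with $$T_1=T\wedge\Bigl\lceil c\,\frac{\mathcal R}{\|M\|_{\max}}\sqrt T\,\log^{3/2}(1+mnT)\,\log\Bigl(T(m+n)\tfrac{L^2}{\sigma^2}\Bigr)\Bigr\rceil$$ satisfies $$R(T)\le C\,\mathcal R\,\sqrt T\,\log^p\bigl(1+mnT\,L/\sigma\bigr),\qquad\text{i.e. } R(T)=\widetilde O\bigl(\mathcal R\sqrt T\bigr).$$ Moreover, for every $h$ there is a constant $C_h$ depending only on $h$ such that, if $M$ and $\rho$ are homogeneous with constant $h$, i.e. $r,\kappa,\mu\le h$, $m\le hn$, $n\le hm$ and $\rho_{\min}\ge 1/(hm)$, then $$R(T)\le C_h\,L\,(m+n)^{3/4}\sqrt T\,\log^p\bigl(1+mnT\,L/\sigma\bigr),\qquad\text{i.e. } R(T)=\widetilde O\bigl(L(m+n)^{3/4}\sqrt T\bigr).$$ -/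

import Mathlib

open MeasureTheory ProbabilityTheory
open scoped NNReal ENNReal Matrix

noncomputable section

namespace LowRankBandit

/-! ### Matrix quantities -/

/-- The entrywise maximum norm `max_{i,j} |A_{i,j}|`. -/
def maxNorm {m n : ℕ} (A : Matrix (Fin m) (Fin n) ℝ) : ℝ :=
  ⨆ p : Fin m × Fin n, |A p.1 p.2|

/-- The two-to-infinity norm: the largest Euclidean norm of a row. -/
def twoInfNorm {m n : ℕ} (A : Matrix (Fin m) (Fin n) ℝ) : ℝ :=
  ⨆ i : Fin m, √(∑ k, A i k ^ 2)

/-- The `m × n` matrix with `s 0, s 1, …` on its main diagonal and zeros elsewhere. -/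
def rectDiagonal (m n : ℕ) (s : ℕ → ℝ) : Matrix (Fin m) (Fin n) ℝ :=
  Matrix.of fun i j => if (i : ℕ) = (j : ℕ) then s i else 0

/-- `A = W S Zᵀ` is a full singular value decomposition of `A`: `W` and `Z` are square orthogonal
matrices and `S` is rectangular diagonal with nonnegative nonincreasing diagonal entries.  The first `r` columns of `W` (resp. `Z`) are then `r` leading left
(resp. right) singular vectors, and the remaining columns span the orthogonal complement. -/
def IsFullSVD {m n : ℕ} (A : Matrix (Fin m) (Fin n) ℝ)
    (W : Matrix (Fin m) (Fin m) ℝ) (Z : Matrix (Fin n) (Fin n) ℝ) : Prop :=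
  Wᵀ * W = 1 ∧ Zᵀ * Z = 1 ∧
    ∃ s : ℕ → ℝ, Antitone s ∧ (∀ k, 0 ≤ s k) ∧ A = W * rectDiagonal m n s * Zᵀ

/-! ### The contextual low-rank bandit -/

/-- A contextual low-rank bandit with `m` contexts, `n` arms and a reward matrix of rank `r ≥ 1`.
The reward matrix comes with a (thin) singular value decomposition `M = U diag(s) Vᵀ`, contexts
have distribution `ρ` of full support, and the noise has a `σ`-subgaussian law `ν`. -/
structure Model (m n r : ℕ) where
  M : Matrix (Fin m) (Fin n) ℝ
  U : Matrix (Fin m) (Fin r) ℝ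
  s : Fin r → ℝ
  V : Matrix (Fin n) (Fin r) ℝ
  r_pos : 0 < r
  U_orth : Uᵀ * U = 1
  V_orth : Vᵀ * V = 1
  s_pos : ∀ k, 0 < s k
  s_anti : Antitone s
  M_eq : M = U * Matrix.diagonal s * Vᵀ
  ρ : PMF (Fin m)
  ρ_pos : ∀ i, ρ i ≠ 0
  σ : ℝ≥0
  σ_pos : 0 < σ
  ν : Measure ℝ
  ν_prob : IsProbabilityMeasure ν
  ν_subgaussian : HasSubgaussianMGF (fun x : ℝ => x) (σ ^ 2) ν

namespace Model

variable {m n r : ℕ} (B : Model m n r)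

/-- The condition number `σ₁(M) / σ_r(M)`. -/
def kappa : ℝ := B.s ⟨0, B.r_pos⟩ / B.s ⟨r - 1, Nat.sub_lt B.r_pos Nat.one_pos⟩

/-- The incoherence parameter. -/
def mu : ℝ := max (√((m : ℝ) / r) * twoInfNorm B.U) (√((n : ℝ) / r) * twoInfNorm B.V)

/-- `L = ‖M‖_max ∨ σ`. -/
def L : ℝ := max (maxNorm B.M) B.σ

/-- The smallest context probability. -/
def rhoMin : ℝ := ⨅ i, (B.ρ i).toReal

/-- Homogeneity of the reward matrix and of the context distribution, with constant `h`. -/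
def IsHomogeneous (h : ℝ) : Prop :=
  (r : ℝ) ≤ h ∧ B.kappa ≤ h ∧ B.mu ≤ h ∧ (m : ℝ) ≤ h * n ∧ (n : ℝ) ≤ h * m ∧
    1 ≤ h * (m * B.rhoMin)

/-- `μ² κ² r^{5/4} L (m+n)^{3/4} (mn)^{1/4} / √(m ρ_min (m ∧ n))`. -/
def rate : ℝ :=
  B.mu ^ 2 * B.kappa ^ 2 * (r : ℝ) ^ (5 / 4 : ℝ) * B.L *
      ((m : ℝ) + n) ^ (3 / 4 : ℝ) * ((m : ℝ) * n) ^ (1 / 4 : ℝ) /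
    √(m * B.rhoMin * min (m : ℝ) n)

/-- Length of the exploration phase for the horizon `T`, with the tuning constant `c`;
it is truncated at `T`. -/
def explorationLength (c : ℝ) (T : ℕ) : ℕ :=
  min T ⌈c * (B.rate / maxNorm B.M) * √T * Real.log (1 + m * n * T) ^ (3 / 2 : ℝ) *
    Real.log (T * ((m : ℝ) + n) * (B.L ^ 2 / (B.σ : ℝ) ^ 2))⌉₊

/-- The interaction variables on a probability space: in round `t`, the context `ctx t`, the arm
`expl t` drawn uniformly (played during exploration only) and the noise `ξ t` are independent with
laws `ρ`, uniform and `ν`, and distinct rounds are independent. -/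
structure Environment {Ω : Type*} [MeasurableSpace Ω] (P : Measure Ω)
    (ctx : ℕ → Ω → Fin m) (expl : ℕ → Ω → Fin n) (ξ : ℕ → Ω → ℝ) : Prop where
  measurable_ctx : ∀ t, Measurable (ctx t)
  measurable_expl : ∀ t, Measurable (expl t)
  measurable_noise : ∀ t, Measurable (ξ t)
  indep : iIndepFun (fun t ω => (ctx t ω, expl t ω, ξ t ω)) P
  law : ∀ t, P.map (fun ω => (ctx t ω, expl t ω, ξ t ω)) =
    B.ρ.toMeasure.prod ((uniformOn (Set.univ : Set (Fin n))).prod B.ν)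

end Model

/-! ### SupLinUCB -/

section SupLinUCB

variable {ι : Type*} [Fintype ι] [DecidableEq ι] {K : ℕ}

/-- `V = lam • I + ∑ x xᵀ` over the recorded (feature, reward) pairs of one level. -/
def gram (lam : ℝ) (D : List ((ι → ℝ) × ℝ)) : Matrix ι ι ℝ :=
  lam • (1 : Matrix ι ι ℝ) + (D.map fun q => Matrix.vecMulVec q.1 q.1).sum

/-- The regularized least squares estimator `V⁻¹ ∑ y x` of one level. -/
def thetaHat (lam : ℝ) (D : List ((ι → ℝ) × ℝ)) : ι → ℝ :=
  (gram lam D)⁻¹ *ᵥ (D.map fun q => q.2 • q.1).sum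

/-- The width `β ‖x‖_{V⁻¹}`. -/
def width (lam β : ℝ) (D : List ((ι → ℝ) × ℝ)) (x : ι → ℝ) : ℝ :=
  β * √(x ⬝ᵥ ((gram lam D)⁻¹ *ᵥ x))

/-- The upper confidence bound: predicted reward plus width. -/
def ucb (lam β : ℝ) (D : List ((ι → ℝ) × ℝ)) (x : ι → ℝ) : ℝ :=
  thetaHat lam D ⬝ᵥ x + width lam β D x

open Classical in
/-- The inner loop of SupLinUCB in one round, at level `j` with candidate arms `A`; `N` is the
number of rounds, `d` the dimension, `x a` the feature of arm `a`, `Ψ j` the data recorded at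
level `j`, and `sel` picks one arm from a set of equally eligible arms.  The result is the chosen
arm and the level at which the round is to be recorded, if any.  The first natural number argument
counts the levels left. -/
def levelLoop (sel : Finset (Fin K) → Fin K) (lam β d : ℝ) (N : ℕ) (x : Fin K → ι → ℝ)
    (Ψ : ℕ → List ((ι → ℝ) × ℝ)) : ℕ → ℕ → Finset (Fin K) → Fin K × Option ℕ
  | 0, _, A => (sel A, none)
  | fuel + 1, j, A =>
    if ∀ a ∈ A, width lam β (Ψ j) (x a) ≤ β * √(d / N) then
      (sel {a ∈ A | ∀ a' ∈ A, ucb lam β (Ψ j) (x a') ≤ ucb lam β (Ψ j) (x a)}, none)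
    else if ∀ a ∈ A, width lam β (Ψ j) (x a) ≤ β * (2 : ℝ)⁻¹ ^ j then
      levelLoop sel lam β d N x Ψ fuel (j + 1)
        {a ∈ A | ∀ a' ∈ A,
          ucb lam β (Ψ j) (x a') - 2 * (2 : ℝ)⁻¹ ^ j * β ≤ ucb lam β (Ψ j) (x a)}
    else
      (sel {a ∈ A | β * (2 : ℝ)⁻¹ ^ j < width lam β (Ψ j) (x a)}, some j)

/-- The number of levels `J = ⌈log₂(N/d)/2⌉ + 1`.  Since `2^{-J} ≤ √(d/N)`, the inner loop stops at
one of the levels `1, …, J`. -/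
def numLevels (d : ℝ) (N : ℕ) : ℕ := ⌈Real.logb 2 (N / d) / 2⌉₊ + 1

/-- One round of SupLinUCB: all arms are candidates at level `1`. -/
def supLinUCBRound (sel : Finset (Fin K) → Fin K) (lam β d : ℝ) (N : ℕ) (x : Fin K → ι → ℝ)
    (Ψ : ℕ → List ((ι → ℝ) × ℝ)) : Fin K × Option ℕ :=
  levelLoop sel lam β d N x Ψ (numLevels d N) 1 Finset.univ

/-- The data recorded at each level before round `τ`; `x τ a` is the feature of arm `a` in round
`τ`, and `y τ a` the reward that is observed in round `τ` if arm `a` is played. -/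
def supLinUCBState (sel : Finset (Fin K) → Fin K) (lam β d : ℝ) (N : ℕ)
    (x : ℕ → Fin K → ι → ℝ) (y : ℕ → Fin K → ℝ) : ℕ → ℕ → List ((ι → ℝ) × ℝ)
  | 0 => fun _ => []
  | τ + 1 =>
    let Ψ := supLinUCBState sel lam β d N x y τ
    let q := supLinUCBRound sel lam β d N (x τ) Ψ
    fun j => if q.2 = some j then (x τ q.1, y τ q.1) :: Ψ j else Ψ j

/-- The arm played by SupLinUCB in round `τ`. -/
def supLinUCBArm (sel : Finset (Fin K) → Fin K) (lam β d : ℝ) (N : ℕ)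
    (x : ℕ → Fin K → ι → ℝ) (y : ℕ → Fin K → ℝ) (τ : ℕ) : Fin K :=
  (supLinUCBRound sel lam β d N (x τ) (supLinUCBState sel lam β d N x y τ)).1

end SupLinUCB

/-! ### RS-RMIN -/

/-- Coordinates of the features: pairs of singular directions of which at least one is among the
first `r`. -/
abbrev FeatureIndex (m n r : ℕ) : Type :=
  {q : Fin m × Fin n // (q.1 : ℕ) < r ∨ (q.2 : ℕ) < r}

theorem card_featureIndex {m n r : ℕ} (hm : r ≤ m) (hn : r ≤ n) :
    (Fintype.card (FeatureIndex m n r) : ℤ) = r * (m + n) - r ^ 2 := by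
  have hc : ∀ k : ℕ, r ≤ k →
      (Finset.univ.filter fun a : Fin k => ¬ (a : ℕ) < r).card = k - r := by
    intro k hk
    have h1 : (Finset.univ.filter fun a : Fin k => (a : ℕ) < r).card = r := by
      simp [Fin.card_filter_val_lt, hk]
    have h2 := Finset.card_filter_add_card_filter_not (s := (Finset.univ : Finset (Fin k)))
      (fun a : Fin k => (a : ℕ) < r)
    simp only [Finset.card_univ, Fintype.card_fin] at h2
    omega
  have h := Finset.card_filter_add_card_filter_not
    (s := (Finset.univ : Finset (Fin m × Fin n)))
    (fun q : Fin m × Fin n => (q.1 : ℕ) < r ∨ (q.2 : ℕ) < r)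
  have he : (Finset.univ.filter fun q : Fin m × Fin n => ¬ ((q.1 : ℕ) < r ∨ (q.2 : ℕ) < r)) =
      (Finset.univ.filter fun a : Fin m => ¬ (a : ℕ) < r) ×ˢ
        (Finset.univ.filter fun b : Fin n => ¬ (b : ℕ) < r) := by
    ext q
    simp [not_or]
  rw [he, Finset.card_product, hc m hm, hc n hn, Finset.card_univ, Fintype.card_prod,
    Fintype.card_fin, Fintype.card_fin] at h
  rw [Fintype.card_subtype]
  generalize (Finset.univ.filter
    fun q : Fin m × Fin n => (q.1 : ℕ) < r ∨ (q.2 : ℕ) < r).card = N at h ⊢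
  zify [hm, hn] at h
  linarith

/-- The feature of `(i, j)`: with `W = [Û, Û⊥]` and `Z = [V̂, V̂⊥]`, the entries of
`Ûᵀ eᵢ eⱼᵀ V̂`, `Ûᵀ eᵢ eⱼᵀ V̂⊥` and `Û⊥ᵀ eᵢ eⱼᵀ V̂`. -/
def feature {m n : ℕ} (r : ℕ) (W : Matrix (Fin m) (Fin m) ℝ) (Z : Matrix (Fin n) (Fin n) ℝ)
    (i : Fin m) (j : Fin n) : FeatureIndex m n r → ℝ :=
  fun q => W i q.1.1 * Z j q.1.2

/-- The dimension `r(m+n) - r²` of the misspecified linear bandit. -/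
def dim (m n r : ℕ) : ℝ := (r : ℝ) * (m + n) - (r : ℝ) ^ 2

/-- The inverse-propensity estimate of the reward matrix from the first `T₁` rounds, in which
context `i` and arm `j` occur together with probability `ω_{i,j} = ρ_i / n`.  Here `c t` is the
context, `e t` the arm and `y t j` the reward that is observed in round `t` if arm `j` is played. -/
def empiricalMatrix {m n : ℕ} (ρ : PMF (Fin m)) (T₁ : ℕ) (c : ℕ → Fin m) (e : ℕ → Fin n)
    (y : ℕ → Fin n → ℝ) : Matrix (Fin m) (Fin n) ℝ :=
  Matrix.of fun i j =>
    (T₁ * ((ρ i).toReal / n))⁻¹ *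
      ∑ t ∈ Finset.range T₁, if c t = i ∧ e t = j then y t j else 0

/-- The arm played by RS-RMIN in round `t` (rounds are numbered from `0`): the uniformly drawn arm
`e t` in the first `T₁` rounds, and then SupLinUCB over the remaining `T₂` rounds with the features
built from the singular vectors `svd M̃` of the exploration estimate `M̃`. -/
def rsRminArm {m n : ℕ} (r : ℕ) (ρ : PMF (Fin m))
    (svd : Matrix (Fin m) (Fin n) ℝ → Matrix (Fin m) (Fin m) ℝ × Matrix (Fin n) (Fin n) ℝ)
    (sel : Finset (Fin n) → Fin n) (lam β : ℝ) (T₁ T₂ : ℕ)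
    (c : ℕ → Fin m) (e : ℕ → Fin n) (y : ℕ → Fin n → ℝ) (t : ℕ) : Fin n :=
  if t < T₁ then e t
  else
    let F := svd (empiricalMatrix ρ T₁ c e y)
    supLinUCBArm sel lam β (dim m n r) T₂
      (fun τ j => feature r F.1 F.2 (c (T₁ + τ)) j) (fun τ => y (T₁ + τ)) (t - T₁)

/-- A measurable routine that returns a singular value decomposition of every matrix. -/
def IsSVDRoutine {m n : ℕ}
    (svd : Matrix (Fin m) (Fin n) ℝ → Matrix (Fin m) (Fin m) ℝ × Matrix (Fin n) (Fin n) ℝ) :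
    Prop :=
  (∀ A, IsFullSVD A (svd A).1 (svd A).2) ∧
    (∀ i k, Measurable fun A : Fin m → Fin n → ℝ => (svd (Matrix.of A)).1 i k) ∧
    (∀ j k, Measurable fun A : Fin m → Fin n → ℝ => (svd (Matrix.of A)).2 j k)

namespace Model

variable {m n r : ℕ} (B : Model m n r)

/-- The regularization `σ² / (mn ‖M‖_max²)` of SupLinUCB. -/
def regularization : ℝ := (B.σ : ℝ) ^ 2 / (m * n * maxNorm B.M ^ 2)

/-- The threshold `σ (1 + √(2 log((T₂ n / δ) ⌈log(T₂ / d) / 2⌉)))` of SupLinUCB over `T₂` rounds,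
with confidence level `δ = 1 / T`; the ceiling is replaced by `1` if it is smaller than `1`. -/
def threshold (T T₂ : ℕ) : ℝ :=
  B.σ * (1 + √(2 * Real.log (T₂ * n * T * max 1 ⌈Real.log (T₂ / dim m n r) / 2⌉₊)))

/-- The arm played in round `t` by RS-RMIN with horizon `T` and tuning constant `c`. -/
def arm {Ω : Type*} (c : ℝ) (T : ℕ)
    (svd : Matrix (Fin m) (Fin n) ℝ → Matrix (Fin m) (Fin m) ℝ × Matrix (Fin n) (Fin n) ℝ)
    (sel : Finset (Fin n) → Fin n)
    (ctx : ℕ → Ω → Fin m) (expl : ℕ → Ω → Fin n) (ξ : ℕ → Ω → ℝ) (t : ℕ) (ω : Ω) : Fin n :=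
  let T₁ := B.explorationLength c T
  let T₂ := T - T₁
  rsRminArm r B.ρ svd sel B.regularization (B.threshold T T₂) T₁ T₂
    (fun t => ctx t ω) (fun t => expl t ω) (fun t j => B.M (ctx t ω) j + ξ t ω) t

/-- The regret accumulated over `T` rounds along the outcome `ω` by the arms `a`. -/
def regret {Ω : Type*} (ctx : ℕ → Ω → Fin m) (a : ℕ → Ω → Fin n) (T : ℕ) (ω : Ω) : ℝ :=
  ∑ t ∈ Finset.range T, ((⨆ j, B.M (ctx t ω) j) - B.M (ctx t ω) (a t ω))

end Model

end LowRankBandit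

end

set_option linter.unusedSectionVars false

/-! ### Deterministic perturbation of singular subspaces. -/

noncomputable section

namespace LowRankBandit

open scoped Matrix.Norms.L2Operator

/-! ### Operator norms of real matrices -/

section OperatorNorm

variable {l m n r : Type*} [Fintype l] [Fintype m] [Fintype n] [Fintype r]
  [DecidableEq l] [DecidableEq m] [DecidableEq n] [DecidableEq r]

/-! Let `E` be the error of the exploration estimate, `P` and `Q` the projections onto the estimated
leading singular subspaces, and `δ = ‖E‖ / σ_r`. The features represent every block of `M` in the
estimated bases except `(1 - P) M (1 - Q)`. This block factors through `(1 - P) U` and `(1 - Q) V`,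
so its entries are quadratic in the row-wise subspace errors. If every row of these errors is at
most the row bound `u = μ √(r / (m ∧ n))` times a relative error of order `T₁ ^ (-1/2)`, the linear
bandit of dimension `d ≤ r (m + n)` in the second phase is misspecified by `ε` of order `1 / T₁`,
and SupLinUCB pays about `L √(d T) + ε T √d`. With the constants inserted, the second term is at
most about `T R² / (‖M‖_max T₁)`, where `R` is the rate. It balances the exploration cost `T₁
‖M‖_max` at `T₁ = R √T / ‖M‖_max`, where both equal `R √T`; the first term is smaller because `L √(r
(m + n)) ≤ R`.

The row-wise bound rests on the exact identity `compl_eq`. Used once for `U` and once for `V`, it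
reduces a row of `(1 - P) U` to the same row of `E V` and of `E Eᵀ U`, up to third-order terms and
terms proportional to the row of `U` (`row_bound`). A row of `E V` is a sum of independent terms,
handled by Bernstein's inequality (`measure_sampleErr_mulVec_le`). In `E Eᵀ U` row `i` of `E` meets
the other rows; given the contexts these come from disjoint rounds and are independent, so Bernstein
applies again after freezing the other rounds (`measure_offRow_le`).

For the operator norm only the second moment is estimated, by symmetrization and a noncommutative
Khintchine inequality (`lintegral_norm_sampleErr_le`). This suffices: the misspecification is linear
in `δ²`, so its mean is what counts, and the failure probability supplied by Markov's inequality
costs no more than the misspecification itself (`maxNorm_div_errTol_le`).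

In SupLinUCB the rounds and features recorded at a level do not depend on the rewards recorded there
(`state_agree`). Hence the noise in the estimate of a level is controlled as if the design were
deterministic (`measure_noise_gt_le`). Elimination then keeps the gap of the surviving arms of order
`2^{-j}` (`levelLoop_regret`), and the elliptical potential limits the number of rounds of a level
(`card_recorded_le`). The noise of the second phase is independent of the contexts and of the
exploration data, so the features may be regarded as fixed when it is integrated
(`Environment.lintegral_exploitLoss`). -/

theorem norm_transpose (A : Matrix m n ℝ) : ‖Aᵀ‖ = ‖A‖ := by
  rw [← Matrix.conjTranspose_eq_transpose_of_trivial, Matrix.l2_opNorm_conjTranspose]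

theorem norm_transpose_mul_self (A : Matrix m n ℝ) : ‖Aᵀ * A‖ = ‖A‖ ^ 2 := by
  rw [← Matrix.conjTranspose_eq_transpose_of_trivial, Matrix.l2_opNorm_conjTranspose_mul_self, sq]

theorem norm_one_le : ‖(1 : Matrix m m ℝ)‖ ≤ 1 := by
  rw [← Matrix.diagonal_one, Matrix.l2_opNorm_diagonal]
  exact (pi_norm_le_iff_of_nonneg zero_le_one).2 fun i => by simp

theorem norm_le_one_of_orthonormal {A : Matrix m n ℝ} (h : Aᵀ * A = 1) : ‖A‖ ≤ 1 := by
  have h1 := norm_transpose_mul_self A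
  rw [h] at h1
  have h2 : ‖A‖ ^ 2 ≤ 1 := h1 ▸ norm_one_le
  exact (sq_le_one_iff₀ (norm_nonneg _)).1 h2

theorem norm_le_one_of_projection {A : Matrix m m ℝ} (h : Aᵀ * A = A) : ‖A‖ ≤ 1 := by
  have h1 := norm_transpose_mul_self A
  rw [h] at h1
  nlinarith [norm_nonneg A]

theorem norm_mul_le_left {A : Matrix l m ℝ} {B : Matrix m n ℝ} (hB : ‖B‖ ≤ 1) :
    ‖A * B‖ ≤ ‖A‖ :=
  (Matrix.l2_opNorm_mul A B).trans (mul_le_of_le_one_right (norm_nonneg _) hB)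

theorem norm_mul_le_right {A : Matrix l m ℝ} {B : Matrix m n ℝ} (hA : ‖A‖ ≤ 1) :
    ‖A * B‖ ≤ ‖B‖ :=
  (Matrix.l2_opNorm_mul A B).trans (mul_le_of_le_one_left (norm_nonneg _) hA)

theorem orthProj_compl_projection {A : Matrix m r ℝ} (h : Aᵀ * A = 1) :
    (1 - A * Aᵀ)ᵀ * (1 - A * Aᵀ) = 1 - A * Aᵀ := by
  have h1 : A * Aᵀ * (A * Aᵀ) = A * Aᵀ := by
    rw [Matrix.mul_assoc, ← Matrix.mul_assoc Aᵀ, h, Matrix.one_mul]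
  simp [Matrix.transpose_sub, Matrix.transpose_mul, Matrix.sub_mul, Matrix.mul_sub, h1]

/-- If the column spaces of `A` and `U` are close, then a row vector of the column space of `A` is
controlled by its product with the projection of `U`. -/
theorem norm_mul_le_two_mul_norm_mul_projection {A U : Matrix m r ℝ} (hA : Aᵀ * A = 1)
    (hU : Uᵀ * U = 1) (h : ‖U - A * Aᵀ * U‖ ≤ 1 / 2) (x : Matrix l m ℝ) :
    ‖x * A‖ ≤ 2 * ‖x * (A * Aᵀ * U)‖ := by
  set G : Matrix r r ℝ := Aᵀ * U with hG
  have hGn : ‖Gᵀ‖ ≤ 1 := by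
    rw [norm_transpose]
    exact (norm_mul_le_left (norm_le_one_of_orthonormal hU)).trans
      (by rw [norm_transpose]; exact norm_le_one_of_orthonormal hA)
  -- As `1 - A * Aᵀ` is a projection, the defect of `G` from orthogonality is the Gram matrix of the
  -- subspace error. It is therefore at most the square of `1 / 2`, and a Neumann series inverts `Gᵀ
  -- * G`.
  have hK : 1 - Gᵀ * G = (U - A * Aᵀ * U)ᵀ * (U - A * Aᵀ * U) := by
    have h1 : (U - A * Aᵀ * U) = (1 - A * Aᵀ) * U := by rw [Matrix.sub_mul, Matrix.one_mul]
    rw [h1, Matrix.transpose_mul (1 - A * Aᵀ) U, Matrix.mul_assoc Uᵀ, ← Matrix.mul_assoc (1 - A * Aᵀ)ᵀ,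
      orthProj_compl_projection hA, Matrix.sub_mul, Matrix.mul_sub, Matrix.one_mul, hU, hG,
      Matrix.transpose_mul, Matrix.transpose_transpose]
    simp only [Matrix.mul_assoc]
  have hKn : ‖1 - Gᵀ * G‖ ≤ 1 / 4 := by
    rw [hK, norm_transpose_mul_self]
    nlinarith [norm_nonneg (U - A * Aᵀ * U)]
  obtain ⟨u, hu⟩ : IsUnit (Gᵀ * G) := by
    have := isUnit_one_sub_of_norm_lt_one (x := 1 - Gᵀ * G) (lt_of_le_of_lt hKn (by norm_num))
    simpa using this
  set Y : Matrix r r ℝ := ↑u⁻¹ with hY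
  have hYK : Gᵀ * G * Y = 1 := by rw [← hu, hY]; exact u.mul_inv
  have hYn : ‖Y‖ ≤ 2 := by
    have h1 : Y = 1 + (1 - Gᵀ * G) * Y := by rw [Matrix.sub_mul, hYK]; simp
    have h2 : ‖Y‖ ≤ 1 + 1 / 4 * ‖Y‖ := by
      calc ‖Y‖ = ‖1 + (1 - Gᵀ * G) * Y‖ := by rw [← h1]
        _ ≤ ‖(1 : Matrix r r ℝ)‖ + ‖(1 - Gᵀ * G) * Y‖ := norm_add_le _ _
        _ ≤ 1 + 1 / 4 * ‖Y‖ := add_le_add norm_one_le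
          ((Matrix.l2_opNorm_mul _ _).trans (mul_le_mul_of_nonneg_right hKn (norm_nonneg _)))
    linarith
  -- All factors are square of the same size, so the right inverse `G * Y` of `Gᵀ` is also a left
  -- inverse.
  have hGY : G * Y * Gᵀ = 1 := by
    rw [mul_eq_one_comm, ← Matrix.mul_assoc, hYK]
  have hx : x * A = x * (A * Aᵀ * U) * (Y * Gᵀ) := by
    calc x * A = x * A * (G * Y * Gᵀ) := by rw [hGY, Matrix.mul_one]
      _ = _ := by rw [hG]; simp only [Matrix.mul_assoc]
  rw [hx]
  refine (Matrix.l2_opNorm_mul _ _).trans ?_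
  rw [mul_comm]
  exact mul_le_mul_of_nonneg_right ((norm_mul_le_left hGn).trans hYn) (norm_nonneg _)

end OperatorNorm

/-! ### Perturbation of singular subspaces -/

section Perturbation

variable {l m n r : Type*} [Fintype l] [Fintype m] [Fintype n] [Fintype r]
  [DecidableEq l] [DecidableEq m] [DecidableEq n] [DecidableEq r]

/-- `(Uh, Vh)` span singular subspaces of the perturbation `U S Vᵀ + E` of a matrix with singular
value decomposition `U S Vᵀ`, and they carry all of it up to an error of the order of `E`. -/
structure IsPerturbedSubspace (E : Matrix m n ℝ) (U Uh : Matrix m r ℝ) (V Vh : Matrix n r ℝ)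
    (S Si : Matrix r r ℝ) : Prop where
  hU : Uᵀ * U = 1
  hV : Vᵀ * V = 1
  hUh : Uhᵀ * Uh = 1
  hVh : Vhᵀ * Vh = 1
  hS : S * Si = 1
  hSt : Sᵀ = S
  comm : (U * S * Vᵀ + E) * (Vh * Vhᵀ) = Uh * Uhᵀ * (U * S * Vᵀ + E)
  resid : ‖(1 - Uh * Uhᵀ) * (U * S * Vᵀ + E)‖ ≤ ‖E‖

namespace IsPerturbedSubspace

variable {E : Matrix m n ℝ} {U Uh : Matrix m r ℝ} {V Vh : Matrix n r ℝ} {S Si : Matrix r r ℝ}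

/-- By `comm` the left residual `(1 - P) A` of the perturbed matrix `A` equals its right residual `A
(1 - Q)`, so the conditions are symmetric in the two sides. -/
theorem transpose (h : IsPerturbedSubspace E U Uh V Vh S Si) :
    IsPerturbedSubspace Eᵀ V Vh U Uh S Si where
  hU := h.hV
  hV := h.hU
  hUh := h.hVh
  hVh := h.hUh
  hS := h.hS
  hSt := h.hSt
  comm := by
    have := congrArg Matrix.transpose h.comm
    simp only [Matrix.transpose_mul, Matrix.transpose_add, Matrix.transpose_transpose, h.hSt]
      at this
    simpa only [Matrix.mul_assoc] using this.symm
  resid := by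
    have h1 : (1 - Vh * Vhᵀ) * (V * S * Uᵀ + Eᵀ) =
        ((1 - Uh * Uhᵀ) * (U * S * Vᵀ + E))ᵀ := by
      rw [Matrix.sub_mul, Matrix.one_mul, Matrix.sub_mul, ← h.comm]
      simp only [Matrix.transpose_mul, Matrix.transpose_add, Matrix.transpose_transpose, h.hSt,
        Matrix.transpose_sub, Matrix.one_mul]
      simp only [Matrix.mul_assoc]
    rw [h1, norm_transpose, norm_transpose]
    exact h.resid

/-- Wedin's argument: multiplying `U S Vᵀ = A - E` by `V * Si` expresses `U` through `A` and `E`,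
and after the projection `1 - P` both have norm at most `‖E‖`. -/
theorem norm_compl_le (h : IsPerturbedSubspace E U Uh V Vh S Si) {σr : ℝ} (hSi : ‖Si‖ ≤ 1 / σr) :
    ‖(1 - Uh * Uhᵀ) * U‖ ≤ 2 * (‖E‖ / σr) := by
  have h1 : (1 - Uh * Uhᵀ) * U =
      ((1 - Uh * Uhᵀ) * (U * S * Vᵀ + E) - (1 - Uh * Uhᵀ) * E) * V * Si := by
    rw [← Matrix.mul_sub, add_sub_cancel_right]
    simp only [Matrix.mul_assoc]
    rw [← Matrix.mul_assoc Vᵀ, h.hV, Matrix.one_mul, h.hS, Matrix.mul_one]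
  have hP : ‖1 - Uh * Uhᵀ‖ ≤ 1 := norm_le_one_of_projection (orthProj_compl_projection h.hUh)
  rw [h1]
  calc _ ≤ ‖((1 - Uh * Uhᵀ) * (U * S * Vᵀ + E) - (1 - Uh * Uhᵀ) * E) * V‖ * ‖Si‖ :=
        Matrix.l2_opNorm_mul _ _
    _ ≤ (‖E‖ + ‖E‖) * (1 / σr) := by
        refine mul_le_mul ((norm_mul_le_left (norm_le_one_of_orthonormal h.hV)).trans
          ((norm_sub_le _ _).trans (add_le_add h.resid (norm_mul_le_right hP)))) hSi
          (norm_nonneg _) (by positivity)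
    _ = _ := by ring

/-- A fixed-point equation for the subspace error. It is `(1 - P) A Q = 0` multiplied by `V`, with
`Vᵀ Q V` written as the identity minus the Gram matrix of `(1 - Q) V`; thus the error of the other
side enters only quadratically. -/
theorem compl_eq (h : IsPerturbedSubspace E U Uh V Vh S Si) :
    (1 - Uh * Uhᵀ) * U = (1 - Uh * Uhᵀ) * U *
        (S * (((1 - Vh * Vhᵀ) * V)ᵀ * ((1 - Vh * Vhᵀ) * V)) * Si) -
      (1 - Uh * Uhᵀ) * E * (Vh * Vhᵀ * V) * Si := by
  have h0 : (1 - Uh * Uhᵀ) * (U * S * Vᵀ + E) * (Vh * Vhᵀ) = 0 := by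
    rw [Matrix.mul_assoc, h.comm, ← Matrix.mul_assoc]
    have : (1 - Uh * Uhᵀ) * (Uh * Uhᵀ) = 0 := by
      rw [Matrix.sub_mul, Matrix.one_mul, Matrix.mul_assoc Uh Uhᵀ, ← Matrix.mul_assoc Uhᵀ, h.hUh,
        Matrix.one_mul, sub_self]
    rw [this, Matrix.zero_mul]
  have h2 : Vᵀ * (Vh * Vhᵀ * V) = 1 - ((1 - Vh * Vhᵀ) * V)ᵀ * ((1 - Vh * Vhᵀ) * V) := by
    rw [Matrix.transpose_mul, Matrix.mul_assoc Vᵀ, ← Matrix.mul_assoc (1 - Vh * Vhᵀ)ᵀ,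
      orthProj_compl_projection h.hVh, Matrix.sub_mul, Matrix.mul_sub, Matrix.one_mul, h.hV]
    abel
  have h3 : (1 - Uh * Uhᵀ) * U * S * (Vᵀ * (Vh * Vhᵀ * V)) =
      - ((1 - Uh * Uhᵀ) * E * (Vh * Vhᵀ * V)) := by
    rw [eq_neg_iff_add_eq_zero]
    have h4 := congrArg (· * V) h0
    simp only [Matrix.mul_add, Matrix.add_mul, Matrix.zero_mul] at h4
    simpa only [Matrix.mul_assoc] using h4
  rw [h2, Matrix.mul_sub, Matrix.mul_one, sub_eq_iff_eq_add] at h3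
  have h5 := congrArg (· * Si) h3
  simp only [Matrix.add_mul, Matrix.neg_mul] at h5
  have h6 : (1 - Uh * Uhᵀ) * U * S * Si = (1 - Uh * Uhᵀ) * U := by
    rw [Matrix.mul_assoc, h.hS, Matrix.mul_one]
  rw [h6] at h5
  rw [neg_add_eq_sub] at h5
  refine h5.trans ?_
  simp only [Matrix.mul_assoc]

/-- By `hκ` the self-referential term of `compl_eq` is a contraction with factor `1 / 16` and can be
absorbed. The matrix `x` of rows is left arbitrary because `row_bound` uses both `e` and `e * E`. -/
theorem norm_mul_compl_le (h : IsPerturbedSubspace E U Uh V Vh S Si) {σ₁ σr : ℝ} (hσ : 0 < σr)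
    (hS₁ : ‖S‖ ≤ σ₁) (hSi : ‖Si‖ ≤ 1 / σr)
    (hκ : σ₁ / σr * (‖E‖ / σr) ^ 2 ≤ 1 / 64) (x : Matrix l m ℝ) :
    ‖x * ((1 - Uh * Uhᵀ) * U)‖ ≤ 2 * (‖x * ((1 - Uh * Uhᵀ) * E * (Vh * Vhᵀ * V))‖ / σr) := by
  set a := (1 - Uh * Uhᵀ) * U with ha
  set b := (1 - Vh * Vhᵀ) * V with hb
  have hbn : ‖b‖ ≤ 2 * (‖E‖ / σr) := by
    have := h.transpose.norm_compl_le hSi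
    rwa [norm_transpose] at this
  have h1 : x * a = x * a * (S * (bᵀ * b) * Si) -
      x * ((1 - Uh * Uhᵀ) * E * (Vh * Vhᵀ * V)) * Si := by
    conv_lhs => rw [ha, h.compl_eq, ← ha, ← hb]
    rw [Matrix.mul_sub]
    simp only [Matrix.mul_assoc]
  have hK : ‖S * (bᵀ * b) * Si‖ ≤ 1 / 16 := by
    calc ‖S * (bᵀ * b) * Si‖ ≤ ‖S * (bᵀ * b)‖ * ‖Si‖ := Matrix.l2_opNorm_mul _ _
      _ ≤ (‖S‖ * ‖bᵀ * b‖) * ‖Si‖ :=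
        mul_le_mul_of_nonneg_right (Matrix.l2_opNorm_mul _ _) (norm_nonneg _)
      _ ≤ (σ₁ * (2 * (‖E‖ / σr)) ^ 2) * (1 / σr) := by
        rw [norm_transpose_mul_self]
        have : 0 ≤ σ₁ := (norm_nonneg _).trans hS₁
        gcongr
      _ = 4 * (σ₁ / σr * (‖E‖ / σr) ^ 2) := by ring
      _ ≤ 1 / 16 := by linarith
  have h2 : ‖x * a‖ ≤ ‖x * a‖ * (1 / 16) +
      ‖x * ((1 - Uh * Uhᵀ) * E * (Vh * Vhᵀ * V))‖ * (1 / σr) := by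
    conv_lhs => rw [h1]
    refine (norm_sub_le _ _).trans (add_le_add ?_ ?_)
    · exact (Matrix.l2_opNorm_mul _ _).trans (mul_le_mul_of_nonneg_left hK (norm_nonneg _))
    · exact (Matrix.l2_opNorm_mul _ _).trans (mul_le_mul_of_nonneg_left hSi (norm_nonneg _))
  rw [mul_one_div _ σr] at h2
  have := div_nonneg (norm_nonneg (x * ((1 - Uh * Uhᵀ) * E * (Vh * Vhᵀ * V)))) hσ.le
  linarith

set_option maxHeartbeats 1000000 in
/-- Row-wise perturbation bound for singular subspaces: beyond the linear and quadratic terms in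
`E`, the error is of third order, or of first order but proportional to the row of `U`. -/
theorem row_bound (h : IsPerturbedSubspace E U Uh V Vh S Si) {σ₁ σr : ℝ} (hσ : 0 < σr)
    (hS₁ : ‖S‖ ≤ σ₁) (hSi : ‖Si‖ ≤ 1 / σr)
    (hκ : σ₁ / σr * (‖E‖ / σr) ^ 2 ≤ 1 / 64) (hδ : ‖E‖ / σr ≤ 1 / 64) (e : Matrix l m ℝ)
    (he : ‖e‖ ≤ 1) :
    ‖e * ((1 - Uh * Uhᵀ) * U)‖ ≤ 5 * (‖e * E * V‖ / σr) + 10 * (‖e * E * Eᵀ * U‖ / σr ^ 2) +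
      20 * (‖E‖ / σr) ^ 3 + 5 * (‖e * U‖ * (‖E‖ / σr)) := by
  have hEt : ‖Eᵀ‖ = ‖E‖ := norm_transpose E
  have hκ' : σ₁ / σr * (‖Eᵀ‖ / σr) ^ 2 ≤ 1 / 64 := by rwa [hEt]
  have hP : ‖1 - Uh * Uhᵀ‖ ≤ 1 := norm_le_one_of_projection (orthProj_compl_projection h.hUh)
  have hQ : ‖1 - Vh * Vhᵀ‖ ≤ 1 := norm_le_one_of_projection (orthProj_compl_projection h.hVh)
  have hUn := norm_le_one_of_orthonormal h.hU
  have hVn := norm_le_one_of_orthonormal h.hV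
  have hUhn := norm_le_one_of_orthonormal h.hUh
  have hVhn := norm_le_one_of_orthonormal h.hVh
  have hUhtn : ‖Uhᵀ‖ ≤ 1 := by rwa [norm_transpose]
  have hVhtn : ‖Vhᵀ‖ ≤ 1 := by rwa [norm_transpose]
  set δ := ‖E‖ / σr with hδdef
  have hδ0 : 0 ≤ δ := by positivity
  have hEδ : ‖E‖ = δ * σr := by rw [hδdef]; field_simp
  have ha2 : ‖(1 - Uh * Uhᵀ) * U‖ ≤ 2 * δ := h.norm_compl_le hSi
  have hb2 : ‖(1 - Vh * Vhᵀ) * V‖ ≤ 2 * δ := by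
    have := h.transpose.norm_compl_le hSi
    rwa [hEt] at this
  have haU : U - Uh * Uhᵀ * U = (1 - Uh * Uhᵀ) * U := by rw [Matrix.sub_mul, Matrix.one_mul]
  have hbV : V - Vh * Vhᵀ * V = (1 - Vh * Vhᵀ) * V := by rw [Matrix.sub_mul, Matrix.one_mul]
  have hPU : Uh * Uhᵀ * U = U - (1 - Uh * Uhᵀ) * U := by rw [← haU]; abel
  have hQV : Vh * Vhᵀ * V = V - (1 - Vh * Vhᵀ) * V := by rw [← hbV]; abel
  set g := ‖e * E * (Vh * Vhᵀ * V)‖ with hg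
  have hg0 : 0 ≤ g := norm_nonneg _
  have hproj : ∀ x : Matrix l n ℝ, ‖x * Vh‖ ≤ 2 * ‖x * (Vh * Vhᵀ * V)‖ := fun x =>
    norm_mul_le_two_mul_norm_mul_projection h.hVh h.hV (by rw [hbV]; linarith) x
  have hproj' : ‖e * Uh‖ ≤ 2 * ‖e * (Uh * Uhᵀ * U)‖ :=
    norm_mul_le_two_mul_norm_mul_projection h.hUh h.hU (by rw [haU]; linarith) e
  -- the second-order term
  have hEb : ‖e * E * ((1 - Vh * Vhᵀ) * V)‖ ≤
      2 * ((‖e * E * Eᵀ * U‖ + 2 * g * ‖E‖ + ‖E‖ ^ 2 * (2 * δ)) / σr) := by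
    have h1 := h.transpose.norm_mul_compl_le hσ hS₁ hSi hκ' (e * E)
    refine h1.trans ?_
    gcongr
    -- The second use of the contraction, for the transposed problem and the row `e * E`, is what
    -- produces `E * Eᵀ * U`. The part through `Vh` leads back to `g`, and the last part carries
    -- three factors of the size of `E`.
    have h2 : e * E * ((1 - Vh * Vhᵀ) * Eᵀ * (Uh * Uhᵀ * U)) =
        e * E * Eᵀ * U - e * E * Vh * (Vhᵀ * Eᵀ * U) -
          e * E * ((1 - Vh * Vhᵀ) * Eᵀ * ((1 - Uh * Uhᵀ) * U)) := by
      rw [hPU]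
      generalize (1 - Uh * Uhᵀ) * U = a
      simp only [Matrix.mul_sub, Matrix.sub_mul, Matrix.one_mul, Matrix.mul_assoc]
    rw [h2]
    refine (norm_sub_le _ _).trans (add_le_add ((norm_sub_le _ _).trans (add_le_add le_rfl ?_)) ?_)
    · refine (Matrix.l2_opNorm_mul _ _).trans (mul_le_mul (hproj _) ?_ (norm_nonneg _)
        (by positivity))
      rw [← hEt]
      exact (norm_mul_le_left hUn).trans (norm_mul_le_right hVhtn)
    · refine (Matrix.l2_opNorm_mul _ _).trans ?_
      have h3 : ‖e * E‖ ≤ ‖E‖ := norm_mul_le_right he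
      have h4 : ‖(1 - Vh * Vhᵀ) * Eᵀ * ((1 - Uh * Uhᵀ) * U)‖ ≤ ‖E‖ * (2 * δ) := by
        refine (Matrix.l2_opNorm_mul _ _).trans (mul_le_mul ?_ ha2 (norm_nonneg _)
          (norm_nonneg _))
        rw [← hEt]
        exact norm_mul_le_right hQ
      calc _ ≤ ‖E‖ * (‖E‖ * (2 * δ)) := mul_le_mul h3 h4 (norm_nonneg _) (norm_nonneg _)
        _ = _ := by ring
  have hgle : g ≤ ‖e * E * V‖ + ‖e * E * ((1 - Vh * Vhᵀ) * V)‖ := by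
    rw [hg, hQV, Matrix.mul_sub]
    exact norm_sub_le _ _
  -- The coefficient of `g` on the right is `4 δ ≤ 1 / 16`, so `g` is absorbed.
  have hgbound : g ≤ 2 * ‖e * E * V‖ + 4 * (‖e * E * Eᵀ * U‖ / σr) + 8 * σr * δ ^ 3 := by
    have h1 : 2 * ((‖e * E * Eᵀ * U‖ + 2 * g * ‖E‖ + ‖E‖ ^ 2 * (2 * δ)) / σr) =
        2 * (‖e * E * Eᵀ * U‖ / σr) + 4 * g * δ + 4 * σr * δ ^ 3 := by
      rw [hEδ]; field_simp; ring
    rw [h1] at hEb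
    have h2 : g * δ ≤ g * (1 / 64) := mul_le_mul_of_nonneg_left hδ hg0
    have h3 : 0 ≤ ‖e * E * V‖ := norm_nonneg _
    have h4 : 0 ≤ ‖e * E * Eᵀ * U‖ / σr := by positivity
    have h5 : 0 ≤ σr * δ ^ 3 := by positivity
    linarith
  have hmain := h.norm_mul_compl_le hσ hS₁ hSi hκ e
  -- The part of `1 - P` along `Uh` is measured by the row `e * Uh`. This is comparable to the row
  -- of `U` plus the very error being estimated, which is absorbed afterwards thanks to the factor
  -- `δ ≤ 1 / 64`.
  have hsplit : ‖e * ((1 - Uh * Uhᵀ) * E * (Vh * Vhᵀ * V))‖ ≤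
      g + 2 * (‖e * U‖ + ‖e * ((1 - Uh * Uhᵀ) * U)‖) * ‖E‖ := by
    have h1 : e * ((1 - Uh * Uhᵀ) * E * (Vh * Vhᵀ * V)) =
        e * E * (Vh * Vhᵀ * V) - e * Uh * (Uhᵀ * E * (Vh * Vhᵀ * V)) := by
      simp only [Matrix.mul_sub, Matrix.sub_mul, Matrix.one_mul, Matrix.mul_assoc]
    rw [h1]
    refine (norm_sub_le _ _).trans (add_le_add le_rfl ?_)
    refine (Matrix.l2_opNorm_mul _ _).trans (mul_le_mul ?_ ?_ (norm_nonneg _) (by positivity))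
    · refine hproj'.trans ?_
      rw [hPU, Matrix.mul_sub]
      exact mul_le_mul_of_nonneg_left (norm_sub_le _ _) (by norm_num)
    · refine (norm_mul_le_left ?_).trans (norm_mul_le_right hUhtn)
      exact (norm_mul_le_left hVn).trans ((norm_mul_le_left hVhtn).trans hVhn)
  set A := ‖e * ((1 - Uh * Uhᵀ) * U)‖ with hA
  have hA0 : 0 ≤ A := norm_nonneg _
  have h7 : A ≤ 2 * (g / σr) + 4 * (‖e * U‖ + A) * δ := by
    refine hmain.trans ?_
    calc _ ≤ 2 * ((g + 2 * (‖e * U‖ + A) * ‖E‖) / σr) := by gcongr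
      _ = _ := by rw [hEδ]; field_simp; ring
  have h8 : g / σr ≤ 2 * (‖e * E * V‖ / σr) + 4 * (‖e * E * Eᵀ * U‖ / σr ^ 2) + 8 * δ ^ 3 := by
    calc g / σr ≤ (2 * ‖e * E * V‖ + 4 * (‖e * E * Eᵀ * U‖ / σr) + 8 * σr * δ ^ 3) / σr := by
          gcongr
      _ = _ := by field_simp
  have h9 : A * δ ≤ A * (1 / 64) := mul_le_mul_of_nonneg_left hδ hA0
  have h10 : 0 ≤ ‖e * U‖ * δ := by positivity
  have h11 : A ≤ 2 * (g / σr) + 4 * (‖e * U‖ * δ) + 4 * (A * δ) := by linarith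
  have h12 : 0 ≤ ‖e * E * V‖ / σr := by positivity
  have h13 : 0 ≤ ‖e * E * Eᵀ * U‖ / σr ^ 2 := by positivity
  have h14 : 0 ≤ δ ^ 3 := by positivity
  linarith

end IsPerturbedSubspace

end Perturbation

end LowRankBandit

end

noncomputable section

namespace LowRankBandit

open scoped Matrix.Norms.L2Operator

/-! ### Singular subspaces of a full singular value decomposition -/

section FullSVD

variable {m n r : ℕ}

/-- The first `r` columns of a square matrix. -/
def leadingCols (hr : r ≤ m) (W : Matrix (Fin m) (Fin m) ℝ) : Matrix (Fin m) (Fin r) ℝ :=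
  W.submatrix id (Fin.castLE hr)

/-- The diagonal projection onto the coordinates `≥ r`. -/
def tailDiag (m r : ℕ) : Matrix (Fin m) (Fin m) ℝ :=
  Matrix.diagonal fun i => if (i : ℕ) < r then 0 else 1

theorem leadingCols_orthonormal (hr : r ≤ m) {W : Matrix (Fin m) (Fin m) ℝ} (hW : Wᵀ * W = 1) :
    (leadingCols hr W)ᵀ * leadingCols hr W = 1 := by
  ext i j
  have := congrFun (congrFun hW (Fin.castLE hr i)) (Fin.castLE hr j)
  simp only [Matrix.mul_apply, Matrix.transpose_apply, Matrix.one_apply] at this ⊢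
  simp only [leadingCols, Matrix.submatrix_apply, id]
  rw [this]
  simp [Fin.ext_iff]

theorem sum_castLE (hr : r ≤ m) (f : Fin m → ℝ) :
    ∑ k : Fin r, f (Fin.castLE hr k) = ∑ k : Fin m, if (k : ℕ) < r then f k else 0 := by
  rw [← Finset.sum_filter]
  refine Finset.sum_bij (fun k _ => Fin.castLE hr k) (by simp) (by simp [Fin.ext_iff]) ?_ (by simp)
  intro k hk
  exact ⟨⟨k, (Finset.mem_filter.1 hk).2⟩, by simp, by ext; simp⟩

theorem one_sub_leadingCols_mul_transpose (hr : r ≤ m) {W : Matrix (Fin m) (Fin m) ℝ}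
    (hW : Wᵀ * W = 1) :
    1 - leadingCols hr W * (leadingCols hr W)ᵀ = W * tailDiag m r * Wᵀ := by
  have hW' : W * Wᵀ = 1 := mul_eq_one_comm.1 hW
  rw [← hW']
  ext i j
  rw [Matrix.sub_apply, Matrix.mul_apply, Matrix.mul_apply, Matrix.mul_apply]
  simp only [Matrix.transpose_apply, tailDiag, Matrix.mul_diagonal, leadingCols,
    Matrix.submatrix_apply, id]
  rw [sum_castLE hr (fun k => W i k * W j k), ← Finset.sum_sub_distrib]
  refine Finset.sum_congr rfl fun k _ => ?_
  split_ifs <;> simp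

theorem norm_transpose_le_one_of_orthogonal {W : Matrix (Fin m) (Fin m) ℝ} (hW : Wᵀ * W = 1) :
    ‖Wᵀ‖ ≤ 1 := by
  rw [norm_transpose]; exact norm_le_one_of_orthonormal hW

theorem tailDiag_mul_rectDiagonal (s : ℕ → ℝ) :
    tailDiag m r * rectDiagonal m n s = rectDiagonal m n s * tailDiag n r := by
  ext i j
  simp only [tailDiag, Matrix.diagonal_mul, Matrix.mul_diagonal, rectDiagonal, Matrix.of_apply]
  by_cases h : (i : ℕ) = j
  · simp [h, mul_comm]
  · simp [h]

theorem rectDiagonal_mulVec (s : ℕ → ℝ) (x : Fin n → ℝ) (i : Fin m) :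
    (rectDiagonal m n s *ᵥ x) i = if h : (i : ℕ) < n then s i * x ⟨i, h⟩ else 0 := by
  simp only [Matrix.mulVec, dotProduct, rectDiagonal, Matrix.of_apply]
  split_ifs with h
  · rw [Finset.sum_eq_single ⟨i, h⟩]
    · simp
    · intro b _ hb
      have : (i : ℕ) ≠ b := fun h' => hb (Fin.ext h'.symm)
      simp [this]
    · simp
  · refine Finset.sum_eq_zero fun b _ => ?_
    have : (i : ℕ) ≠ b := fun h' => h (h' ▸ b.2)
    simp [this]

theorem norm_le_of_mulVec_sq_le {A : Matrix (Fin m) (Fin n) ℝ} {c : ℝ} (hc : 0 ≤ c)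
    (h : ∀ x : Fin n → ℝ, ∑ i, (A *ᵥ x) i ^ 2 ≤ c ^ 2 * ∑ j, x j ^ 2) : ‖A‖ ≤ c := by
  rw [Matrix.l2_opNorm_def]
  refine ContinuousLinearMap.opNorm_le_bound _ hc fun x => ?_
  refine (sq_le_sq₀ (norm_nonneg _) (by positivity)).1 ?_
  have h1 := h (WithLp.ofLp x)
  rw [mul_pow, EuclideanSpace.norm_sq_eq, EuclideanSpace.norm_sq_eq]
  simpa using h1

theorem mulVec_sq_le (A : Matrix (Fin m) (Fin n) ℝ) (x : Fin n → ℝ) :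
    ∑ i, (A *ᵥ x) i ^ 2 ≤ ‖A‖ ^ 2 * ∑ j, x j ^ 2 := by
  have := Matrix.l2_opNorm_mulVec A (WithLp.toLp 2 x)
  have h2 := pow_le_pow_left₀ (norm_nonneg _) this 2
  rw [mul_pow, EuclideanSpace.norm_sq_eq, EuclideanSpace.norm_sq_eq] at h2
  simpa using h2

/-- Indices start at zero, so `s r` is the largest singular value that is not among the first `r`.
-/
theorem norm_tailDiag_mul_rectDiagonal_le {s : ℕ → ℝ} (hs : Antitone s) (hs0 : ∀ k, 0 ≤ s k) :
    ‖tailDiag m r * rectDiagonal m n s‖ ≤ s r := by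
  refine norm_le_of_mulVec_sq_le (hs0 r) fun x => ?_
  have h1 : ∀ i : Fin m, ((tailDiag m r * rectDiagonal m n s) *ᵥ x) i ^ 2 ≤
      s r ^ 2 * (if h : (i : ℕ) < n then x ⟨i, h⟩ ^ 2 else 0) := by
    intro i
    rw [← Matrix.mulVec_mulVec, tailDiag, Matrix.mulVec_diagonal, rectDiagonal_mulVec]
    split_ifs with h2 h3 h3
    · simp; positivity
    · simp
    · rw [one_mul, mul_pow]
      have := hs (not_lt.1 h2)
      have := hs0 i
      gcongr
    · simp
  refine (Finset.sum_le_sum fun i _ => h1 i).trans ?_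
  rw [← Finset.mul_sum]
  refine mul_le_mul_of_nonneg_left ?_ (sq_nonneg _)
  rw [← Finset.sum_filter_add_sum_filter_not _ (fun i : Fin m => (i : ℕ) < n)]
  have h2 : ∑ i ∈ Finset.univ.filter (fun i : Fin m => ¬ (i : ℕ) < n),
      (if h : (i : ℕ) < n then x ⟨i, h⟩ ^ 2 else 0) = 0 :=
    Finset.sum_eq_zero fun i hi => by rw [dif_neg (Finset.mem_filter.1 hi).2]
  rw [h2, add_zero]
  calc ∑ i ∈ Finset.univ.filter (fun i : Fin m => (i : ℕ) < n),
        (if h : (i : ℕ) < n then x ⟨i, h⟩ ^ 2 else 0)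
      = ∑ j ∈ Finset.univ.filter (fun j : Fin n => (j : ℕ) < m), x j ^ 2 := by
        refine Finset.sum_bij (fun i hi => ⟨i, (Finset.mem_filter.1 hi).2⟩) ?_ ?_ ?_ ?_
        · intro i hi; simp
        · intro i hi j hj hij; simpa [Fin.ext_iff] using hij
        · intro j hj
          exact ⟨⟨j, (Finset.mem_filter.1 hj).2⟩, by simp, by simp⟩
        · intro i hi; simp [(Finset.mem_filter.1 hi).2]
    _ ≤ ∑ j : Fin n, x j ^ 2 :=
        Finset.sum_le_sum_of_subset_of_nonneg (Finset.filter_subset _ _) fun _ _ _ => sq_nonneg _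

/-- Weyl's inequality for the first singular value beyond the rank. -/
theorem singularValue_le_of_rank {A E : Matrix (Fin m) (Fin n) ℝ} {W : Matrix (Fin m) (Fin m) ℝ}
    {Z : Matrix (Fin n) (Fin n) ℝ} {s : ℕ → ℝ} {X : Matrix (Fin m) (Fin r) ℝ}
    {Y : Matrix (Fin r) (Fin n) ℝ} (hW : Wᵀ * W = 1) (hZ : Zᵀ * Z = 1) (hs : Antitone s)
    (hs0 : ∀ k, 0 ≤ s k) (hA : A = W * rectDiagonal m n s * Zᵀ) (hAE : A = X * Y + E)
    (hm : r < m) (hn : r < n) : s r ≤ ‖E‖ := by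
  have hn' : r + 1 ≤ n := hn
  -- A linear map from dimension `r + 1` to dimension `r`. A vector of its kernel gives a
  -- combination of the first `r + 1` right singular vectors on which `A` and `E` agree, while `A`
  -- stretches it by at least `s r`.
  let f : (Fin (r + 1) → ℝ) →ₗ[ℝ] (Fin r → ℝ) :=
    Matrix.toLin' (Y * Z.submatrix id (Fin.castLE hn'))
  obtain ⟨y, hy, hy0⟩ : ∃ y : Fin (r + 1) → ℝ, f y = 0 ∧ y ≠ 0 := by
    have h1 : LinearMap.ker f ≠ ⊥ := LinearMap.ker_ne_bot_of_finrank_lt (by simp)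
    obtain ⟨y, hy, hy0⟩ := (Submodule.ne_bot_iff _).1 h1
    exact ⟨y, hy, hy0⟩
  let z : Fin n → ℝ := fun k => if h : (k : ℕ) < r + 1 then y ⟨k, h⟩ else 0
  have hz : ∀ k : Fin (r + 1), z (Fin.castLE hn' k) = y k := fun k => dif_pos k.2
  have hz' : ∀ k : Fin n, ¬ (k : ℕ) < r + 1 → z k = 0 := fun k hk => dif_neg hk
  have hsub : Z.submatrix id (Fin.castLE hn') *ᵥ y = Z *ᵥ z := by
    ext i
    simp only [Matrix.mulVec, dotProduct, Matrix.submatrix_apply, id]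
    have := sum_castLE hn' (fun k => Z i k * z k)
    simp only [hz] at this
    rw [this]
    refine Finset.sum_congr rfl fun k _ => ?_
    split_ifs with h
    · rfl
    · rw [hz' k h, mul_zero]
  have hEx : E *ᵥ (Z *ᵥ z) = W *ᵥ (rectDiagonal m n s *ᵥ z) := by
    have h1 : A *ᵥ (Z *ᵥ z) = W *ᵥ (rectDiagonal m n s *ᵥ z) := by
      rw [hA]
      simp only [← Matrix.mulVec_mulVec]
      rw [Matrix.mulVec_mulVec z Zᵀ Z, hZ, Matrix.one_mulVec]
    have h2 : Y *ᵥ (Z *ᵥ z) = 0 := by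
      rw [← hsub, Matrix.mulVec_mulVec]
      exact hy
    rw [← h1, hAE, Matrix.add_mulVec, ← Matrix.mulVec_mulVec, h2, Matrix.mulVec_zero, zero_add]
  have hiso : ∀ {k : ℕ} {O : Matrix (Fin k) (Fin k) ℝ}, Oᵀ * O = 1 → ∀ x : Fin k → ℝ,
      ∑ i, (O *ᵥ x) i ^ 2 = ∑ i, x i ^ 2 := by
    intro k O hO x
    have h1 : ∀ v : Fin k → ℝ, ∑ i, v i ^ 2 = v ⬝ᵥ v := fun v => by
      simp [dotProduct, sq]
    rw [h1, h1, Matrix.dotProduct_mulVec, Matrix.vecMul_mulVec, hO, Matrix.vecMul_one]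
  have h3 := mulVec_sq_le E (Z *ᵥ z)
  rw [hEx, hiso hW, hiso hZ] at h3
  have hzpos : 0 < ∑ j, z j ^ 2 := by
    obtain ⟨k, hk⟩ := Function.ne_iff.1 hy0
    refine Finset.sum_pos' (fun _ _ => sq_nonneg _) ⟨Fin.castLE hn' k, by simp, ?_⟩
    rw [hz]
    exact sq_pos_of_ne_zero hk
  have h4 : s r ^ 2 * ∑ j, z j ^ 2 ≤ ∑ i, (rectDiagonal m n s *ᵥ z) i ^ 2 := by
    have hm' : r + 1 ≤ m := hm
    have e1 : ∑ j, z j ^ 2 = ∑ k : Fin (r + 1), y k ^ 2 := by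
      have := sum_castLE hn' (fun k => z k ^ 2)
      simp only [hz] at this
      rw [this]
      refine Finset.sum_congr rfl fun k _ => ?_
      split_ifs with h
      · rfl
      · rw [hz' k h]; norm_num
    have e2 : ∑ k : Fin (r + 1), (rectDiagonal m n s *ᵥ z) (Fin.castLE hm' k) ^ 2 ≤
        ∑ i, (rectDiagonal m n s *ᵥ z) i ^ 2 := by
      rw [sum_castLE hm' (fun k => (rectDiagonal m n s *ᵥ z) k ^ 2)]
      refine Finset.sum_le_sum fun k _ => ?_
      split_ifs
      · exact le_rfl
      · positivity
    refine le_trans ?_ e2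
    rw [e1, Finset.mul_sum]
    refine Finset.sum_le_sum fun k _ => ?_
    rw [rectDiagonal_mulVec, dif_pos (by simpa using k.2.trans_le hn')]
    have hk : s r ≤ s k := hs (Nat.lt_succ_iff.1 k.2)
    have : z ⟨(Fin.castLE hm' k : Fin m), by simpa using k.2.trans_le hn'⟩ = y k := hz k
    rw [this, mul_pow]
    have := hs0 r
    simp only [Fin.val_castLE]
    gcongr
  have h5 : s r ^ 2 ≤ ‖E‖ ^ 2 := le_of_mul_le_mul_right (h4.trans h3) hzpos
  exact (sq_le_sq₀ (hs0 r) (norm_nonneg _)).1 h5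

theorem IsFullSVD.isPerturbedSubspace {A E : Matrix (Fin m) (Fin n) ℝ}
    {W : Matrix (Fin m) (Fin m) ℝ} {Z : Matrix (Fin n) (Fin n) ℝ} (hA : IsFullSVD A W Z)
    (hm : r ≤ m) (hn : r ≤ n) {U : Matrix (Fin m) (Fin r) ℝ} {V : Matrix (Fin n) (Fin r) ℝ}
    {S Si : Matrix (Fin r) (Fin r) ℝ} (hU : Uᵀ * U = 1) (hV : Vᵀ * V = 1) (hS : S * Si = 1)
    (hSt : Sᵀ = S) (hAE : A = U * S * Vᵀ + E) :
    IsPerturbedSubspace E U (leadingCols hm W) V (leadingCols hn Z) S Si := by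
  obtain ⟨hW, hZ, s, hs, hs0, hAs⟩ := hA
  have hres : (1 - leadingCols hm W * (leadingCols hm W)ᵀ) * A =
      W * (tailDiag m r * rectDiagonal m n s) * Zᵀ := by
    rw [one_sub_leadingCols_mul_transpose hm hW, hAs]
    calc W * tailDiag m r * Wᵀ * (W * rectDiagonal m n s * Zᵀ)
        = W * tailDiag m r * (Wᵀ * W) * (rectDiagonal m n s * Zᵀ) := by
          simp only [Matrix.mul_assoc]
      _ = _ := by rw [hW]; simp only [Matrix.mul_assoc, Matrix.one_mul]
  have hres' : A * (1 - leadingCols hn Z * (leadingCols hn Z)ᵀ) =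
      W * (rectDiagonal m n s * tailDiag n r) * Zᵀ := by
    rw [one_sub_leadingCols_mul_transpose hn hZ, hAs]
    calc W * rectDiagonal m n s * Zᵀ * (Z * tailDiag n r * Zᵀ)
        = W * rectDiagonal m n s * (Zᵀ * Z) * (tailDiag n r * Zᵀ) := by
          simp only [Matrix.mul_assoc]
      _ = _ := by rw [hZ]; simp only [Matrix.mul_assoc, Matrix.one_mul]
  refine ⟨hU, hV, leadingCols_orthonormal hm hW, leadingCols_orthonormal hn hZ, hS, hSt, ?_, ?_⟩
  · rw [← hAE]
    rw [tailDiag_mul_rectDiagonal, ← hres', Matrix.sub_mul, Matrix.mul_sub, Matrix.one_mul,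
      Matrix.mul_one] at hres
    exact (sub_right_inj.1 hres).symm
  · rw [← hAE, hres]
    have h1 : ‖W * (tailDiag m r * rectDiagonal m n s) * Zᵀ‖ ≤
        ‖tailDiag m r * rectDiagonal m n s‖ :=
      (norm_mul_le_left (norm_transpose_le_one_of_orthogonal hZ)).trans
        (norm_mul_le_right (norm_le_one_of_orthonormal hW))
    refine h1.trans ?_
    -- If `r` equals one of the dimensions the tail is empty and the residual vanishes; Weyl's
    -- inequality is needed only otherwise.
    by_cases hlt : r < m ∧ r < n
    · refine (norm_tailDiag_mul_rectDiagonal_le hs hs0).trans ?_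
      exact singularValue_le_of_rank hW hZ hs hs0 hAs hAE hlt.1 hlt.2
    · have h0 : tailDiag m r * rectDiagonal m n s = 0 := by
        ext i j
        simp only [tailDiag, Matrix.diagonal_mul, rectDiagonal, Matrix.of_apply,
          Matrix.zero_apply, ite_mul, zero_mul, one_mul]
        split_ifs with h2 h3
        · rfl
        · exact absurd ⟨(not_lt.1 h2).trans_lt i.2, (h3 ▸ not_lt.1 h2).trans_lt j.2⟩ hlt
        · rfl
      rw [h0, norm_zero]
      exact norm_nonneg _

end FullSVD

end LowRankBandit

end

/-! ### Concentration of the exploration error. -/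

noncomputable section

namespace LowRankBandit

open scoped Matrix.Norms.L2Operator

/-! ### A noncommutative Khintchine inequality -/

section Khintchine

variable {d : Type*} [Fintype d] [DecidableEq d]

theorem exists_orthogonal_diagonalization {A : Matrix d d ℝ} (hA : Aᵀ = A) :
    ∃ (O : Matrix d d ℝ) (α : d → ℝ), Oᵀ * O = 1 ∧ A = O * Matrix.diagonal α * Oᵀ := by
  have hA' : A.IsHermitian := by
    rw [Matrix.IsHermitian, Matrix.conjTranspose_eq_transpose_of_trivial, hA]
  refine ⟨(hA'.eigenvectorUnitary : Matrix d d ℝ), hA'.eigenvalues, ?_, ?_⟩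
  · have := Unitary.coe_star_mul_self hA'.eigenvectorUnitary
    rwa [Matrix.star_eq_conjTranspose, Matrix.conjTranspose_eq_transpose_of_trivial] at this
  · have := hA'.spectral_theorem
    rw [Unitary.conjStarAlgAut_apply, Matrix.star_eq_conjTranspose,
      Matrix.conjTranspose_eq_transpose_of_trivial] at this
    exact this

theorem conj_diagonal_pow {O : Matrix d d ℝ} (hO : Oᵀ * O = 1) (α : d → ℝ) (p : ℕ) :
    (O * Matrix.diagonal α * Oᵀ) ^ p = O * Matrix.diagonal (fun i => α i ^ p) * Oᵀ := by
  induction p with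
  | zero => simp [mul_eq_one_comm.1 hO]
  | succ p ih =>
    rw [pow_succ, ih]
    calc _ = O * Matrix.diagonal (fun i => α i ^ p) * (Oᵀ * O) * Matrix.diagonal α * Oᵀ := by
          simp only [Matrix.mul_assoc]
      _ = _ := by
          rw [hO, Matrix.mul_one, Matrix.mul_assoc O, Matrix.diagonal_mul_diagonal]
          simp only [pow_succ]

/-- The difference of the odd powers is `x - y` times a sum of `2k + 1` monomials. A monomial and
its mirror image add up to at most `x^(2k) + y^(2k)`, since powers of `|x|` and `|y|` are ordered
alike; the pairing yields the factor `(2k + 1) / 2`. -/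
theorem sub_mul_pow_sub_pow_le (x y : ℝ) (k : ℕ) :
    (x - y) * (x ^ (2 * k + 1) - y ^ (2 * k + 1)) ≤
      (2 * k + 1) / 2 * ((x - y) ^ 2 * (x ^ (2 * k) + y ^ (2 * k))) := by
  have h1 : x ^ (2 * k + 1) - y ^ (2 * k + 1) =
      (∑ i ∈ Finset.range (2 * k + 1), x ^ i * y ^ (2 * k + 1 - 1 - i)) * (x - y) :=
    ((Commute.all x y).geom_sum₂_mul _).symm
  have hpair : ∀ i ∈ Finset.range (2 * k + 1),
      x ^ i * y ^ (2 * k - i) + x ^ (2 * k - i) * y ^ i ≤ x ^ (2 * k) + y ^ (2 * k) := by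
    intro i hi
    obtain ⟨j, hj⟩ : ∃ j, 2 * k = i + j :=
      Nat.exists_eq_add_of_le (Nat.lt_succ_iff.1 (Finset.mem_range.1 hi))
    have hev : Even (i + j) := ⟨k, by omega⟩
    have h2 : 2 * k - i = j := by omega
    rw [h2, hj, ← hev.pow_abs x, ← hev.pow_abs y, pow_add, pow_add]
    have h3 : x ^ i * y ^ j ≤ |x| ^ i * |y| ^ j := by
      rw [← abs_pow, ← abs_pow, ← abs_mul]; exact le_abs_self _
    have h4 : x ^ j * y ^ i ≤ |x| ^ j * |y| ^ i := by
      rw [← abs_pow, ← abs_pow, ← abs_mul]; exact le_abs_self _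
    have h5 : 0 ≤ (|x| ^ i - |y| ^ i) * (|x| ^ j - |y| ^ j) := by
      rcases le_total |x| |y| with h | h
      · exact mul_nonneg_of_nonpos_of_nonpos
          (sub_nonpos.2 (pow_le_pow_left₀ (abs_nonneg _) h _))
          (sub_nonpos.2 (pow_le_pow_left₀ (abs_nonneg _) h _))
      · exact mul_nonneg (sub_nonneg.2 (pow_le_pow_left₀ (abs_nonneg _) h _))
          (sub_nonneg.2 (pow_le_pow_left₀ (abs_nonneg _) h _))
    nlinarith
  have hrefl : ∑ i ∈ Finset.range (2 * k + 1), x ^ (2 * k - i) * y ^ i =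
      ∑ i ∈ Finset.range (2 * k + 1), x ^ i * y ^ (2 * k - i) := by
    rw [← Finset.sum_range_reflect]
    refine Finset.sum_congr rfl fun i hi => ?_
    have := Finset.mem_range.1 hi
    (congr 2; omega)
  have h2 := Finset.sum_le_sum hpair
  rw [Finset.sum_add_distrib, hrefl, Finset.sum_const, Finset.card_range, nsmul_eq_mul] at h2
  push_cast at h2
  rw [h1]
  have h3 : 2 * k + 1 - 1 = 2 * k := by omega
  rw [h3]
  nlinarith [mul_le_mul_of_nonneg_left h2 (sq_nonneg (x - y))]

theorem trace_mul_transpose_eq_sum (X Y : Matrix d d ℝ) :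
    (X * Yᵀ).trace = ∑ i, ∑ j, X i j * Y i j := by
  simp [Matrix.trace, Matrix.mul_apply]

theorem trace_conj_orthogonal {O Q : Matrix d d ℝ} (hO : Oᵀ * O = 1) (hQ : Qᵀ * Q = 1)
    (X Y : Matrix d d ℝ) :
    (X * Yᵀ).trace = ∑ i, ∑ j, (Oᵀ * X * Q) i j * (Oᵀ * Y * Q) i j := by
  rw [← trace_mul_transpose_eq_sum]
  have hQ' : Q * Qᵀ = 1 := mul_eq_one_comm.1 hQ
  have hO' : O * Oᵀ = 1 := mul_eq_one_comm.1 hO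
  have : Oᵀ * X * Q * (Oᵀ * Y * Q)ᵀ = Oᵀ * (X * (Q * Qᵀ) * Yᵀ * O) := by
    simp only [Matrix.transpose_mul, Matrix.transpose_transpose, Matrix.mul_assoc]
  rw [this, Matrix.trace_mul_comm Oᵀ, hQ', Matrix.mul_one, Matrix.mul_assoc, hO', Matrix.mul_one]

/-- The mean value inequality for the trace of an odd power. -/
theorem trace_sub_mul_pow_sub_pow_le {A B : Matrix d d ℝ} (hA : Aᵀ = A) (hB : Bᵀ = B) (k : ℕ) :
    ((A - B) * (A ^ (2 * k + 1) - B ^ (2 * k + 1))).trace ≤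
      (2 * k + 1) / 2 * ((A - B) * (A - B) * (A ^ (2 * k) + B ^ (2 * k))).trace := by
  obtain ⟨O, α, hO, rfl⟩ := exists_orthogonal_diagonalization hA
  obtain ⟨Q, β, hQ, rfl⟩ := exists_orthogonal_diagonalization hB
  set A := O * Matrix.diagonal α * Oᵀ with hAdef
  set B := Q * Matrix.diagonal β * Qᵀ with hBdef
  -- The overlaps of the two eigenbases. In these coordinates powers of `A` act on the index `i` and
  -- powers of `B` on `j`, so every trace is a sum of scalar expressions weighted by `c i j ^ 2`,
  -- and the scalar inequality applies term by term.
  set c := Oᵀ * Q with hc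
  have hApow : ∀ p, (A ^ p)ᵀ = A ^ p := fun p => by rw [Matrix.transpose_pow, hA]
  have hBpow : ∀ p, (B ^ p)ᵀ = B ^ p := fun p => by rw [Matrix.transpose_pow, hB]
  have eA : ∀ p i j, (Oᵀ * A ^ p * Q) i j = α i ^ p * c i j := by
    intro p i j
    rw [hAdef, conj_diagonal_pow hO]
    have : Oᵀ * (O * Matrix.diagonal (fun i => α i ^ p) * Oᵀ) * Q =
        (Oᵀ * O) * Matrix.diagonal (fun i => α i ^ p) * c := by
      rw [hc]; simp only [Matrix.mul_assoc]
    rw [this, hO, Matrix.one_mul, Matrix.diagonal_mul]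
  have eB : ∀ p i j, (Oᵀ * B ^ p * Q) i j = β j ^ p * c i j := by
    intro p i j
    rw [hBdef, conj_diagonal_pow hQ]
    have : Oᵀ * (Q * Matrix.diagonal (fun i => β i ^ p) * Qᵀ) * Q =
        c * Matrix.diagonal (fun i => β i ^ p) * (Qᵀ * Q) := by
      rw [hc]; simp only [Matrix.mul_assoc]
    rw [this, hQ, Matrix.mul_one, Matrix.mul_diagonal, mul_comm]
  have eD : ∀ p i j, (Oᵀ * (A ^ p - B ^ p) * Q) i j = (α i ^ p - β j ^ p) * c i j := by
    intro p i j
    rw [Matrix.mul_sub, Matrix.sub_mul, Matrix.sub_apply, eA, eB, sub_mul]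
  have eD1 : ∀ i j, (Oᵀ * (A - B) * Q) i j = (α i - β j) * c i j := by
    intro i j
    simpa using eD 1 i j
  have eAD : ∀ i j, (Oᵀ * (A ^ k * (A - B)) * Q) i j = α i ^ k * (α i - β j) * c i j := by
    intro i j
    rw [Matrix.mul_sub, ← pow_succ]
    have h2 : Oᵀ * (A ^ k * B) * Q = Matrix.diagonal (fun i => α i ^ k) * (Oᵀ * B * Q) := by
      rw [hAdef, conj_diagonal_pow hO]
      calc _ = (Oᵀ * O) * Matrix.diagonal (fun i => α i ^ k) * (Oᵀ * B * Q) := by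
            simp only [Matrix.mul_assoc]
        _ = _ := by rw [hO, Matrix.one_mul]
    have h3 := eB 1 i j
    simp only [pow_one] at h3
    rw [Matrix.mul_sub, Matrix.sub_mul, Matrix.sub_apply, eA, h2, Matrix.diagonal_mul, h3]
    ring
  have eBD : ∀ i j, (Oᵀ * ((A - B) * B ^ k) * Q) i j = β j ^ k * (α i - β j) * c i j := by
    intro i j
    rw [Matrix.sub_mul, ← pow_succ']
    have h2 : Oᵀ * (A * B ^ k) * Q = Oᵀ * A * Q * Matrix.diagonal (fun i => β i ^ k) := by
      rw [hBdef, conj_diagonal_pow hQ]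
      calc _ = (Oᵀ * A * Q) * Matrix.diagonal (fun i => β i ^ k) * (Qᵀ * Q) := by
            simp only [Matrix.mul_assoc]
        _ = _ := by rw [hQ, Matrix.mul_one]
    have h3 := eA 1 i j
    simp only [pow_one] at h3
    rw [Matrix.mul_sub, Matrix.sub_mul, Matrix.sub_apply, eB, h2, Matrix.mul_diagonal, h3]
    ring
  have hsub : (A - B)ᵀ = A - B := by rw [Matrix.transpose_sub, hA, hB]
  have t1 : ((A - B) * (A ^ (2 * k + 1) - B ^ (2 * k + 1))).trace =
      ∑ i, ∑ j, (α i - β j) * (α i ^ (2 * k + 1) - β j ^ (2 * k + 1)) * c i j ^ 2 := by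
    have := trace_conj_orthogonal hO hQ (A - B) (A ^ (2 * k + 1) - B ^ (2 * k + 1))
    rw [Matrix.transpose_sub, hApow, hBpow] at this
    rw [this]
    refine Finset.sum_congr rfl fun i _ => Finset.sum_congr rfl fun j _ => ?_
    rw [eD1, eD]; ring
  have t2 : ((A - B) * (A - B) * A ^ (2 * k)).trace =
      ∑ i, ∑ j, (α i - β j) ^ 2 * α i ^ (2 * k) * c i j ^ 2 := by
    have := trace_conj_orthogonal hO hQ (A ^ k * (A - B)) (A ^ k * (A - B))
    rw [Matrix.transpose_mul, hApow, hsub] at this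
    have h2 : ((A - B) * (A - B) * A ^ (2 * k)).trace =
        (A ^ k * (A - B) * ((A - B) * A ^ k)).trace := by
      rw [two_mul, pow_add, ← Matrix.mul_assoc, Matrix.trace_mul_comm]
      simp only [Matrix.mul_assoc]
    rw [h2, this]
    refine Finset.sum_congr rfl fun i _ => Finset.sum_congr rfl fun j _ => ?_
    rw [eAD]; ring
  have t3 : ((A - B) * (A - B) * B ^ (2 * k)).trace =
      ∑ i, ∑ j, (α i - β j) ^ 2 * β j ^ (2 * k) * c i j ^ 2 := by
    have := trace_conj_orthogonal hO hQ ((A - B) * B ^ k) ((A - B) * B ^ k)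
    rw [Matrix.transpose_mul, hBpow, hsub] at this
    have h2 : ((A - B) * (A - B) * B ^ (2 * k)).trace =
        ((A - B) * B ^ k * (B ^ k * (A - B))).trace := by
      rw [two_mul, pow_add, Matrix.mul_assoc, Matrix.trace_mul_comm]
      simp only [Matrix.mul_assoc]
    rw [h2, this]
    refine Finset.sum_congr rfl fun i _ => Finset.sum_congr rfl fun j _ => ?_
    rw [eBD]; ring
  rw [t1, Matrix.mul_add, Matrix.trace_add, t2, t3, ← Finset.sum_add_distrib, Finset.mul_sum]
  refine Finset.sum_le_sum fun i _ => ?_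
  rw [← Finset.sum_add_distrib, Finset.mul_sum]
  refine Finset.sum_le_sum fun j _ => ?_
  have := mul_le_mul_of_nonneg_right (sub_mul_pow_sub_pow_le (α i) (β j) k) (sq_nonneg (c i j))
  linarith

/-- The value `±1` of a sign. -/
def sgn (b : Bool) : ℝ := if b then 1 else -1

theorem sgn_mul_self (b : Bool) : sgn b * sgn b = 1 := by cases b <;> simp [sgn]

theorem sgn_not (b : Bool) : sgn (!b) = - sgn b := by cases b <;> simp [sgn]

variable {τ : Type*} [Fintype τ] [DecidableEq τ]

/-- The signed sum `∑ ε_t H_t`. -/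
def signedSum {l o : Type*} (H : τ → Matrix l o ℝ) (ε : τ → Bool) : Matrix l o ℝ :=
  ∑ t, sgn (ε t) • H t

/-- Flip one sign. -/
def flipSign (t : τ) (ε : τ → Bool) : τ → Bool := Function.update ε t (!ε t)

theorem flipSign_involutive (t : τ) : Function.Involutive (flipSign t) := by
  intro ε
  simp [flipSign]

theorem signedSum_sub_flipSign {l o : Type*} (H : τ → Matrix l o ℝ) (t : τ) (ε : τ → Bool) :
    signedSum H ε - signedSum H (flipSign t ε) = (2 * sgn (ε t)) • H t := by
  rw [signedSum, signedSum, ← Finset.sum_sub_distrib, Finset.sum_eq_single t]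
  · rw [← sub_smul, flipSign, Function.update_self, sgn_not]; congr 1; ring
  · intro s _ hs
    rw [flipSign, Function.update_of_ne hs, sub_self]
  · simp

theorem signedSum_transpose {H : τ → Matrix d d ℝ} (hH : ∀ t, (H t)ᵀ = H t) (ε : τ → Bool) :
    (signedSum H ε)ᵀ = signedSum H ε := by
  simp [signedSum, Matrix.transpose_sum, Matrix.transpose_smul, hH]

/-- Discrete integration by parts: averaging a term with its image under a flip of the sign `ε t`
turns it into a product of differences, to which the mean value inequality for traces applies. Two
powers of the signed sum are thereby traded for the factor `(2k + 1) v`. -/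
theorem sum_trace_signedSum_pow_le {H : τ → Matrix d d ℝ} (hH : ∀ t, (H t)ᵀ = H t)
    {D : d → ℝ} {v : ℝ} (hD : ∑ t, H t * H t = Matrix.diagonal D) (hv : ∀ i, D i ≤ v) (k : ℕ) :
    ∑ ε : τ → Bool, (signedSum H ε ^ (2 * k + 2)).trace ≤
      (2 * k + 1) * v * ∑ ε : τ → Bool, (signedSum H ε ^ (2 * k)).trace := by
  have hsplit : ∀ ε : τ → Bool, (signedSum H ε ^ (2 * k + 2)).trace =
      ∑ t, sgn (ε t) * (H t * signedSum H ε ^ (2 * k + 1)).trace := by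
    intro ε
    have : 2 * k + 2 = 2 * k + 1 + 1 := rfl
    rw [this, pow_succ']
    conv_lhs => enter [1, 1]; rw [signedSum]
    rw [Finset.sum_mul, Matrix.trace_sum]
    refine Finset.sum_congr rfl fun t _ => ?_
    rw [Matrix.smul_mul, Matrix.trace_smul, smul_eq_mul]
  have hflip : ∀ (t : τ) (f : (τ → Bool) → ℝ), ∑ ε, f (flipSign t ε) = ∑ ε, f ε := fun t f =>
    Fintype.sum_bijective _ (flipSign_involutive t).bijective _ _ fun _ => rfl
  have hterm : ∀ t, ∑ ε : τ → Bool, sgn (ε t) * (H t * signedSum H ε ^ (2 * k + 1)).trace ≤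
      (2 * k + 1) * ∑ ε : τ → Bool, (H t * H t * signedSum H ε ^ (2 * k)).trace := by
    intro t
    have h1 : ∑ ε : τ → Bool, sgn (ε t) * (H t * signedSum H ε ^ (2 * k + 1)).trace =
        1 / 4 * ∑ ε : τ → Bool, ((signedSum H ε - signedSum H (flipSign t ε)) *
          (signedSum H ε ^ (2 * k + 1) - signedSum H (flipSign t ε) ^ (2 * k + 1))).trace := by
      have h2 := hflip t fun ε => sgn (ε t) * (H t * signedSum H ε ^ (2 * k + 1)).trace
      have h3 : ∀ ε : τ → Bool, sgn (flipSign t ε t) = - sgn (ε t) := fun ε => by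
        rw [flipSign, Function.update_self, sgn_not]
      simp only [h3] at h2
      have h4 : ∀ ε : τ → Bool, ((signedSum H ε - signedSum H (flipSign t ε)) *
          (signedSum H ε ^ (2 * k + 1) - signedSum H (flipSign t ε) ^ (2 * k + 1))).trace =
          2 * (sgn (ε t) * (H t * signedSum H ε ^ (2 * k + 1)).trace) +
          2 * (- sgn (ε t) * (H t * signedSum H (flipSign t ε) ^ (2 * k + 1)).trace) := by
        intro ε
        rw [signedSum_sub_flipSign, Matrix.smul_mul, Matrix.trace_smul, Matrix.mul_sub,
          Matrix.trace_sub, smul_eq_mul]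
        ring
      simp only [h4]
      rw [Finset.sum_add_distrib, ← Finset.mul_sum, ← Finset.mul_sum, h2]
      ring
    rw [h1]
    have h5 : ∀ ε : τ → Bool, ((signedSum H ε - signedSum H (flipSign t ε)) *
          (signedSum H ε ^ (2 * k + 1) - signedSum H (flipSign t ε) ^ (2 * k + 1))).trace ≤
        (2 * k + 1) * (2 * (H t * H t * signedSum H ε ^ (2 * k)).trace +
          2 * (H t * H t * signedSum H (flipSign t ε) ^ (2 * k)).trace) := by
      intro ε
      refine (trace_sub_mul_pow_sub_pow_le (signedSum_transpose hH ε)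
        (signedSum_transpose hH _) k).trans (le_of_eq ?_)
      rw [signedSum_sub_flipSign, Matrix.smul_mul, Matrix.mul_smul, smul_smul, Matrix.smul_mul,
        Matrix.trace_smul, Matrix.mul_add, Matrix.trace_add, smul_eq_mul]
      have := sgn_mul_self (ε t)
      have h6 : 2 * sgn (ε t) * (2 * sgn (ε t)) = 4 := by linarith
      rw [h6]; ring
    refine (mul_le_mul_of_nonneg_left (Finset.sum_le_sum fun ε _ => h5 ε) (by norm_num)).trans
      (le_of_eq ?_)
    rw [← Finset.mul_sum, Finset.sum_add_distrib, ← Finset.mul_sum, ← Finset.mul_sum,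
      hflip t fun ε => (H t * H t * signedSum H ε ^ (2 * k)).trace]
    ring
  calc _ = ∑ t, ∑ ε : τ → Bool, sgn (ε t) * (H t * signedSum H ε ^ (2 * k + 1)).trace := by
        rw [Finset.sum_comm]; exact Finset.sum_congr rfl fun ε _ => hsplit ε
    _ ≤ ∑ t, (2 * k + 1) * ∑ ε : τ → Bool, (H t * H t * signedSum H ε ^ (2 * k)).trace :=
        Finset.sum_le_sum fun t _ => hterm t
    _ = (2 * k + 1) * ∑ ε : τ → Bool, ((∑ t, H t * H t) * signedSum H ε ^ (2 * k)).trace := by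
        rw [← Finset.mul_sum, Finset.sum_comm]
        simp only [Finset.sum_mul, Matrix.trace_sum]
    _ ≤ (2 * k + 1) * ∑ ε : τ → Bool, v * (signedSum H ε ^ (2 * k)).trace := by
        refine mul_le_mul_of_nonneg_left (Finset.sum_le_sum fun ε _ => ?_) (by positivity)
        -- Here the square function has to be diagonal: an even power of a symmetric matrix has
        -- nonnegative diagonal entries, so each `D i` may be replaced by `v`.
        rw [hD, Matrix.trace, Matrix.trace, Finset.mul_sum]
        refine Finset.sum_le_sum fun i _ => ?_
        rw [Matrix.diag_apply, Matrix.diagonal_mul, Matrix.diag_apply]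
        refine mul_le_mul_of_nonneg_right (hv i) ?_
        rw [two_mul, pow_add, Matrix.mul_apply]
        refine Finset.sum_nonneg fun j _ => ?_
        have : (signedSum H ε ^ k) j i = (signedSum H ε ^ k) i j := by
          conv_lhs => rw [← signedSum_transpose hH ε, ← Matrix.transpose_pow]
          rfl
        rw [this]
        exact mul_self_nonneg _
    _ = _ := by rw [← Finset.mul_sum]; ring

theorem sum_trace_signedSum_even_pow_le {H : τ → Matrix d d ℝ} (hH : ∀ t, (H t)ᵀ = H t)
    {D : d → ℝ} {v : ℝ} (hD : ∑ t, H t * H t = Matrix.diagonal D) (hv : ∀ i, D i ≤ v)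
    (hv0 : 0 ≤ v) {K k : ℕ} (hk : k ≤ K) :
    ∑ ε : τ → Bool, (signedSum H ε ^ (2 * k)).trace ≤
      (2 * K * v) ^ k * (Fintype.card (τ → Bool) * Fintype.card d) := by
  induction k with
  | zero => simp [Matrix.trace_one]
  | succ k ih =>
    have h1 := sum_trace_signedSum_pow_le hH hD hv k
    have h2 : (2 * k + 1 : ℝ) ≤ 2 * K := by
      have : (k : ℝ) + 1 ≤ K := by exact_mod_cast hk
      linarith
    have h3 := ih (by omega)
    have h4 : 2 * (k + 1) = 2 * k + 2 := by ring
    rw [h4, pow_succ]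
    calc _ ≤ (2 * k + 1) * v * ∑ ε : τ → Bool, (signedSum H ε ^ (2 * k)).trace := h1
      _ ≤ (2 * k + 1) * v * ((2 * K * v) ^ k * (Fintype.card (τ → Bool) * Fintype.card d)) :=
          mul_le_mul_of_nonneg_left h3 (by positivity)
      _ ≤ (2 * K) * v * ((2 * K * v) ^ k * (Fintype.card (τ → Bool) * Fintype.card d)) := by
          gcongr
      _ = _ := by ring

/-- The trace is the sum of the even powers of the eigenvalues, one of which realizes the norm. -/
theorem norm_pow_le_trace_pow {A : Matrix d d ℝ} (hA : Aᵀ = A) {k : ℕ} (hk : k ≠ 0) :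
    (‖A‖ ^ 2) ^ k ≤ (A ^ (2 * k)).trace := by
  obtain ⟨O, α, hO, rfl⟩ := exists_orthogonal_diagonalization hA
  have hOt : ‖Oᵀ‖ ≤ 1 := by rw [norm_transpose]; exact norm_le_one_of_orthonormal hO
  have h1 : ‖O * Matrix.diagonal α * Oᵀ‖ ≤ ‖α‖ := by
    rw [← Matrix.l2_opNorm_diagonal]
    exact (norm_mul_le_left hOt).trans (norm_mul_le_right (norm_le_one_of_orthonormal hO))
  have h2 : ((O * Matrix.diagonal α * Oᵀ) ^ (2 * k)).trace = ∑ i, α i ^ (2 * k) := by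
    rw [conj_diagonal_pow hO, Matrix.trace_mul_comm, ← Matrix.mul_assoc, hO, Matrix.one_mul,
      Matrix.trace_diagonal]
  have hnn : ∀ i, 0 ≤ α i ^ (2 * k) := fun i => by rw [pow_mul]; positivity
  rw [h2]
  have h3 : (‖α‖ ^ 2) ^ k ≤ ∑ i, α i ^ (2 * k) := by
    rcases isEmpty_or_nonempty d with hd | hd
    · have : α = 0 := Subsingleton.elim _ _
      simp [this, hk]
    · obtain ⟨i, hi⟩ : ∃ i, ‖α‖ = ‖α i‖ := by
        obtain ⟨i, -, hi⟩ := Finset.exists_mem_eq_sup' (Finset.univ_nonempty (α := d))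
          (fun i => ‖α i‖₊)
        refine ⟨i, ?_⟩
        have : ‖α‖₊ = ‖α i‖₊ := by
          rw [Pi.nnnorm_def, ← Finset.sup'_eq_sup Finset.univ_nonempty, hi]
        exact congrArg NNReal.toReal this
      rw [hi, Real.norm_eq_abs, sq_abs, ← pow_mul]
      exact Finset.single_le_sum (fun i _ => hnn i) (Finset.mem_univ i)
  refine le_trans ?_ h3
  gcongr

/-- The noncommutative Khintchine inequality for signed sums with diagonal square function. -/
theorem sum_norm_sq_signedSum_le {H : τ → Matrix d d ℝ} (hH : ∀ t, (H t)ᵀ = H t)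
    {D : d → ℝ} {v : ℝ} (hD : ∑ t, H t * H t = Matrix.diagonal D) (hv : ∀ i, D i ≤ v)
    (hv0 : 0 < v) [Nonempty d] :
    ∑ ε : τ → Bool, ‖signedSum H ε‖ ^ 2 ≤
      Fintype.card (τ → Bool) * (12 * (Real.log (Fintype.card d) + 1) * v) := by
  set c : ℝ := (Fintype.card d : ℝ) with hc
  have hc1 : 1 ≤ c := by rw [hc]; exact_mod_cast Fintype.card_pos
  have hlog : 0 ≤ Real.log c := Real.log_nonneg hc1
  -- A moment of the order of the logarithm of the dimension, so that the dimension factor lost in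
  -- passing to the trace is at most `e ^ k`.
  set k : ℕ := ⌊Real.log c⌋₊ + 1 with hk
  have hk1 : Real.log c ≤ k := by rw [hk]; push_cast; exact (Nat.lt_floor_add_one _).le
  have hk2 : (k : ℝ) ≤ Real.log c + 1 := by
    rw [hk]; push_cast; linarith [Nat.floor_le hlog]
  have hk0 : (0 : ℝ) < k := by rw [hk]; positivity
  set K : ℝ := 2 * Real.exp 1 * k * v with hK
  have hK0 : 0 < K := by positivity
  -- This bound by a `k`-th moment takes the place of Jensen's inequality. `K` is such that the
  -- normalized moment is at most one on average.
  have hy : ∀ y : ℝ, 0 ≤ y → y ≤ K + K * (y ^ k / K ^ k) := by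
    intro y hy0
    rcases le_total y K with h | h
    · have : 0 ≤ K * (y ^ k / K ^ k) := by positivity
      linarith
    · have h1 : 1 ≤ y / K := (one_le_div hK0).2 h
      have h2 : y / K ≤ (y / K) ^ k := le_self_pow₀ h1 (by omega)
      rw [div_pow] at h2
      have h3 : y ≤ K * (y ^ k / K ^ k) := by
        rw [div_le_iff₀ hK0] at h2; linarith
      linarith
  have h1 := sum_trace_signedSum_even_pow_le hH hD hv hv0.le (le_refl k)
  have h2 : ∑ ε : τ → Bool, (‖signedSum H ε‖ ^ 2) ^ k ≤
      (2 * k * v) ^ k * (Fintype.card (τ → Bool) * c) :=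
    (Finset.sum_le_sum fun ε _ =>
      norm_pow_le_trace_pow (signedSum_transpose hH ε) (by omega)).trans h1
  have hexp : c ≤ Real.exp 1 ^ k := by
    rw [← Real.exp_nat_mul, mul_one]
    calc c = Real.exp (Real.log c) := (Real.exp_log (by linarith)).symm
      _ ≤ _ := Real.exp_le_exp.2 hk1
  have h3 : (∑ ε : τ → Bool, (‖signedSum H ε‖ ^ 2) ^ k) / K ^ k ≤ Fintype.card (τ → Bool) := by
    rw [div_le_iff₀ (by positivity)]
    refine h2.trans ?_
    have : K ^ k = Real.exp 1 ^ k * (2 * k * v) ^ k := by rw [← mul_pow, hK]; ring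
    rw [this]
    have h4 : (0 : ℝ) ≤ (2 * k * v) ^ k * Fintype.card (τ → Bool) := by positivity
    nlinarith [mul_le_mul_of_nonneg_left hexp h4]
  calc ∑ ε : τ → Bool, ‖signedSum H ε‖ ^ 2
      ≤ ∑ ε : τ → Bool, (K + K * ((‖signedSum H ε‖ ^ 2) ^ k / K ^ k)) :=
        Finset.sum_le_sum fun ε _ => hy _ (by positivity)
    _ = Fintype.card (τ → Bool) * K + K * ((∑ ε : τ → Bool, (‖signedSum H ε‖ ^ 2) ^ k) / K ^ k) := by
        rw [Finset.sum_add_distrib, Finset.sum_const, Finset.card_univ, nsmul_eq_mul,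
          ← Finset.mul_sum, Finset.sum_div]
    _ ≤ Fintype.card (τ → Bool) * K + K * Fintype.card (τ → Bool) := by gcongr
    _ = Fintype.card (τ → Bool) * (4 * Real.exp 1 * k * v) := by rw [hK]; ring
    _ ≤ _ := by
        have he : Real.exp 1 ≤ 3 := Real.exp_one_lt_d9.le.trans (by norm_num)
        have h4 : 4 * Real.exp 1 * k ≤ 12 * (Real.log c + 1) := by
          calc 4 * Real.exp 1 * k ≤ 4 * 3 * (Real.log c + 1) := by gcongr
            _ = _ := by ring
        exact mul_le_mul_of_nonneg_left (mul_le_mul_of_nonneg_right h4 hv0.le) (by positivity)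

/-- The self-adjoint dilation of a rectangular matrix. -/
def dilation {m n : Type*} (X : Matrix m n ℝ) : Matrix (m ⊕ n) (m ⊕ n) ℝ :=
  Matrix.fromBlocks 0 X Xᵀ 0

/-- The matrix `X` is a block of its dilation, cut out by two contractions. -/
theorem norm_le_norm_dilation {m n : Type*} [Fintype m] [Fintype n] [DecidableEq m]
    [DecidableEq n] (X : Matrix m n ℝ) : ‖X‖ ≤ ‖dilation X‖ := by
  have h1 : X = (Matrix.fromCols (1 : Matrix m m ℝ) (0 : Matrix m n ℝ)) * dilation X *
      (Matrix.fromRows (0 : Matrix m n ℝ) (1 : Matrix n n ℝ)) := by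
    simp [dilation, Matrix.fromCols_mul_fromBlocks, Matrix.fromCols_mul_fromRows]
  have hR : ‖Matrix.fromRows (0 : Matrix m n ℝ) (1 : Matrix n n ℝ)‖ ≤ 1 := by
    apply norm_le_one_of_orthonormal
    simp [Matrix.transpose_fromRows, Matrix.fromCols_mul_fromRows]
  have hC : ‖Matrix.fromCols (1 : Matrix m m ℝ) (0 : Matrix m n ℝ)‖ ≤ 1 := by
    rw [← norm_transpose]
    apply norm_le_one_of_orthonormal
    rw [Matrix.transpose_fromCols, Matrix.transpose_fromRows, Matrix.fromCols_mul_fromRows]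
    simp
  calc ‖X‖ = _ := congrArg norm h1
    _ ≤ _ := (norm_mul_le_left hR).trans (norm_mul_le_right hC)

/-- Khintchine's inequality for matrices with one nonzero entry each. -/
theorem sum_norm_sq_signedSum_single_le {m n : ℕ} [NeZero m] (i : τ → Fin m) (j : τ → Fin n)
    (x : τ → ℝ) {v : ℝ} (hv0 : 0 < v) (hrow : ∀ a, ∑ t, (if i t = a then x t ^ 2 else 0) ≤ v)
    (hcol : ∀ b, ∑ t, (if j t = b then x t ^ 2 else 0) ≤ v) :
    ∑ ε : τ → Bool, ‖signedSum (fun t => Matrix.single (i t) (j t) (x t)) ε‖ ^ 2 ≤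
      Fintype.card (τ → Bool) * (12 * (Real.log ((m : ℝ) + n) + 1) * v) := by
  set X : τ → Matrix (Fin m) (Fin n) ℝ := fun t => Matrix.single (i t) (j t) (x t) with hX
  set H : τ → Matrix (Fin m ⊕ Fin n) (Fin m ⊕ Fin n) ℝ := fun t => dilation (X t) with hH
  have hHt : ∀ t, (H t)ᵀ = H t := fun t => by
    simp [hH, dilation, Matrix.fromBlocks_transpose]
  have hsum : ∀ ε, signedSum H ε = dilation (signedSum X ε) := by
    intro ε
    ext a b
    rcases a with a | a <;> rcases b with b | b <;>
      simp [signedSum, hH, dilation, Matrix.sum_apply, Matrix.transpose_apply]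
  -- For a matrix with a single nonzero entry the square of the dilation is diagonal. Its entries
  -- add up to the square sums over the rows and over the columns.
  have hD : ∑ t, H t * H t = Matrix.diagonal (Sum.elim
      (fun a => ∑ t, (if i t = a then x t ^ 2 else 0))
      (fun b => ∑ t, (if j t = b then x t ^ 2 else 0))) := by
    have h1 : ∀ t, H t * H t = Matrix.diagonal (Sum.elim
        (fun a => (if i t = a then x t ^ 2 else 0)) (fun b => (if j t = b then x t ^ 2 else 0))) := by
      intro t
      have e1 : Matrix.single (i t) (i t) (x t ^ 2) =
          Matrix.diagonal (fun a => if i t = a then x t ^ 2 else 0) := by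
        ext a b
        simp only [Matrix.single_apply, Matrix.diagonal_apply]
        by_cases h : a = b <;> by_cases h' : i t = a <;> simp_all
      have e2 : Matrix.single (j t) (j t) (x t ^ 2) =
          Matrix.diagonal (fun a => if j t = a then x t ^ 2 else 0) := by
        ext a b
        simp only [Matrix.single_apply, Matrix.diagonal_apply]
        by_cases h : a = b <;> by_cases h' : j t = a <;> simp_all
      rw [← Matrix.fromBlocks_diagonal, ← e1, ← e2]
      simp [hH, dilation, hX, Matrix.fromBlocks_multiply, Matrix.transpose_single, sq]
    simp only [h1]
    ext a b
    rw [Matrix.sum_apply, Matrix.diagonal_apply]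
    by_cases hab : a = b
    · subst hab
      rcases a with a | a <;> simp
    · simp [hab]
  have h2 := sum_norm_sq_signedSum_le (τ := τ) hHt hD (v := v)
    (by rintro (a | b) <;> simp only [Sum.elim_inl, Sum.elim_inr]
        · exact hrow a
        · exact hcol b) hv0
  rw [Fintype.card_sum, Fintype.card_fin, Fintype.card_fin] at h2
  push_cast at h2
  refine le_trans (Finset.sum_le_sum fun ε _ => ?_) h2
  rw [hsum]
  exact pow_le_pow_left₀ (norm_nonneg _) (norm_le_norm_dilation _) 2

end Khintchine

end LowRankBandit

end

noncomputable section

namespace LowRankBandit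

/-! ### Independence -/

section Independence

variable {Ω : Type*} [MeasurableSpace Ω] {P : Measure Ω} [IsProbabilityMeasure P]
  {α β : Type*} [MeasurableSpace α] [MeasurableSpace β]

/-- Decoupling: the second variable is evaluated at a separate outcome of the same probability
space, which serves as an independent copy. -/
theorem lintegral_of_indepFun {X : Ω → α} {Y : Ω → β} (h : IndepFun X Y P) (hX : Measurable X)
    (hY : Measurable Y) {f : α × β → ℝ≥0∞} (hf : Measurable f) :
    ∫⁻ ω, f (X ω, Y ω) ∂P = ∫⁻ ω, ∫⁻ ω', f (X ω, Y ω') ∂P ∂P := by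
  have h1 := (indepFun_iff_map_prod_eq_prod_map_map hX.aemeasurable hY.aemeasurable).1 h
  have : IsProbabilityMeasure (P.map Y) := Measure.isProbabilityMeasure_map hY.aemeasurable
  rw [← lintegral_map (f := f) hf (hX.prodMk hY), h1, lintegral_prod _ hf.aemeasurable,
    lintegral_map hf.lintegral_prod_right' hX]
  refine lintegral_congr fun ω => ?_
  exact lintegral_map (f := fun y => f (X ω, y)) (hf.comp measurable_prodMk_left) hY

/-- Conditioning on `X`: a bound valid for each of its frozen values carries over to the joint
event. -/
theorem measure_le_of_indepFun {X : Ω → α} {Y : Ω → β} (h : IndepFun X Y P) (hX : Measurable X)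
    (hY : Measurable Y) {S : Set (α × β)} (hS : MeasurableSet S) {ε : ℝ≥0∞}
    (hε : ∀ x, P {ω | (x, Y ω) ∈ S} ≤ ε) : P {ω | (X ω, Y ω) ∈ S} ≤ ε := by
  have hm : Measurable (S.indicator (1 : α × β → ℝ≥0∞)) := measurable_one.indicator hS
  have h1 := lintegral_of_indepFun h hX hY hm
  have h2 : ∀ {Z : Ω → α × β}, Measurable Z →
      ∫⁻ ω, S.indicator (1 : α × β → ℝ≥0∞) (Z ω) ∂P = P {ω | Z ω ∈ S} := by
    intro Z hZ
    have : (fun ω => S.indicator (1 : α × β → ℝ≥0∞) (Z ω)) = (Z ⁻¹' S).indicator 1 := rfl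
    rw [this, lintegral_indicator_one (hZ hS)]
    rfl
  rw [h2 (hX.prodMk hY)] at h1
  rw [h1]
  calc _ ≤ ∫⁻ _, ε ∂P := by
        refine lintegral_mono fun ω => ?_
        rw [h2 (measurable_const.prodMk hY)]
        exact hε _
    _ = ε := by simp

/-- The law of the sequence of pairs is a product over the rounds of products of two laws;
reordering the factors separates the two sequences. -/
theorem indepFun_pi_of_iIndepFun_prod {τ : Type*} [Fintype τ] {A : τ → Ω → α} {B : τ → Ω → β}
    (hA : ∀ t, Measurable (A t)) (hB : ∀ t, Measurable (B t))
    (h : iIndepFun (fun t ω => (A t ω, B t ω)) P) (hAB : ∀ t, IndepFun (A t) (B t) P) :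
    IndepFun (fun ω t => A t ω) (fun ω t => B t ω) P := by
  have mA : Measurable fun ω t => A t ω := measurable_pi_lambda _ hA
  have mB : Measurable fun ω t => B t ω := measurable_pi_lambda _ hB
  have hA' : iIndepFun A P := h.comp (fun _ => Prod.fst) fun _ => measurable_fst
  have hB' : iIndepFun B P := h.comp (fun _ => Prod.snd) fun _ => measurable_snd
  have pA : ∀ t, IsProbabilityMeasure (P.map (A t)) := fun t =>
    Measure.isProbabilityMeasure_map (hA t).aemeasurable
  have pB : ∀ t, IsProbabilityMeasure (P.map (B t)) := fun t =>
    Measure.isProbabilityMeasure_map (hB t).aemeasurable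
  rw [indepFun_iff_map_prod_eq_prod_map_map mA.aemeasurable mB.aemeasurable,
    (iIndepFun_iff_map_fun_eq_pi_map fun t => (hA t).aemeasurable).1 hA',
    (iIndepFun_iff_map_fun_eq_pi_map fun t => (hB t).aemeasurable).1 hB',
    ← (measurePreserving_arrowProdEquivProdArrow α β τ (fun t => P.map (A t))
      (fun t => P.map (B t))).map_eq]
  have h1 := (iIndepFun_iff_map_fun_eq_pi_map
    fun t => ((hA t).prodMk (hB t)).aemeasurable).1 h
  have h2 : ∀ t, P.map (fun ω => (A t ω, B t ω)) = (P.map (A t)).prod (P.map (B t)) := fun t =>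
    (indepFun_iff_map_prod_eq_prod_map_map (hA t).aemeasurable (hB t).aemeasurable).1 (hAB t)
  simp only [h2] at h1
  rw [← h1, Measure.map_map (MeasurableEquiv.measurable _)
    (measurable_pi_lambda _ fun t => (hA t).prodMk (hB t))]
  rfl

/-- Swapping any of the coordinates of two independent copies of a sequence of independent
variables preserves the joint law. -/
theorem lintegral_swap_coordinates {τ : Type*} [Fintype τ] {z : τ → Ω → α}
    (hz : ∀ t, Measurable (z t)) (h : iIndepFun z P) (ε : τ → Bool) {Q : (τ → α × α) → ℝ≥0∞}
    (hQ : Measurable Q) :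
    ∫⁻ ω, ∫⁻ ω', Q (fun t => (z t ω, z t ω')) ∂P ∂P =
      ∫⁻ ω, ∫⁻ ω', Q (fun t => if ε t then (z t ω, z t ω') else (z t ω', z t ω)) ∂P ∂P := by
  have pz : ∀ t, IsProbabilityMeasure (P.map (z t)) := fun t =>
    Measure.isProbabilityMeasure_map (hz t).aemeasurable
  have mz : Measurable fun ω t => z t ω := measurable_pi_lambda _ hz
  have key : ∀ {R : (τ → α × α) → ℝ≥0∞}, Measurable R →
      ∫⁻ ω, ∫⁻ ω', R (fun t => (z t ω, z t ω')) ∂P ∂P =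
        ∫⁻ w, R w ∂(Measure.pi fun t => (P.map (z t)).prod (P.map (z t))) := by
    intro R hR
    have e := measurePreserving_arrowProdEquivProdArrow α α τ (fun t => P.map (z t))
      (fun t => P.map (z t))
    have hR' : Measurable fun x : (τ → α) × (τ → α) =>
        R ((MeasurableEquiv.arrowProdEquivProdArrow α α τ).symm x) :=
      hR.comp (MeasurableEquiv.measurable _)
    have e2 : ∫⁻ w, R w ∂(Measure.pi fun t => (P.map (z t)).prod (P.map (z t))) =
        ∫⁻ x, R ((MeasurableEquiv.arrowProdEquivProdArrow α α τ).symm x)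
          ∂((Measure.pi fun t => P.map (z t)).prod (Measure.pi fun t => P.map (z t))) := by
      rw [← e.map_eq, lintegral_map hR' (MeasurableEquiv.measurable _)]
      simp
    rw [e2, ← (iIndepFun_iff_map_fun_eq_pi_map fun t => (hz t).aemeasurable).1 h]
    have : IsProbabilityMeasure (P.map fun ω t => z t ω) :=
      Measure.isProbabilityMeasure_map mz.aemeasurable
    rw [lintegral_prod _ hR'.aemeasurable, lintegral_map hR'.lintegral_prod_right' mz]
    refine lintegral_congr fun ω => ?_
    exact (lintegral_map (f := fun y =>
      R ((MeasurableEquiv.arrowProdEquivProdArrow α α τ).symm (fun t => z t ω, y)))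
      (hR'.comp measurable_prodMk_left) mz).symm
  -- Each coordinate carries the product of a law with itself, which the swap preserves.
  have hswap : MeasurePreserving (fun (w : τ → α × α) t => if ε t then w t else (w t).swap)
      (Measure.pi fun t => (P.map (z t)).prod (P.map (z t)))
      (Measure.pi fun t => (P.map (z t)).prod (P.map (z t))) := by
    refine measurePreserving_pi _ _ (f := fun t (x : α × α) => if ε t then x else x.swap) fun t => ?_
    cases ε t
    · simpa using Measure.measurePreserving_swap
    · simp only [↓reduceIte]; exact MeasurePreserving.id _
  rw [key hQ, ← hswap.lintegral_comp hQ]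
  exact (key (hQ.comp hswap.measurable)).symm

end Independence

/-! ### Bernstein's inequality -/

section Bernstein

variable {Ω : Type*} [MeasurableSpace Ω] {P : Measure Ω} [IsProbabilityMeasure P]

/-- The upper tail in Bernstein's inequality. -/
theorem bernstein_upper {τ : Type*} {Z : τ → Ω → ℝ} (hZ : ∀ t, Measurable (Z t))
    (hind : iIndepFun Z P) (S : Finset τ) {μ w : τ → ℝ} {s₀ ℓ : ℝ} (hs₀ : 0 < s₀) (hℓ : 0 < ℓ)
    (hw : ∀ t, 0 ≤ w t) (hint : ∀ t s, Integrable (fun ω => Real.exp (s * Z t ω)) P)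
    (hmgf : ∀ t s, |s| ≤ s₀ → mgf (Z t) P s ≤ Real.exp (s * μ t + s ^ 2 * w t)) :
    P.real {ω | 2 * √((∑ t ∈ S, w t) * ℓ) + ℓ / s₀ ≤ ∑ t ∈ S, Z t ω - ∑ t ∈ S, μ t} ≤
      Real.exp (-ℓ) := by
  set W := ∑ t ∈ S, w t with hW
  have hW0 : 0 ≤ W := Finset.sum_nonneg fun t _ => hw t
  set x := 2 * √(W * ℓ) + ℓ / s₀ with hx
  have key : ∀ s, 0 ≤ s → s ≤ s₀ → s ^ 2 * W - s * x ≤ -ℓ →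
      P.real {ω | x ≤ ∑ t ∈ S, Z t ω - ∑ t ∈ S, μ t} ≤ Real.exp (-ℓ) := by
    intro s hs hss hle
    have h1 := measure_ge_le_exp_mul_mgf (μ := P) (X := ∑ t ∈ S, Z t) (x + ∑ t ∈ S, μ t) hs
      (hind.integrable_exp_mul_sum hZ fun t _ => hint t s)
    have h2 : {ω | x ≤ ∑ t ∈ S, Z t ω - ∑ t ∈ S, μ t} =
        {ω | x + ∑ t ∈ S, μ t ≤ (∑ t ∈ S, Z t) ω} := by
      ext ω; simp only [Set.mem_ofPred_eq, Finset.sum_apply, le_sub_iff_add_le]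
    rw [h2]
    refine h1.trans ?_
    rw [hind.mgf_sum hZ]
    calc _ ≤ Real.exp (-s * (x + ∑ t ∈ S, μ t)) *
          ∏ t ∈ S, Real.exp (s * μ t + s ^ 2 * w t) := by
          refine mul_le_mul_of_nonneg_left ?_ (Real.exp_nonneg _)
          exact Finset.prod_le_prod (fun t _ => mgf_nonneg)
            fun t _ => hmgf t s (by rwa [abs_of_nonneg hs])
      _ = Real.exp (s ^ 2 * W - s * x) := by
          rw [← Real.exp_sum, ← Real.exp_add, Finset.sum_add_distrib, ← Finset.mul_sum,
            ← Finset.mul_sum, ← hW]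
          congr 1; ring
      _ ≤ _ := Real.exp_le_exp.2 hle
  -- The exponent is taken at `s = √(ℓ / W)`, capped at the admissible value `s₀`.
  by_cases hcase : W * s₀ ^ 2 ≤ ℓ
  · refine key s₀ hs₀.le le_rfl ?_
    have h1 : s₀ * √W ≤ √ℓ := by
      rw [← Real.sqrt_sq hs₀.le, ← Real.sqrt_mul (sq_nonneg _)]
      exact Real.sqrt_le_sqrt (by linarith)
    have h2 : s₀ ^ 2 * W ≤ s₀ * √(W * ℓ) := by
      rw [Real.sqrt_mul hW0]
      calc s₀ ^ 2 * W = (s₀ * √W) * (s₀ * √W) := by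
            have := Real.mul_self_sqrt hW0; linear_combination (-s₀ ^ 2) * this
        _ ≤ (s₀ * √W) * √ℓ := mul_le_mul_of_nonneg_left h1 (by positivity)
        _ = _ := by ring
    have h3 : s₀ * (ℓ / s₀) = ℓ := by field_simp
    have h4 : 0 ≤ s₀ * √(W * ℓ) := by positivity
    rw [hx, mul_add, h3]
    linarith
  · push Not at hcase
    have hWpos : 0 < W := by
      rcases hW0.lt_or_eq with h | h
      · exact h
      · rw [← h, zero_mul] at hcase; linarith
    refine key (√(ℓ / W)) (Real.sqrt_nonneg _) ?_ ?_
    · rw [Real.sqrt_le_left hs₀.le, div_le_iff₀ hWpos]; linarith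
    · have h1 : √(ℓ / W) ^ 2 * W = ℓ := by
        rw [Real.sq_sqrt (by positivity)]; field_simp
      have h2 : √(ℓ / W) * √(W * ℓ) = ℓ := by
        rw [← Real.sqrt_mul (by positivity)]
        have : ℓ / W * (W * ℓ) = ℓ ^ 2 := by field_simp
        rw [this, Real.sqrt_sq hℓ.le]
      have h3 : 0 ≤ √(ℓ / W) * (ℓ / s₀) := by positivity
      rw [hx, h1, mul_add]
      linarith

/-- Bernstein's inequality. -/
theorem bernstein {τ : Type*} {Z : τ → Ω → ℝ} (hZ : ∀ t, Measurable (Z t))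
    (hind : iIndepFun Z P) (S : Finset τ) {μ w : τ → ℝ} {s₀ ℓ : ℝ} (hs₀ : 0 < s₀) (hℓ : 0 < ℓ)
    (hw : ∀ t, 0 ≤ w t) (hint : ∀ t s, Integrable (fun ω => Real.exp (s * Z t ω)) P)
    (hmgf : ∀ t s, |s| ≤ s₀ → mgf (Z t) P s ≤ Real.exp (s * μ t + s ^ 2 * w t)) :
    P.real {ω | 2 * √((∑ t ∈ S, w t) * ℓ) + ℓ / s₀ < |∑ t ∈ S, Z t ω - ∑ t ∈ S, μ t|} ≤
      2 * Real.exp (-ℓ) := by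
  have h1 := bernstein_upper hZ hind S hs₀ hℓ hw hint hmgf
  have h2 := bernstein_upper (Z := fun t ω => - Z t ω) (μ := fun t => - μ t)
    (fun t => (hZ t).neg) (hind.comp (fun _ x => -x) fun _ => measurable_neg) S hs₀ hℓ hw
    (fun t s => by simpa using hint t (-s))
    (fun t s hs => by
      have := hmgf t (-s) (by rwa [abs_neg])
      have h3 : mgf (fun ω => - Z t ω) P s = mgf (Z t) P (-s) := by
        simp [mgf]
      rw [h3]
      refine this.trans (le_of_eq ?_)
      congr 1; ring)
  refine (measureReal_mono (fun ω hω => ?_)).trans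
    ((measureReal_union_le _ _).trans ((add_le_add h1 h2).trans (le_of_eq (by ring))))
  simp only [Set.mem_ofPred_eq, Set.mem_union, Finset.sum_neg_distrib] at hω ⊢
  rcases lt_abs.1 hω with h | h
  · left; exact h.le
  · right; linarith

/-- Moment generating function of an observation `f X + ξ` weighted by `h X`. -/
theorem mgf_weighted_observation {α : Type*} [Fintype α] [MeasurableSpace α]
    [MeasurableSingletonClass α] {X : Ω → α} {ξ : Ω → ℝ} (hX : Measurable X)
    (hXξ : IndepFun X ξ P) {σ : ℝ≥0} (hξ : HasSubgaussianMGF ξ (σ ^ 2) P) {f h : α → ℝ}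
    {L b : ℝ} (hL : (σ : ℝ) ≤ L) (hf : ∀ a, |f a| ≤ L) (hh : ∀ a, |h a| ≤ b) :
    (∀ s, Integrable (fun ω => Real.exp (s * (h (X ω) * (f (X ω) + ξ ω)))) P) ∧
    ∀ s, |s| * (b * L) ≤ 1 / 2 →
      mgf (fun ω => h (X ω) * (f (X ω) + ξ ω)) P s ≤
        Real.exp (s * ∑ a, P.real (X ⁻¹' {a}) * (h a * f a) +
          s ^ 2 * (3 * L ^ 2 * ∑ a, P.real (X ⁻¹' {a}) * h a ^ 2)) := by
  classical
  have hL0 : 0 ≤ L := σ.2.trans hL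
  have hms : ∀ a, MeasurableSet (X ⁻¹' {a}) := fun a => hX (measurableSet_singleton a)
  -- Splitting according to the value of `X` leaves a constant multiple of the noise in each term,
  -- so that independence factorizes the expectation.
  have hdecomp : ∀ s ω, Real.exp (s * (h (X ω) * (f (X ω) + ξ ω))) =
      ∑ a, Real.exp (s * (h a * f a)) *
        ((X ⁻¹' {a}).indicator (fun _ => (1 : ℝ)) ω * Real.exp (s * h a * ξ ω)) := by
    intro s ω
    rw [Finset.sum_eq_single (X ω)]
    · rw [Set.indicator_of_mem (by simp), one_mul, ← Real.exp_add]
      congr 1; ring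
    · intro a _ ha
      rw [Set.indicator_of_notMem (by simpa using ha.symm)]; simp
    · simp
  have hint : ∀ s a, Integrable (fun ω => (X ⁻¹' {a}).indicator (fun _ => (1 : ℝ)) ω *
      Real.exp (s * h a * ξ ω)) P := by
    intro s a
    have : (fun ω => (X ⁻¹' {a}).indicator (fun _ => (1 : ℝ)) ω * Real.exp (s * h a * ξ ω)) =
        (X ⁻¹' {a}).indicator fun ω => Real.exp (s * h a * ξ ω) := by
      ext ω
      by_cases hω : ω ∈ X ⁻¹' {a} <;> simp [hω]
    rw [this]
    exact (hξ.integrable_exp_mul (s * h a)).indicator (hms a)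
  have hintegral : ∀ s a, ∫ ω, (X ⁻¹' {a}).indicator (fun _ => (1 : ℝ)) ω *
      Real.exp (s * h a * ξ ω) ∂P = P.real (X ⁻¹' {a}) * mgf ξ P (s * h a) := by
    intro s a
    have hI : IndepFun (fun ω => (X ⁻¹' {a}).indicator (fun _ => (1 : ℝ)) ω)
        (fun ω => Real.exp (s * h a * ξ ω)) P := by
      have := hXξ.comp (_mγ := Real.measurableSpace)
        (φ := fun x => ({a} : Set α).indicator (fun _ => (1 : ℝ)) x)
        (ψ := fun x => Real.exp (s * h a * x))
        (measurable_const.indicator (measurableSet_singleton a)) (by fun_prop)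
      exact this
    have h1 := hI.integral_fun_mul_eq_mul_integral
      ((measurable_const.indicator (hms a)).aestronglyMeasurable)
      (hξ.integrable_exp_mul (s * h a)).aestronglyMeasurable
    rw [h1, integral_indicator_const _ (hms a)]
    simp [mgf]
  refine ⟨fun s => ?_, fun s hs => ?_⟩
  · simp only [hdecomp]
    exact integrable_finsetSum _ fun a _ => (hint s a).const_mul _
  · have hw1 : ∑ a, P.real (X ⁻¹' {a}) = 1 := by
      have := sum_measureReal_preimage_singleton (μ := P) (f := X) (Finset.univ : Finset α)
        (fun a _ => hms a)
      simpa using this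
    have hmgf : mgf (fun ω => h (X ω) * (f (X ω) + ξ ω)) P s =
        ∑ a, Real.exp (s * (h a * f a)) * (P.real (X ⁻¹' {a}) * mgf ξ P (s * h a)) := by
      rw [mgf]
      simp only [hdecomp]
      rw [integral_finsetSum _ fun a _ => (hint s a).const_mul _]
      refine Finset.sum_congr rfl fun a _ => ?_
      rw [integral_const_mul, hintegral]
    rw [hmgf]
    have hterm : ∀ a, Real.exp (s * (h a * f a)) * (P.real (X ⁻¹' {a}) * mgf ξ P (s * h a)) ≤
        P.real (X ⁻¹' {a}) * (1 + s * (h a * f a) + 3 * s ^ 2 * L ^ 2 * h a ^ 2) := by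
      intro a
      have h1 : mgf ξ P (s * h a) ≤ Real.exp ((σ : ℝ) ^ 2 * (s * h a) ^ 2 / 2) := by
        have := hξ.mgf_le (s * h a)
        simpa using this
      set u := s * (h a * f a) + (σ : ℝ) ^ 2 * (s * h a) ^ 2 / 2 with hu
      have hb : |s| * |h a| * L ≤ 1 / 2 := by
        calc |s| * |h a| * L ≤ |s| * b * L := by
              have := hh a; gcongr
          _ ≤ 1 / 2 := by linarith
      set y := |s| * |h a| * L with hy
      have hy0 : 0 ≤ y := by positivity
      have h2 : |s * (h a * f a)| ≤ y := by
        rw [abs_mul, abs_mul, hy, mul_assoc]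
        have := hf a
        gcongr
      have h3 : (σ : ℝ) ^ 2 * (s * h a) ^ 2 ≤ y ^ 2 := by
        have : y ^ 2 = L ^ 2 * (s * h a) ^ 2 := by
          rw [hy, mul_pow, mul_pow, sq_abs, sq_abs]; ring
        rw [this]
        have := σ.2
        gcongr
      have h30 : 0 ≤ (σ : ℝ) ^ 2 * (s * h a) ^ 2 := by positivity
      have hu1 : |u| ≤ y + y ^ 2 / 2 := by
        refine (abs_add_le _ _).trans (add_le_add h2 ?_)
        rw [abs_of_nonneg (by positivity)]; linarith
      have hule : |u| ≤ 5 / 4 * y := hu1.trans (by nlinarith)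
      -- As `|u| ≤ 5/8`, the exponential is at most `1 + u + u²`. The quadratic terms amount to at
      -- most `1/2 + 25/16 ≤ 3` times `y²`, whence the constant `3`.
      have hu2 := Real.abs_exp_sub_one_sub_id_le (x := u) (hule.trans (by linarith))
      have hu3 : u ^ 2 ≤ 25 / 16 * y ^ 2 := by
        rw [← sq_abs]; nlinarith [abs_nonneg u]
      have hexp : Real.exp u ≤ 1 + s * (h a * f a) + 3 * s ^ 2 * L ^ 2 * h a ^ 2 := by
        have h4 := (abs_le.1 hu2).2
        have h5 : y ^ 2 = s ^ 2 * L ^ 2 * h a ^ 2 := by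
          rw [hy, mul_pow, mul_pow, sq_abs, sq_abs]; ring
        have h6 : 0 ≤ y ^ 2 := sq_nonneg _
        nlinarith
      calc _ = P.real (X ⁻¹' {a}) * (Real.exp (s * (h a * f a)) * mgf ξ P (s * h a)) := by ring
        _ ≤ P.real (X ⁻¹' {a}) * Real.exp u := by
            refine mul_le_mul_of_nonneg_left ?_ measureReal_nonneg
            rw [hu, Real.exp_add]
            exact mul_le_mul_of_nonneg_left h1 (Real.exp_nonneg _)
        _ ≤ _ := mul_le_mul_of_nonneg_left hexp measureReal_nonneg
    refine (Finset.sum_le_sum fun a _ => hterm a).trans ?_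
    have hsum : ∑ a, P.real (X ⁻¹' {a}) * (1 + s * (h a * f a) + 3 * s ^ 2 * L ^ 2 * h a ^ 2) =
        (s * ∑ a, P.real (X ⁻¹' {a}) * (h a * f a) +
          s ^ 2 * (3 * L ^ 2 * ∑ a, P.real (X ⁻¹' {a}) * h a ^ 2)) + 1 := by
      simp only [mul_add, mul_one, Finset.sum_add_distrib, hw1, Finset.mul_sum]
      have e1 : ∀ a, P.real (X ⁻¹' {a}) * (s * (h a * f a)) =
          s * (P.real (X ⁻¹' {a}) * (h a * f a)) := fun a => by ring
      have e2 : ∀ a, P.real (X ⁻¹' {a}) * (3 * s ^ 2 * L ^ 2 * h a ^ 2) =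
          s ^ 2 * (3 * L ^ 2 * (P.real (X ⁻¹' {a}) * h a ^ 2)) := fun a => by ring
      simp only [e1, e2]
      ring
    rw [hsum]
    exact Real.add_one_le_exp _

end Bernstein

end LowRankBandit

end

noncomputable section

namespace LowRankBandit

open scoped Matrix.Norms.L2Operator

/-! ### Symmetrization -/

section Symmetrization

variable {Ω : Type*} [MeasurableSpace Ω] {P : Measure Ω} [IsProbabilityMeasure P]

/-- The exponential bound alone centres the variable: `1 + s a ≤ exp (c s² / 2)` has a linear left
side and an excess over `1` of second order on the right, which fails for small `s` of the sign of a
nonzero `a`. -/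
theorem integral_eq_zero_of_hasSubgaussianMGF {X : Ω → ℝ} {c : ℝ≥0}
    (h : HasSubgaussianMGF X c P) : ∫ ω, X ω ∂P = 0 := by
  set a := ∫ ω, X ω ∂P with ha
  by_contra hne
  have h1 : ∀ s : ℝ, 1 + s * a ≤ Real.exp (c * s ^ 2 / 2) := by
    intro s
    refine le_trans ?_ (h.mgf_le s)
    rw [mgf, ha, ← integral_const_mul]
    have h2 : (1 : ℝ) = ∫ _, (1 : ℝ) ∂P := by simp
    rw [h2, ← integral_add (integrable_const _) (h.integrable.const_mul s)]
    refine integral_mono ((integrable_const _).add (h.integrable.const_mul s))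
      (h.integrable_exp_mul s) fun ω => ?_
    have := Real.add_one_le_exp (s * X ω)
    simp only
    linarith
  have hc : (0 : ℝ) ≤ c := c.2
  have ha2 : 0 < a ^ 2 := by positivity
  -- Small enough for both `c η ≤ 1 / 2` and `η a² ≤ 1`; the contradiction arises at `s = η a`.
  set η : ℝ := 1 / (2 * (c + 1) * (1 + a ^ 2)) with hη
  have hη0 : 0 < η := by positivity
  have hη1 : c * η ≤ 1 / 2 := by
    rw [hη, mul_one_div, div_le_div_iff₀ (by positivity) (by norm_num)]
    nlinarith
  have hη2 : η * a ^ 2 ≤ 1 := by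
    rw [hη, one_div, ← div_eq_inv_mul, div_le_one (by positivity)]
    nlinarith
  have h3 := h1 (η * a)
  set x := c * (η * a) ^ 2 / 2 with hx
  have hx' : x = (c * η) * (η * a ^ 2) / 2 := by rw [hx]; ring
  have hx0 : 0 ≤ x := by positivity
  have hx1 : x ≤ 1 := by
    rw [hx']; nlinarith [mul_le_mul hη1 hη2 (by positivity) (by norm_num)]
  have h4 := (abs_le.1 (Real.abs_exp_sub_one_sub_id_le (x := x)
    (by rw [abs_of_nonneg hx0]; exact hx1))).2
  have h5 : η * a ^ 2 ≤ 2 * x := by nlinarith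
  have h6 : 2 * x ≤ 1 / 2 * (η * a ^ 2) := by
    rw [hx']; nlinarith [mul_le_mul_of_nonneg_right hη1 (by positivity : 0 ≤ η * a ^ 2)]
  nlinarith [mul_pos hη0 ha2]

theorem sq_lintegral_le {f : Ω → ℝ≥0∞} (hf : AEMeasurable f P) :
    (∫⁻ ω, f ω ∂P) ^ 2 ≤ ∫⁻ ω, f ω ^ 2 ∂P := by
  have h := ENNReal.lintegral_mul_le_Lp_mul_Lq P (Real.HolderConjugate.two_two) hf
    (aemeasurable_const (b := (1 : ℝ≥0∞)))
  simp only [Pi.mul_apply, mul_one, ENNReal.one_rpow, lintegral_const, measure_univ] at h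
  have h2 := ENNReal.rpow_le_rpow h (z := 2) (by norm_num)
  rw [← ENNReal.rpow_mul] at h2
  norm_num at h2
  exact h2

/-- Jensen's inequality replaces the mean by an independent copy, realized as a second integral over
the same space. -/
theorem lintegral_enorm_sub_integral_sq_le {F : Type*} [NormedAddCommGroup F] [NormedSpace ℝ F]
    [CompleteSpace F] {Y : Ω → F} (hY : Integrable Y P) :
    ∫⁻ ω, ‖Y ω - ∫ ω', Y ω' ∂P‖ₑ ^ 2 ∂P ≤ ∫⁻ ω, ∫⁻ ω', ‖Y ω - Y ω'‖ₑ ^ 2 ∂P ∂P := by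
  refine lintegral_mono fun ω => ?_
  have h1 : Y ω - ∫ ω', Y ω' ∂P = ∫ ω', (Y ω - Y ω') ∂P := by
    rw [integral_sub (integrable_const _) hY]; simp
  have hint : Integrable (fun ω' => Y ω - Y ω') P := (integrable_const _).sub hY
  calc ‖Y ω - ∫ ω', Y ω' ∂P‖ₑ ^ 2 ≤ (∫⁻ ω', ‖Y ω - Y ω'‖ₑ ∂P) ^ 2 := by
        rw [h1]; gcongr; exact enorm_integral_le_lintegral_enorm _
    _ ≤ _ := sq_lintegral_le hint.aestronglyMeasurable.enorm

theorem enorm_sub_sq_le {F : Type*} [NormedAddCommGroup F] (x y : F) :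
    ‖x - y‖ₑ ^ 2 ≤ 2 * ‖x‖ₑ ^ 2 + 2 * ‖y‖ₑ ^ 2 := by
  simp only [← ofReal_norm]
  have h2 : (2 : ℝ≥0∞) = ENNReal.ofReal 2 := by simp
  rw [h2, ← ENNReal.ofReal_pow (norm_nonneg _), ← ENNReal.ofReal_pow (norm_nonneg _),
    ← ENNReal.ofReal_pow (norm_nonneg _), ← ENNReal.ofReal_mul (by norm_num),
    ← ENNReal.ofReal_mul (by norm_num), ← ENNReal.ofReal_add (by positivity) (by positivity)]
  refine ENNReal.ofReal_le_ofReal ?_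
  have := norm_sub_le x y
  have h3 := norm_nonneg (x - y)
  nlinarith [sq_nonneg (‖x‖ - ‖y‖), norm_nonneg x, norm_nonneg y]

theorem measurable_norm_matrix {α : Type*} [MeasurableSpace α] {m n : ℕ}
    {A : α → Matrix (Fin m) (Fin n) ℝ} (hA : ∀ i j, Measurable fun x => A x i j) :
    Measurable fun x => ‖A x‖ := by
  have h : Continuous (fun B : Fin m → Fin n → ℝ => ‖(Matrix.of B : Matrix (Fin m) (Fin n) ℝ)‖) :=
    (continuous_norm : Continuous (fun B : Matrix (Fin m) (Fin n) ℝ => ‖B‖))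
  exact h.measurable.comp (f := fun x i j => A x i j)
    (measurable_pi_lambda _ fun i => measurable_pi_lambda _ fun j => hA i j)

/-- Symmetrization for the operator norm of a sum of independent random matrices. -/
theorem lintegral_norm_sum_sq_le_signedSum {τ α : Type*} [Fintype τ] [MeasurableSpace α]
    {m n : ℕ} {z : τ → Ω → α} (hz : ∀ t, Measurable (z t)) (h : iIndepFun z P)
    {g : α → Matrix (Fin m) (Fin n) ℝ} (hg : ∀ i j, Measurable fun x => g x i j)
    (hint : ∀ t, Integrable (fun ω => g (z t ω)) P) (ε : τ → Bool) :
    ∫⁻ ω, ‖∑ t, g (z t ω) - ∫ ω', ∑ t, g (z t ω') ∂P‖ₑ ^ 2 ∂P ≤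
      4 * ∫⁻ ω, ‖signedSum (fun t => g (z t ω)) ε‖ₑ ^ 2 ∂P := by
  have hI : Integrable (fun ω => ∑ t, g (z t ω)) P := integrable_finsetSum _ fun t _ => hint t
  refine (lintegral_enorm_sub_integral_sq_le hI).trans ?_
  have hQ : Measurable fun w : τ → α × α => ‖∑ t, (g (w t).1 - g (w t).2)‖ₑ ^ 2 := by
    refine Measurable.pow_const ?_ 2
    have : Measurable fun w : τ → α × α => ‖∑ t, (g (w t).1 - g (w t).2)‖ := by
      refine measurable_norm_matrix fun i j => ?_
      simp only [Matrix.sum_apply, Matrix.sub_apply]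
      refine Finset.measurable_sum _ fun t _ => ?_
      exact ((hg i j).comp ((measurable_pi_apply t).fst)).sub
        ((hg i j).comp ((measurable_pi_apply t).snd))
    simpa only [ofReal_norm] using this.ennreal_ofReal
  have hsgn : Measurable fun ω => ‖signedSum (fun t => g (z t ω)) ε‖ₑ ^ 2 := by
    refine Measurable.pow_const ?_ 2
    have : Measurable fun ω => ‖signedSum (fun t => g (z t ω)) ε‖ := by
      refine measurable_norm_matrix fun i j => ?_
      simp only [signedSum, Matrix.sum_apply, Matrix.smul_apply, smul_eq_mul]
      refine Finset.measurable_sum _ fun t _ => ?_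
      exact ((hg i j).comp (hz t)).const_mul _
    simpa only [ofReal_norm] using this.ennreal_ofReal
  -- Exchanging the two copies in the rounds with a negative sign preserves the joint law and
  -- reverses exactly those differences. The sign pattern is fixed; averaging over all patterns
  -- happens only when Khintchine's inequality is applied.
  have h1 : ∫⁻ ω, ∫⁻ ω', ‖∑ t, g (z t ω) - ∑ t, g (z t ω')‖ₑ ^ 2 ∂P ∂P =
      ∫⁻ ω, ∫⁻ ω', ‖signedSum (fun t => g (z t ω)) ε - signedSum (fun t => g (z t ω')) ε‖ₑ ^ 2
        ∂P ∂P := by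
    have := lintegral_swap_coordinates hz h ε hQ
    simp only [← Finset.sum_sub_distrib]
    rw [this]
    refine lintegral_congr fun ω => lintegral_congr fun ω' => ?_
    congr 2
    rw [signedSum, signedSum, ← Finset.sum_sub_distrib]
    refine Finset.sum_congr rfl fun t _ => ?_
    by_cases hε : ε t = true <;> simp [hε, sgn, neg_add_eq_sub]
  rw [h1]
  calc _ ≤ ∫⁻ ω, ∫⁻ ω', (2 * ‖signedSum (fun t => g (z t ω)) ε‖ₑ ^ 2 +
        2 * ‖signedSum (fun t => g (z t ω')) ε‖ₑ ^ 2) ∂P ∂P :=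
        lintegral_mono fun ω => lintegral_mono fun ω' => enorm_sub_sq_le _ _
    _ = ∫⁻ ω, (2 * ‖signedSum (fun t => g (z t ω)) ε‖ₑ ^ 2 +
        2 * ∫⁻ ω', ‖signedSum (fun t => g (z t ω')) ε‖ₑ ^ 2 ∂P) ∂P := by
        refine lintegral_congr fun ω => ?_
        rw [lintegral_add_left measurable_const, lintegral_const, measure_univ, mul_one,
          lintegral_const_mul _ hsgn]
    _ = 4 * ∫⁻ ω, ‖signedSum (fun t => g (z t ω)) ε‖ₑ ^ 2 ∂P := by
        rw [lintegral_add_right _ measurable_const, lintegral_const, measure_univ, mul_one,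
          lintegral_const_mul _ hsgn, ← add_mul]
        norm_num

end Symmetrization

/-! ### Sampling entries of a matrix -/

section Sampling

variable {Ω : Type*} [MeasurableSpace Ω] {P : Measure Ω} [IsProbabilityMeasure P] {T m n : ℕ}

/-- Noisy observations at independently drawn positions of a matrix: the row and the column of an
observation are independent with laws `p` and `q`. -/
structure Sampling (P : Measure Ω) (p : Fin m → ℝ) (q : Fin n → ℝ) (σ : ℝ≥0)
    (c : Fin T → Ω → Fin m) (e : Fin T → Ω → Fin n) (ξ : Fin T → Ω → ℝ) : Prop where
  measurable_row : ∀ t, Measurable (c t)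
  measurable_col : ∀ t, Measurable (e t)
  measurable_noise : ∀ t, Measurable (ξ t)
  indep : iIndepFun (fun t ω => (c t ω, e t ω, ξ t ω)) P
  indep_noise : ∀ t, IndepFun (fun ω => (c t ω, e t ω)) (ξ t) P
  indep_row : ∀ t, IndepFun (c t) (fun ω => (e t ω, ξ t ω)) P
  indep_col : ∀ t, IndepFun (e t) (fun ω => (c t ω, ξ t ω)) P
  law_row : ∀ t i, P.real (c t ⁻¹' {i}) = p i
  law_col : ∀ t j, P.real (e t ⁻¹' {j}) = q j
  row_pos : ∀ i, 0 < p i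
  col_pos : ∀ j, 0 < q j
  subgaussian : ∀ t, HasSubgaussianMGF (ξ t) (σ ^ 2) P

namespace Sampling

variable {p : Fin m → ℝ} {q : Fin n → ℝ} {σ : ℝ≥0} {c : Fin T → Ω → Fin m}
  {e : Fin T → Ω → Fin n} {ξ : Fin T → Ω → ℝ}

/-- Positions have a product law, so rows and columns are interchangeable and every row estimate has
its column version. -/
theorem transpose (h : Sampling P p q σ c e ξ) : Sampling P q p σ e c ξ where
  measurable_row := h.measurable_col
  measurable_col := h.measurable_row
  measurable_noise := h.measurable_noise
  indep := h.indep.comp (fun _ (x : Fin m × Fin n × ℝ) => (x.2.1, x.1, x.2.2)) fun _ => by fun_prop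
  indep_noise t := (h.indep_noise t).comp (φ := Prod.swap) (ψ := id) measurable_swap measurable_id
  indep_row := h.indep_col
  indep_col := h.indep_row
  law_row := h.law_col
  law_col := h.law_row
  row_pos := h.col_pos
  col_pos := h.row_pos
  subgaussian := h.subgaussian

theorem law_pair (h : Sampling P p q σ c e ξ) (t : Fin T) (i : Fin m) (j : Fin n) :
    P.real ((fun ω => (c t ω, e t ω)) ⁻¹' {(i, j)}) = p i * q j := by
  have h1 : IndepFun (c t) (e t) P :=
    (h.indep_row t).comp (φ := id) (ψ := Prod.fst) measurable_id measurable_fst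
  have h2 := h1.measure_inter_preimage_eq_mul {i} {j} (measurableSet_singleton _)
    (measurableSet_singleton _)
  have h3 : (fun ω => (c t ω, e t ω)) ⁻¹' {(i, j)} = c t ⁻¹' {i} ∩ e t ⁻¹' {j} := by
    ext ω; simp
  rw [h3, measureReal_def, h2, ENNReal.toReal_mul, ← measureReal_def, ← measureReal_def,
    h.law_row, h.law_col]

theorem sum_row (h : Sampling P p q σ c e ξ) (t : Fin T) : ∑ i, p i = 1 := by
  have := sum_measureReal_preimage_singleton (μ := P) (f := c t) (Finset.univ : Finset (Fin m))
    (fun a _ => h.measurable_row t (measurableSet_singleton a))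
  simpa [h.law_row] using this

end Sampling

/-- The inverse-propensity weighted observation of one entry. -/
def obsMat (p : Fin m → ℝ) (q : Fin n → ℝ) (M : Matrix (Fin m) (Fin n) ℝ)
    (z : Fin m × Fin n × ℝ) : Matrix (Fin m) (Fin n) ℝ :=
  Matrix.single z.1 z.2.1 ((M z.1 z.2.1 + z.2.2) / (p z.1 * q z.2.1))

/-- The error of the inverse-propensity estimate of a matrix. -/
def sampleErr (p : Fin m → ℝ) (q : Fin n → ℝ) (M : Matrix (Fin m) (Fin n) ℝ)
    (c : Fin T → Fin m) (e : Fin T → Fin n) (x : Fin T → ℝ) : Matrix (Fin m) (Fin n) ℝ :=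
  (T : ℝ)⁻¹ • ∑ t, obsMat p q M (c t, e t, x t) - M

theorem obsMat_apply (p : Fin m → ℝ) (q : Fin n → ℝ) (M : Matrix (Fin m) (Fin n) ℝ)
    (z : Fin m × Fin n × ℝ) (i : Fin m) (j : Fin n) :
    obsMat p q M z i j = if z.1 = i ∧ z.2.1 = j then (M i j + z.2.2) / (p i * q j) else 0 := by
  rw [obsMat, Matrix.single_apply]
  split_ifs with h
  · rw [h.1, h.2]
  · rfl

theorem measurable_obsMat (p : Fin m → ℝ) (q : Fin n → ℝ) (M : Matrix (Fin m) (Fin n) ℝ)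
    (i : Fin m) (j : Fin n) : Measurable fun z => obsMat p q M z i j := by
  simp only [obsMat_apply]
  refine Measurable.ite ?_ (by fun_prop) measurable_const
  exact (measurableSet_eq_fun measurable_fst measurable_const).inter
    (measurableSet_eq_fun measurable_snd.fst measurable_const)

variable {p : Fin m → ℝ} {q : Fin n → ℝ} {σ : ℝ≥0} {c : Fin T → Ω → Fin m}
  {e : Fin T → Ω → Fin n} {ξ : Fin T → Ω → ℝ} {M : Matrix (Fin m) (Fin n) ℝ}

namespace Sampling

/-- Unbiasedness: the probability `p i * q j` of the position cancels the weight, and the noise is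
centred and independent of the position. -/
theorem integrable_obsMat_apply (h : Sampling P p q σ c e ξ) (t : Fin T) (i : Fin m) (j : Fin n) :
    Integrable (fun ω => obsMat p q M (c t ω, e t ω, ξ t ω) i j) P ∧
      ∫ ω, obsMat p q M (c t ω, e t ω, ξ t ω) i j ∂P = M i j := by
  set A : Set Ω := (fun ω => (c t ω, e t ω)) ⁻¹' {(i, j)} with hA
  have hAm : MeasurableSet A :=
    ((h.measurable_row t).prodMk (h.measurable_col t)) (measurableSet_singleton _)
  have h1 : (fun ω => obsMat p q M (c t ω, e t ω, ξ t ω) i j) = fun ω =>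
      A.indicator (fun _ => (p i * q j)⁻¹) ω * (M i j + ξ t ω) := by
    ext ω
    rw [obsMat_apply]
    by_cases hω : c t ω = i ∧ e t ω = j
    · rw [if_pos hω, Set.indicator_of_mem (by simp [hA, hω])]; ring
    · rw [if_neg hω, Set.indicator_of_notMem (by simpa [hA] using hω), zero_mul]
  have hξ : Integrable (ξ t) P := (h.subgaussian t).integrable
  have h2 : Integrable (fun ω => M i j + ξ t ω) P := (integrable_const _).add hξ
  have hI : IndepFun (fun ω => A.indicator (fun _ => (p i * q j)⁻¹) ω) (fun ω => M i j + ξ t ω) P :=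
    (h.indep_noise t).comp (_mγ := Real.measurableSpace)
      (φ := fun x => ({(i, j)} : Set (Fin m × Fin n)).indicator (fun _ => (p i * q j)⁻¹) x)
      (ψ := fun x => M i j + x)
      (measurable_const.indicator (measurableSet_singleton _)) (by fun_prop)
  have h3 : Integrable (fun ω => A.indicator (fun _ => (p i * q j)⁻¹) ω) P :=
    (integrable_const _).indicator hAm
  rw [h1]
  refine ⟨hI.integrable_mul h3 h2, ?_⟩
  rw [hI.integral_fun_mul_eq_mul_integral h3.aestronglyMeasurable h2.aestronglyMeasurable,
    integral_indicator_const _ hAm, h.law_pair, integral_add (integrable_const _) hξ,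
    integral_eq_zero_of_hasSubgaussianMGF (h.subgaussian t)]
  have := (mul_pos (h.row_pos i) (h.col_pos j)).ne'
  simp only [smul_eq_mul, integral_const, probReal_univ, one_mul, add_zero]
  rw [mul_inv_cancel₀ this, one_mul]

theorem integrable_obsMat (h : Sampling P p q σ c e ξ) (t : Fin T) :
    Integrable (fun ω => obsMat p q M (c t ω, e t ω, ξ t ω)) P ∧
      ∫ ω, obsMat p q M (c t ω, e t ω, ξ t ω) ∂P = M := by
  have h1 : ∀ A : Matrix (Fin m) (Fin n) ℝ, A = ∑ i, ∑ j, A i j • Matrix.single i j (1 : ℝ) := by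
    intro A
    conv_lhs => rw [Matrix.matrix_eq_sum_single A]
    simp
  have h2 : (fun ω => obsMat p q M (c t ω, e t ω, ξ t ω)) = fun ω =>
      ∑ i, ∑ j, obsMat p q M (c t ω, e t ω, ξ t ω) i j • Matrix.single i j (1 : ℝ) := by
    ext1 ω; exact h1 _
  rw [h2]
  have h3 : ∀ i j, Integrable (fun ω => obsMat p q M (c t ω, e t ω, ξ t ω) i j •
      (Matrix.single i j (1 : ℝ) : Matrix (Fin m) (Fin n) ℝ)) P := fun i j =>
    (h.integrable_obsMat_apply t i j).1.smul_const _
  refine ⟨integrable_finsetSum _ fun i _ => integrable_finsetSum _ fun j _ => h3 i j, ?_⟩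
  rw [integral_finsetSum _ fun i _ => integrable_finsetSum _ fun j _ => h3 i j]
  conv_rhs => rw [h1 M]
  refine Finset.sum_congr rfl fun i _ => ?_
  rw [integral_finsetSum _ fun j _ => h3 i j]
  refine Finset.sum_congr rfl fun j _ => ?_
  rw [integral_smul_const, (h.integrable_obsMat_apply t i j).2]

theorem lintegral_norm_sampleErr_le_signedSum (h : Sampling P p q σ c e ξ) (hT : 0 < T)
    (ε : Fin T → Bool) :
    ∫⁻ ω, ‖sampleErr p q M (fun t => c t ω) (fun t => e t ω) (fun t => ξ t ω)‖ₑ ^ 2 ∂P ≤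
      ENNReal.ofReal (4 / T ^ 2) *
        ∫⁻ ω, ‖signedSum (fun t => obsMat p q M (c t ω, e t ω, ξ t ω)) ε‖ₑ ^ 2 ∂P := by
  have hz : ∀ t, Measurable fun ω => (c t ω, e t ω, ξ t ω) := fun t =>
    (h.measurable_row t).prodMk ((h.measurable_col t).prodMk (h.measurable_noise t))
  have h1 := lintegral_norm_sum_sq_le_signedSum hz h.indep (measurable_obsMat p q M)
    (fun t => (h.integrable_obsMat t).1) ε
  have h2 : ∫ ω', ∑ t, obsMat p q M (c t ω', e t ω', ξ t ω') ∂P = (T : ℝ) • M := by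
    rw [integral_finsetSum _ fun t _ => (h.integrable_obsMat t).1]
    simp only [fun t => (h.integrable_obsMat (M := M) t).2, Finset.sum_const, Finset.card_univ,
      Fintype.card_fin]
    rw [Nat.cast_smul_eq_nsmul]
  rw [h2] at h1
  have hT' : (T : ℝ) ≠ 0 := by positivity
  have h3 : ∀ ω, ‖sampleErr p q M (fun t => c t ω) (fun t => e t ω) (fun t => ξ t ω)‖ₑ ^ 2 =
      ENNReal.ofReal (1 / T ^ 2) *
        ‖∑ t, obsMat p q M (c t ω, e t ω, ξ t ω) - (T : ℝ) • M‖ₑ ^ 2 := by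
    intro ω
    have : sampleErr p q M (fun t => c t ω) (fun t => e t ω) (fun t => ξ t ω) =
        (T : ℝ)⁻¹ • (∑ t, obsMat p q M (c t ω, e t ω, ξ t ω) - (T : ℝ) • M) := by
      rw [sampleErr, smul_sub, smul_smul, inv_mul_cancel₀ hT', one_smul]
    rw [this, enorm_smul, mul_pow]
    congr 1
    rw [Real.enorm_eq_ofReal (by positivity), ← ENNReal.ofReal_pow (by positivity)]
    congr 1
    field_simp
  simp only [h3]
  have hm : Measurable fun ω => ‖∑ t, obsMat p q M (c t ω, e t ω, ξ t ω) - (T : ℝ) • M‖ₑ ^ 2 := by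
    refine Measurable.pow_const ?_ 2
    have : Measurable fun ω => ‖∑ t, obsMat p q M (c t ω, e t ω, ξ t ω) - (T : ℝ) • M‖ := by
      refine measurable_norm_matrix fun i j => ?_
      simp only [Matrix.sub_apply, Matrix.sum_apply]
      exact (Finset.measurable_sum _ fun t _ => (measurable_obsMat p q M i j).comp (hz t)).sub_const _
    simpa only [ofReal_norm] using this.ennreal_ofReal
  rw [lintegral_const_mul _ hm]
  calc _ ≤ ENNReal.ofReal (1 / T ^ 2) *
        (4 * ∫⁻ ω, ‖signedSum (fun t => obsMat p q M (c t ω, e t ω, ξ t ω)) ε‖ₑ ^ 2 ∂P) := by gcongr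
    _ = _ := by
        rw [← mul_assoc]
        congr 1
        have : (4 : ℝ≥0∞) = ENNReal.ofReal 4 := by simp
        rw [this, ← ENNReal.ofReal_mul (by positivity)]
        congr 1
        ring

end Sampling

end Sampling

end LowRankBandit

end

noncomputable section

namespace LowRankBandit

open scoped Matrix.Norms.L2Operator

/-! ### The mean square of the operator norm of the sampling error -/

section OperatorNorm

variable {Ω : Type*} [MeasurableSpace Ω] {P : Measure Ω} [IsProbabilityMeasure P] {T m n : ℕ}

theorem integral_comp_fintype {α : Type*} [Fintype α] [MeasurableSpace α]
    [MeasurableSingletonClass α] {X : Ω → α} (hX : Measurable X) (g : α → ℝ) :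
    Integrable (fun ω => g (X ω)) P ∧ ∫ ω, g (X ω) ∂P = ∑ a, P.real (X ⁻¹' {a}) * g a := by
  have : IsProbabilityMeasure (P.map X) := Measure.isProbabilityMeasure_map hX.aemeasurable
  have hg : Integrable g (P.map X) := Integrable.of_finite
  have hgm : Measurable g := measurable_of_finite g
  refine ⟨hg.comp_measurable hX, ?_⟩
  rw [← integral_map hX.aemeasurable hgm.aestronglyMeasurable, integral_fintype hg]
  refine Finset.sum_congr rfl fun a _ => ?_
  rw [map_measureReal_apply hX (measurableSet_singleton a), smul_eq_mul]

/-- The sum of the squared inverse propensities of the observations in row `i`. -/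
def rowWeight (p : Fin m → ℝ) (q : Fin n → ℝ) (c : Fin T → Fin m) (e : Fin T → Fin n)
    (i : Fin m) : ℝ :=
  ∑ t, if c t = i then ((p (c t) * q (e t))⁻¹) ^ 2 else 0

/-- The maximum of the squared observations is dominated by this smooth quantity. -/
def noiseEnvelope (L σ : ℝ) (x : Fin T → ℝ) : ℝ :=
  2 * L ^ 2 + 2 * σ ^ 2 * (Real.log T ^ 2 +
    ∑ t, (2 / T) * (Real.exp (2 / σ * x t) + Real.exp (-(2 / σ) * x t)))

/-- The maximum of the row and column weights is dominated by this smooth quantity. -/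
def weightEnvelope (p : Fin m → ℝ) (q : Fin n → ℝ) (b K : ℝ) (c : Fin T → Fin m)
    (e : Fin T → Fin n) : ℝ :=
  K + (∑ i, b ^ 2 * Real.exp ((b ^ 2)⁻¹ * rowWeight p q c e i - (b ^ 2)⁻¹ * K) +
    ∑ j, b ^ 2 * Real.exp ((b ^ 2)⁻¹ * rowWeight q p e c j - (b ^ 2)⁻¹ * K))

/-- Up to the level `log T` the square is trivially bounded; above it `u² ≤ 2 e^u ≤ (2 / T) e^(2u)`.
The weight `1 / T` keeps the sum of the exponentials over all rounds bounded in mean. -/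
theorem sq_le_noiseEnvelope {L σ : ℝ} (hσ : 0 < σ) {x : Fin T → ℝ} {y : ℝ} (hy : |y| ≤ L)
    (t : Fin T) : (y + x t) ^ 2 ≤ noiseEnvelope L σ x := by
  have hT : (1 : ℝ) ≤ T := by exact_mod_cast (Nat.one_le_of_lt t.2)
  have hT0 : (0 : ℝ) < T := by linarith
  have h1 : (y + x t) ^ 2 ≤ 2 * L ^ 2 + 2 * x t ^ 2 := by
    have : y ^ 2 ≤ L ^ 2 := sq_le_sq' (by linarith [(abs_le.1 hy).1]) (abs_le.1 hy).2
    nlinarith [sq_nonneg (y - x t)]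
  set B := Real.log T with hB
  have hB0 : 0 ≤ B := Real.log_nonneg hT
  have key : ∀ u : ℝ, 0 ≤ u → u ^ 2 ≤ B ^ 2 + (2 / T) * Real.exp (2 * u) := by
    intro u hu
    by_cases h : u ≤ B
    · have : 0 < (2 / T : ℝ) * Real.exp (2 * u) := by positivity
      nlinarith
    · push Not at h
      have h2 : (T : ℝ) ≤ Real.exp u := by
        rw [← Real.exp_log hT0]; exact Real.exp_le_exp.2 h.le
      have h3 : u ^ 2 ≤ 2 * Real.exp u := by
        have := Real.quadratic_le_exp_of_nonneg hu
        nlinarith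
      have h4 : 2 * Real.exp u ≤ (2 / T) * Real.exp (2 * u) := by
        rw [two_mul u, Real.exp_add, div_mul_eq_mul_div, le_div_iff₀ hT0]
        nlinarith [Real.exp_pos u]
      nlinarith [sq_nonneg B]
  have h2 : (x t / σ) ^ 2 ≤ B ^ 2 + (2 / T) *
      (Real.exp (2 / σ * x t) + Real.exp (-(2 / σ) * x t)) := by
    have := key |x t / σ| (abs_nonneg _)
    rw [sq_abs] at this
    refine this.trans ?_
    have e1 : 2 / σ * x t = 2 * (x t / σ) := by ring
    have e2 : -(2 / σ) * x t = 2 * (-(x t / σ)) := by ring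
    rw [e1, e2]
    gcongr
    rcases abs_choice (x t / σ) with h | h <;> rw [h]
    · linarith [Real.exp_pos (2 * (-(x t / σ)))]
    · linarith [Real.exp_pos (2 * ((x t / σ)))]
  have h3 : (2 / T) * (Real.exp (2 / σ * x t) + Real.exp (-(2 / σ) * x t)) ≤
      ∑ t, (2 / T) * (Real.exp (2 / σ * x t) + Real.exp (-(2 / σ) * x t)) :=
    Finset.single_le_sum (f := fun t => (2 / (T : ℝ)) *
      (Real.exp (2 / σ * x t) + Real.exp (-(2 / σ) * x t)))
      (fun t _ => by positivity) (Finset.mem_univ t)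
  have h4 : x t ^ 2 = σ ^ 2 * (x t / σ) ^ 2 := by field_simp
  rw [noiseEnvelope]
  rw [h4] at h1
  nlinarith [mul_le_mul_of_nonneg_left (h2.trans (add_le_add_right h3 _))
    (by positivity : 0 ≤ 2 * σ ^ 2)]

/-- A soft maximum: adding the exponentials of all candidates bounds each of them at once, and the
mean of the sum is computable from moment generating functions. -/
theorem le_add_mul_exp {s : ℝ} (hs : 0 < s) (W K : ℝ) :
    W ≤ K + s * Real.exp (s⁻¹ * W - s⁻¹ * K) := by
  have := Real.add_one_le_exp (s⁻¹ * W - s⁻¹ * K)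
  have h2 := mul_le_mul_of_nonneg_left this hs.le
  have h3 : s * (s⁻¹ * W - s⁻¹ * K + 1) = W - K + s := by field_simp
  linarith

theorem rowWeight_le_weightEnvelope (p : Fin m → ℝ) (q : Fin n → ℝ) {b : ℝ} (hb : 0 < b) (K : ℝ)
    (c : Fin T → Fin m) (e : Fin T → Fin n) :
    (∀ i, rowWeight p q c e i ≤ weightEnvelope p q b K c e) ∧
      ∀ j, rowWeight q p e c j ≤ weightEnvelope p q b K c e := by
  have h1 : 0 ≤ ∑ i, b ^ 2 * Real.exp ((b ^ 2)⁻¹ * rowWeight p q c e i - (b ^ 2)⁻¹ * K) :=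
    Finset.sum_nonneg fun i _ => by positivity
  have h2 : 0 ≤ ∑ j, b ^ 2 * Real.exp ((b ^ 2)⁻¹ * rowWeight q p e c j - (b ^ 2)⁻¹ * K) :=
    Finset.sum_nonneg fun i _ => by positivity
  have hb2 : 0 < b ^ 2 := by positivity
  constructor
  · intro i
    have h3 := le_add_mul_exp hb2 (rowWeight p q c e i) K
    have h4 := Finset.single_le_sum (f := fun i => b ^ 2 *
      Real.exp ((b ^ 2)⁻¹ * rowWeight p q c e i - (b ^ 2)⁻¹ * K))
      (fun i _ => by positivity) (Finset.mem_univ i)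
    rw [weightEnvelope]
    linarith
  · intro j
    have h3 := le_add_mul_exp hb2 (rowWeight q p e c j) K
    have h4 := Finset.single_le_sum (f := fun j => b ^ 2 *
      Real.exp ((b ^ 2)⁻¹ * rowWeight q p e c j - (b ^ 2)⁻¹ * K))
      (fun i _ => by positivity) (Finset.mem_univ j)
    rw [weightEnvelope]
    linarith

variable {p : Fin m → ℝ} {q : Fin n → ℝ} {σ : ℝ≥0} {c : Fin T → Ω → Fin m}
  {e : Fin T → Ω → Fin n} {ξ : Fin T → Ω → ℝ} {M : Matrix (Fin m) (Fin n) ℝ}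

namespace Sampling

theorem integral_noiseEnvelope_le (h : Sampling P p q σ c e ξ) (hT : 0 < T) (hσ : 0 < σ) {L : ℝ}
    (hL : (σ : ℝ) ≤ L) :
    Integrable (fun ω => noiseEnvelope L σ (fun t => ξ t ω)) P ∧
      ∫ ω, noiseEnvelope L σ (fun t => ξ t ω) ∂P ≤ L ^ 2 * (70 + 2 * Real.log T ^ 2) := by
  have hσ' : (0 : ℝ) < σ := hσ
  have hT' : (0 : ℝ) < T := by exact_mod_cast hT
  have hm : ∀ t s, |s| = 2 / (σ : ℝ) → ∫ ω, Real.exp (s * ξ t ω) ∂P ≤ 8 := by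
    intro t s hs
    have h1 := (h.subgaussian t).mgf_le s
    have h2 : ((σ ^ 2 : ℝ≥0) : ℝ) * s ^ 2 / 2 = 2 := by
      rw [← sq_abs s, hs]; push_cast; field_simp
    rw [h2] at h1
    refine h1.trans ?_
    have := Real.exp_one_lt_d9
    have h3 : Real.exp 2 = Real.exp 1 * Real.exp 1 := by rw [← Real.exp_add]; norm_num
    rw [h3]; nlinarith [Real.exp_pos 1]
  have hi : ∀ t, Integrable (fun ω => (2 / (T : ℝ)) *
      (Real.exp (2 / σ * ξ t ω) + Real.exp (-(2 / σ) * ξ t ω))) P := fun t =>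
    (((h.subgaussian t).integrable_exp_mul _).add
      ((h.subgaussian t).integrable_exp_mul _)).const_mul _
  have hI : Integrable (fun ω => ∑ t, (2 / (T : ℝ)) *
      (Real.exp (2 / σ * ξ t ω) + Real.exp (-(2 / σ) * ξ t ω))) P :=
    integrable_finsetSum _ fun t _ => hi t
  have hI2 : Integrable (fun ω => Real.log T ^ 2 + ∑ t, (2 / (T : ℝ)) *
      (Real.exp (2 / σ * ξ t ω) + Real.exp (-(2 / σ) * ξ t ω))) P := (integrable_const _).add hI
  refine ⟨(integrable_const _).add (hI2.const_mul _), ?_⟩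
  simp only [noiseEnvelope]
  rw [integral_add (integrable_const _) (hI2.const_mul _), integral_const_mul (2 * (σ : ℝ) ^ 2),
    integral_add (integrable_const _) hI, integral_finsetSum _ fun t _ => hi t]
  have h1 : ∀ t, ∫ ω, (2 / (T : ℝ)) *
      (Real.exp (2 / σ * ξ t ω) + Real.exp (-(2 / σ) * ξ t ω)) ∂P ≤ 32 / T := by
    intro t
    rw [integral_const_mul, integral_add ((h.subgaussian t).integrable_exp_mul _)
      ((h.subgaussian t).integrable_exp_mul _)]
    have h1 := hm t (2 / σ) (abs_of_pos (by positivity))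
    have h2 := hm t (-(2 / σ)) (by rw [abs_neg, abs_of_pos (by positivity)])
    calc _ ≤ 2 / (T : ℝ) * (8 + 8) := by gcongr
      _ = 32 / T := by ring
  have h2 := Finset.sum_le_sum fun t (_ : t ∈ (Finset.univ : Finset (Fin T))) => h1 t
  rw [Finset.sum_const, Finset.card_univ, Fintype.card_fin, nsmul_eq_mul,
    mul_div_cancel₀ _ hT'.ne'] at h2
  simp only [integral_const, probReal_univ, smul_eq_mul, one_mul]
  have h3 : (σ : ℝ) ^ 2 ≤ L ^ 2 := by gcongr
  have h4 := sq_nonneg (Real.log T)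
  calc _ ≤ 2 * L ^ 2 + 2 * (σ : ℝ) ^ 2 * (Real.log T ^ 2 + 32) := by gcongr
    _ ≤ 2 * L ^ 2 + 2 * L ^ 2 * (Real.log T ^ 2 + 32) := by gcongr
    _ ≤ _ := by nlinarith [sq_nonneg L]

/-- The scale `b²` normalizes each summand to `[0, 1]`, where `e^x ≤ 1 + 2x`. A summand has mean at
most `n b`, because the propensity cancels one of its two inverse factors. -/
theorem integral_exp_rowWeight_le (h : Sampling P p q σ c e ξ) {b : ℝ} (hb : 0 < b)
    (hpq : ∀ i j, (p i * q j)⁻¹ ≤ b) (i : Fin m) :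
    Integrable (fun ω => Real.exp ((b ^ 2)⁻¹ *
        rowWeight p q (fun t => c t ω) (fun t => e t ω) i)) P ∧
      ∫ ω, Real.exp ((b ^ 2)⁻¹ * rowWeight p q (fun t => c t ω) (fun t => e t ω) i) ∂P ≤
        Real.exp ((b ^ 2)⁻¹ * (2 * T * n * b)) := by
  set g : Fin m × Fin n → ℝ := fun x => if x.1 = i then ((p x.1 * q x.2)⁻¹) ^ 2 else 0 with hg
  have hX : ∀ t, Measurable fun ω => (c t ω, e t ω) := fun t =>
    (h.measurable_row t).prodMk (h.measurable_col t)
  have hXv : Measurable fun ω (t : Fin T) => (c t ω, e t ω) := measurable_pi_lambda _ hX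
  have hb2 : 0 < b ^ 2 := by positivity
  have hpos : ∀ i j, 0 < (p i * q j)⁻¹ := fun i j =>
    inv_pos.2 (mul_pos (h.row_pos i) (h.col_pos j))
  have hg0 : ∀ x, 0 ≤ g x := fun x => by rw [hg]; dsimp only; split_ifs <;> positivity
  have hgb : ∀ x, (b ^ 2)⁻¹ * g x ≤ 1 := by
    intro x
    rw [← div_eq_inv_mul, div_le_one hb2]
    rw [hg]; dsimp only; split_ifs
    · exact pow_le_pow_left₀ (hpos _ _).le (hpq _ _) 2
    · positivity
  refine ⟨(integral_comp_fintype hXv (fun w => Real.exp ((b ^ 2)⁻¹ *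
    rowWeight p q (fun t => (w t).1) (fun t => (w t).2) i))).1, ?_⟩
  have hind : iIndepFun (fun t ω => g (c t ω, e t ω)) P :=
    h.indep.comp (fun _ x => g (x.1, x.2.1)) fun _ =>
      (measurable_of_finite g).comp (measurable_fst.prodMk measurable_snd.fst)
  have h1 := hind.mgf_sum (t := (b ^ 2)⁻¹)
    (fun t => (measurable_of_finite g).comp (hX t)) Finset.univ
  have h2 : ∫ ω, Real.exp ((b ^ 2)⁻¹ *
      rowWeight p q (fun t => c t ω) (fun t => e t ω) i) ∂P =
      mgf (∑ t, fun ω => g (c t ω, e t ω)) P (b ^ 2)⁻¹ := by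
    rw [mgf]
    refine integral_congr_ae (Filter.Eventually.of_forall fun ω => ?_)
    simp only [rowWeight, Finset.sum_apply, hg]
  rw [h2, h1]
  have h3 : ∀ t, mgf (fun ω => g (c t ω, e t ω)) P (b ^ 2)⁻¹ ≤
      Real.exp ((b ^ 2)⁻¹ * (2 * n * b)) := by
    intro t
    have hgi := integral_comp_fintype (P := P) (hX t) g
    have hgs : ∑ a, P.real ((fun ω => (c t ω, e t ω)) ⁻¹' {a}) * g a ≤ n * b := by
      rw [Fintype.sum_prod_type, Finset.sum_eq_single i]
      · calc _ ≤ ∑ _j : Fin n, b := by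
              refine Finset.sum_le_sum fun j _ => ?_
              rw [h.law_pair, hg]
              simp only [if_true]
              have := mul_pos (h.row_pos i) (h.col_pos j)
              rw [pow_two, ← mul_assoc, mul_inv_cancel₀ this.ne', one_mul]
              exact hpq i j
          _ = n * b := by simp
      · intro i' _ hi'
        simp [hg, hi']
      · simp
    have h4 : mgf (fun ω => g (c t ω, e t ω)) P (b ^ 2)⁻¹ ≤
        ∫ ω, (1 + 2 * (b ^ 2)⁻¹ * g (c t ω, e t ω)) ∂P := by
      refine integral_mono (integral_comp_fintype (hX t)
        (fun x => Real.exp ((b ^ 2)⁻¹ * g x))).1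
        ((integrable_const _).add (hgi.1.const_mul _)) fun ω => ?_
      have hx0 : 0 ≤ (b ^ 2)⁻¹ * g (c t ω, e t ω) := mul_nonneg (by positivity) (hg0 _)
      have hx1 := hgb (c t ω, e t ω)
      have h5 := (abs_le.1 (Real.abs_exp_sub_one_sub_id_le
        (x := (b ^ 2)⁻¹ * g (c t ω, e t ω)) (by rwa [abs_of_nonneg hx0]))).2
      simp only
      nlinarith
    refine h4.trans ?_
    rw [integral_add (integrable_const _) (hgi.1.const_mul _), integral_const_mul, hgi.2]
    simp only [integral_const, probReal_univ, smul_eq_mul, one_mul]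
    have h6 := Real.add_one_le_exp ((b ^ 2)⁻¹ * (2 * n * b))
    refine le_trans ?_ h6
    have := mul_le_mul_of_nonneg_left hgs (by positivity : 0 ≤ 2 * (b ^ 2)⁻¹)
    linarith
  calc _ ≤ ∏ _t : Fin T, Real.exp ((b ^ 2)⁻¹ * (2 * n * b)) :=
        Finset.prod_le_prod (fun t _ => mgf_nonneg) fun t _ => h3 t
    _ = Real.exp ((b ^ 2)⁻¹ * (2 * T * n * b)) := by
        rw [Finset.prod_const, Finset.card_univ, Fintype.card_fin, ← Real.exp_nat_mul]
        congr 1; ring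

theorem integral_weightEnvelope_le (h : Sampling P p q σ c e ξ) {b : ℝ} (hb : 0 < b)
    (hpq : ∀ i j, (p i * q j)⁻¹ ≤ b) {N : ℝ} (hN : N = m + n) (hm : 0 < m) (hbT : b ≤ T * N) :
    let K := 2 * T * N * b + b ^ 2 * Real.log N
    Integrable (fun ω => weightEnvelope p q b K (fun t => c t ω) (fun t => e t ω)) P ∧
      ∫ ω, weightEnvelope p q b K (fun t => c t ω) (fun t => e t ω) ∂P ≤
        T * N * b * (3 + Real.log N) := by
  intro K
  have hm' : (1 : ℝ) ≤ m := by exact_mod_cast hm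
  have hn0 : (0 : ℝ) ≤ n := Nat.cast_nonneg n
  have hN1 : 1 ≤ N := by rw [hN]; linarith
  have hN0 : 0 < N := by linarith
  have hb2 : 0 < b ^ 2 := by positivity
  -- The part `b² log N` of `K` makes each exponential at most `1 / N` in mean, so that all `m + n`
  -- of them together contribute at most `b²`.
  have row : ∀ i, Integrable (fun ω => b ^ 2 * Real.exp ((b ^ 2)⁻¹ *
      rowWeight p q (fun t => c t ω) (fun t => e t ω) i - (b ^ 2)⁻¹ * K)) P ∧
      ∫ ω, b ^ 2 * Real.exp ((b ^ 2)⁻¹ *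
      rowWeight p q (fun t => c t ω) (fun t => e t ω) i - (b ^ 2)⁻¹ * K) ∂P ≤ b ^ 2 / N := by
    intro i
    obtain ⟨h1, h2⟩ := h.integral_exp_rowWeight_le hb hpq i
    simp only [Real.exp_sub, div_eq_mul_inv]
    refine ⟨(h1.mul_const _).const_mul _, ?_⟩
    rw [integral_const_mul, integral_mul_const]
    gcongr
    rw [← div_eq_mul_inv, div_le_iff₀ (Real.exp_pos _)]
    refine h2.trans ?_
    have : N⁻¹ * Real.exp ((b ^ 2)⁻¹ * K) = Real.exp ((b ^ 2)⁻¹ * (2 * T * N * b)) := by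
      have e1 : (b ^ 2)⁻¹ * K = (b ^ 2)⁻¹ * (2 * T * N * b) + Real.log N := by
        simp only [K]; field_simp
      rw [e1, Real.exp_add, Real.exp_log hN0]; field_simp
    rw [this]
    gcongr
    rw [hN]; linarith
  have hpq' : ∀ i j, (q i * p j)⁻¹ ≤ b := fun i j => by rw [mul_comm]; exact hpq j i
  have col : ∀ j, Integrable (fun ω => b ^ 2 * Real.exp ((b ^ 2)⁻¹ *
      rowWeight q p (fun t => e t ω) (fun t => c t ω) j - (b ^ 2)⁻¹ * K)) P ∧
      ∫ ω, b ^ 2 * Real.exp ((b ^ 2)⁻¹ *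
      rowWeight q p (fun t => e t ω) (fun t => c t ω) j - (b ^ 2)⁻¹ * K) ∂P ≤ b ^ 2 / N := by
    intro i
    obtain ⟨h1, h2⟩ := h.transpose.integral_exp_rowWeight_le hb hpq' i
    simp only [Real.exp_sub, div_eq_mul_inv]
    refine ⟨(h1.mul_const _).const_mul _, ?_⟩
    rw [integral_const_mul, integral_mul_const]
    gcongr
    rw [← div_eq_mul_inv, div_le_iff₀ (Real.exp_pos _)]
    refine h2.trans ?_
    have : N⁻¹ * Real.exp ((b ^ 2)⁻¹ * K) = Real.exp ((b ^ 2)⁻¹ * (2 * T * N * b)) := by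
      have e1 : (b ^ 2)⁻¹ * K = (b ^ 2)⁻¹ * (2 * T * N * b) + Real.log N := by
        simp only [K]; field_simp
      rw [e1, Real.exp_add, Real.exp_log hN0]; field_simp
    rw [this]
    gcongr
    rw [hN]; linarith
  have hR := integrable_finsetSum Finset.univ fun i _ => (row i).1
  have hC := integrable_finsetSum Finset.univ fun i _ => (col i).1
  have hRC : Integrable (fun ω =>
      ∑ i, b ^ 2 * Real.exp ((b ^ 2)⁻¹ * rowWeight p q (fun t => c t ω) (fun t => e t ω) i -
        (b ^ 2)⁻¹ * K) +
      ∑ j, b ^ 2 * Real.exp ((b ^ 2)⁻¹ * rowWeight q p (fun t => e t ω) (fun t => c t ω) j -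
        (b ^ 2)⁻¹ * K)) P := hR.add hC
  refine ⟨(integrable_const _).add hRC, ?_⟩
  simp only [weightEnvelope]
  rw [integral_add (integrable_const _) hRC, integral_add hR hC,
    integral_finsetSum _ fun i _ => (row i).1, integral_finsetSum _ fun i _ => (col i).1]
  have s1 := Finset.sum_le_sum fun t (_ : t ∈ (Finset.univ : Finset (Fin m))) => (row t).2
  have s2 := Finset.sum_le_sum fun t (_ : t ∈ (Finset.univ : Finset (Fin n))) => (col t).2
  rw [Finset.sum_const, Finset.card_univ, Fintype.card_fin, nsmul_eq_mul] at s1 s2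
  have s3 : m * (b ^ 2 / N) + n * (b ^ 2 / N) = b ^ 2 := by
    rw [← add_mul, ← hN]; field_simp
  simp only [integral_const, probReal_univ, smul_eq_mul, one_mul]
  have hlog : 0 ≤ Real.log N := Real.log_nonneg hN1
  have s4 : b ^ 2 ≤ T * N * b := by nlinarith
  simp only [K]
  nlinarith [mul_le_mul_of_nonneg_right s4 hlog]

theorem lintegral_norm_sampleErr_le (h : Sampling P p q σ c e ξ) (hT : 0 < T) (hσ : 0 < σ)
    (hm : 0 < m) {L b : ℝ} (hL : (σ : ℝ) ≤ L) (hM : ∀ i j, |M i j| ≤ L) (hb : 0 < b)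
    (hpq : ∀ i j, (p i * q j)⁻¹ ≤ b) {N : ℝ} (hN : N = m + n) (hbT : b ≤ T * N) :
    ∫⁻ ω, ‖sampleErr p q M (fun t => c t ω) (fun t => e t ω) (fun t => ξ t ω)‖ₑ ^ 2 ∂P ≤
      ENNReal.ofReal (48 * (Real.log N + 1) * (3 + Real.log N) * (70 + 2 * Real.log T ^ 2) *
        (L ^ 2 * b * N / T)) := by
  have : NeZero m := ⟨hm.ne'⟩
  have hT' : (0 : ℝ) < T := by exact_mod_cast hT
  have hσ' : (0 : ℝ) < σ := hσ
  have hm' : (1 : ℝ) ≤ m := by exact_mod_cast hm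
  have hn0 : (0 : ℝ) ≤ n := Nat.cast_nonneg n
  have hN1 : 1 ≤ N := by rw [hN]; linarith
  have hlog : 0 ≤ Real.log N := Real.log_nonneg hN1
  obtain ⟨G1, G2⟩ := h.integral_noiseEnvelope_le hT hσ hL
  obtain ⟨H1, H2⟩ := h.integral_weightEnvelope_le hb hpq hN hm hbT
  set K := 2 * T * N * b + b ^ 2 * Real.log N with hK
  set G : Ω → ℝ := fun ω => noiseEnvelope L σ (fun t => ξ t ω) with hG
  set H : Ω → ℝ := fun ω => weightEnvelope p q b K (fun t => c t ω) (fun t => e t ω) with hH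
  have hG0 : ∀ ω, 0 < G ω := by
    intro ω
    have hL0 : 0 < L := by linarith
    simp only [hG, noiseEnvelope]
    have : 0 ≤ ∑ t, (2 / (T : ℝ)) * (Real.exp (2 / σ * ξ t ω) + Real.exp (-(2 / σ) * ξ t ω)) :=
      Finset.sum_nonneg fun t _ => by positivity
    positivity
  have hH0 : ∀ ω, 0 < H ω := by
    intro ω
    have hK0 : 0 < K := by positivity
    simp only [hH, weightEnvelope]
    have h1 : 0 ≤ ∑ i, b ^ 2 * Real.exp ((b ^ 2)⁻¹ *
        rowWeight p q (fun t => c t ω) (fun t => e t ω) i - (b ^ 2)⁻¹ * K) :=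
      Finset.sum_nonneg fun i _ => by positivity
    have h2 : 0 ≤ ∑ i, b ^ 2 * Real.exp ((b ^ 2)⁻¹ *
        rowWeight q p (fun t => e t ω) (fun t => c t ω) i - (b ^ 2)⁻¹ * K) :=
      Finset.sum_nonneg fun i _ => by positivity
    positivity
  -- One envelope is a function of the positions only and the other of the noise only. This is why
  -- two envelopes are used: the mean of their product factorizes.
  have hind : IndepFun H G P := by
    have h1 := indepFun_pi_of_iIndepFun_prod (A := fun t ω => (c t ω, e t ω)) (B := ξ)
      (fun t => (h.measurable_row t).prodMk (h.measurable_col t)) h.measurable_noise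
      (h.indep.comp (fun _ (x : Fin m × Fin n × ℝ) => ((x.1, x.2.1), x.2.2)) fun _ => by fun_prop)
      h.indep_noise
    have h2 : Measurable fun w : Fin T → Fin m × Fin n =>
        weightEnvelope p q b K (fun t => (w t).1) (fun t => (w t).2) := measurable_of_finite _
    have h3 : Measurable fun x : Fin T → ℝ => noiseEnvelope L σ x := by
      unfold noiseEnvelope
      fun_prop
    exact h1.comp h2 h3
  set A := 12 * (Real.log ((m : ℝ) + n) + 1) with hA
  have hA0 : 0 ≤ A := by rw [hA, ← hN]; positivity
  have hz : ∀ t, Measurable fun ω => (c t ω, e t ω, ξ t ω) := fun t =>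
    (h.measurable_row t).prodMk ((h.measurable_col t).prodMk (h.measurable_noise t))
  have hkh : ∀ ω, ∑ ε : Fin T → Bool,
      ‖signedSum (fun t => obsMat p q M (c t ω, e t ω, ξ t ω)) ε‖ₑ ^ 2 ≤
      ENNReal.ofReal (Fintype.card (Fin T → Bool) * (A * (H ω * G ω))) := by
    intro ω
    have hy : ∀ t, ((M (c t ω) (e t ω) + ξ t ω) / (p (c t ω) * q (e t ω))) ^ 2 ≤
        ((p (c t ω) * q (e t ω))⁻¹) ^ 2 * G ω := by
      intro t
      rw [div_eq_mul_inv, mul_pow, mul_comm]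
      gcongr
      exact sq_le_noiseEnvelope (x := fun t => ξ t ω) hσ' (hM _ _) t
    obtain ⟨w1, w2⟩ := rowWeight_le_weightEnvelope p q hb K (fun t => c t ω) (fun t => e t ω)
    have := sum_norm_sq_signedSum_single_le (fun t => c t ω) (fun t => e t ω)
      (fun t => (M (c t ω) (e t ω) + ξ t ω) / (p (c t ω) * q (e t ω)))
      (v := H ω * G ω) (mul_pos (hH0 ω) (hG0 ω)) (fun a => by
        refine le_trans ?_ (mul_le_mul_of_nonneg_right (w1 a) (hG0 ω).le)
        rw [rowWeight, Finset.sum_mul]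
        refine Finset.sum_le_sum fun t _ => ?_
        split_ifs
        · exact hy t
        · simp) (fun a => by
        refine le_trans ?_ (mul_le_mul_of_nonneg_right (w2 a) (hG0 ω).le)
        rw [rowWeight, Finset.sum_mul]
        refine Finset.sum_le_sum fun t _ => ?_
        split_ifs
        · rw [mul_comm (q _)]; exact hy t
        · simp)
    simp only [← ofReal_norm, ← ENNReal.ofReal_pow (norm_nonneg _)]
    rw [← ENNReal.ofReal_sum_of_nonneg fun ε _ => by positivity]
    exact ENNReal.ofReal_le_ofReal this
  have hmeas : ∀ ε : Fin T → Bool, Measurable fun ω =>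
      ‖signedSum (fun t => obsMat p q M (c t ω, e t ω, ξ t ω)) ε‖ₑ ^ 2 := by
    intro ε
    refine Measurable.pow_const ?_ 2
    have : Measurable fun ω => ‖signedSum (fun t => obsMat p q M (c t ω, e t ω, ξ t ω)) ε‖ := by
      refine measurable_norm_matrix fun i j => ?_
      simp only [signedSum, Matrix.sum_apply, Matrix.smul_apply, smul_eq_mul]
      refine Finset.measurable_sum _ fun t _ => ?_
      exact ((measurable_obsMat p q M i j).comp (hz t)).const_mul _
    simpa only [ofReal_norm] using this.ennreal_ofReal
  set D := Fintype.card (Fin T → Bool) with hD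
  have hD0 : (0 : ℝ) < D := by rw [hD]; exact_mod_cast Fintype.card_pos
  -- The symmetrized bound holds for each of the `D` sign patterns. Summing over them lets
  -- Khintchine's inequality act outcome by outcome.
  have hsum : (D : ℝ≥0∞) *
      ∫⁻ ω, ‖sampleErr p q M (fun t => c t ω) (fun t => e t ω) (fun t => ξ t ω)‖ₑ ^ 2 ∂P ≤
      ENNReal.ofReal (4 / T ^ 2) * ENNReal.ofReal (D * (A * ((T * N * b * (3 + Real.log N)) *
        (L ^ 2 * (70 + 2 * Real.log T ^ 2))))) := by
    have h1 := Finset.sum_le_sum fun ε (_ : ε ∈ (Finset.univ : Finset (Fin T → Bool))) =>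
      h.lintegral_norm_sampleErr_le_signedSum (M := M) hT ε
    rw [Finset.sum_const, Finset.card_univ, nsmul_eq_mul, ← Finset.mul_sum,
      ← lintegral_finsetSum _ fun ε _ => hmeas ε] at h1
    refine h1.trans ?_
    gcongr
    refine (lintegral_mono hkh).trans ?_
    have hHG := hind.integrable_mul H1 G1
    have hint : Integrable (fun ω => (D : ℝ) * (A * (H ω * G ω))) P :=
      (Integrable.const_mul hHG _).const_mul _
    rw [← ofReal_integral_eq_lintegral_ofReal hint (Filter.Eventually.of_forall fun ω => by
      have := hH0 ω; have := hG0 ω; simp only [Pi.zero_apply]; positivity)]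
    refine ENNReal.ofReal_le_ofReal ?_
    rw [integral_const_mul, integral_const_mul, hind.integral_fun_mul_eq_mul_integral
      H1.aestronglyMeasurable G1.aestronglyMeasurable]
    have : 0 ≤ ∫ ω, G ω ∂P := integral_nonneg fun ω => (hG0 ω).le
    gcongr
  have hDe : (D : ℝ≥0∞) = ENNReal.ofReal D := by simp
  rw [hDe, ← ENNReal.ofReal_mul (by positivity)] at hsum
  have hfin : ∫⁻ ω, ‖sampleErr p q M (fun t => c t ω) (fun t => e t ω) (fun t => ξ t ω)‖ₑ ^ 2 ∂P ≤
      (ENNReal.ofReal D)⁻¹ * ENNReal.ofReal (4 / T ^ 2 * (D * (A * ((T * N * b *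
        (3 + Real.log N)) * (L ^ 2 * (70 + 2 * Real.log T ^ 2)))))) := by
    rw [← ENNReal.mul_le_iff_le_inv (ENNReal.ofReal_pos.2 hD0).ne' ENNReal.ofReal_ne_top]
    exact hsum
  refine hfin.trans (le_of_eq ?_)
  rw [← ENNReal.ofReal_inv_of_pos hD0, ← ENNReal.ofReal_mul (by positivity)]
  congr 1
  rw [hA, ← hN]
  field_simp
  ring

end Sampling

end OperatorNorm

end LowRankBandit

end

noncomputable section

namespace LowRankBandit

open scoped Matrix.Norms.L2Operator

/-! ### Rows of the sampling error -/

section Rows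

variable {Ω : Type*} [MeasurableSpace Ω] {P : Measure Ω} [IsProbabilityMeasure P] {T m n r : ℕ}

theorem sampleErr_mulVec (p : Fin m → ℝ) (q : Fin n → ℝ) (M : Matrix (Fin m) (Fin n) ℝ)
    (c : Fin T → Fin m) (e : Fin T → Fin n) (x : Fin T → ℝ) (w : Fin n → ℝ) (i : Fin m) :
    (sampleErr p q M c e x *ᵥ w) i =
      (T : ℝ)⁻¹ * ∑ t, (if c t = i then w (e t) / (p i * q (e t)) * (M i (e t) + x t) else 0) -
        (M *ᵥ w) i := by
  have h1 : ∀ t, ∑ j, obsMat p q M (c t, e t, x t) i j * w j =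
      if c t = i then w (e t) / (p i * q (e t)) * (M i (e t) + x t) else 0 := by
    intro t
    rw [Finset.sum_eq_single (e t)]
    · rw [obsMat_apply]
      simp only [and_true]
      split_ifs <;> ring
    · intro j _ hj
      rw [obsMat_apply, if_neg (fun h => hj h.2.symm), zero_mul]
    · simp
  simp only [← h1]
  rw [Finset.sum_comm, Finset.mul_sum]
  simp only [sampleErr, Matrix.mulVec, dotProduct, Matrix.sub_apply, Matrix.smul_apply,
    Matrix.sum_apply, smul_eq_mul]
  rw [← Finset.sum_sub_distrib]
  refine Finset.sum_congr rfl fun j _ => ?_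
  rw [← Finset.sum_mul]
  ring

theorem measurable_sampleErr (p : Fin m → ℝ) (q : Fin n → ℝ) (M : Matrix (Fin m) (Fin n) ℝ)
    (i : Fin m) (j : Fin n) :
    Measurable fun z : Fin T → Fin m × Fin n × ℝ =>
      sampleErr p q M (fun t => (z t).1) (fun t => (z t).2.1) (fun t => (z t).2.2) i j := by
  simp only [sampleErr, Matrix.sub_apply, Matrix.smul_apply, Matrix.sum_apply, smul_eq_mul]
  refine Measurable.sub_const (Measurable.const_mul (Finset.measurable_sum _ fun t _ => ?_) _) _
  exact (measurable_obsMat p q M i j).comp (measurable_pi_apply t)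

/-- The combination with coefficients `u` of the rows of the sampling error other than row `i`. -/
def offRow (p : Fin m → ℝ) (q : Fin n → ℝ) (M : Matrix (Fin m) (Fin n) ℝ) (i : Fin m)
    (u : Fin m → ℝ) (c : Fin T → Fin m) (e : Fin T → Fin n) (x : Fin T → ℝ) : Fin n → ℝ :=
  (sampleErr p q M c e x)ᵀ *ᵥ (fun i' => if i' = i then 0 else u i')

/-- Rounds in row `i` contribute only to row `i` of the estimate, which the combination omits. This
decouples row `i` from the vector that it meets in `E * Eᵀ * U`. -/
theorem offRow_congr (p : Fin m → ℝ) (q : Fin n → ℝ) (M : Matrix (Fin m) (Fin n) ℝ) (i : Fin m)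
    (u : Fin m → ℝ) (c : Fin T → Fin m) {e e' : Fin T → Fin n} {x x' : Fin T → ℝ}
    (he : ∀ t, c t ≠ i → e t = e' t) (hx : ∀ t, c t ≠ i → x t = x' t) :
    offRow p q M i u c e x = offRow p q M i u c e' x' := by
  ext j
  simp only [offRow, Matrix.mulVec, dotProduct, Matrix.transpose_apply]
  refine Finset.sum_congr rfl fun i' _ => ?_
  by_cases h : i' = i
  · simp [h]
  · rw [if_neg h]
    congr 1
    simp only [sampleErr, Matrix.sub_apply, Matrix.smul_apply, Matrix.sum_apply, obsMat_apply]
    congr 2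
    refine Finset.sum_congr rfl fun t _ => ?_
    by_cases ht : c t = i
    · rw [if_neg (fun h' => h (h'.1.symm.trans ht)), if_neg (fun h' => h (h'.1.symm.trans ht))]
    · rw [he t ht, hx t ht]

/-- Conditioning on the coordinates outside `I`, which are frozen at arbitrary values while those in
`I` stay random. -/
theorem measure_le_of_split {α τ : Type*} [Fintype τ] [DecidableEq τ] [MeasurableSpace α]
    {z : τ → Ω → α} (hz : ∀ t, Measurable (z t)) (h : iIndepFun z P) (I : Finset τ)
    {S : Set (τ → α)} (hS : MeasurableSet S) {ε : ℝ≥0∞}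
    (hε : ∀ x : τ → α, P {ω | (fun t => if t ∈ I then z t ω else x t) ∈ S} ≤ ε) :
    P {ω | (fun t => z t ω) ∈ S} ≤ ε := by
  obtain ⟨ω₀⟩ : Nonempty Ω := nonempty_of_isProbabilityMeasure P
  have hind := h.indepFun_finset Iᶜ I disjoint_compl_left hz
  let glue : ((Iᶜ : Finset τ) → α) × (I → α) → τ → α := fun w t =>
    if ht : t ∈ I then w.2 ⟨t, ht⟩ else w.1 ⟨t, Finset.mem_compl.2 ht⟩
  have hglue : Measurable glue := by
    refine measurable_pi_lambda _ fun t => ?_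
    by_cases ht : t ∈ I
    · simp only [glue, ht, dif_pos]
      exact (measurable_pi_apply _).comp measurable_snd
    · simp only [glue, ht, dif_neg, not_false_eq_true]
      exact (measurable_pi_apply _).comp measurable_fst
  have h1 := measure_le_of_indepFun hind (measurable_pi_lambda _ fun t => hz t)
    (measurable_pi_lambda _ fun t => hz t) (hglue hS) (ε := ε) (fun x => by
      -- The coordinates of this vector in `I` are never read, so an arbitrary outcome may fill
      -- them.
      have h2 := hε (fun t => if ht : t ∈ I then z t ω₀ else x ⟨t, Finset.mem_compl.2 ht⟩)
      refine le_trans (measure_mono fun ω hω => ?_) h2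
      simp only [Set.mem_preimage, Set.mem_ofPred_eq] at hω ⊢
      convert hω using 1
      ext t
      by_cases ht : t ∈ I <;> simp [glue, ht])
  refine le_trans (measure_mono fun ω hω => ?_) h1
  simp only [Set.mem_preimage, Set.mem_ofPred_eq] at hω ⊢
  convert hω using 1
  ext t
  by_cases ht : t ∈ I <;> simp [glue, ht]

theorem measurable_zip (T : ℕ) {α β : Type*} [MeasurableSpace α] [MeasurableSpace β] :
    Measurable fun (z : (Fin T → α) × (Fin T → β)) t => (z.1 t, z.2 t) :=
  measurable_pi_lambda _ fun t =>
    ((measurable_pi_apply t).comp measurable_fst).prodMk ((measurable_pi_apply t).comp measurable_snd)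

/-- The positions and observations for which the product of row `i` with the combination of the
other rows is far from its conditional mean although row `i` is not observed too often. -/
def offRowBad (T : ℕ) (p : Fin m → ℝ) (q : Fin n → ℝ) (M : Matrix (Fin m) (Fin n) ℝ) (i : Fin m)
    (u : Fin m → ℝ) (ν β : ℝ) : Set ((Fin T → Fin m) × (Fin T → Fin n × ℝ)) :=
  {z | (∑ t, if z.1 t = i then (1 : ℝ) else 0) ≤ T * p i * ν ∧
      √(∑ j, offRow p q M i u z.1 (fun t => (z.2 t).1) (fun t => (z.2 t).2) j ^ 2) * β <
      |(sampleErr p q M z.1 (fun t => (z.2 t).1) (fun t => (z.2 t).2) *ᵥ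
          offRow p q M i u z.1 (fun t => (z.2 t).1) (fun t => (z.2 t).2)) i -
        ((∑ t, if z.1 t = i then (1 : ℝ) else 0) / (T * p i) - 1) *
          (M *ᵥ offRow p q M i u z.1 (fun t => (z.2 t).1) (fun t => (z.2 t).2)) i|}

theorem measurableSet_offRowBad (p : Fin m → ℝ) (q : Fin n → ℝ) (M : Matrix (Fin m) (Fin n) ℝ)
    (i : Fin m) (u : Fin m → ℝ) (ν β : ℝ) : MeasurableSet (offRowBad T p q M i u ν β) := by
  have hs : ∀ i j, Measurable fun z : (Fin T → Fin m) × (Fin T → Fin n × ℝ) =>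
      sampleErr p q M z.1 (fun t => (z.2 t).1) (fun t => (z.2 t).2) i j := by
    intro i j
    have h1 := (measurable_sampleErr (T := T) p q M i j).comp (measurable_zip T)
    simpa only [Function.comp_def] using h1
  have ho : ∀ j, Measurable fun z : (Fin T → Fin m) × (Fin T → Fin n × ℝ) =>
      offRow p q M i u z.1 (fun t => (z.2 t).1) (fun t => (z.2 t).2) j := by
    intro j
    simp only [offRow, Matrix.mulVec, dotProduct, Matrix.transpose_apply]
    exact Finset.measurable_sum _ fun i' _ => (hs i' j).mul_const _
  have hcnt : Measurable fun z : (Fin T → Fin m) × (Fin T → Fin n × ℝ) =>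
      ∑ t, if z.1 t = i then (1 : ℝ) else 0 :=
    (measurable_of_finite fun γ : Fin T → Fin m =>
      ∑ t, if γ t = i then (1 : ℝ) else 0).comp measurable_fst
  rw [offRowBad, Set.ofPred_and]
  refine (measurableSet_le hcnt measurable_const).inter (measurableSet_lt ?_ ?_)
  · exact (Finset.measurable_sum _ fun j _ => (ho j).pow_const 2).sqrt.mul_const _
  · have h1 : Measurable fun z : (Fin T → Fin m) × (Fin T → Fin n × ℝ) =>
        (sampleErr p q M z.1 (fun t => (z.2 t).1) (fun t => (z.2 t).2) *ᵥ
          offRow p q M i u z.1 (fun t => (z.2 t).1) (fun t => (z.2 t).2)) i := by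
      simp only [Matrix.mulVec, dotProduct]
      exact Finset.measurable_sum _ fun j _ => (hs i j).mul (ho j)
    have h2 : Measurable fun z : (Fin T → Fin m) × (Fin T → Fin n × ℝ) =>
        (M *ᵥ offRow p q M i u z.1 (fun t => (z.2 t).1) (fun t => (z.2 t).2)) i := by
      simp only [Matrix.mulVec, dotProduct]
      exact Finset.measurable_sum _ fun j _ => (ho j).const_mul _
    exact measurable_abs.comp (h1.sub (((hcnt.div_const _).sub_const _).mul h2))

variable {p : Fin m → ℝ} {q : Fin n → ℝ} {σ : ℝ≥0} {c : Fin T → Ω → Fin m}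
  {e : Fin T → Ω → Fin n} {ξ : Fin T → Ω → ℝ} {M : Matrix (Fin m) (Fin n) ℝ}

theorem sqrt_bernstein {T L b ℓ : ℝ} (hT : 0 < T) (hL : 0 ≤ L) (x : ℝ) :
    T⁻¹ * (2 * √(T * (3 * L ^ 2 * b * x ^ 2) * ℓ)) = |x| * (L * (2 * √(3 * b * ℓ / T))) := by
  have h1 : T * (3 * L ^ 2 * b * x ^ 2) * ℓ = (T * L * x) ^ 2 * (3 * b * ℓ / T) := by
    field_simp
  rw [h1, Real.sqrt_mul (sq_nonneg _), Real.sqrt_sq_eq_abs, abs_mul, abs_mul, abs_of_pos hT,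
    abs_of_nonneg hL]
  field_simp

namespace Sampling

/-- Bernstein's inequality with the weights `w j / (p i * q j)` on the rounds of row `i`. Their
second moment is at most `b` and their size at most `b v`, so the incoherence `v` affects only the
lower-order term. -/
theorem measure_sampleErr_mulVec_le (h : Sampling P p q σ c e ξ) (hT : 0 < T) (hσ : 0 < σ)
    {L b v ℓ : ℝ} (hL : (σ : ℝ) ≤ L) (hM : ∀ i j, |M i j| ≤ L) (hb : 0 < b)
    (hpq : ∀ i j, (p i * q j)⁻¹ ≤ b) (hv : 0 < v) (hℓ : 0 < ℓ) {w : Fin n → ℝ}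
    (hw : ∑ j, w j ^ 2 ≤ 1) (hwv : ∀ j, |w j| ≤ v) (i : Fin m) :
    P.real {ω | L * (2 * √(3 * b * ℓ / T) + 2 * b * v * ℓ / T) <
      |(sampleErr p q M (fun t => c t ω) (fun t => e t ω) (fun t => ξ t ω) *ᵥ w) i|} ≤
      2 * Real.exp (-ℓ) := by
  have hσ' : (0 : ℝ) < σ := hσ
  have hL0 : 0 < L := by linarith
  have hT' : (0 : ℝ) < T := by exact_mod_cast hT
  have hX : ∀ t, Measurable fun ω => (c t ω, e t ω) := fun t =>
    (h.measurable_row t).prodMk (h.measurable_col t)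
  have hpos : ∀ i j, 0 < p i * q j := fun i j => mul_pos (h.row_pos i) (h.col_pos j)
  set g : Fin m × Fin n → ℝ := fun x => if x.1 = i then w x.2 / (p i * q x.2) else 0 with hg
  set f : Fin m × Fin n → ℝ := fun x => M x.1 x.2 with hf
  have hgb : ∀ x, |g x| ≤ b * v := by
    intro x
    simp only [hg]
    split_ifs
    · rw [abs_div, abs_of_pos (hpos _ _), div_eq_inv_mul]
      exact mul_le_mul (hpq _ _) (hwv _) (abs_nonneg _) hb.le
    · rw [abs_zero]; positivity
  have hmean : ∀ t, ∑ a, P.real ((fun ω => (c t ω, e t ω)) ⁻¹' {a}) * (g a * f a) =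
      (M *ᵥ w) i := by
    intro t
    rw [Fintype.sum_prod_type, Finset.sum_eq_single i]
    · simp only [Matrix.mulVec, dotProduct]
      refine Finset.sum_congr rfl fun j _ => ?_
      rw [h.law_pair]
      simp only [hg, hf, if_true]
      have := (hpos i j).ne'
      rw [div_mul_eq_mul_div, mul_div_cancel₀ _ this, mul_comm]
    · intro i' _ hi'
      simp [hg, hi']
    · simp
  have hvar : ∀ t, ∑ a, P.real ((fun ω => (c t ω, e t ω)) ⁻¹' {a}) * g a ^ 2 ≤ b := by
    intro t
    rw [Fintype.sum_prod_type, Finset.sum_eq_single i]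
    · calc _ ≤ ∑ j, b * w j ^ 2 := by
            refine Finset.sum_le_sum fun j _ => ?_
            rw [h.law_pair]
            simp only [hg, if_true]
            have := (hpos i j).ne'
            have e1 : p i * q j * (w j / (p i * q j)) ^ 2 = (p i * q j)⁻¹ * w j ^ 2 := by
              have h1 := (h.row_pos i).ne'
              have h2 := (h.col_pos j).ne'
              field_simp
            rw [e1]
            gcongr
            exact hpq i j
        _ ≤ b := by rw [← Finset.mul_sum]; nlinarith
    · intro i' _ hi'
      simp [hg, hi']
    · simp
  have hmgf := fun t => mgf_weighted_observation (hX t) (h.indep_noise t) (h.subgaussian t)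
    (f := f) (h := g) hL (fun a => hM _ _) hgb
  have hZ : ∀ t, Measurable fun ω => g (c t ω, e t ω) * (f (c t ω, e t ω) + ξ t ω) := fun t =>
    ((measurable_of_finite g).comp (hX t)).mul
      (((measurable_of_finite f).comp (hX t)).add (h.measurable_noise t))
  have hind : iIndepFun (fun t ω => g (c t ω, e t ω) * (f (c t ω, e t ω) + ξ t ω)) P := by
    have hgm := measurable_of_finite g
    have hfm := measurable_of_finite f
    refine h.indep.comp (fun _ (x : Fin m × Fin n × ℝ) => g (x.1, x.2.1) * (f (x.1, x.2.1) + x.2.2))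
      fun _ => ?_
    fun_prop
  have hB := bernstein hZ hind Finset.univ (μ := fun _ => (M *ᵥ w) i)
    (w := fun _ => 3 * L ^ 2 * b * 1 ^ 2) (s₀ := 1 / (2 * (b * v) * L)) (ℓ := ℓ) (by positivity) hℓ
    (fun t => by positivity) (fun t s => (hmgf t).1 s) (fun t s hs => by
      have h1 := (hmgf t).2 s (by
        rw [le_div_iff₀ (by positivity)] at hs
        nlinarith)
      rw [hmean] at h1
      refine h1.trans (Real.exp_le_exp.2 ?_)
      rw [one_pow, mul_one]
      have := hvar t
      gcongr)
  refine le_trans (measureReal_mono fun ω hω => ?_) hB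
  simp only [Set.mem_ofPred_eq, Finset.sum_const, Finset.card_univ, Fintype.card_fin,
    nsmul_eq_mul] at hω ⊢
  have e1 : (sampleErr p q M (fun t => c t ω) (fun t => e t ω) (fun t => ξ t ω) *ᵥ w) i =
      (T : ℝ)⁻¹ * (∑ t, g (c t ω, e t ω) * (f (c t ω, e t ω) + ξ t ω) - T * (M *ᵥ w) i) := by
    rw [sampleErr_mulVec, mul_sub, inv_mul_cancel_left₀ hT'.ne']
    congr 2
    refine Finset.sum_congr rfl fun t _ => ?_
    simp only [hg, hf]
    split_ifs with h1
    · rw [h1]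
    · rw [zero_mul]
  rw [e1, abs_mul, abs_of_pos (inv_pos.2 hT')] at hω
  have e2 := sqrt_bernstein (b := b) (ℓ := ℓ) hT' hL0.le 1
  rw [abs_one, one_mul] at e2
  have e3 : (T : ℝ)⁻¹ * (ℓ / (1 / (2 * (b * v) * L))) = L * (2 * b * v * ℓ / T) := by
    field_simp
  rw [mul_add, ← e2, ← e3, ← mul_add] at hω
  exact lt_of_mul_lt_mul_left hω (inv_pos.2 hT').le

/-- Bernstein's inequality for the number of visits; `2 √(x ℓ) ≤ x + ℓ` and `1 ≤ T p i` bring every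
term to a multiple of `T p i`. -/
theorem measure_count_row_le (h : Sampling P p q σ c e ξ) {ℓ : ℝ} (hℓ : 0 < ℓ) (i : Fin m)
    (hTp : 1 ≤ T * p i) :
    P.real {ω | T * p i * (2 + 2 * ℓ) < ∑ t, if c t ω = i then (1 : ℝ) else 0} ≤
      2 * Real.exp (-ℓ) := by
  set g : Fin m → ℝ := fun a => if a = i then 1 else 0 with hg
  have hgm : Measurable g := measurable_of_finite g
  have hB := bernstein (P := P) (Z := fun t ω => g (c t ω)) (fun t => hgm.comp (h.measurable_row t))
    (h.indep.comp (fun _ (x : Fin m × Fin n × ℝ) => g x.1) fun _ => hgm.comp measurable_fst)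
    Finset.univ (μ := fun _ => p i) (w := fun _ => p i) (s₀ := 1) one_pos hℓ
    (fun _ => (h.row_pos i).le)
    (fun t s => (integral_comp_fintype (h.measurable_row t) fun a => Real.exp (s * g a)).1)
    (fun t s hs => by
      rw [mgf, (integral_comp_fintype (h.measurable_row t) fun a => Real.exp (s * g a)).2]
      have h1 : ∑ a, P.real (c t ⁻¹' {a}) * Real.exp (s * g a) ≤
          ∑ a, (p a + (s + s ^ 2) * (p a * g a)) := by
        refine Finset.sum_le_sum fun a _ => ?_
        rw [h.law_row]
        have hp := h.row_pos a
        simp only [hg]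
        split_ifs
        · have := (abs_le.1 (Real.abs_exp_sub_one_sub_id_le hs)).2
          rw [mul_one]
          nlinarith
        · simp
      refine h1.trans ?_
      rw [Finset.sum_add_distrib, h.sum_row t, ← Finset.mul_sum]
      have h2 : ∑ a, p a * g a = p i := by simp [hg]
      rw [h2]
      have := Real.add_one_le_exp (s * p i + s ^ 2 * p i)
      linarith)
  refine le_trans (measureReal_mono fun ω hω => ?_) hB
  simp only [Set.mem_ofPred_eq, Finset.sum_const, Finset.card_univ, Fintype.card_fin,
    nsmul_eq_mul, div_one] at hω ⊢
  refine lt_of_lt_of_le ?_ (le_abs_self _)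
  have h3 : 2 * √(T * p i * ℓ) ≤ T * p i + ℓ := by
    have h4 : √(T * p i * ℓ) ≤ (T * p i + ℓ) / 2 := by
      refine Real.sqrt_le_iff.2 ⟨by positivity, ?_⟩
      nlinarith [sq_nonneg (T * p i - ℓ)]
    linarith
  have h5 : (∑ t, g (c t ω)) = ∑ t, if c t ω = i then (1 : ℝ) else 0 := rfl
  rw [h5]
  nlinarith

/-- The part of the square of the sampling error that couples row `i` with the other rows, for
fixed positions. -/
theorem measure_offRow_fixed_le (h : Sampling P p q σ c e ξ) (hT : 0 < T) (hσ : 0 < σ)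
    {L b ℓ : ℝ} (hL : (σ : ℝ) ≤ L) (hM : ∀ i j, |M i j| ≤ L) (hb : 0 < b)
    (hpq : ∀ i j, (p i * q j)⁻¹ ≤ b) (hℓ : 0 < ℓ) (i : Fin m) (γ : Fin T → Fin m) {ν : ℝ}
    (hν : (∑ t, if γ t = i then (1 : ℝ) else 0) ≤ T * p i * ν) (w : Fin n → ℝ)
    (x : Fin T → Fin n × ℝ) :
    P.real {ω | √(∑ j, w j ^ 2) * (L * (2 * √(3 * (b * ν) * ℓ / T) + 2 * b * ℓ / T)) <
      |(sampleErr p q M γ (fun t => if γ t = i then e t ω else (x t).1)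
          (fun t => if γ t = i then ξ t ω else (x t).2) *ᵥ w) i -
        ((∑ t, if γ t = i then (1 : ℝ) else 0) / (T * p i) - 1) * (M *ᵥ w) i|} ≤
      2 * Real.exp (-ℓ) := by
  have hσ' : (0 : ℝ) < σ := hσ
  have hL0 : 0 < L := by linarith
  have hT' : (0 : ℝ) < T := by exact_mod_cast hT
  have hpos : ∀ i j, 0 < p i * q j := fun i j => mul_pos (h.row_pos i) (h.col_pos j)
  have hp := h.row_pos i
  set W := √(∑ j, w j ^ 2) with hW
  have hWsq : W ^ 2 = ∑ j, w j ^ 2 := Real.sq_sqrt (Finset.sum_nonneg fun j _ => sq_nonneg _)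
  have hwW : ∀ j, |w j| ≤ W := by
    intro j
    refine Real.abs_le_sqrt ?_
    exact Finset.single_le_sum (f := fun j => w j ^ 2) (fun j _ => sq_nonneg _) (Finset.mem_univ j)
  set g : Fin n → ℝ := fun j => w j / (p i * q j) with hg
  set I : Finset (Fin T) := Finset.univ.filter fun t => γ t = i with hI
  have hcount : (∑ t, if γ t = i then (1 : ℝ) else 0) = I.card := by
    rw [hI, ← Finset.sum_filter]; simp
  rw [hcount] at hν ⊢
  -- With the rows fixed, each round of `I` has mean `(M *ᵥ w) i / p i`. This accounts for the
  -- centring: the mean is the ratio of the actual to the expected number of visits, less one for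
  -- the subtraction of `M`, times `(M *ᵥ w) i`.
  have e1 : ∀ ω, (sampleErr p q M γ (fun t => if γ t = i then e t ω else (x t).1)
          (fun t => if γ t = i then ξ t ω else (x t).2) *ᵥ w) i -
        ((I.card : ℝ) / (T * p i) - 1) * (M *ᵥ w) i =
      (T : ℝ)⁻¹ * (∑ t ∈ I, g (e t ω) * (M i (e t ω) + ξ t ω) -
        ∑ t ∈ I, (M *ᵥ w) i / p i) := by
    intro ω
    rw [sampleErr_mulVec, Finset.sum_const, nsmul_eq_mul]
    have e2 : (∑ t, if γ t = i then w (if γ t = i then e t ω else (x t).1) /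
        (p i * q (if γ t = i then e t ω else (x t).1)) *
          (M i (if γ t = i then e t ω else (x t).1) + if γ t = i then ξ t ω else (x t).2) else 0) =
        ∑ t ∈ I, g (e t ω) * (M i (e t ω) + ξ t ω) := by
      rw [hI, Finset.sum_filter]
      refine Finset.sum_congr rfl fun t _ => ?_
      split_ifs <;> rfl
    rw [e2]
    field_simp
    ring
  simp only [e1, abs_mul, abs_of_pos (inv_pos.2 hT')]
  -- The range of the exponent is inversely proportional to `W`. For `W = 0` both sides of the
  -- strict inequality vanish and the event is empty.
  rcases (Real.sqrt_nonneg (∑ j, w j ^ 2)).eq_or_lt with hW0 | hW0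
  · have hw0 : ∀ j, w j = 0 := fun j => by
      have := hwW j
      rw [hW, ← hW0] at this
      exact abs_nonpos_iff.1 this
    have : ∀ ω, (T : ℝ)⁻¹ * |∑ t ∈ I, g (e t ω) * (M i (e t ω) + ξ t ω) -
        ∑ t ∈ I, (M *ᵥ w) i / p i| = 0 := by
      intro ω
      simp [hg, hw0, Matrix.mulVec, dotProduct]
    simp only [this]
    rw [hW, ← hW0, zero_mul]
    simp only [lt_irrefl, Set.ofPred_false, measureReal_empty]
    positivity
  rw [← hW] at hW0
  have hgb : ∀ j, |g j| ≤ b * W := by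
    intro j
    simp only [hg]
    rw [abs_div, abs_of_pos (hpos _ _), div_eq_inv_mul]
    exact mul_le_mul (hpq _ _) (hwW _) (abs_nonneg _) hb.le
  have hmean : ∀ t, ∑ a, P.real (e t ⁻¹' {a}) * (g a * M i a) = (M *ᵥ w) i / p i := by
    intro t
    simp only [Matrix.mulVec, dotProduct, Finset.sum_div]
    refine Finset.sum_congr rfl fun j _ => ?_
    have h2 := (h.col_pos j).ne'
    rw [h.law_col]
    simp only [hg]
    field_simp
  have hvar : ∀ t, ∑ a, P.real (e t ⁻¹' {a}) * g a ^ 2 ≤ b * W ^ 2 / p i := by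
    intro t
    rw [hWsq, Finset.mul_sum, Finset.sum_div]
    refine Finset.sum_le_sum fun j _ => ?_
    have h2 := (h.col_pos j).ne'
    have e1 : q j * (w j / (p i * q j)) ^ 2 = (p i * q j)⁻¹ * w j ^ 2 / p i := by
      field_simp
    rw [h.law_col]
    simp only [hg]
    rw [e1]
    gcongr
    exact hpq i j
  have hmgf := fun t => mgf_weighted_observation (h.measurable_col t)
    (X := e t) ((h.indep_noise t).comp (φ := Prod.snd) (ψ := id) measurable_snd measurable_id)
    (h.subgaussian t) (f := fun j => M i j) (h := g) hL (fun a => hM _ _) hgb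
  have hgm := measurable_of_finite g
  have hMm : Measurable fun j => M i j := measurable_of_finite _
  have hZ : ∀ t, Measurable fun ω => g (e t ω) * (M i (e t ω) + ξ t ω) := fun t =>
    (hgm.comp (h.measurable_col t)).mul
      ((hMm.comp (h.measurable_col t)).add (h.measurable_noise t))
  have hind : iIndepFun (fun t ω => g (e t ω) * (M i (e t ω) + ξ t ω)) P := by
    refine h.indep.comp (fun _ (x : Fin m × Fin n × ℝ) => g x.2.1 * (M i x.2.1 + x.2.2))
      fun _ => ?_
    have h1 : Measurable fun x : Fin m × Fin n × ℝ => M i x.2.1 := hMm.comp measurable_snd.fst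
    fun_prop
  have hB := bernstein hZ hind I (μ := fun _ => (M *ᵥ w) i / p i)
    (w := fun _ => 3 * L ^ 2 * (b * W ^ 2 / p i)) (s₀ := 1 / (2 * (b * W) * L)) (ℓ := ℓ)
    (by positivity) hℓ
    (fun t => by positivity) (fun t s => (hmgf t).1 s) (fun t s hs => by
      have h1 := (hmgf t).2 s (by
        rw [le_div_iff₀ (by positivity)] at hs
        nlinarith)
      rw [hmean] at h1
      refine h1.trans (Real.exp_le_exp.2 ?_)
      have := hvar t
      gcongr)
  refine le_trans (measureReal_mono fun ω hω => ?_) hB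
  simp only [Set.mem_ofPred_eq] at hω ⊢
  have e2 := sqrt_bernstein (b := b * ν) (ℓ := ℓ) hT' hL0.le W
  rw [abs_of_pos hW0] at e2
  have e3 : (T : ℝ)⁻¹ * (ℓ / (1 / (2 * (b * W) * L))) = W * (L * (2 * b * ℓ / T)) := by
    field_simp
  rw [mul_add, mul_add, ← e2, ← e3, ← mul_add] at hω
  refine lt_of_le_of_lt ?_ (lt_of_mul_lt_mul_left hω (inv_pos.2 hT').le)
  gcongr
  rw [Finset.sum_const, nsmul_eq_mul]
  calc (I.card : ℝ) * (3 * L ^ 2 * (b * W ^ 2 / p i)) ≤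
        (T * p i * ν) * (3 * L ^ 2 * (b * W ^ 2 / p i)) := by gcongr
    _ = _ := by field_simp

/-- Two successive freezings: of all rows, and then of the columns and the noise in the rounds
outside row `i`. After them `offRow` is a constant vector and the estimate for fixed rows applies.
-/
theorem measure_offRow_le (h : Sampling P p q σ c e ξ) (hT : 0 < T) (hσ : 0 < σ)
    {L b ℓ : ℝ} (hL : (σ : ℝ) ≤ L) (hM : ∀ i j, |M i j| ≤ L) (hb : 0 < b)
    (hpq : ∀ i j, (p i * q j)⁻¹ ≤ b) (hℓ : 0 < ℓ) (i : Fin m) (u : Fin m → ℝ) (ν : ℝ) :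
    P.real {ω | (fun t => c t ω, fun t => (e t ω, ξ t ω)) ∈
      offRowBad T p q M i u ν (L * (2 * √(3 * (b * ν) * ℓ / T) + 2 * b * ℓ / T))} ≤
      2 * Real.exp (-ℓ) := by
  have hBm := measurableSet_offRowBad (T := T) p q M i u ν
    (L * (2 * √(3 * (b * ν) * ℓ / T) + 2 * b * ℓ / T))
  set Bad := offRowBad T p q M i u ν
    (L * (2 * √(3 * (b * ν) * ℓ / T) + 2 * b * ℓ / T)) with hBad
  have hη : ∀ t, Measurable fun ω => (e t ω, ξ t ω) := fun t =>
    (h.measurable_col t).prodMk (h.measurable_noise t)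
  have hind : IndepFun (fun ω t => c t ω) (fun ω t => (e t ω, ξ t ω)) P :=
    indepFun_pi_of_iIndepFun_prod h.measurable_row hη h.indep h.indep_row
  have hiη : iIndepFun (fun t ω => (e t ω, ξ t ω)) P :=
    h.indep.comp (fun _ => Prod.snd) fun _ => measurable_snd
  have key := measure_le_of_indepFun hind (measurable_pi_lambda _ h.measurable_row)
    (measurable_pi_lambda _ hη) hBm (ε := ENNReal.ofReal (2 * Real.exp (-ℓ))) (fun γ => by
      refine measure_le_of_split (S := {η | (γ, η) ∈ Bad}) hη hiη
        (Finset.univ.filter fun t => γ t = i) (measurable_prodMk_left hBm) fun x => ?_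
      by_cases hν : (∑ t, if γ t = i then (1 : ℝ) else 0) ≤ T * p i * ν
      · have h1 := h.measure_offRow_fixed_le hT hσ hL hM hb hpq hℓ i γ hν
          (offRow p q M i u γ (fun t => (x t).1) (fun t => (x t).2)) x
        refine le_trans ?_ ((ENNReal.le_ofReal_iff_toReal_le (measure_ne_top _ _)
          (by positivity)).2 h1)
        refine measure_mono fun ω hω => ?_
        simp only [hBad, offRowBad, Set.mem_ofPred_eq, Finset.mem_filter, Finset.mem_univ, true_and] at hω ⊢
        have e1 : (fun t => (if γ t = i then (e t ω, ξ t ω) else x t).1) =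
            fun t => if γ t = i then e t ω else (x t).1 := by
          ext t; split_ifs <;> rfl
        have e2 : (fun t => (if γ t = i then (e t ω, ξ t ω) else x t).2) =
            fun t => if γ t = i then ξ t ω else (x t).2 := by
          ext t; split_ifs <;> rfl
        rw [e1, e2] at hω
        rw [offRow_congr p q M i u γ (e' := fun t => (x t).1) (x' := fun t => (x t).2)
          (fun t ht => by simp [ht]) (fun t ht => by simp [ht])] at hω
        exact hω.2
      · have : {ω | (fun t => if t ∈ Finset.univ.filter (fun t => γ t = i) then (e t ω, ξ t ω)
            else x t) ∈ {η | (γ, η) ∈ Bad}} = ∅ := by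
          ext ω
          simp only [hBad, offRowBad, Set.mem_ofPred_eq, Set.mem_empty_iff_false, iff_false]
          exact fun h => hν h.1
        rw [this, measure_empty]
        exact zero_le)
  exact (ENNReal.le_ofReal_iff_toReal_le (measure_ne_top _ _) (by positivity)).1 key

end Sampling

end Rows

end LowRankBandit

end

noncomputable section

namespace LowRankBandit

open scoped Matrix.Norms.L2Operator

/-! ### The perturbation terms of one row -/

section RowEvent

variable {Ω : Type*} [MeasurableSpace Ω] {P : Measure Ω} [IsProbabilityMeasure P] {T m n r : ℕ}

/-- The `i`-th unit vector as a row. -/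
def unitRow (i : Fin m) : Matrix (Fin 1) (Fin m) ℝ := Matrix.single 0 i 1

theorem unitRow_mul (i : Fin m) (A : Matrix (Fin m) (Fin n) ℝ) (a : Fin 1) (k : Fin n) :
    (unitRow i * A) a k = A i k := by
  rw [unitRow, Subsingleton.elim a 0, Matrix.single_mul_apply_same, one_mul]

theorem norm_row_le (A : Matrix (Fin 1) (Fin n) ℝ) : ‖A‖ ≤ √(∑ k, A 0 k ^ 2) := by
  refine norm_le_of_mulVec_sq_le (Real.sqrt_nonneg _) fun x => ?_
  rw [Real.sq_sqrt (Finset.sum_nonneg fun k _ => sq_nonneg _), Fin.sum_univ_one]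
  exact Finset.sum_mul_sq_le_sq_mul_sq Finset.univ (fun k => A 0 k) x

theorem norm_unitRow_mul_le (i : Fin m) (A : Matrix (Fin m) (Fin n) ℝ) :
    ‖unitRow i * A‖ ≤ √(∑ k, A i k ^ 2) := by
  have := norm_row_le (unitRow i * A)
  simpa only [unitRow_mul] using this

theorem norm_unitRow_le (i : Fin m) : ‖unitRow i‖ ≤ 1 := by
  refine (norm_row_le _).trans ?_
  rw [Finset.sum_eq_single i]
  · simp [unitRow]
  · intro k _ hk
    simp [unitRow, Matrix.single_apply, hk.symm]
  · simp

theorem abs_apply_le_norm (A : Matrix (Fin m) (Fin n) ℝ) (i : Fin m) (j : Fin n) :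
    |A i j| ≤ ‖A‖ := by
  have h1 := mulVec_sq_le A (Pi.single j 1)
  have h2 : ∑ k, (Pi.single j (1 : ℝ) : Fin n → ℝ) k ^ 2 = 1 := by
    rw [Finset.sum_eq_single j] <;> simp +contextual
  rw [h2, mul_one] at h1
  have h3 := (Finset.single_le_sum (f := fun i => (A *ᵥ Pi.single j 1) i ^ 2)
    (fun i _ => sq_nonneg _) (Finset.mem_univ i)).trans h1
  simp only [Matrix.mulVec_single_one, Matrix.col_apply] at h3
  exact abs_le_of_sq_le_sq h3 (norm_nonneg _)

theorem norm_row_le_sqrt_mul {A : Matrix (Fin 1) (Fin r) ℝ} {β : ℝ} (hβ : 0 ≤ β)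
    (h : ∀ k, |A 0 k| ≤ β) : ‖A‖ ≤ √r * β := by
  refine (norm_row_le A).trans (Real.sqrt_le_iff.2 ⟨by positivity, ?_⟩)
  rw [mul_pow, Real.sq_sqrt (Nat.cast_nonneg _)]
  calc ∑ k, A 0 k ^ 2 ≤ ∑ _k : Fin r, β ^ 2 := Finset.sum_le_sum fun k _ =>
        sq_le_sq' (by linarith [(abs_le.1 (h k)).1]) (abs_le.1 (h k)).2
    _ = r * β ^ 2 := by simp

theorem sum_sq_col_of_orthonormal {U : Matrix (Fin m) (Fin r) ℝ} (hU : Uᵀ * U = 1) (k : Fin r) :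
    ∑ i, U i k ^ 2 = 1 := by
  have := congrFun (congrFun hU k) k
  rw [Matrix.mul_apply, Matrix.one_apply_eq] at this
  simpa [Matrix.transpose_apply, sq] using this

/-- The row splits into a diagonal entry of `E Eᵀ` times row `i` of `U`, the conditional mean of the
coupling with the other rows, which is `α` times a row of `M Eᵀ U` without row `i`, and a centred
remainder. The first two are proportional to `u` by themselves; only the remainder needs `h`. -/
theorem norm_unitRow_mul_mul_transpose_le {E M : Matrix (Fin m) (Fin n) ℝ}
    {U : Matrix (Fin m) (Fin r) ℝ} {V : Matrix (Fin n) (Fin r) ℝ} {S : Matrix (Fin r) (Fin r) ℝ}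
    (hU : Uᵀ * U = 1) (hV : Vᵀ * V = 1) (hM : M = U * S * Vᵀ) {σ₁ : ℝ} (hS : ‖S‖ ≤ σ₁)
    (i : Fin m) {u a α β : ℝ} (hu : √(∑ k, U i k ^ 2) ≤ u) (ha : |α| ≤ a) (hβ : 0 ≤ β)
    (h : ∀ k, |(E *ᵥ (Eᵀ *ᵥ fun i' => if i' = i then 0 else U i' k)) i -
      α * (M *ᵥ (Eᵀ *ᵥ fun i' => if i' = i then 0 else U i' k)) i| ≤
        √(∑ j, (Eᵀ *ᵥ fun i' => if i' = i then 0 else U i' k) j ^ 2) * β) :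
    ‖unitRow i * E * Eᵀ * U‖ ≤ ‖E‖ ^ 2 * u + a * (u * σ₁ * ‖E‖) + √r * (‖E‖ * β) := by
  have hE := norm_nonneg E
  have hu0 : 0 ≤ u := (Real.sqrt_nonneg _).trans hu
  have hσ0 : 0 ≤ σ₁ := (norm_nonneg _).trans hS
  have ha0 : 0 ≤ a := (abs_nonneg _).trans ha
  set d : Fin m → ℝ := fun i' => if i' = i then 0 else 1 with hd
  set D : Matrix (Fin m) (Fin m) ℝ := Matrix.diagonal d with hD
  have hDn : ‖D‖ ≤ 1 := by
    rw [hD, Matrix.l2_opNorm_diagonal]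
    refine (pi_norm_le_iff_of_nonneg zero_le_one).2 fun i' => ?_
    simp only [hd]; split_ifs <;> simp
  have hcol : ∀ k, (fun i' => if i' = i then 0 else U i' k) = fun i' => (D * U) i' k := by
    intro k; ext i'
    rw [hD, Matrix.diagonal_mul]
    simp only [hd]; split_ifs <;> simp
  have hmv : ∀ {l : ℕ} (A : Matrix (Fin l) (Fin n) ℝ) (k : Fin r) (a : Fin l),
      (A *ᵥ (Eᵀ *ᵥ fun i' => (D * U) i' k)) a = (A * Eᵀ * (D * U)) a k := by
    intro l A k a
    rw [Matrix.mulVec_mulVec]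
    rfl
  have hU1 := norm_le_one_of_orthonormal hU
  have hV1 := norm_le_one_of_orthonormal hV
  have hDU : ‖D * U‖ ≤ 1 := (norm_mul_le_right hDn).trans hU1
  set R := unitRow i * (E * Eᵀ * (D * U)) - α • (unitRow i * (M * Eᵀ * (D * U))) with hR
  have hRn : ‖R‖ ≤ √r * (‖E‖ * β) := by
    refine norm_row_le_sqrt_mul (by positivity) fun k => ?_
    have h1 := h k
    rw [hcol k, hmv, hmv] at h1
    rw [hR, Matrix.sub_apply, Matrix.smul_apply, unitRow_mul, unitRow_mul, smul_eq_mul]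
    refine h1.trans (mul_le_mul_of_nonneg_right ?_ hβ)
    refine Real.sqrt_le_iff.2 ⟨hE, ?_⟩
    have h2 := mulVec_sq_le Eᵀ (fun i' => (D * U) i' k)
    rw [norm_transpose] at h2
    refine h2.trans (mul_le_of_le_one_right (by positivity) ?_)
    rw [← sum_sq_col_of_orthonormal hU k]
    refine Finset.sum_le_sum fun i' _ => ?_
    rw [← congrFun (hcol k) i']
    split_ifs
    · rw [zero_pow two_ne_zero]; positivity
    · exact le_rfl
  have hdec : unitRow i * E * Eᵀ * U =
      (E * Eᵀ) i i • (unitRow i * U) + α • (unitRow i * (M * Eᵀ * (D * U))) + R := by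
    rw [hR]
    have h1 : unitRow i * E * Eᵀ * U = unitRow i * (E * Eᵀ * U) := by simp only [Matrix.mul_assoc]
    ext a k
    rw [h1]
    simp only [Matrix.add_apply, Matrix.sub_apply, Matrix.smul_apply, unitRow_mul, smul_eq_mul]
    rw [Matrix.mul_apply, Matrix.mul_apply (M := E * Eᵀ) (N := D * U)]
    have h2 : ∑ j, (E * Eᵀ) i j * U j k =
        (E * Eᵀ) i i * U i k + ∑ j, (E * Eᵀ) i j * (D * U) j k := by
      rw [← Finset.add_sum_erase _ _ (Finset.mem_univ i)]
      congr 1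
      rw [← Finset.add_sum_erase _ _ (Finset.mem_univ i)]
      rw [hD, Matrix.diagonal_mul]
      simp only [hd, if_true, zero_mul, mul_zero, zero_add]
      refine Finset.sum_congr rfl fun j hj => ?_
      rw [Matrix.diagonal_mul, if_neg (Finset.ne_of_mem_erase hj), one_mul]
    rw [h2]; ring
  rw [hdec]
  have hn1 : ‖(E * Eᵀ) i i • (unitRow i * U)‖ ≤ ‖E‖ ^ 2 * u := by
    rw [norm_smul, Real.norm_eq_abs]
    refine mul_le_mul ?_ ((norm_unitRow_mul_le i U).trans hu) (norm_nonneg _) (by positivity)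
    refine (abs_apply_le_norm _ i i).trans ((Matrix.l2_opNorm_mul _ _).trans ?_)
    rw [norm_transpose, sq]
  have hn2 : ‖α • (unitRow i * (M * Eᵀ * (D * U)))‖ ≤ a * (u * σ₁ * ‖E‖) := by
    rw [norm_smul, Real.norm_eq_abs]
    refine mul_le_mul ha ?_ (norm_nonneg _) ha0
    have h1 : unitRow i * (M * Eᵀ * (D * U)) = unitRow i * U * S * Vᵀ * Eᵀ * (D * U) := by
      rw [hM]; simp only [Matrix.mul_assoc]
    rw [h1]
    refine (norm_mul_le_left hDU).trans ?_
    refine (Matrix.l2_opNorm_mul _ _).trans ?_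
    rw [norm_transpose]
    refine mul_le_mul_of_nonneg_right ?_ hE
    refine (norm_mul_le_left (by rw [norm_transpose]; exact hV1)).trans ?_
    refine (Matrix.l2_opNorm_mul _ _).trans ?_
    exact mul_le_mul ((norm_unitRow_mul_le i U).trans hu) hS (norm_nonneg _) hu0
  exact (norm_add₃_le).trans (add_le_add_three hn1 hn2 hRn)

variable {p : Fin m → ℝ} {q : Fin n → ℝ} {σ : ℝ≥0} {c : Fin T → Ω → Fin m}
  {e : Fin T → Ω → Fin n} {ξ : Fin T → Ω → ℝ} {M : Matrix (Fin m) (Fin n) ℝ}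

/-- The bounds on row `i` of the sampling error `E` that control the perturbation of row `i` of the
singular vectors. -/
def RowGood (E : Matrix (Fin m) (Fin n) ℝ) (U : Matrix (Fin m) (Fin r) ℝ)
    (V : Matrix (Fin n) (Fin r) ℝ) (u σ₁ ℓ β₁ β₂ : ℝ) (i : Fin m) : Prop :=
  ‖unitRow i * E * V‖ ≤ √r * β₁ ∧
    ‖unitRow i * E * Eᵀ * U‖ ≤ ‖E‖ ^ 2 * u + (1 + 2 * ℓ) * (u * σ₁ * ‖E‖) + √r * (‖E‖ * β₂)

/-- A union over the `r` columns of `V`, the `r` columns of `U` and the number of visits, each event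
having probability at most `2 e^(-ℓ)`. -/
theorem Sampling.measure_not_rowGood_le (h : Sampling P p q σ c e ξ) (hT : 0 < T) (hσ : 0 < σ)
    {L b v ℓ : ℝ} (hL : (σ : ℝ) ≤ L) (hM : ∀ i j, |M i j| ≤ L) (hb : 0 < b)
    (hpq : ∀ i j, (p i * q j)⁻¹ ≤ b) (hv : 0 < v) (hℓ : 0 < ℓ)
    {U : Matrix (Fin m) (Fin r) ℝ} {V : Matrix (Fin n) (Fin r) ℝ} {S : Matrix (Fin r) (Fin r) ℝ}
    (hU : Uᵀ * U = 1) (hV : Vᵀ * V = 1) (hMeq : M = U * S * Vᵀ) {σ₁ : ℝ} (hS : ‖S‖ ≤ σ₁)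
    (hVv : ∀ j k, |V j k| ≤ v) (i : Fin m) {u : ℝ} (hu : √(∑ k, U i k ^ 2) ≤ u)
    (hTp : 1 ≤ T * p i) :
    P.real {ω | ¬ RowGood (sampleErr p q M (fun t => c t ω) (fun t => e t ω) (fun t => ξ t ω))
      U V u σ₁ ℓ (L * (2 * √(3 * b * ℓ / T) + 2 * b * v * ℓ / T))
        (L * (2 * √(3 * (b * (2 + 2 * ℓ)) * ℓ / T) + 2 * b * ℓ / T)) i} ≤
      (4 * r + 2) * Real.exp (-ℓ) := by
  have hσ' : (0 : ℝ) < σ := hσ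
  have hL0 : 0 < L := by linarith
  have hT' : (0 : ℝ) < T := by exact_mod_cast hT
  set β₁ := L * (2 * √(3 * b * ℓ / T) + 2 * b * v * ℓ / T) with hβ₁
  set β₂ := L * (2 * √(3 * (b * (2 + 2 * ℓ)) * ℓ / T) + 2 * b * ℓ / T) with hβ₂
  have hβ₁0 : 0 ≤ β₁ := by positivity
  have hβ₂0 : 0 ≤ β₂ := by positivity
  set E : Ω → Matrix (Fin m) (Fin n) ℝ := fun ω =>
    sampleErr p q M (fun t => c t ω) (fun t => e t ω) (fun t => ξ t ω) with hE
  set A₁ : Fin r → Set Ω := fun k => {ω | β₁ < |(E ω *ᵥ fun j => V j k) i|} with hA₁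
  set A₂ : Set Ω := {ω | T * p i * (2 + 2 * ℓ) < ∑ t, if c t ω = i then (1 : ℝ) else 0} with hA₂
  set A₃ : Fin r → Set Ω := fun k => {ω | (fun t => c t ω, fun t => (e t ω, ξ t ω)) ∈
      offRowBad T p q M i (fun i' => U i' k) (2 + 2 * ℓ) β₂} with hA₃
  have m₁ : ∀ k, P.real (A₁ k) ≤ 2 * Real.exp (-ℓ) := fun k =>
    h.measure_sampleErr_mulVec_le hT hσ hL hM hb hpq hv hℓ
      (sum_sq_col_of_orthonormal hV k).le (fun j => hVv j k) i
  have m₂ : P.real A₂ ≤ 2 * Real.exp (-ℓ) := h.measure_count_row_le hℓ i hTp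
  have m₃ : ∀ k, P.real (A₃ k) ≤ 2 * Real.exp (-ℓ) := fun k =>
    h.measure_offRow_le hT hσ hL hM hb hpq hℓ i _ _
  have hsub : {ω | ¬ RowGood (E ω) U V u σ₁ ℓ β₁ β₂ i} ⊆ (⋃ k, A₁ k) ∪ A₂ ∪ ⋃ k, A₃ k := by
    intro ω hω
    by_contra hcon
    simp only [Set.mem_union, Set.mem_iUnion, not_or, not_exists] at hcon
    obtain ⟨⟨h1, h2⟩, h3⟩ := hcon
    refine hω ⟨?_, ?_⟩
    · refine norm_row_le_sqrt_mul hβ₁0 fun k => ?_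
      have := h1 k
      simp only [hA₁, Set.mem_ofPred_eq, not_lt] at this
      rw [Matrix.mul_assoc, unitRow_mul]
      exact this
    · simp only [hA₂, Set.mem_ofPred_eq, not_lt] at h2
      have hpi := h.row_pos i
      refine norm_unitRow_mul_mul_transpose_le hU hV hMeq hS i hu
        (α := (∑ t, if c t ω = i then (1 : ℝ) else 0) / (T * p i) - 1) ?_ hβ₂0 fun k => ?_
      · have h5 : 0 ≤ (∑ t, if c t ω = i then (1 : ℝ) else 0) / (T * p i) :=
          div_nonneg (Finset.sum_nonneg fun t _ => by split_ifs <;> norm_num) (by positivity)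
        have h6 : (∑ t, if c t ω = i then (1 : ℝ) else 0) / (T * p i) ≤ 2 + 2 * ℓ := by
          rw [div_le_iff₀ (by positivity)]; linarith
        exact abs_le.2 ⟨by linarith, by linarith⟩
      · have h4 := h3 k
        simp only [hA₃, offRowBad, Set.mem_ofPred_eq, not_and, not_lt] at h4
        exact h4 h2
  refine (measureReal_mono hsub).trans ?_
  have s1 : P.real (⋃ k, A₁ k) ≤ r * (2 * Real.exp (-ℓ)) := by
    refine (measureReal_iUnion_fintype_le _).trans ?_
    calc _ ≤ ∑ _k : Fin r, 2 * Real.exp (-ℓ) := Finset.sum_le_sum fun k _ => m₁ k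
      _ = _ := by simp
  have s3 : P.real (⋃ k, A₃ k) ≤ r * (2 * Real.exp (-ℓ)) := by
    refine (measureReal_iUnion_fintype_le _).trans ?_
    calc _ ≤ ∑ _k : Fin r, 2 * Real.exp (-ℓ) := Finset.sum_le_sum fun k _ => m₃ k
      _ = _ := by simp
  have s4 := measureReal_union_le (μ := P) ((⋃ k, A₁ k) ∪ A₂) (⋃ k, A₃ k)
  have s5 := measureReal_union_le (μ := P) (⋃ k, A₁ k) A₂
  linarith

end RowEvent

end LowRankBandit

end

/-! ### SupLinUCB with misspecified linear rewards. -/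

noncomputable section

namespace LowRankBandit

/-! ### Regularized least squares -/

section LeastSquares

variable {ι : Type*} [Fintype ι] [DecidableEq ι]

theorem vecMulVec_mulVec_self (z v : ι → ℝ) : Matrix.vecMulVec z z *ᵥ v = (z ⬝ᵥ v) • z := by
  ext i
  simp only [Matrix.mulVec, dotProduct, Matrix.vecMulVec_apply, Pi.smul_apply, smul_eq_mul,
    Finset.sum_mul]
  exact Finset.sum_congr rfl fun j _ => by ring

theorem posSemidef_vecMulVec (z : ι → ℝ) : (Matrix.vecMulVec z z).PosSemidef := by
  have := Matrix.posSemidef_vecMulVec_self_star z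
  rwa [star_trivial] at this

variable {τ : Type*} {lam : ℝ} {S : Finset τ} {z : τ → ι → ℝ} {V : Matrix ι ι ℝ}

theorem posDef_regularized (hlam : 0 < lam) (S : Finset τ) (z : τ → ι → ℝ) :
    (lam • (1 : Matrix ι ι ℝ) + ∑ s ∈ S, Matrix.vecMulVec (z s) (z s)).PosDef :=
  (Matrix.PosDef.one.smul hlam).add_posSemidef
    (Matrix.posSemidef_sum _ fun s _ => posSemidef_vecMulVec (z s))

theorem regularized_mulVec (hV : V = lam • (1 : Matrix ι ι ℝ) + ∑ s ∈ S, Matrix.vecMulVec (z s) (z s))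
    (v : ι → ℝ) : V *ᵥ v = lam • v + ∑ s ∈ S, (z s ⬝ᵥ v) • z s := by
  rw [hV, Matrix.add_mulVec, Matrix.smul_mulVec, Matrix.one_mulVec, Matrix.sum_mulVec]
  simp only [vecMulVec_mulVec_self]

theorem regularized_inv (hlam : 0 < lam)
    (hV : V = lam • (1 : Matrix ι ι ℝ) + ∑ s ∈ S, Matrix.vecMulVec (z s) (z s)) (x : ι → ℝ) :
    V *ᵥ (V⁻¹ *ᵥ x) = x ∧ ∀ v, (V⁻¹ *ᵥ v) ⬝ᵥ x = v ⬝ᵥ (V⁻¹ *ᵥ x) := by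
  have hpd : V.PosDef := hV ▸ posDef_regularized hlam S z
  have hu : IsUnit V.det := (Matrix.isUnit_iff_isUnit_det V).1 hpd.isUnit
  refine ⟨by rw [Matrix.mulVec_mulVec, Matrix.mul_nonsing_inv _ hu, Matrix.one_mulVec], fun v => ?_⟩
  have hsym : (V⁻¹)ᵀ = V⁻¹ := by
    rw [← Matrix.conjTranspose_eq_transpose_of_trivial]
    exact hpd.inv.1
  rw [Matrix.dotProduct_mulVec, ← Matrix.mulVec_transpose, hsym]

/-- The square of the width splits into the regularization and the recorded features. -/
theorem sq_width_eq (hlam : 0 < lam)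
    (hV : V = lam • (1 : Matrix ι ι ℝ) + ∑ s ∈ S, Matrix.vecMulVec (z s) (z s)) (x : ι → ℝ) :
    x ⬝ᵥ (V⁻¹ *ᵥ x) = lam * ((V⁻¹ *ᵥ x) ⬝ᵥ (V⁻¹ *ᵥ x)) + ∑ s ∈ S, (z s ⬝ᵥ (V⁻¹ *ᵥ x)) ^ 2 := by
  have h1 := (regularized_inv hlam hV x).1
  have h2 := regularized_mulVec hV (V⁻¹ *ᵥ x)
  set g := V⁻¹ *ᵥ x with hg
  calc x ⬝ᵥ g = (V *ᵥ g) ⬝ᵥ g := by rw [h1]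
    _ = _ := by
      rw [h2, add_dotProduct, smul_dotProduct, sum_dotProduct, smul_eq_mul]
      congr 1
      refine Finset.sum_congr rfl fun s _ => ?_
      rw [smul_dotProduct, smul_eq_mul, sq]

theorem sq_width_nonneg (hlam : 0 < lam)
    (hV : V = lam • (1 : Matrix ι ι ℝ) + ∑ s ∈ S, Matrix.vecMulVec (z s) (z s)) (x : ι → ℝ) :
    0 ≤ x ⬝ᵥ (V⁻¹ *ᵥ x) := by
  rw [sq_width_eq hlam hV]
  have : 0 ≤ (V⁻¹ *ᵥ x) ⬝ᵥ (V⁻¹ *ᵥ x) := Finset.sum_nonneg fun i _ => mul_self_nonneg _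
  have h2 : 0 ≤ ∑ s ∈ S, (z s ⬝ᵥ (V⁻¹ *ᵥ x)) ^ 2 := Finset.sum_nonneg fun i _ => sq_nonneg _
  positivity

theorem estimate_sub_eq (hlam : 0 < lam)
    (hV : V = lam • (1 : Matrix ι ι ℝ) + ∑ s ∈ S, Matrix.vecMulVec (z s) (z s)) (x θ : ι → ℝ)
    (Y : τ → ℝ) :
    (V⁻¹ *ᵥ ∑ s ∈ S, Y s • z s) ⬝ᵥ x - θ ⬝ᵥ x =
      ∑ s ∈ S, (Y s - θ ⬝ᵥ z s) * (z s ⬝ᵥ (V⁻¹ *ᵥ x)) - lam * (θ ⬝ᵥ (V⁻¹ *ᵥ x)) := by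
  obtain ⟨h1, h2⟩ := regularized_inv hlam hV x
  have h3 := regularized_mulVec hV (V⁻¹ *ᵥ x)
  rw [h1] at h3
  rw [h2]
  set g := V⁻¹ *ᵥ x with hg
  have h4 : θ ⬝ᵥ x = lam * (θ ⬝ᵥ g) + ∑ s ∈ S, (θ ⬝ᵥ z s) * (z s ⬝ᵥ g) := by
    rw [h3, dotProduct_add, dotProduct_smul, dotProduct_sum, smul_eq_mul]
    congr 1
    refine Finset.sum_congr rfl fun s _ => ?_
    rw [dotProduct_smul, smul_eq_mul, mul_comm]
  rw [h4, sum_dotProduct]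
  simp only [smul_dotProduct, smul_eq_mul, sub_mul, Finset.sum_sub_distrib]
  ring

/-- Ridge bias and misspecification are bounded by Cauchy–Schwarz, using that `sq_width_eq`
dominates both the regularization and the recorded features by the width. The misspecification is
amplified by the root of the number of records, which the width offsets later. -/
theorem abs_estimate_sub_le (hlam : 0 < lam)
    (hV : V = lam • (1 : Matrix ι ι ℝ) + ∑ s ∈ S, Matrix.vecMulVec (z s) (z s)) (x θ : ι → ℝ)
    {Y ξ : τ → ℝ} {ε σ B : ℝ} (hε : ∀ s ∈ S, |Y s - θ ⬝ᵥ z s - ξ s| ≤ ε) (hσ : 0 ≤ σ)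
    (hθ : lam * (θ ⬝ᵥ θ) ≤ σ ^ 2)
    (hξ : |∑ s ∈ S, ξ s * (z s ⬝ᵥ (V⁻¹ *ᵥ x))| ≤ B * √(x ⬝ᵥ (V⁻¹ *ᵥ x))) :
    |(V⁻¹ *ᵥ ∑ s ∈ S, Y s • z s) ⬝ᵥ x - θ ⬝ᵥ x| ≤
      (σ + B) * √(x ⬝ᵥ (V⁻¹ *ᵥ x)) + ε * (√S.card * √(x ⬝ᵥ (V⁻¹ *ᵥ x))) := by
  have hw0 := sq_width_nonneg hlam hV x
  have hw := sq_width_eq hlam hV x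
  rw [estimate_sub_eq hlam hV]
  set g := V⁻¹ *ᵥ x with hg
  set w := √(x ⬝ᵥ g) with hwdef
  have hwsq : w ^ 2 = x ⬝ᵥ g := Real.sq_sqrt hw0
  have hw0' : 0 ≤ w := Real.sqrt_nonneg _
  have hgg : 0 ≤ g ⬝ᵥ g := Finset.sum_nonneg fun i _ => mul_self_nonneg _
  have hθθ : 0 ≤ θ ⬝ᵥ θ := Finset.sum_nonneg fun i _ => mul_self_nonneg _
  have hzz : 0 ≤ ∑ s ∈ S, (z s ⬝ᵥ g) ^ 2 := Finset.sum_nonneg fun i _ => sq_nonneg _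
  have hbias : |lam * (θ ⬝ᵥ g)| ≤ σ * w := by
    refine abs_le_of_sq_le_sq ?_ (by positivity)
    have hcs : (θ ⬝ᵥ g) ^ 2 ≤ (θ ⬝ᵥ θ) * (g ⬝ᵥ g) := by
      have := Finset.sum_mul_sq_le_sq_mul_sq Finset.univ θ g
      simpa only [dotProduct, sq] using this
    have h1 : lam * (g ⬝ᵥ g) ≤ w ^ 2 := by rw [hwsq, hw]; linarith
    calc (lam * (θ ⬝ᵥ g)) ^ 2 = lam ^ 2 * (θ ⬝ᵥ g) ^ 2 := by ring
      _ ≤ lam ^ 2 * ((θ ⬝ᵥ θ) * (g ⬝ᵥ g)) := by gcongr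
      _ = (lam * (θ ⬝ᵥ θ)) * (lam * (g ⬝ᵥ g)) := by ring
      _ ≤ σ ^ 2 * w ^ 2 := by gcongr
      _ = (σ * w) ^ 2 := by ring
  have hmis : |∑ s ∈ S, (Y s - θ ⬝ᵥ z s - ξ s) * (z s ⬝ᵥ g)| ≤ ε * (√S.card * w) := by
    rcases S.eq_empty_or_nonempty with rfl | ⟨s₀, hs₀⟩
    · simp
    have hε0 : 0 ≤ ε := (abs_nonneg _).trans (hε s₀ hs₀)
    refine abs_le_of_sq_le_sq ?_ (by positivity)
    have h1 := Finset.sum_mul_sq_le_sq_mul_sq S (fun s => Y s - θ ⬝ᵥ z s - ξ s) fun s => z s ⬝ᵥ g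
    refine h1.trans ?_
    have h2 : ∑ s ∈ S, (Y s - θ ⬝ᵥ z s - ξ s) ^ 2 ≤ S.card * ε ^ 2 := by
      rw [← nsmul_eq_mul]
      refine Finset.sum_le_card_nsmul _ _ _ fun s hs => ?_
      exact sq_le_sq' (by linarith [(abs_le.1 (hε s hs)).1]) (abs_le.1 (hε s hs)).2
    have h3 : ∑ s ∈ S, (z s ⬝ᵥ g) ^ 2 ≤ w ^ 2 := by
      rw [hwsq, hw]; have := mul_nonneg hlam.le hgg; linarith
    calc _ ≤ (S.card * ε ^ 2) * w ^ 2 := by gcongr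
      _ = (ε * (√S.card * w)) ^ 2 := by
        rw [mul_pow, mul_pow, Real.sq_sqrt (Nat.cast_nonneg _)]; ring
  have hsplit : ∑ s ∈ S, (Y s - θ ⬝ᵥ z s) * (z s ⬝ᵥ g) =
      ∑ s ∈ S, (Y s - θ ⬝ᵥ z s - ξ s) * (z s ⬝ᵥ g) + ∑ s ∈ S, ξ s * (z s ⬝ᵥ g) := by
    rw [← Finset.sum_add_distrib]
    exact Finset.sum_congr rfl fun s _ => by ring
  rw [hsplit]
  have a1 := abs_le.1 hbias
  have a2 := abs_le.1 hmis
  have a3 := abs_le.1 hξ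
  exact abs_le.2 ⟨by linarith, by linarith⟩

theorem det_add_vecMulVec_self {V : Matrix ι ι ℝ} (hV : V.PosDef) (z : ι → ℝ) :
    (V + Matrix.vecMulVec z z).det = V.det * (1 + z ⬝ᵥ (V⁻¹ *ᵥ z)) := by
  have hu : IsUnit V.det := (Matrix.isUnit_iff_isUnit_det V).1 hV.isUnit
  rw [Matrix.vecMulVec_eq Unit, Matrix.det_add_replicateCol_mul_replicateRow hu]
  congr 1
  rw [Matrix.det_unique, Matrix.add_apply, Matrix.one_apply_eq, Matrix.mul_assoc]
  congr 1

/-- A crude form of the inequality of arithmetic and geometric means: each eigenvalue is at most the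
trace. Only logarithms of the bound are used, so the loss is harmless. -/
theorem det_le_trace_pow {V : Matrix ι ι ℝ} (hV : V.PosSemidef) :
    V.det ≤ V.trace ^ Fintype.card ι := by
  rw [hV.1.det_eq_prod_eigenvalues, hV.1.trace_eq_sum_eigenvalues]
  simp only [RCLike.ofReal_real_eq_id, id_eq]
  calc ∏ i, hV.1.eigenvalues i ≤ ∏ _i : ι, ∑ k, hV.1.eigenvalues k :=
        Finset.prod_le_prod (fun i _ => hV.eigenvalues_nonneg i) fun i _ =>
          Finset.single_le_sum (fun k _ => hV.eigenvalues_nonneg k) (Finset.mem_univ i)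
    _ = _ := by rw [Finset.prod_const, Finset.card_univ]

end LeastSquares

/-! ### The data recorded by SupLinUCB -/

section Recorded

variable {ι : Type*} [Fintype ι] [DecidableEq ι] {K : ℕ}

theorem gram_cons (lam : ℝ) (q : (ι → ℝ) × ℝ) (D : List ((ι → ℝ) × ℝ)) :
    gram lam (q :: D) = gram lam D + Matrix.vecMulVec q.1 q.1 := by
  simp only [gram, List.map_cons, List.sum_cons]
  abel

theorem posDef_gram {lam : ℝ} (hlam : 0 < lam) (D : List ((ι → ℝ) × ℝ)) : (gram lam D).PosDef := by
  induction D with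
  | nil => simpa [gram] using (Matrix.PosDef.one.smul hlam : (lam • (1 : Matrix ι ι ℝ)).PosDef)
  | cons q D ih => rw [gram_cons]; exact ih.add_posSemidef (posSemidef_vecMulVec q.1)

theorem trace_gram_le {lam : ℝ} {D : List ((ι → ℝ) × ℝ)} (h : ∀ q ∈ D, q.1 ⬝ᵥ q.1 ≤ 1) :
    (gram lam D).trace ≤ Fintype.card ι * lam + D.length := by
  induction D with
  | nil => simp [gram, Matrix.trace_smul, mul_comm]
  | cons q D ih =>
    rw [gram_cons, Matrix.trace_add, Matrix.trace_vecMulVec]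
    have h1 := ih fun q hq => h q (List.mem_cons_of_mem _ hq)
    have h2 := h q List.mem_cons_self
    push_cast [List.length_cons]
    linarith

variable (sel : Finset (Fin K) → Fin K) (lam β d : ℝ) (N : ℕ) (x : ℕ → Fin K → ι → ℝ)
  (y : ℕ → Fin K → ℝ)

/-- The arm played in round `τ` and the level at which the round is recorded. -/
def play (τ : ℕ) : Fin K × Option ℕ :=
  supLinUCBRound sel lam β d N (x τ) (supLinUCBState sel lam β d N x y τ)

/-- The rounds before `τ` that are recorded at level `j`. -/
def recorded (τ j : ℕ) : Finset ℕ :=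
  (Finset.range τ).filter fun s => (play sel lam β d N x y s).2 = some j

theorem state_succ (τ j : ℕ) : supLinUCBState sel lam β d N x y (τ + 1) j =
    if (play sel lam β d N x y τ).2 = some j then
      (x τ (play sel lam β d N x y τ).1, y τ (play sel lam β d N x y τ).1) ::
        supLinUCBState sel lam β d N x y τ j
    else supLinUCBState sel lam β d N x y τ j := rfl

theorem recorded_succ (τ j : ℕ) : recorded sel lam β d N x y (τ + 1) j =
    if (play sel lam β d N x y τ).2 = some j then insert τ (recorded sel lam β d N x y τ j)
    else recorded sel lam β d N x y τ j := by
  simp only [recorded, Finset.range_add_one, Finset.filter_insert]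

theorem sum_state {A : Type*} [AddCommMonoid A] (F : (ι → ℝ) × ℝ → A) (τ j : ℕ) :
    ((supLinUCBState sel lam β d N x y τ j).map F).sum =
      ∑ s ∈ recorded sel lam β d N x y τ j,
        F (x s (play sel lam β d N x y s).1, y s (play sel lam β d N x y s).1) := by
  induction τ with
  | zero => simp [supLinUCBState, recorded]
  | succ τ ih =>
    rw [state_succ, recorded_succ]
    split_ifs with h
    · rw [List.map_cons, List.sum_cons, Finset.sum_insert (by simp [recorded]), ih]
    · exact ih

theorem length_state (τ j : ℕ) : (supLinUCBState sel lam β d N x y τ j).length =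
    (recorded sel lam β d N x y τ j).card := by
  have := sum_state sel lam β d N x y (fun _ => (1 : ℕ)) τ j
  simpa using this

theorem gram_state (τ j : ℕ) : gram lam (supLinUCBState sel lam β d N x y τ j) =
    lam • (1 : Matrix ι ι ℝ) + ∑ s ∈ recorded sel lam β d N x y τ j,
      Matrix.vecMulVec (x s (play sel lam β d N x y s).1) (x s (play sel lam β d N x y s).1) := by
  rw [gram, sum_state]

theorem thetaHat_state (τ j : ℕ) : thetaHat lam (supLinUCBState sel lam β d N x y τ j) =
    (gram lam (supLinUCBState sel lam β d N x y τ j))⁻¹ *ᵥ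
      ∑ s ∈ recorded sel lam β d N x y τ j,
        y s (play sel lam β d N x y s).1 • x s (play sel lam β d N x y s).1 := by
  rw [thetaHat, sum_state]

theorem mem_state {τ j : ℕ} {q : (ι → ℝ) × ℝ} (h : q ∈ supLinUCBState sel lam β d N x y τ j) :
    ∃ s < τ, ∃ a, q = (x s a, y s a) := by
  induction τ with
  | zero => simp [supLinUCBState] at h
  | succ τ ih =>
    rw [state_succ] at h
    split_ifs at h with h1
    · rcases List.mem_cons.1 h with h2 | h2
      · exact ⟨τ, Nat.lt_succ_self τ, _, h2⟩
      · obtain ⟨s, hs, a, ha⟩ := ih h2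
        exact ⟨s, hs.trans (Nat.lt_succ_self τ), a, ha⟩
    · obtain ⟨s, hs, a, ha⟩ := ih h
      exact ⟨s, hs.trans (Nat.lt_succ_self τ), a, ha⟩

/-! ### The inner loop -/

variable {sel lam β d N x y}

open Classical in
theorem le_of_levelLoop_eq_some {X : Fin K → ι → ℝ} {Ψ : ℕ → List ((ι → ℝ) × ℝ)} {fuel j : ℕ}
    {A : Finset (Fin K)} {k : ℕ}
    (h : (levelLoop sel lam β d N X Ψ fuel j A).2 = some k) : j ≤ k := by
  induction fuel generalizing j A with
  | zero => simp [levelLoop] at h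
  | succ fuel ih =>
    rw [levelLoop] at h
    split_ifs at h with h1 h2
    · exact (Nat.le_succ j).trans (ih h)
    · exact (Option.some.inj h).le

open Classical in
theorem width_of_levelLoop_eq_some (hsel : ∀ S : Finset (Fin K), S.Nonempty → sel S ∈ S)
    {X : Fin K → ι → ℝ} {Ψ : ℕ → List ((ι → ℝ) × ℝ)} {fuel j : ℕ}
    {A : Finset (Fin K)} {k : ℕ} (h : (levelLoop sel lam β d N X Ψ fuel j A).2 = some k) :
    β * (2 : ℝ)⁻¹ ^ k < width lam β (Ψ k) (X (levelLoop sel lam β d N X Ψ fuel j A).1) := by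
  induction fuel generalizing j A with
  | zero => simp [levelLoop] at h
  | succ fuel ih =>
    rw [levelLoop] at h ⊢
    split_ifs at h ⊢ with h1 h2
    · exact ih h
    · simp only [Option.some.injEq] at h
      subst h
      push Not at h2
      obtain ⟨a, ha, ha2⟩ := h2
      have := hsel {a ∈ A | β * (2 : ℝ)⁻¹ ^ j < width lam β (Ψ j) (X a)}
        ⟨a, Finset.mem_filter.2 ⟨ha, ha2⟩⟩
      exact (Finset.mem_filter.1 this).2

open Classical in
/-- The regret of one round when the estimates are accurate up to the widths and `ε`. -/
theorem levelLoop_regret (hsel : ∀ S : Finset (Fin K), S.Nonempty → sel S ∈ S) (hβ : 0 ≤ β)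
    {X : Fin K → ι → ℝ} {Ψ : ℕ → List ((ι → ℝ) × ℝ)} {f : Fin K → ℝ} {ε F G : ℝ} {J : ℕ}
    (hε : 0 ≤ ε) (hJ : (2 : ℝ)⁻¹ ^ J ≤ √(d / N))
    (hacc : ∀ j ≤ J, ∀ a, (width lam β (Ψ j) (X a) ≤ β * (2 : ℝ)⁻¹ ^ j ∨
        width lam β (Ψ j) (X a) ≤ β * √(d / N)) →
      |thetaHat lam (Ψ j) ⬝ᵥ X a - f a| ≤ width lam β (Ψ j) (X a) + ε)
    {fuel j : ℕ} {A : Finset (Fin K)} (hfuel : fuel + j = J + 1) (hj : 1 ≤ j) (hf1 : 1 ≤ fuel)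
    (hbest : ∃ a ∈ A, F - 2 * (j - 1) * ε ≤ f a)
    (hall : ∀ a ∈ A, F - f a ≤ if j = 1 then G else 8 * (2 : ℝ)⁻¹ ^ j * β + 2 * (j - 1) * ε) :
    let v := levelLoop sel lam β d N X Ψ fuel j A
    (∀ k, v.2 = some k → k ≤ J ∧
      F - f v.1 ≤ if k = 1 then G else 8 * (2 : ℝ)⁻¹ ^ k * β + 2 * J * ε) ∧
      (v.2 = none → F - f v.1 ≤ 2 * β * √(d / N) + 2 * J * ε) := by
  induction fuel generalizing j A with
  | zero => omega
  | succ fuel ih =>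
    intro v
    have hjJn : j ≤ J := by omega
    have hjJ : (j : ℝ) ≤ J := by exact_mod_cast hjJn
    have hj1 : (1 : ℝ) ≤ j := by exact_mod_cast hj
    obtain ⟨a₀, ha₀, ha₀f⟩ := hbest
    have hv : v = levelLoop sel lam β d N X Ψ (fuel + 1) j A := rfl
    rw [levelLoop] at hv
    have lower : ∀ a ∈ A, |thetaHat lam (Ψ j) ⬝ᵥ X a - f a| ≤ width lam β (Ψ j) (X a) + ε →
        f a - ε ≤ ucb lam β (Ψ j) (X a) ∧
          ucb lam β (Ψ j) (X a) ≤ f a + 2 * width lam β (Ψ j) (X a) + ε := by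
      intro a _ h
      have := abs_le.1 h
      simp only [ucb]
      constructor <;> linarith
    split_ifs at hv with h1 h2
    · rw [hv]
      refine ⟨fun k hk => by simp at hk, fun _ => ?_⟩
      have hne : Finset.Nonempty {a ∈ A | ∀ a' ∈ A, ucb lam β (Ψ j) (X a') ≤
          ucb lam β (Ψ j) (X a)} := by
        obtain ⟨a, ha, hmax⟩ := A.exists_max_image (fun a => ucb lam β (Ψ j) (X a)) ⟨a₀, ha₀⟩
        exact ⟨a, Finset.mem_filter.2 ⟨ha, hmax⟩⟩
      have hs := Finset.mem_filter.1 (hsel _ hne)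
      set a := sel {a ∈ A | ∀ a' ∈ A, ucb lam β (Ψ j) (X a') ≤ ucb lam β (Ψ j) (X a)} with ha
      have b1 := (lower a hs.1 (hacc j hjJn a (Or.inr (h1 a hs.1)))).2
      have b2 := (lower a₀ ha₀ (hacc j hjJn a₀ (Or.inr (h1 a₀ ha₀)))).1
      have b3 := hs.2 a₀ ha₀
      have b4 := h1 a hs.1
      show F - f a ≤ _
      nlinarith
    · have hacc' : ∀ a ∈ A, f a - ε ≤ ucb lam β (Ψ j) (X a) ∧
          ucb lam β (Ψ j) (X a) ≤ f a + 2 * width lam β (Ψ j) (X a) + ε := fun a ha =>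
        lower a ha (hacc j hjJn a (Or.inl (h2 a ha)))
      obtain ⟨am, ham, hmax⟩ := A.exists_max_image (fun a => ucb lam β (Ψ j) (X a)) ⟨a₀, ha₀⟩
      rw [hv]
      -- At level `J` the threshold `2^{-J}` is at most `√(d / N)`, so the second test would imply
      -- the first. Hence the recursion stops before the fuel is used up.
      have hf0 : 1 ≤ fuel := by
        by_contra hcon
        have hjJ' : j = J := by omega
        push Not at h1
        obtain ⟨a, ha, ha1⟩ := h1
        have := h2 a ha
        have h3 := mul_le_mul_of_nonneg_left hJ hβ
        rw [hjJ'] at this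
        rw [hjJ'] at ha1
        linarith
      have hpow : (2 : ℝ)⁻¹ ^ (j + 1) = (2 : ℝ)⁻¹ ^ j * 2⁻¹ := pow_succ _ _
      refine ih (by omega) (by omega) hf0 ?_ ?_
      · by_cases hsurv : ∀ a' ∈ A, ucb lam β (Ψ j) (X a') - 2 * (2 : ℝ)⁻¹ ^ j * β ≤
            ucb lam β (Ψ j) (X a₀)
        · refine ⟨a₀, Finset.mem_filter.2 ⟨ha₀, hsurv⟩, ?_⟩
          push_cast
          nlinarith
        · push Not at hsurv
          obtain ⟨a', ha', hlt⟩ := hsurv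
          have hpos : 0 ≤ 2 * (2 : ℝ)⁻¹ ^ j * β := by positivity
          -- If `a₀` is eliminated, the maximizer `am` of the upper bound exceeds it by more than `2
          -- · 2^{-j} β`. This pays for twice the width of `am`, so `am` is worse than `a₀` by at
          -- most `2 ε`.
          refine ⟨am, Finset.mem_filter.2 ⟨ham, fun a'' ha'' => ?_⟩, ?_⟩
          · have := hmax a'' ha''
            linarith
          · have c1 := (hacc' am ham).2
            have c2 := h2 am ham
            have c3 := (hacc' a₀ ha₀).1
            have c4 := hmax a' ha'
            push_cast
            nlinarith
      · intro a ha
        obtain ⟨haA, hau⟩ := Finset.mem_filter.1 ha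
        have c1 := (hacc' a haA).2
        have c2 := h2 a haA
        have c3 := (hacc' a₀ ha₀).1
        have c4 := hau a₀ ha₀
        -- A survivor is within `4 · 2^{-j} β + 2 ε` of `a₀`: the elimination margin and twice its
        -- width contribute `2 · 2^{-j} β` each. In terms of the next level this is `8 · 2^{-(j+1)}
        -- β + 2 ε`.
        rw [if_neg (by omega), hpow]
        push_cast
        nlinarith
    · rw [hv]
      refine ⟨fun k hk => ?_, fun h => by simp at h⟩
      simp only [Option.some.injEq] at hk
      subst hk
      refine ⟨by omega, ?_⟩
      push Not at h2
      obtain ⟨a, ha, ha2⟩ := h2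
      have hs := Finset.mem_filter.1 (hsel {a ∈ A | β * (2 : ℝ)⁻¹ ^ j < width lam β (Ψ j) (X a)}
        ⟨a, Finset.mem_filter.2 ⟨ha, ha2⟩⟩)
      refine (hall _ hs.1).trans ?_
      split_ifs
      · exact le_rfl
      · nlinarith

/-! ### The number of recorded rounds -/

/-- A feature recorded at level `j` has norm above `2^{-j}` with respect to the inverse Gram matrix,
so each record multiplies the determinant by at least `1 + 4^{-j}`. -/
theorem det_gram_state_ge (hsel : ∀ S : Finset (Fin K), S.Nonempty → sel S ∈ S) (hlam : 0 < lam)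
    (hβ : 0 < β) (τ j : ℕ) :
    lam ^ Fintype.card ι * (1 + ((2 : ℝ)⁻¹ ^ j) ^ 2) ^ (recorded sel lam β d N x y τ j).card ≤
      (gram lam (supLinUCBState sel lam β d N x y τ j)).det := by
  induction τ with
  | zero => simp [supLinUCBState, recorded, gram]
  | succ τ ih =>
    rw [state_succ, recorded_succ]
    split_ifs with h
    · rw [Finset.card_insert_of_notMem (by simp [recorded]), gram_cons,
        det_add_vecMulVec_self (posDef_gram hlam _), pow_succ, ← mul_assoc]
      have hw := width_of_levelLoop_eq_some hsel h
      rw [width] at hw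
      have hw2 := lt_of_mul_lt_mul_left hw hβ.le
      have hp : (0 : ℝ) ≤ (2 : ℝ)⁻¹ ^ j := by positivity
      have hw4 := (Real.lt_sqrt hp).1 hw2
      refine mul_le_mul ih ?_ (by positivity) (posDef_gram hlam _).det_pos.le
      exact add_le_add_right hw4.le 1
    · exact ih

/-- The elliptical potential argument: the growth of the determinant is confronted with its bound by
the trace, and `log (1 + q) ≥ q / 2` for `0 ≤ q ≤ 1` turns this into a bound on the number of
records. -/
theorem card_recorded_le (hsel : ∀ S : Finset (Fin K), S.Nonempty → sel S ∈ S) (hlam : 0 < lam)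
    (hβ : 0 < β) (hx : ∀ s a, x s a ⬝ᵥ x s a ≤ 1) {τ : ℕ} (hτ : τ ≤ N) (j : ℕ)
    {ℓ : ℝ} (hℓ : Real.log (Fintype.card ι + N / lam) ≤ ℓ) (hι : 0 < Fintype.card ι) :
    (recorded sel lam β d N x y τ j).card * ((2 : ℝ)⁻¹ ^ j) ^ 2 ≤ 2 * Fintype.card ι * ℓ := by
  set k := (recorded sel lam β d N x y τ j).card with hk
  have hkN : k ≤ N := by
    refine le_trans ?_ hτ
    rw [hk, recorded]
    exact (Finset.card_filter_le _ _).trans (by simp)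
  have h1 := det_gram_state_ge (sel := sel) (d := d) (N := N) (x := x) (y := y) hsel hlam hβ τ j
  have h2 := det_le_trace_pow (posDef_gram hlam (supLinUCBState sel lam β d N x y τ j)).posSemidef
  have h3 : (gram lam (supLinUCBState sel lam β d N x y τ j)).trace ≤
      Fintype.card ι * lam + k := by
    rw [hk, ← length_state]
    refine trace_gram_le fun q hq => ?_
    obtain ⟨s, _, a, rfl⟩ := mem_state sel lam β d N x y hq
    exact hx s a
  set D := Fintype.card ι with hD
  have htr : 0 ≤ (gram lam (supLinUCBState sel lam β d N x y τ j)).trace :=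
    (posDef_gram hlam _).posSemidef.trace_nonneg
  have hι' : (1 : ℝ) ≤ D := by exact_mod_cast hι
  have hkN' : (k : ℝ) ≤ N := by exact_mod_cast hkN
  have h4 : (1 + ((2 : ℝ)⁻¹ ^ j) ^ 2) ^ k ≤ (D + N / lam) ^ D := by
    have h5 : lam ^ D * (1 + ((2 : ℝ)⁻¹ ^ j) ^ 2) ^ k ≤ lam ^ D * (D + N / lam) ^ D := by
      refine (h1.trans h2).trans ?_
      rw [← mul_pow]
      refine pow_le_pow_left₀ htr (h3.trans ?_) _
      have : lam * (D + N / lam) = D * lam + N := by field_simp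
      rw [this]
      linarith
    exact le_of_mul_le_mul_left h5 (by positivity)
  have h6 := Real.log_le_log (by positivity) h4
  rw [Real.log_pow, Real.log_pow] at h6
  have hq1 : ((2 : ℝ)⁻¹ ^ j) ^ 2 ≤ 1 := by
    rw [← pow_mul]; exact pow_le_one₀ (by norm_num) (by norm_num)
  have hq0 : (0 : ℝ) ≤ ((2 : ℝ)⁻¹ ^ j) ^ 2 := by positivity
  set q := ((2 : ℝ)⁻¹ ^ j) ^ 2 with hqdef
  have h7 : q / 2 ≤ Real.log (1 + q) := by
    have := Real.one_sub_inv_le_log_of_pos (by positivity : 0 < 1 + q)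
    refine le_trans ?_ this
    rw [← one_div, div_le_iff₀ two_pos]
    have h8 : 1 - 1 / (1 + q) = q / (1 + q) := by field_simp; ring
    rw [h8, div_mul_eq_mul_div, le_div_iff₀ (by positivity)]
    nlinarith
  have h9 := mul_le_mul_of_nonneg_left h7 (Nat.cast_nonneg (α := ℝ) k)
  have h10 := mul_le_mul_of_nonneg_left hℓ (by linarith : (0 : ℝ) ≤ D)
  nlinarith

end Recorded

end LowRankBandit

end

noncomputable section

namespace LowRankBandit

/-! ### The design of a level does not depend on the rewards recorded at that level -/

section Design

variable {ι : Type*} [Fintype ι] [DecidableEq ι] {K : ℕ}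
  {sel : Finset (Fin K) → Fin K} {lam β d : ℝ} {N : ℕ} {x : ℕ → Fin K → ι → ℝ}

theorem width_congr {D D' : List ((ι → ℝ) × ℝ)} (h : D.map Prod.fst = D'.map Prod.fst)
    (X : ι → ℝ) : width lam β D X = width lam β D' X := by
  have hg : ∀ D : List ((ι → ℝ) × ℝ), gram lam D =
      lam • (1 : Matrix ι ι ℝ) + ((D.map Prod.fst).map fun z => Matrix.vecMulVec z z).sum := by
    intro D; rw [gram, List.map_map]; rfl
  rw [width, width, hg, hg, h]

-- The decision to record at a level `k ≤ j` uses the full data of the levels below `j`, but of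
-- level `j` only the widths, which do not involve rewards. Moving on from level `j` is irrelevant,
-- because the round is then recorded higher or not at all.
open Classical in
theorem levelLoop_eq_of_agree {X : Fin K → ι → ℝ} {Ψ Ψ' : ℕ → List ((ι → ℝ) × ℝ)} {j : ℕ}
    (hlt : ∀ k < j, Ψ k = Ψ' k) (hj : (Ψ j).map Prod.fst = (Ψ' j).map Prod.fst) {fuel i k : ℕ}
    {A : Finset (Fin K)} (hi : i ≤ j) (hk : k ≤ j)
    (h : (levelLoop sel lam β d N X Ψ fuel i A).2 = some k) :
    levelLoop sel lam β d N X Ψ' fuel i A = levelLoop sel lam β d N X Ψ fuel i A := by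
  induction fuel generalizing i A with
  | zero => simp [levelLoop] at h
  | succ fuel ih =>
    rw [levelLoop] at h
    rw [levelLoop, levelLoop]
    rcases hi.lt_or_eq with hi' | rfl
    · rw [← hlt i hi']
      split_ifs at h ⊢ with h1 h2
      · exact ih hi' h
      · rfl
    · have hw : ∀ Y, width lam β (Ψ' i) Y = width lam β (Ψ i) Y := fun Y => (width_congr hj Y).symm
      simp only [hw]
      split_ifs at h ⊢ with h1 h2
      · have := le_of_levelLoop_eq_some h
        omega
      · rfl

/-- The arms played in the rounds recorded at level `j`. -/
def design (sel : Finset (Fin K) → Fin K) (lam β d : ℝ) (N : ℕ) (x : ℕ → Fin K → ι → ℝ)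
    (y : ℕ → Fin K → ℝ) (j s : ℕ) : Option (Fin K) :=
  if (play sel lam β d N x y s).2 = some j then some (play sel lam β d N x y s).1 else none

theorem play_eq_of_agree {y y' : ℕ → Fin K → ℝ} {j t : ℕ}
    (hlt : ∀ k < j, supLinUCBState sel lam β d N x y t k = supLinUCBState sel lam β d N x y' t k)
    (hj : (supLinUCBState sel lam β d N x y t j).map Prod.fst =
      (supLinUCBState sel lam β d N x y' t j).map Prod.fst) {k : ℕ} (hk : k ≤ j) :
    ((play sel lam β d N x y t).2 = some k ∨ (play sel lam β d N x y' t).2 = some k) →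
      play sel lam β d N x y t = play sel lam β d N x y' t := by
  have hle : ∀ {y : ℕ → Fin K → ℝ}, (play sel lam β d N x y t).2 = some k → 1 ≤ j := fun h =>
    (le_of_levelLoop_eq_some h).trans hk
  rintro (h | h)
  · exact (levelLoop_eq_of_agree hlt hj (hle h) hk h).symm
  · exact levelLoop_eq_of_agree (fun k hk => (hlt k hk).symm) hj.symm (hle h) hk h

/-- The structural point of SupLinUCB: the rewards recorded at level `j` influence only the levels
above it. Here exactly those rewards are allowed to differ, and neither the lower levels nor the
features of level `j` notice. -/
theorem state_agree {y y' : ℕ → Fin K → ℝ} {j τ : ℕ}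
    (hy : ∀ s < τ, design sel lam β d N x y j s = none → ∀ a, y s a = y' s a) :
    ∀ t ≤ τ, (∀ k < j, supLinUCBState sel lam β d N x y t k =
      supLinUCBState sel lam β d N x y' t k) ∧
      (supLinUCBState sel lam β d N x y t j).map Prod.fst =
        (supLinUCBState sel lam β d N x y' t j).map Prod.fst := by
  intro t
  induction t with
  | zero => intro _; simp [supLinUCBState]
  | succ t ih =>
    intro ht
    obtain ⟨hlt, hj⟩ := ih (by omega)
    have hp := fun (k : ℕ) (hk : k ≤ j) => play_eq_of_agree (sel := sel) (lam := lam) (β := β)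
      (d := d) (N := N) (x := x) hlt hj (k := k) hk
    constructor
    · intro k hk
      rw [state_succ, state_succ]
      by_cases h1 : (play sel lam β d N x y t).2 = some k
      · have h2 := hp k hk.le (Or.inl h1)
        rw [← h2, if_pos h1, if_pos h1, hlt k hk]
        rw [hy t (by omega) (by rw [design, if_neg (by rw [h1]; simp; omega)])]
      · have h2 : ¬ (play sel lam β d N x y' t).2 = some k := fun h2 =>
          h1 (by rw [hp k hk.le (Or.inr h2)]; exact h2)
        rw [if_neg h1, if_neg h2, hlt k hk]
    · rw [state_succ, state_succ]
      by_cases h1 : (play sel lam β d N x y t).2 = some j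
      · have h2 := hp j le_rfl (Or.inl h1)
        rw [← h2, if_pos h1, if_pos h1, List.map_cons, List.map_cons, hj]
      · have h2 : ¬ (play sel lam β d N x y' t).2 = some j := fun h2 =>
          h1 (by rw [hp j le_rfl (Or.inr h2)]; exact h2)
        rw [if_neg h1, if_neg h2, hj]

theorem design_agree {y y' : ℕ → Fin K → ℝ} {j τ : ℕ}
    (hy : ∀ s < τ, design sel lam β d N x y j s = none → ∀ a, y s a = y' s a) :
    ∀ s < τ, design sel lam β d N x y' j s = design sel lam β d N x y j s := by
  intro s hs
  obtain ⟨hlt, hj⟩ := state_agree hy s hs.le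
  have hp := play_eq_of_agree (sel := sel) (lam := lam) (β := β)
      (d := d) (N := N) (x := x) hlt hj (k := j) le_rfl
  rw [design, design]
  by_cases h1 : (play sel lam β d N x y s).2 = some j
  · rw [hp (Or.inl h1)]
  · have h2 : ¬ (play sel lam β d N x y' s).2 = some j := fun h2 =>
      h1 (by rw [hp (Or.inr h2)]; exact h2)
    rw [if_neg h1, if_neg h2]

end Design

/-! ### Measurability -/

section Measurability

variable {ι : Type*} [Fintype ι] [DecidableEq ι] {K : ℕ} {α : Type*} [MeasurableSpace α]

theorem measurable_matrix_inv {A : α → Matrix ι ι ℝ} (hA : ∀ i k, Measurable fun ω => A ω i k)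
    (i k : ι) : Measurable fun ω => (A ω)⁻¹ i k := by
  have c1 : Continuous fun B : ι → ι → ℝ => (Matrix.of B).det :=
    Continuous.matrix_det (continuous_id : Continuous fun B : Matrix ι ι ℝ => B)
  have c2 : Continuous fun B : ι → ι → ℝ => (Matrix.of B).adjugate i k :=
    (Continuous.matrix_adjugate (continuous_id : Continuous fun B : Matrix ι ι ℝ => B)).matrix_elem
      i k
  have h1 := c1.measurable
  have h2 := c2.measurable
  have hAm : Measurable fun ω i k => A ω i k :=
    measurable_pi_lambda _ fun i => measurable_pi_lambda _ fun k => hA i k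
  have h3 : ∀ ω, (A ω)⁻¹ i k = (A ω).det⁻¹ * (A ω).adjugate i k := by
    intro ω
    rw [Matrix.inv_def, Ring.inverse_eq_inv', Matrix.smul_apply, smul_eq_mul]
  simp only [h3]
  exact (h1.comp hAm).inv.mul (h2.comp hAm)

/-- Measurability of a random list of data: the Gram matrix and the vector of responses. -/
def MeasurableData (D : α → List ((ι → ℝ) × ℝ)) : Prop :=
  (∀ (lam : ℝ) i k, Measurable fun ω => gram lam (D ω) i k) ∧
    ∀ i, Measurable fun ω => ((D ω).map fun q => q.2 • q.1).sum i

theorem MeasurableData.width {D : α → List ((ι → ℝ) × ℝ)} (hD : MeasurableData D) (lam β : ℝ)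
    {X : α → ι → ℝ} (hX : ∀ i, Measurable fun ω => X ω i) :
    Measurable fun ω => width lam β (D ω) (X ω) := by
  simp only [LowRankBandit.width, dotProduct, Matrix.mulVec]
  refine Measurable.const_mul (Measurable.sqrt ?_) _
  refine Finset.measurable_sum _ fun i _ => (hX i).mul (Finset.measurable_sum _ fun k _ => ?_)
  exact (measurable_matrix_inv (hD.1 lam) i k).mul (hX k)

theorem MeasurableData.ucb {D : α → List ((ι → ℝ) × ℝ)} (hD : MeasurableData D) (lam β : ℝ)
    {X : α → ι → ℝ} (hX : ∀ i, Measurable fun ω => X ω i) :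
    Measurable fun ω => ucb lam β (D ω) (X ω) := by
  unfold LowRankBandit.ucb
  refine Measurable.add ?_ (hD.width lam β hX)
  simp only [thetaHat, dotProduct, Matrix.mulVec]
  refine Finset.measurable_sum _ fun i _ => Measurable.mul (Finset.measurable_sum _ fun k _ => ?_)
    (hX i)
  exact (measurable_matrix_inv (hD.1 lam) i k).mul (hD.2 k)

theorem measurableSet_ite_eq {γ : Type*} {c : α → Prop} [∀ ω, Decidable (c ω)] {f g : α → γ}
    {v : γ} (hc : MeasurableSet {ω | c ω}) (hf : MeasurableSet {ω | f ω = v})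
    (hg : MeasurableSet {ω | g ω = v}) : MeasurableSet {ω | (if c ω then f ω else g ω) = v} := by
  have : {ω | (if c ω then f ω else g ω) = v} =
      ({ω | c ω} ∩ {ω | f ω = v}) ∪ ({ω | c ω}ᶜ ∩ {ω | g ω = v}) := by
    ext ω
    by_cases h : c ω <;> simp [h]
  rw [this]
  exact (hc.inter hf).union (hc.compl.inter hg)

/-- A random set of arms has finitely many values, so the survivors of an elimination step may be
treated as a fixed set on each piece. -/
theorem measurableSet_finset_param {F : α → Finset (Fin K)} {Q : Finset (Fin K) → α → Prop}
    (hF : ∀ a, MeasurableSet {ω | a ∈ F ω}) (hQ : ∀ A, MeasurableSet {ω | Q A ω}) :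
    MeasurableSet {ω | Q (F ω) ω} := by
  have h1 : ∀ A, MeasurableSet {ω | F ω = A} := by
    intro A
    have : {ω | F ω = A} = ⋂ a, {ω | a ∈ F ω ↔ a ∈ A} := by
      ext ω; simp [Finset.ext_iff]
    rw [this]
    refine MeasurableSet.iInter fun a => ?_
    by_cases ha : a ∈ A
    · simpa [ha] using hF a
    · simpa [ha, Set.compl_ofPred] using (hF a).compl
  have : {ω | Q (F ω) ω} = ⋃ A, {ω | F ω = A} ∩ {ω | Q A ω} := by
    ext ω; simp
  rw [this]
  exact MeasurableSet.iUnion fun A => (h1 A).inter (hQ A)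

open Classical in
theorem measurableSet_levelLoop_eq (sel : Finset (Fin K) → Fin K) (lam β d : ℝ) (N : ℕ)
    {X : α → Fin K → ι → ℝ} (hX : ∀ a i, Measurable fun ω => X ω a i)
    {Ψ : α → ℕ → List ((ι → ℝ) × ℝ)} (hΨ : ∀ k, MeasurableData fun ω => Ψ ω k)
    (fuel j : ℕ) (A : Finset (Fin K)) (v : Fin K × Option ℕ) :
    MeasurableSet {ω | levelLoop sel lam β d N (X ω) (Ψ ω) fuel j A = v} := by
  induction fuel generalizing j A with
  | zero => simp only [levelLoop]; exact MeasurableSet.const _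
  | succ fuel ih =>
    have hw : ∀ a, Measurable fun ω => width lam β (Ψ ω j) (X ω a) := fun a =>
      (hΨ j).width lam β (hX a)
    have hu : ∀ a, Measurable fun ω => ucb lam β (Ψ ω j) (X ω a) := fun a =>
      (hΨ j).ucb lam β (hX a)
    have hall : ∀ r : ℝ, MeasurableSet {ω | ∀ a ∈ A, width lam β (Ψ ω j) (X ω a) ≤ r} := by
      intro r
      have : {ω | ∀ a ∈ A, width lam β (Ψ ω j) (X ω a) ≤ r} =
          ⋂ a ∈ A, {ω | width lam β (Ψ ω j) (X ω a) ≤ r} := by ext ω; simp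
      rw [this]
      exact Finset.measurableSet_biInter _ fun a _ => measurableSet_le (hw a) measurable_const
    have hmem : ∀ {q : α → Prop} (a : Fin K), MeasurableSet {ω | q ω} →
        MeasurableSet {ω | a ∈ A ∧ q ω} := fun a hq => (MeasurableSet.const (a ∈ A)).inter hq
    have hbest : ∀ (r : ℝ) (a : Fin K), MeasurableSet {ω | ∀ a' ∈ A,
        ucb lam β (Ψ ω j) (X ω a') - r ≤ ucb lam β (Ψ ω j) (X ω a)} := by
      intro r a
      have : {ω | ∀ a' ∈ A, ucb lam β (Ψ ω j) (X ω a') - r ≤ ucb lam β (Ψ ω j) (X ω a)} =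
          ⋂ a' ∈ A, {ω | ucb lam β (Ψ ω j) (X ω a') - r ≤ ucb lam β (Ψ ω j) (X ω a)} := by
        ext ω; simp
      rw [this]
      exact Finset.measurableSet_biInter _ fun a' _ => measurableSet_le ((hu a').sub_const r) (hu a)
    simp only [levelLoop]
    refine measurableSet_ite_eq (hall _) ?_ (measurableSet_ite_eq (hall _) ?_ ?_)
    · refine measurableSet_finset_param (Q := fun A' _ => (sel A', none) = v) (fun a => ?_)
        fun A' => MeasurableSet.const _
      simp only [Finset.mem_filter]
      refine hmem a ?_
      simpa only [sub_zero] using hbest 0 a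
    · refine measurableSet_finset_param (Q := fun A' ω =>
        levelLoop sel lam β d N (X ω) (Ψ ω) fuel (j + 1) A' = v) (fun a => ?_)
        fun A' => ih (j + 1) A'
      simp only [Finset.mem_filter]
      exact hmem a (hbest _ a)
    · refine measurableSet_finset_param (Q := fun A' _ => (sel A', some j) = v)
        (fun a => ?_) fun A' => MeasurableSet.const _
      simp only [Finset.mem_filter]
      exact hmem a (measurableSet_lt measurable_const (hw a))

/-- The update as a finite sum of indicators over the arms, a form that inherits measurability. -/
theorem gram_state_succ_apply (sel : Finset (Fin K) → Fin K) (lam β d : ℝ) (N : ℕ)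
    (x : ℕ → Fin K → ι → ℝ) (y : ℕ → Fin K → ℝ) (lam' : ℝ) (τ j : ℕ) (i k : ι) :
    gram lam' (supLinUCBState sel lam β d N x y (τ + 1) j) i k =
      gram lam' (supLinUCBState sel lam β d N x y τ j) i k +
        ∑ a, if play sel lam β d N x y τ = (a, some j) then x τ a i * x τ a k else 0 := by
  rw [state_succ]
  split_ifs with h
  · rw [gram_cons, Matrix.add_apply, Matrix.vecMulVec_apply]
    congr 1
    rw [Finset.sum_eq_single (play sel lam β d N x y τ).1]
    · rw [if_pos (by rw [← h])]
    · intro b _ hb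
      rw [if_neg fun hc => hb (by rw [hc])]
    · simp
  · rw [Finset.sum_eq_zero, add_zero]
    intro a _
    rw [if_neg fun hc => h (by rw [hc])]

theorem response_state_succ_apply (sel : Finset (Fin K) → Fin K) (lam β d : ℝ) (N : ℕ)
    (x : ℕ → Fin K → ι → ℝ) (y : ℕ → Fin K → ℝ) (τ j : ℕ) (i : ι) :
    ((supLinUCBState sel lam β d N x y (τ + 1) j).map fun q => q.2 • q.1).sum i =
      ((supLinUCBState sel lam β d N x y τ j).map fun q => q.2 • q.1).sum i +
        ∑ a, if play sel lam β d N x y τ = (a, some j) then y τ a * x τ a i else 0 := by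
  rw [state_succ]
  split_ifs with h
  · rw [List.map_cons, List.sum_cons, Pi.add_apply, add_comm]
    congr 1
    rw [Finset.sum_eq_single (play sel lam β d N x y τ).1]
    · rw [if_pos (by rw [← h])]; rfl
    · intro b _ hb
      rw [if_neg fun hc => hb (by rw [hc])]
    · simp
  · rw [Finset.sum_eq_zero, add_zero]
    intro a _
    rw [if_neg fun hc => h (by rw [hc])]

theorem measurable_state_play (sel : Finset (Fin K) → Fin K) (lam β d : ℝ) (N : ℕ)
    {x : α → ℕ → Fin K → ι → ℝ} (hx : ∀ s a i, Measurable fun ω => x ω s a i)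
    {y : α → ℕ → Fin K → ℝ} (hy : ∀ s a, Measurable fun ω => y ω s a) (τ : ℕ) :
    (∀ j, MeasurableData fun ω => supLinUCBState sel lam β d N (x ω) (y ω) τ j) ∧
      ∀ v, MeasurableSet {ω | play sel lam β d N (x ω) (y ω) τ = v} := by
  have hplay : ∀ τ, (∀ j, MeasurableData fun ω => supLinUCBState sel lam β d N (x ω) (y ω) τ j) →
      ∀ v, MeasurableSet {ω | play sel lam β d N (x ω) (y ω) τ = v} := fun τ h v =>
    measurableSet_levelLoop_eq sel lam β d N (fun a i => hx τ a i) h _ _ _ v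
  induction τ with
  | zero =>
    have h0 : ∀ j, MeasurableData fun ω => supLinUCBState sel lam β d N (x ω) (y ω) 0 j := by
      intro j
      refine ⟨fun _ i k => ?_, fun i => ?_⟩
      · simp only [supLinUCBState]; exact measurable_const
      · simp only [supLinUCBState]; exact measurable_const
    exact ⟨h0, hplay 0 h0⟩
  | succ τ ih =>
    obtain ⟨h1, h2⟩ := ih
    have h3 : ∀ j, MeasurableData fun ω => supLinUCBState sel lam β d N (x ω) (y ω) (τ + 1) j := by
      intro j
      refine ⟨fun lam' i k => ?_, fun i => ?_⟩
      · simp only [gram_state_succ_apply]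
        refine ((h1 j).1 lam' i k).add (Finset.measurable_sum _ fun a _ => ?_)
        exact Measurable.ite (h2 _) ((hx τ a i).mul (hx τ a k)) measurable_const
      · simp only [response_state_succ_apply]
        refine ((h1 j).2 i).add (Finset.measurable_sum _ fun a _ => ?_)
        exact Measurable.ite (h2 _) ((hy τ a).mul (hx τ a i)) measurable_const
    exact ⟨h3, hplay (τ + 1) h3⟩

theorem measurable_supLinUCBArm (sel : Finset (Fin K) → Fin K) (lam β d : ℝ) (N : ℕ)
    {x : α → ℕ → Fin K → ι → ℝ} (hx : ∀ s a i, Measurable fun ω => x ω s a i)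
    {y : α → ℕ → Fin K → ℝ} (hy : ∀ s a, Measurable fun ω => y ω s a) (τ : ℕ) :
    Measurable fun ω => supLinUCBArm sel lam β d N (x ω) (y ω) τ := by
  refine measurable_to_countable' fun a => ?_
  have : (fun ω => supLinUCBArm sel lam β d N (x ω) (y ω) τ) ⁻¹' {a} =
      ⋃ o : Option ℕ, {ω | play sel lam β d N (x ω) (y ω) τ = (a, o)} := by
    ext ω
    simp only [Set.mem_preimage, Set.mem_singleton_iff, Set.mem_iUnion, Set.mem_ofPred_eq]
    exact ⟨fun h => ⟨_, Prod.ext h rfl⟩, fun ⟨o, h⟩ => by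
      show (play sel lam β d N (x ω) (y ω) τ).1 = a
      rw [h]⟩
  rw [this]
  exact MeasurableSet.iUnion fun o => (measurable_state_play sel lam β d N hx hy τ).2 _

end Measurability

end LowRankBandit

end

noncomputable section

namespace LowRankBandit

/-! ### Concentration of the estimates of SupLinUCB -/

section Concentration

variable {Ω : Type*} [MeasurableSpace Ω] {P : Measure Ω} [IsProbabilityMeasure P]

theorem measure_abs_weighted_sum_gt_le {τ : Type*} [Fintype τ] {η : τ → Ω → ℝ}
    (hind : iIndepFun η P) {σ : ℝ≥0} (hσ : 0 < σ) (hsub : ∀ t, HasSubgaussianMGF (η t) (σ ^ 2) P)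
    (α : τ → ℝ) {w s : ℝ} (hw : 0 ≤ w) (hs : 0 ≤ s) (hα : ∑ t, α t ^ 2 ≤ w ^ 2) :
    P.real {ω | σ * s * w < |∑ t, α t * η t ω|} ≤ 2 * Real.exp (-(s ^ 2 / 2)) := by
  have hσ' : (0 : ℝ) < σ := hσ
  have hnn : 0 ≤ ∑ t, α t ^ 2 := Finset.sum_nonneg fun t _ => sq_nonneg _
  -- Without nonzero coefficients the strict inequality never holds. The other case supplies the
  -- positive variance by which the exponent is divided.
  rcases hnn.eq_or_lt with h0 | h0
  · have hz : ∀ t, α t = 0 := fun t => by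
      have := (Finset.sum_eq_zero_iff_of_nonneg fun t _ => sq_nonneg (α t)).1 h0.symm t
        (Finset.mem_univ t)
      simpa using this
    have hempty : {ω | σ * s * w < |∑ t, α t * η t ω|} = ∅ := by
      ext ω
      simp only [hz, zero_mul, Finset.sum_const_zero, abs_zero, Set.mem_ofPred_eq,
        Set.mem_empty_iff_false, iff_false, not_lt]
      positivity
    rw [hempty, measureReal_empty]
    positivity
  have hone : ∀ α : τ → ℝ, ∑ t, α t ^ 2 ≤ w ^ 2 → 0 < ∑ t, α t ^ 2 →
      P.real {ω | σ * s * w ≤ ∑ t, α t * η t ω} ≤ Real.exp (-(s ^ 2 / 2)) := by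
    intro α hα h0
    have hind' : iIndepFun (fun t ω => α t * η t ω) P :=
      hind.comp (fun t x => α t * x) fun t => measurable_const_mul (α t)
    have h1 := HasSubgaussianMGF.measure_sum_ge_le_of_iIndepFun hind'
      (s := Finset.univ) (c := fun t => NNReal.mk (α t ^ 2) (sq_nonneg (α t)) * σ ^ 2)
      (fun t _ => (hsub t).const_mul (α t)) (ε := σ * s * w) (by positivity)
    refine h1.trans (Real.exp_le_exp.2 ?_)
    have hc : ((∑ t, NNReal.mk (α t ^ 2) (sq_nonneg (α t)) * σ ^ 2 : ℝ≥0) : ℝ) =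
        (∑ t, α t ^ 2) * (σ : ℝ) ^ 2 := by
      rw [Finset.sum_mul, NNReal.coe_sum]
      refine Finset.sum_congr rfl fun t _ => ?_
      rw [NNReal.coe_mul, NNReal.coe_pow, NNReal.coe_mk]
    rw [hc, neg_div, neg_le_neg_iff, div_le_div_iff₀ two_pos (by positivity)]
    have h2 : s ^ 2 * (2 * ((∑ t, α t ^ 2) * (σ : ℝ) ^ 2)) ≤ s ^ 2 * (2 * (w ^ 2 * (σ : ℝ) ^ 2)) := by
      gcongr
    nlinarith
  have h1 := hone α hα h0
  have h2 := hone (fun t => -α t) (by simpa using hα) (by simpa using h0)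
  have hsub : {ω | σ * s * w < |∑ t, α t * η t ω|} ⊆
      {ω | σ * s * w ≤ ∑ t, α t * η t ω} ∪ {ω | σ * s * w ≤ ∑ t, -α t * η t ω} := by
    intro ω hω
    rcases lt_abs.1 (Set.mem_ofPred_eq ▸ hω) with h | h
    · exact Or.inl h.le
    · refine Or.inr ?_
      simp only [Set.mem_ofPred_eq, neg_mul, Finset.sum_neg_distrib]
      exact h.le
  have h3 := (measureReal_mono hsub (measure_ne_top P _)).trans (measureReal_union_le _ _)
  linarith

variable {ι : Type*} [Fintype ι] [DecidableEq ι] {K : ℕ}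
  {sel : Finset (Fin K) → Fin K} {lam β d : ℝ} {N : ℕ} {x : ℕ → Fin K → ι → ℝ}
  {f : ℕ → Fin K → ℝ} {ξ : ℕ → Ω → ℝ} {σ : ℝ≥0}

/-- The feature recorded in round `s` according to a design. -/
def designFeature (x : ℕ → Fin K → ι → ℝ) {τ : ℕ} (δ : Fin τ → Option (Fin K)) (s : Fin τ) :
    ι → ℝ :=
  match δ s with
  | some a => x s a
  | none => 0

theorem sum_recorded_eq {A : Type*} [AddCommMonoid A] {y : ℕ → Fin K → ℝ} {τ j : ℕ}
    {δ : Fin τ → Option (Fin K)} (hδ : ∀ s : Fin τ, design sel lam β d N x y j s = δ s)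
    (F : ℕ → (ι → ℝ) → A) (hF : ∀ s, F s 0 = 0) :
    ∑ s ∈ recorded sel lam β d N x y τ j, F s (x s (play sel lam β d N x y s).1) =
      ∑ s : Fin τ, F s (designFeature x δ s) := by
  rw [recorded, Finset.sum_filter, ← Fin.sum_univ_eq_sum_range (fun s =>
    if (play sel lam β d N x y s).2 = some j then F s (x s (play sel lam β d N x y s).1) else 0)]
  refine Finset.sum_congr rfl fun s _ => ?_
  have h := hδ s
  rw [design] at h
  rw [designFeature, ← h]
  split_ifs with h1
  · rfl
  · simp [hF]

theorem measurableSet_design_eq {α : Type*} [MeasurableSpace α] {y : α → ℕ → Fin K → ℝ}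
    (hy : ∀ s a, Measurable fun ω => y ω s a) (j s : ℕ) (o : Option (Fin K)) :
    MeasurableSet {ω | design sel lam β d N x (y ω) j s = o} := by
  have hp := (measurable_state_play sel lam β d N (x := fun _ : α => x)
    (fun _ _ _ => measurable_const) hy s).2
  have h1 : ∀ o, MeasurableSet {ω | (play sel lam β d N x (y ω) s).2 = o} := by
    intro o
    have : {ω | (play sel lam β d N x (y ω) s).2 = o} =
        ⋃ a, {ω | play sel lam β d N x (y ω) s = (a, o)} := by
      ext ω; simp [Prod.ext_iff]
    rw [this]
    exact MeasurableSet.iUnion fun a => hp _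
  have h2 : ∀ a, MeasurableSet {ω | some (play sel lam β d N x (y ω) s).1 = a} := by
    rintro (_ | a)
    · simp
    · have : {ω | some (play sel lam β d N x (y ω) s).1 = some a} =
          ⋃ o, {ω | play sel lam β d N x (y ω) s = (a, o)} := by
        ext ω; simp [Prod.ext_iff]
      rw [this]
      exact MeasurableSet.iUnion fun a => hp _
  unfold design
  exact measurableSet_ite_eq (h1 _) (h2 _) (MeasurableSet.const _)

/-- Whether level `j` has the design `δ` is determined by the rewards in the rounds that `δ` does
not record. -/
theorem design_eq_iff {y y' : ℕ → Fin K → ℝ} {j τ : ℕ} {δ : Fin τ → Option (Fin K)}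
    (h : ∀ s : Fin τ, δ s = none → ∀ a, y s a = y' s a) :
    (∀ s : Fin τ, design sel lam β d N x y j s = δ s) ↔
      ∀ s : Fin τ, design sel lam β d N x y' j s = δ s := by
  constructor
  · intro hy s
    rw [← hy s]
    exact design_agree (fun s hs h0 a => h ⟨s, hs⟩ ((hy ⟨s, hs⟩).symm.trans h0) a) s s.2
  · intro hy s
    rw [← hy s]
    exact design_agree (fun s hs h0 a => (h ⟨s, hs⟩ ((hy ⟨s, hs⟩).symm.trans h0) a).symm) s s.2

/-- The noise part of the estimate at a level is controlled by the width, because the design of the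
level is independent of the noise in the rounds recorded there. -/
theorem measure_noise_gt_le (hlam : 0 < lam) (hξ : ∀ t, Measurable (ξ t)) (hind : iIndepFun ξ P)
    (hσ : 0 < σ) (hsub : ∀ t, HasSubgaussianMGF (ξ t) (σ ^ 2) P) {s₀ : ℝ} (hs₀ : 0 ≤ s₀)
    (τ j : ℕ) (X : ι → ℝ) :
    P.real {ω | σ * s₀ * √(X ⬝ᵥ ((gram lam
        (supLinUCBState sel lam β d N x (fun s a => f s a + ξ s ω) τ j))⁻¹ *ᵥ X)) <
      |∑ s ∈ recorded sel lam β d N x (fun s a => f s a + ξ s ω) τ j, ξ s ω *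
        (x s (play sel lam β d N x (fun s a => f s a + ξ s ω) s).1 ⬝ᵥ ((gram lam
          (supLinUCBState sel lam β d N x (fun s a => f s a + ξ s ω) τ j))⁻¹ *ᵥ X))|} ≤
      2 * Real.exp (-(s₀ ^ 2 / 2)) := by
  set y : Ω → ℕ → Fin K → ℝ := fun ω s a => f s a + ξ s ω with hy
  have hym : ∀ s a, Measurable fun ω => y ω s a := fun s a => (hξ s).const_add _
  set V : (Fin τ → Option (Fin K)) → Matrix ι ι ℝ := fun δ =>
    lam • (1 : Matrix ι ι ℝ) + ∑ s, Matrix.vecMulVec (designFeature x δ s) (designFeature x δ s)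
    with hV
  set α : (Fin τ → Option (Fin K)) → Fin τ → ℝ := fun δ s =>
    designFeature x δ s ⬝ᵥ ((V δ)⁻¹ *ᵥ X) with hα
  set des : Ω → Fin τ → Option (Fin K) := fun ω s => design sel lam β d N x (y ω) j s with hdes
  set C : (Fin τ → Option (Fin K)) → Set Ω := fun δ =>
    {ω | σ * s₀ * √(X ⬝ᵥ ((V δ)⁻¹ *ᵥ X)) < |∑ s, α δ s * ξ s ω|} with hC
  have hindτ : iIndepFun (fun s : Fin τ => ξ s) P := hind.precomp Fin.val_injective
  have hCle : ∀ δ, P.real (C δ) ≤ 2 * Real.exp (-(s₀ ^ 2 / 2)) := by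
    intro δ
    refine measure_abs_weighted_sum_gt_le hindτ hσ (fun t => hsub t) (α δ) (Real.sqrt_nonneg _)
      hs₀ ?_
    have h0 := sq_width_nonneg hlam (V := V δ) rfl X
    rw [Real.sq_sqrt h0, sq_width_eq hlam (V := V δ) rfl X]
    have : 0 ≤ ((V δ)⁻¹ *ᵥ X) ⬝ᵥ ((V δ)⁻¹ *ᵥ X) := Finset.sum_nonneg fun i _ => mul_self_nonneg _
    simp only [hα]
    have := mul_nonneg hlam.le this
    linarith
  have hAm : ∀ δ, MeasurableSet (des ⁻¹' {δ}) := by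
    intro δ
    have : des ⁻¹' {δ} = ⋂ s : Fin τ, {ω | design sel lam β d N x (y ω) j s = δ s} := by
      ext ω; simp [hdes, funext_iff]
    rw [this]
    exact MeasurableSet.iInter fun s => measurableSet_design_eq hym j s _
  -- The first event depends on the noise outside the rounds of `δ`, and `C δ` on the noise in them.
  -- Given the design, the recorded noise thus behaves as if the design were deterministic.
  have hprod : ∀ δ, P.real (des ⁻¹' {δ} ∩ C δ) = P.real (des ⁻¹' {δ}) * P.real (C δ) := by
    intro δ
    classical
    set I : Finset (Fin τ) := Finset.univ.filter fun s => δ s ≠ none with hI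
    have hindI := hindτ.indepFun_finset Iᶜ I disjoint_compl_left (fun s => hξ s)
    -- Rewards rebuilt from the noise outside `I`, with zero noise elsewhere; by `design_eq_iff` the
    -- event is unaffected.
    set ext : ((Iᶜ : Finset (Fin τ)) → ℝ) → ℕ → Fin K → ℝ := fun v s a =>
      f s a + if h : ∃ hs : s < τ, (⟨s, hs⟩ : Fin τ) ∈ Iᶜ then v ⟨⟨s, h.1⟩, h.2⟩ else 0 with hext
    have hextm : ∀ s a, Measurable fun v => ext v s a := by
      intro s a
      simp only [hext]
      by_cases h : ∃ hs : s < τ, (⟨s, hs⟩ : Fin τ) ∈ Iᶜ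
      · simp only [h, dif_pos]
        exact (measurable_pi_apply _).const_add _
      · simp only [h, dif_neg, not_false_eq_true]
        exact measurable_const
    have hA : des ⁻¹' {δ} = (fun ω (s : (Iᶜ : Finset (Fin τ))) => ξ s ω) ⁻¹'
        (⋂ s : Fin τ, {v | design sel lam β d N x (ext v) j s = δ s}) := by
      ext ω
      simp only [Set.mem_preimage, Set.mem_singleton_iff, Set.mem_iInter, Set.mem_ofPred_eq]
      rw [funext_iff]
      refine design_eq_iff fun s hs a => ?_
      have h : ∃ hs : (s : ℕ) < τ, (⟨s, hs⟩ : Fin τ) ∈ Iᶜ := ⟨s.2, by simp [hI, hs]⟩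
      simp only [hy, hext, dif_pos h]
    have hCp : C δ = (fun ω (s : I) => ξ s ω) ⁻¹'
        {v | σ * s₀ * √(X ⬝ᵥ ((V δ)⁻¹ *ᵥ X)) < |∑ s : I, α δ s * v s|} := by
      ext ω
      simp only [hC, Set.mem_preimage, Set.mem_ofPred_eq]
      have : ∑ s, α δ s * ξ s ω = ∑ s : I, α δ s * ξ s ω := by
        rw [Finset.sum_coe_sort I (fun s => α δ s * ξ s ω)]
        refine (Finset.sum_subset (Finset.subset_univ I) fun s _ hs => ?_).symm
        have hs' : δ s = none := by simpa [hI] using hs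
        have hz : designFeature x δ s = 0 := by simp [designFeature, hs']
        simp only [hα, hz, zero_dotProduct, zero_mul]
      rw [this]
    have := hindI.measure_inter_preimage_eq_mul
      (⋂ s : Fin τ, {v | design sel lam β d N x (ext v) j s = δ s})
      {v | σ * s₀ * √(X ⬝ᵥ ((V δ)⁻¹ *ᵥ X)) < |∑ s : I, α δ s * v s|}
      (MeasurableSet.iInter fun s => measurableSet_design_eq hextm j s _)
      (measurableSet_lt measurable_const (measurable_abs.comp
        (Finset.measurable_sum _ fun s _ => (measurable_pi_apply s).const_mul _)))
    rw [measureReal_def, measureReal_def, measureReal_def, ← ENNReal.toReal_mul, hA, hCp]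
    exact congrArg ENNReal.toReal this
  refine (measureReal_mono (s₂ := ⋃ δ, des ⁻¹' {δ} ∩ C δ) ?_ (measure_ne_top P _)).trans ?_
  · intro ω hω
    refine Set.mem_iUnion.2 ⟨des ω, rfl, ?_⟩
    have hd : ∀ s : Fin τ, design sel lam β d N x (y ω) j s = des ω s := fun s => rfl
    have hg : gram lam (supLinUCBState sel lam β d N x (y ω) τ j) = V (des ω) := by
      rw [gram_state, sum_recorded_eq hd (fun _ z => Matrix.vecMulVec z z) (by simp)]
    simp only [Set.mem_ofPred_eq] at hω
    rw [hg] at hω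
    have := sum_recorded_eq hd (fun s z => ξ s ω * (z ⬝ᵥ ((V (des ω))⁻¹ *ᵥ X))) (by simp)
    rw [this] at hω
    simp only [hC, hα, Set.mem_ofPred_eq]
    simp only [mul_comm (ξ _ ω)] at hω
    exact hω
  · refine (measureReal_iUnion_fintype_le _).trans ?_
    calc ∑ δ, P.real (des ⁻¹' {δ} ∩ C δ) ≤
          ∑ δ, P.real (des ⁻¹' {δ}) * (2 * Real.exp (-(s₀ ^ 2 / 2))) := by
          refine Finset.sum_le_sum fun δ _ => ?_
          rw [hprod δ]
          exact mul_le_mul_of_nonneg_left (hCle δ) measureReal_nonneg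
      _ = 2 * Real.exp (-(s₀ ^ 2 / 2)) := by
          rw [← Finset.sum_mul, sum_measureReal_preimage_singleton _ fun δ _ => hAm δ]
          simp

/-! ### The regret of SupLinUCB -/

theorem two_inv_pow_numLevels_le (hd : 0 < d) (hN : 0 < N) :
    (2 : ℝ)⁻¹ ^ numLevels d N ≤ √(d / N) := by
  have hN' : (0 : ℝ) < N := by exact_mod_cast hN
  set J := numLevels d N with hJ
  have h1 : Real.logb 2 (N / d) / 2 ≤ J := by
    rw [hJ, numLevels]
    push_cast
    linarith [Nat.le_ceil (Real.logb 2 (N / d) / 2)]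
  refine Real.le_sqrt_of_sq_le ?_
  have h2 : (N : ℝ) / d ≤ ((2 : ℝ) ^ J) ^ 2 := by
    have h3 : (N : ℝ) / d = (2 : ℝ) ^ (Real.logb 2 (N / d)) :=
      (Real.rpow_logb two_pos (by norm_num) (by positivity)).symm
    rw [h3, ← pow_mul, ← Real.rpow_natCast]
    refine Real.rpow_le_rpow_of_exponent_le one_le_two ?_
    push_cast
    linarith
  rw [inv_pow, inv_pow]
  have h4 : (d / N : ℝ) = ((N : ℝ) / d)⁻¹ := by rw [inv_div]
  rw [h4]
  exact inv_anti₀ (by positivity) h2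

/-- The regret of SupLinUCB along an outcome for which the noise is controlled by the widths. -/
theorem supLinUCB_regret_of_good {y : ℕ → Fin K → ℝ} {e : ℕ → ℝ} {θ : ι → ℝ} {ε s₀ ℓ G σ : ℝ}
    {F : ℕ → ℝ} (hsel : ∀ S : Finset (Fin K), S.Nonempty → sel S ∈ S) (hlam : 0 < lam)
    (hN : 0 < N) (hdι : d = Fintype.card ι) (hι : 0 < Fintype.card ι) (hσ : 0 < σ) (hs₀ : 0 ≤ s₀)
    (hβ : β = σ * (1 + s₀)) (hx : ∀ s a, x s a ⬝ᵥ x s a ≤ 1)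
    (hf : ∀ s a, |f s a - θ ⬝ᵥ x s a| ≤ ε) (hθ : lam * (θ ⬝ᵥ θ) ≤ σ ^ 2)
    (hy : ∀ s a, y s a = f s a + e s)
    (hF : ∀ s, ∃ a, F s = f s a) (hG : ∀ s a, F s - f s a ≤ G)
    (hℓ : Real.log (Fintype.card ι + N / lam) ≤ ℓ) (hℓ1 : 1 ≤ ℓ)
    (hgood : ∀ τ < N, ∀ j ≤ numLevels d N, ∀ a,
      |∑ s ∈ recorded sel lam β d N x y τ j, e s *
        (x s (play sel lam β d N x y s).1 ⬝ᵥ ((gram lam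
          (supLinUCBState sel lam β d N x y τ j))⁻¹ *ᵥ x τ a))| ≤
      σ * s₀ * √(x τ a ⬝ᵥ ((gram lam
        (supLinUCBState sel lam β d N x y τ j))⁻¹ *ᵥ x τ a))) :
    ∑ τ ∈ Finset.range N, (F τ - f τ (supLinUCBArm sel lam β d N x y τ)) ≤
      8 * d * ℓ * G + 8 * numLevels d N * β * √(2 * d * ℓ * N) + 2 * β * √(d * N) +
        2 * numLevels d N * N * (ε * (1 + √(2 * d * ℓ))) := by
  set J := numLevels d N with hJ
  have hN' : (0 : ℝ) < N := by exact_mod_cast hN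
  have hd1 : 1 ≤ d := by rw [hdι]; exact_mod_cast hι
  have hβ0 : 0 < β := by rw [hβ]; positivity
  have hε : 0 ≤ ε := by
    obtain ⟨a, _⟩ := hF 0
    exact (abs_nonneg _).trans (hf 0 a)
  have hG0 : 0 ≤ G := by
    obtain ⟨a, ha⟩ := hF 0
    have := hG 0 a
    rw [ha, sub_self] at this
    exact this
  set ε' := ε * (1 + √(2 * d * ℓ)) with hε'
  have hε'0 : 0 ≤ ε' := by positivity
  have hcard : ∀ {τ}, τ ≤ N → ∀ j, ((recorded sel lam β d N x y τ j).card : ℝ) *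
      ((2 : ℝ)⁻¹ ^ j) ^ 2 ≤ 2 * d * ℓ := by
    intro τ hτ j
    rw [hdι]
    exact card_recorded_le hsel hlam hβ0 hx hτ j hℓ hι
  have hcardN : ∀ {τ}, τ ≤ N → ∀ j, ((recorded sel lam β d N x y τ j).card : ℝ) ≤ N := by
    intro τ hτ j
    have : (recorded sel lam β d N x y τ j).card ≤ N := by
      refine le_trans ?_ hτ
      rw [recorded]
      exact (Finset.card_filter_le _ _).trans (by simp)
    exact_mod_cast this
  have hround : ∀ τ < N, F τ - f τ (supLinUCBArm sel lam β d N x y τ) ≤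
      2 * β * √(d / N) + 2 * J * ε' +
        ((if (play sel lam β d N x y τ).2 = some 1 then G else 0) +
          ∑ k ∈ Finset.Icc 1 J, if (play sel lam β d N x y τ).2 = some k then
            8 * (2 : ℝ)⁻¹ ^ k * β else 0) := by
    intro τ hτ
    have hacc : ∀ j ≤ J, ∀ a,
        (width lam β (supLinUCBState sel lam β d N x y τ j) (x τ a) ≤ β * (2 : ℝ)⁻¹ ^ j ∨
          width lam β (supLinUCBState sel lam β d N x y τ j) (x τ a) ≤ β * √(d / N)) →
        |thetaHat lam (supLinUCBState sel lam β d N x y τ j) ⬝ᵥ x τ a - f τ a| ≤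
          width lam β (supLinUCBState sel lam β d N x y τ j) (x τ a) + ε' := by
      intro j hj a hwid
      have h1 := abs_estimate_sub_le hlam (gram_state sel lam β d N x y τ j) (x τ a) θ
        (Y := fun s => y s (play sel lam β d N x y s).1) (ξ := e) (ε := ε) (σ := σ)
        (B := σ * s₀) (fun s _ => by
          have := hf s (play sel lam β d N x y s).1
          rw [hy]
          have e1 : f s (play sel lam β d N x y s).1 + e s -
            θ ⬝ᵥ x s (play sel lam β d N x y s).1 - e s = f s (play sel lam β d N x y s).1 -
              θ ⬝ᵥ x s (play sel lam β d N x y s).1 := by ring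
          rw [e1]
          exact this) hσ.le hθ (hgood τ hτ j hj a)
      rw [← thetaHat_state] at h1
      have hb : σ + σ * s₀ = β := by rw [hβ]; ring
      rw [hb] at h1
      have hw : width lam β (supLinUCBState sel lam β d N x y τ j) (x τ a) =
        β * √(x τ a ⬝ᵥ ((gram lam (supLinUCBState sel lam β d N x y τ j))⁻¹ *ᵥ x τ a)) := rfl
      rw [← hw] at h1
      rw [hw] at hwid
      set w := √(x τ a ⬝ᵥ ((gram lam (supLinUCBState sel lam β d N x y τ j))⁻¹ *ᵥ x τ a)) with hwd
      have hw0 : 0 ≤ w := Real.sqrt_nonneg _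
      set k := (recorded sel lam β d N x y τ j).card with hk
      -- If the width is below `2^{-j}` the potential bound applies; if it is below `√(d / N)`,
      -- bounding the count by `N` is enough. So the misspecification is amplified by no more than
      -- `√(2 d ℓ)`.
      have hkw : √k * w ≤ √(2 * d * ℓ) := by
        refine Real.le_sqrt_of_sq_le ?_
        rw [mul_pow, Real.sq_sqrt (Nat.cast_nonneg _)]
        rcases hwid with hwid | hwid
        · have h2 := le_of_mul_le_mul_left hwid hβ0
          refine le_trans ?_ (hcard hτ.le j)
          gcongr
        · have h2 := le_of_mul_le_mul_left hwid hβ0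
          calc (k : ℝ) * w ^ 2 ≤ N * √(d / N) ^ 2 := by
                have := hcardN hτ.le j
                rw [← hk] at this
                gcongr
            _ = d := by rw [Real.sq_sqrt (by positivity)]; field_simp
            _ ≤ 2 * d * ℓ := by nlinarith
      have h3 := hf τ a
      have h4 := mul_le_mul_of_nonneg_left hkw hε
      have h5 := abs_le.1 h1
      have h6 := abs_le.1 h3
      refine abs_le.2 ⟨?_, ?_⟩ <;> rw [hε', mul_add, mul_one] <;> linarith
    obtain ⟨abest, habest⟩ := hF τ
    have hfuel : 1 ≤ J := by rw [hJ, numLevels]; omega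
    have hreg := levelLoop_regret hsel hβ0.le (f := f τ) (F := F τ) (G := G) hε'0
      (two_inv_pow_numLevels_le (by linarith) hN) hacc (fuel := J) (j := 1) (A := Finset.univ)
      rfl le_rfl hfuel ⟨abest, Finset.mem_univ _, by rw [habest]; simp⟩
      (fun a _ => by rw [if_pos rfl]; exact hG τ a)
    obtain ⟨hr1, hr2⟩ := hreg
    have hpl : levelLoop sel lam β d N (x τ) (supLinUCBState sel lam β d N x y τ) J 1
      Finset.univ = play sel lam β d N x y τ := rfl
    rw [hpl] at hr1 hr2
    have harm : supLinUCBArm sel lam β d N x y τ = (play sel lam β d N x y τ).1 := rfl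
    rw [harm]
    have t1 : 0 ≤ 2 * β * √(d / N) := by positivity
    have t2 : 0 ≤ 2 * J * ε' := by positivity
    have t3 : 0 ≤ if (play sel lam β d N x y τ).2 = some 1 then G else 0 := by
      split_ifs
      · exact hG0
      · exact le_rfl
    have hnn : ∀ k, 0 ≤ if (play sel lam β d N x y τ).2 = some k then
        8 * (2 : ℝ)⁻¹ ^ k * β else 0 := by
      intro k; split_ifs
      · positivity
      · exact le_rfl
    have t4 := Finset.sum_nonneg fun k (_ : k ∈ Finset.Icc 1 J) => hnn k
    rcases hlev : (play sel lam β d N x y τ).2 with _ | k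
    · have := hr2 hlev
      rw [hlev] at t3 t4
      linarith
    · obtain ⟨hkJ, hk⟩ := hr1 k hlev
      have hk1 : 1 ≤ k := le_of_levelLoop_eq_some hlev
      rw [hlev] at t3 t4 hnn
      by_cases hk' : k = 1
      · subst hk'
        rw [if_pos rfl] at hk
        rw [if_pos rfl]
        linarith
      · rw [if_neg hk'] at hk
        have := Finset.single_le_sum (fun k' (_ : k' ∈ Finset.Icc 1 J) => hnn k')
          (Finset.mem_Icc.2 ⟨hk1, hkJ⟩)
        rw [if_pos rfl] at this
        linarith
  refine (Finset.sum_le_sum fun τ hτ => hround τ (Finset.mem_range.1 hτ)).trans ?_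
  have hcount : ∀ (k : ℕ) (c : ℝ), ∑ τ ∈ Finset.range N,
      (if (play sel lam β d N x y τ).2 = some k then c else 0) =
      (recorded sel lam β d N x y N k).card * c := by
    intro k c
    rw [← Finset.sum_filter, Finset.sum_const, nsmul_eq_mul]
    rfl
  rw [Finset.sum_add_distrib, Finset.sum_const, Finset.card_range, nsmul_eq_mul,
    Finset.sum_add_distrib, hcount, Finset.sum_comm]
  simp only [hcount]
  -- At level `1` no arm has been eliminated, so each of its at most `4 · 2 d ℓ` rounds may cost
  -- `G`.
  have a1 : ((recorded sel lam β d N x y N 1).card : ℝ) * G ≤ 8 * d * ℓ * G := by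
    have := hcard le_rfl 1
    have h2 : ((recorded sel lam β d N x y N 1).card : ℝ) ≤ 8 * d * ℓ := by
      norm_num at this
      linarith
    gcongr
  have a2 : ∑ k ∈ Finset.Icc 1 J, ((recorded sel lam β d N x y N k).card : ℝ) *
      (8 * (2 : ℝ)⁻¹ ^ k * β) ≤ 8 * J * β * √(2 * d * ℓ * N) := by
    have h1 : ∀ k, ((recorded sel lam β d N x y N k).card : ℝ) * (8 * (2 : ℝ)⁻¹ ^ k * β) ≤
        8 * β * √(2 * d * ℓ * N) := by
      intro k
      set q := ((recorded sel lam β d N x y N k).card : ℝ) with hq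
      have hq0 : 0 ≤ q := Nat.cast_nonneg _
      -- The geometric mean of the bounds `q 4^{-k} ≤ 2 d ℓ` and `q ≤ N`.
      have h2 : q * (2 : ℝ)⁻¹ ^ k ≤ √(2 * d * ℓ * N) := by
        refine Real.le_sqrt_of_sq_le ?_
        calc (q * (2 : ℝ)⁻¹ ^ k) ^ 2 = (q * ((2 : ℝ)⁻¹ ^ k) ^ 2) * q := by ring
          _ ≤ (2 * d * ℓ) * N := mul_le_mul (hcard le_rfl k) (hcardN le_rfl k) hq0
              (le_trans (by positivity) (hcard le_rfl k))
      have := mul_le_mul_of_nonneg_left h2 (by positivity : 0 ≤ 8 * β)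
      linarith
    calc _ ≤ ∑ _k ∈ Finset.Icc 1 J, 8 * β * √(2 * d * ℓ * N) := Finset.sum_le_sum fun k _ => h1 k
      _ = _ := by
        rw [Finset.sum_const, Nat.card_Icc, nsmul_eq_mul]
        push_cast
        ring_nf
  have a3 : N * (2 * β * √(d / N) + 2 * J * ε') = 2 * β * √(d * N) + 2 * J * N * ε' := by
    have : √(d * N) = N * √(d / N) := by
      have h1 : d * N = N ^ 2 * (d / N) := by field_simp
      rw [h1, Real.sqrt_mul (by positivity), Real.sqrt_sq hN'.le]
    rw [this]; ring
  linarith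

/-- The expected regret of SupLinUCB in a misspecified linear bandit. -/
theorem supLinUCB_regret {θ : ι → ℝ} {ε s₀ ℓ G : ℝ}
    {F : ℕ → ℝ} (hsel : ∀ S : Finset (Fin K), S.Nonempty → sel S ∈ S) (hlam : 0 < lam)
    (hN : 0 < N) (hdι : d = Fintype.card ι) (hι : 0 < Fintype.card ι) (hσ : 0 < σ) (hs₀ : 0 ≤ s₀)
    (hβ : β = σ * (1 + s₀)) (hx : ∀ s a, x s a ⬝ᵥ x s a ≤ 1)
    (hf : ∀ s a, |f s a - θ ⬝ᵥ x s a| ≤ ε) (hθ : lam * (θ ⬝ᵥ θ) ≤ (σ : ℝ) ^ 2)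
    (hF : ∀ s, ∃ a, F s = f s a) (hG : ∀ s a, F s - f s a ≤ G) (hFf : ∀ s a, f s a ≤ F s)
    (hℓ : Real.log (Fintype.card ι + N / lam) ≤ ℓ) (hℓ1 : 1 ≤ ℓ)
    (hξ : ∀ t, Measurable (ξ t)) (hind : iIndepFun ξ P)
    (hsub : ∀ t, HasSubgaussianMGF (ξ t) (σ ^ 2) P) :
    ∫ ω, ∑ τ ∈ Finset.range N,
        (F τ - f τ (supLinUCBArm sel lam β d N x (fun s a => f s a + ξ s ω) τ)) ∂P ≤
      8 * d * ℓ * G + 8 * numLevels d N * β * √(2 * d * ℓ * N) + 2 * β * √(d * N) +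
        2 * numLevels d N * N * (ε * (1 + √(2 * d * ℓ))) +
        N * (numLevels d N + 1) * K * (2 * Real.exp (-(s₀ ^ 2 / 2))) * (N * G) := by
  have hN' : (0 : ℝ) < N := by exact_mod_cast hN
  set R : Ω → ℝ := fun ω => ∑ τ ∈ Finset.range N,
        (F τ - f τ (supLinUCBArm sel lam β d N x (fun s a => f s a + ξ s ω) τ)) with hR
  set J := numLevels d N with hJ
  set C := 8 * d * ℓ * G + 8 * J * β * √(2 * d * ℓ * N) + 2 * β * √(d * N) +
        2 * J * N * (ε * (1 + √(2 * d * ℓ))) with hC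
  set bad : ℕ × ℕ × Fin K → Set Ω := fun p =>
    {ω | σ * s₀ * √(x p.1 p.2.2 ⬝ᵥ ((gram lam
        (supLinUCBState sel lam β d N x (fun s a => f s a + ξ s ω) p.1 p.2.1))⁻¹ *ᵥ x p.1 p.2.2)) <
      |∑ s ∈ recorded sel lam β d N x (fun s a => f s a + ξ s ω) p.1 p.2.1, ξ s ω *
        (x s (play sel lam β d N x (fun s a => f s a + ξ s ω) s).1 ⬝ᵥ ((gram lam
          (supLinUCBState sel lam β d N x (fun s a => f s a + ξ s ω) p.1 p.2.1))⁻¹ *ᵥ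
            x p.1 p.2.2))|} with hbad
  set I : Finset (ℕ × ℕ × Fin K) :=
    Finset.range N ×ˢ (Finset.range (J + 1) ×ˢ Finset.univ) with hI
  set Bd : Set Ω := ⋃ p ∈ I, bad p with hBd
  have hBdle : P.real Bd ≤ N * (J + 1) * K * (2 * Real.exp (-(s₀ ^ 2 / 2))) := by
    refine (measureReal_biUnion_finset_le _ _).trans ?_
    refine (Finset.sum_le_card_nsmul _ _ _ fun p _ =>
      measure_noise_gt_le hlam hξ hind hσ hsub hs₀ p.1 p.2.1 (x p.1 p.2.2)).trans (le_of_eq ?_)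
    rw [nsmul_eq_mul, hI, Finset.card_product, Finset.card_product, Finset.card_range,
      Finset.card_range, Finset.card_univ, Fintype.card_fin]
    push_cast
    ring
  have hRm : Measurable R := by
    refine Finset.measurable_sum _ fun τ _ => measurable_const.sub ?_
    exact (measurable_of_finite (f τ)).comp (measurable_supLinUCBArm sel lam β d N
      (x := fun _ => x) (fun _ _ _ => measurable_const) (fun s a => (hξ s).const_add _) τ)
  have hG0 : 0 ≤ G := by
    obtain ⟨a, ha⟩ := hF 0
    have := hG 0 a
    rw [ha, sub_self] at this
    exact this
  have hR0 : ∀ ω, 0 ≤ R ω := fun ω => Finset.sum_nonneg fun τ _ => sub_nonneg.2 (hFf _ _)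
  have hRG : ∀ ω, R ω ≤ N * G := by
    intro ω
    refine (Finset.sum_le_card_nsmul _ _ _ fun τ _ => hG τ _).trans (le_of_eq ?_)
    rw [Finset.card_range, nsmul_eq_mul]
  have hRgood : ∀ ω, ω ∉ Bd → R ω ≤ C := by
    intro ω hω
    refine supLinUCB_regret_of_good (e := fun s => ξ s ω) hsel hlam hN hdι hι (σ := σ) hσ hs₀ hβ hx
      hf hθ (fun s a => rfl) hF hG hℓ hℓ1 fun τ hτ j hj a => ?_
    by_contra hcon
    push Not at hcon
    refine hω (Set.mem_biUnion (x := (τ, j, a)) ?_ hcon)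
    simp only [hI, Finset.coe_product, Set.mem_prod, Finset.coe_range, Set.mem_Iio,
      Finset.coe_univ, Set.mem_univ, and_true]
    exact ⟨hτ, by omega⟩
  have hC0 : 0 ≤ C := by
    have hd1 : 0 ≤ d := by rw [hdι]; positivity
    have hε : 0 ≤ ε := by
      obtain ⟨a, _⟩ := hF 0
      exact (abs_nonneg _).trans (hf 0 a)
    have hβ0 : 0 ≤ β := by rw [hβ]; positivity
    positivity
  have hRint : Integrable R P := by
    refine Integrable.of_bound hRm.aestronglyMeasurable (N * G) (Filter.Eventually.of_forall
      fun ω => ?_)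
    rw [Real.norm_eq_abs, abs_of_nonneg (hR0 ω)]
    exact hRG ω
  -- A measurable hull of the same measure replaces the bad event, whose own measurability is then
  -- not needed.
  set Bm := toMeasurable P Bd with hBm
  have hBmm : MeasurableSet Bm := measurableSet_toMeasurable P Bd
  have hBmle : P.real Bm = P.real Bd := by
    rw [measureReal_def, measureReal_def, measure_toMeasurable]
  have hle : ∀ ω, R ω ≤ C + Bm.indicator (fun _ => N * G) ω := by
    intro ω
    by_cases hω : ω ∈ Bm
    · rw [Set.indicator_of_mem hω]
      linarith [hRG ω]
    · rw [Set.indicator_of_notMem hω, add_zero]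
      exact hRgood ω fun h => hω (subset_toMeasurable P Bd h)
  have hIint : Integrable (Bm.indicator fun _ => N * G) P := (integrable_const _).indicator hBmm
  calc ∫ ω, R ω ∂P ≤ ∫ ω, (C + Bm.indicator (fun _ => N * G) ω) ∂P :=
        integral_mono hRint ((integrable_const _).add hIint) hle
    _ = C + P.real Bm * (N * G) := by
        rw [integral_add (integrable_const _) hIint, integral_indicator_const _ hBmm]
        simp
    _ ≤ C + N * (J + 1) * K * (2 * Real.exp (-(s₀ ^ 2 / 2))) * (N * G) := by
        rw [hBmle]
        gcongr

end Concentration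

end LowRankBandit

end

/-! ### From the exploration error to the regret of the two phases. -/

noncomputable section

namespace LowRankBandit

open scoped Matrix.Norms.L2Operator

/-! ### Misspecification of the features -/

section Features

variable {m n r : ℕ}

/-- The coordinates of `M` in the bases `W` and `Z`. -/
def featureParam (r : ℕ) (M : Matrix (Fin m) (Fin n) ℝ) (W : Matrix (Fin m) (Fin m) ℝ)
    (Z : Matrix (Fin n) (Fin n) ℝ) : FeatureIndex m n r → ℝ :=
  fun q => (Wᵀ * M * Z) q.1.1 q.1.2

theorem sum_featureIndex (F : Fin m → Fin n → ℝ) :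
    ∑ q : FeatureIndex m n r, F q.1.1 q.1.2 =
      ∑ a : Fin m, ∑ b : Fin n, if (a : ℕ) < r ∨ (b : ℕ) < r then F a b else 0 := by
  rw [← Fintype.sum_prod_type' (fun (a : Fin m) (b : Fin n) => if (a : ℕ) < r ∨ (b : ℕ) < r then F a b else 0),
    ← Finset.sum_filter]
  exact (Finset.sum_subtype (Finset.univ.filter fun q : Fin m × Fin n =>
    (q.1 : ℕ) < r ∨ (q.2 : ℕ) < r) (by simp) (fun q => F q.1 q.2)).symm

theorem sum_featureIndex_le {F : Fin m → Fin n → ℝ} (hF : ∀ a b, 0 ≤ F a b) :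
    ∑ q : FeatureIndex m n r, F q.1.1 q.1.2 ≤ ∑ a, ∑ b, F a b := by
  rw [sum_featureIndex]
  refine Finset.sum_le_sum fun a _ => Finset.sum_le_sum fun b _ => ?_
  split_ifs
  · exact le_rfl
  · exact hF a b

theorem sum_sq_row_of_orthogonal {W : Matrix (Fin m) (Fin m) ℝ} (hW : Wᵀ * W = 1) (i : Fin m) :
    ∑ a, W i a ^ 2 = 1 := by
  have h := mul_eq_one_comm.1 hW
  have := congrFun (congrFun h i) i
  rw [Matrix.mul_apply, Matrix.one_apply_eq] at this
  simpa [Matrix.transpose_apply, sq] using this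

theorem feature_dotProduct_self_le {W : Matrix (Fin m) (Fin m) ℝ} {Z : Matrix (Fin n) (Fin n) ℝ}
    (hW : Wᵀ * W = 1) (hZ : Zᵀ * Z = 1) (i : Fin m) (j : Fin n) :
    feature r W Z i j ⬝ᵥ feature r W Z i j ≤ 1 := by
  have h := sum_featureIndex_le (r := r) (F := fun a b => (W i a * Z j b) ^ 2)
    fun a b => sq_nonneg _
  calc feature r W Z i j ⬝ᵥ feature r W Z i j =
        ∑ q : FeatureIndex m n r, (W i q.1.1 * Z j q.1.2) ^ 2 := by
        simp only [dotProduct, feature, sq]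
    _ ≤ ∑ a, ∑ b, (W i a * Z j b) ^ 2 := h
    _ = 1 := by
      simp only [mul_pow, ← Finset.mul_sum, sum_sq_row_of_orthogonal hZ, mul_one,
        sum_sq_row_of_orthogonal hW]

theorem sum_sq_eq_trace (A : Matrix (Fin m) (Fin n) ℝ) : ∑ a, ∑ b, A a b ^ 2 = (A * Aᵀ).trace := by
  simp only [Matrix.trace, Matrix.diag_apply, Matrix.mul_apply, Matrix.transpose_apply, sq]

/-- The Frobenius norm is invariant under orthogonal changes of bases. The regularization of
SupLinUCB is calibrated to this size. -/
theorem featureParam_dotProduct_self_le {M : Matrix (Fin m) (Fin n) ℝ}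
    {W : Matrix (Fin m) (Fin m) ℝ} {Z : Matrix (Fin n) (Fin n) ℝ}
    (hW : Wᵀ * W = 1) (hZ : Zᵀ * Z = 1) {B : ℝ} (hM : ∀ i j, |M i j| ≤ B) :
    featureParam r M W Z ⬝ᵥ featureParam r M W Z ≤ m * n * B ^ 2 := by
  have h := sum_featureIndex_le (r := r) (F := fun a b => (Wᵀ * M * Z) a b ^ 2)
    fun a b => sq_nonneg _
  have h1 : ∑ a, ∑ b, (Wᵀ * M * Z) a b ^ 2 = ∑ a, ∑ b, M a b ^ 2 := by
    rw [sum_sq_eq_trace, sum_sq_eq_trace]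
    have e1 : Wᵀ * M * Z * (Wᵀ * M * Z)ᵀ = Wᵀ * (M * (Z * Zᵀ) * Mᵀ * W) := by
      simp only [Matrix.transpose_mul, Matrix.transpose_transpose, Matrix.mul_assoc]
    rw [e1, mul_eq_one_comm.1 hZ, Matrix.mul_one, Matrix.trace_mul_comm, Matrix.mul_assoc,
      mul_eq_one_comm.1 hW, Matrix.mul_one]
  calc featureParam r M W Z ⬝ᵥ featureParam r M W Z =
        ∑ q : FeatureIndex m n r, (Wᵀ * M * Z) q.1.1 q.1.2 ^ 2 := by
        simp only [dotProduct, featureParam, sq]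
    _ ≤ ∑ a, ∑ b, M a b ^ 2 := h.trans h1.le
    _ ≤ ∑ _a : Fin m, ∑ _b : Fin n, B ^ 2 := by
      refine Finset.sum_le_sum fun a _ => Finset.sum_le_sum fun b _ => ?_
      exact sq_le_sq' (by linarith [(abs_le.1 (hM a b)).1]) (abs_le.1 (hM a b)).2
    _ = m * n * B ^ 2 := by simp [mul_assoc]

/-- The part of `M` that the features cannot represent. -/
theorem sub_featureParam_dotProduct {M : Matrix (Fin m) (Fin n) ℝ}
    {W : Matrix (Fin m) (Fin m) ℝ} {Z : Matrix (Fin n) (Fin n) ℝ}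
    (hW : Wᵀ * W = 1) (hZ : Zᵀ * Z = 1) (hm : r ≤ m) (hn : r ≤ n) (i : Fin m) (j : Fin n) :
    M i j - featureParam r M W Z ⬝ᵥ feature r W Z i j =
      (((1 : Matrix (Fin m) (Fin m) ℝ) - leadingCols hm W * (leadingCols hm W)ᵀ) * M *
        ((1 : Matrix (Fin n) (Fin n) ℝ) - leadingCols hn Z * (leadingCols hn Z)ᵀ)) i j := by
  rw [one_sub_leadingCols_mul_transpose hm hW, one_sub_leadingCols_mul_transpose hn hZ]
  set Y := Wᵀ * M * Z with hY
  have h1 : M = W * Y * Zᵀ := by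
    rw [hY]
    calc M = (W * Wᵀ) * M * (Z * Zᵀ) := by
          rw [mul_eq_one_comm.1 hW, mul_eq_one_comm.1 hZ, Matrix.one_mul, Matrix.mul_one]
      _ = _ := by simp only [Matrix.mul_assoc]
  have h2 : W * tailDiag m r * Wᵀ * M * (Z * tailDiag n r * Zᵀ) =
      W * (tailDiag m r * Y * tailDiag n r) * Zᵀ := by
    rw [hY]; simp only [Matrix.mul_assoc]
  have h3 : ∀ A : Matrix (Fin m) (Fin n) ℝ, (W * A * Zᵀ) i j =
      ∑ a, ∑ b, W i a * Z j b * A a b := by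
    intro A
    rw [Matrix.mul_assoc, Matrix.mul_apply]
    refine Finset.sum_congr rfl fun a _ => ?_
    rw [Matrix.mul_apply, Finset.mul_sum]
    refine Finset.sum_congr rfl fun b _ => ?_
    rw [Matrix.transpose_apply]; ring
  rw [h2, h3]
  have h4 : M i j = ∑ a, ∑ b, W i a * Z j b * Y a b := by rw [← h3, ← h1]
  have h5 : featureParam r M W Z ⬝ᵥ feature r W Z i j =
      ∑ a : Fin m, ∑ b : Fin n, if (a : ℕ) < r ∨ (b : ℕ) < r then W i a * Z j b * Y a b else 0 := by
    rw [← sum_featureIndex]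
    simp only [dotProduct, featureParam, feature, hY]
    exact Finset.sum_congr rfl fun q _ => by ring
  rw [h4, h5, ← Finset.sum_sub_distrib]
  refine Finset.sum_congr rfl fun a _ => ?_
  rw [← Finset.sum_sub_distrib]
  refine Finset.sum_congr rfl fun b _ => ?_
  rw [tailDiag, tailDiag, Matrix.mul_diagonal, Matrix.diagonal_mul]
  by_cases ha : (a : ℕ) < r <;> by_cases hb : (b : ℕ) < r <;> simp [ha, hb]

/-- The unrepresented block factors through the two subspace errors, so an entry is a bilinear form
in one row of each. This makes the misspecification quadratic. -/
theorem abs_sub_featureParam_le {M : Matrix (Fin m) (Fin n) ℝ}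
    {W : Matrix (Fin m) (Fin m) ℝ} {Z : Matrix (Fin n) (Fin n) ℝ}
    {U : Matrix (Fin m) (Fin r) ℝ} {V : Matrix (Fin n) (Fin r) ℝ} {S : Matrix (Fin r) (Fin r) ℝ}
    (hW : Wᵀ * W = 1) (hZ : Zᵀ * Z = 1) (hm : r ≤ m) (hn : r ≤ n)
    (hM : M = U * S * Vᵀ) {σ₁ : ℝ} (hS : ‖S‖ ≤ σ₁) (i : Fin m) (j : Fin n) {a b : ℝ}
    (ha : ‖unitRow i * ((1 - leadingCols hm W * (leadingCols hm W)ᵀ) * U)‖ ≤ a)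
    (hb : ‖unitRow j * ((1 - leadingCols hn Z * (leadingCols hn Z)ᵀ) * V)‖ ≤ b) :
    |M i j - featureParam r M W Z ⬝ᵥ feature r W Z i j| ≤ σ₁ * (a * b) := by
  rw [sub_featureParam_dotProduct hW hZ hm hn]
  set Pc := 1 - leadingCols hm W * (leadingCols hm W)ᵀ with hPc
  set Qc := 1 - leadingCols hn Z * (leadingCols hn Z)ᵀ with hQc
  have hQt : Qcᵀ = Qc := by
    rw [hQc, Matrix.transpose_sub, Matrix.transpose_mul, Matrix.transpose_transpose,
      Matrix.transpose_one]
  have h1 : (Pc * M * Qc) i j =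
      ((unitRow i * (Pc * U)) * S * (unitRow j * (Qc * V))ᵀ) 0 0 := by
    have e1 : (unitRow i * (Pc * U)) * S * (unitRow j * (Qc * V))ᵀ =
        unitRow i * ((Pc * M * Qc) * (unitRow j)ᵀ) := by
      rw [hM]
      simp only [Matrix.transpose_mul, hQt, Matrix.mul_assoc]
    rw [e1, unitRow_mul]
    have e2 : (Pc * M * Qc) * (unitRow j)ᵀ = (unitRow j * (Pc * M * Qc)ᵀ)ᵀ := by
      rw [Matrix.transpose_mul, Matrix.transpose_transpose]
    rw [e2, Matrix.transpose_apply, unitRow_mul, Matrix.transpose_apply]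
  rw [h1]
  refine (abs_apply_le_norm _ 0 0).trans ?_
  refine (Matrix.l2_opNorm_mul _ _).trans ?_
  rw [norm_transpose]
  have ha0 := (norm_nonneg _).trans ha
  have hσ0 : 0 ≤ σ₁ := (norm_nonneg _).trans hS
  calc _ ≤ (‖unitRow i * (Pc * U)‖ * ‖S‖) * ‖unitRow j * (Qc * V)‖ := by
        gcongr; exact Matrix.l2_opNorm_mul _ _
    _ ≤ (a * σ₁) * b := by gcongr
    _ = _ := by ring

end Features

end LowRankBandit

end

noncomputable section

namespace LowRankBandit

open scoped Matrix.Norms.L2Operator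

/-! ### Row-wise error of the estimated singular subspaces -/

section RowError

variable {T m n r : ℕ} {E : Matrix (Fin m) (Fin n) ℝ} {U Uh : Matrix (Fin m) (Fin r) ℝ}
  {V Vh : Matrix (Fin n) (Fin r) ℝ} {S Si : Matrix (Fin r) (Fin r) ℝ}

/-- Everything is brought to the form `u √N`: `hru` trades `√r` for it in the main term, and `hbr`
trades `√(b r / T)` for `√N` in the second term of Bernstein's inequality. -/
theorem sampling_fluctuation_le {b L u ℓ σr N r T : ℝ} (hb : 0 ≤ b) (hT : 0 < T) (hL : 0 ≤ L)
    (hu : 0 ≤ u) (hℓ : 1 ≤ ℓ) (hσr : 0 < σr) (hN : 0 ≤ N) (hr : 0 ≤ r)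
    (hru : r ≤ u ^ 2 * N) (hbr : b / T * r ≤ N) :
    √r * (L * (2 * √(3 * b * ℓ / T) + 2 * b * u * ℓ / T)) / σr ≤
      6 * ℓ * u * (L * √(b * N / T) / σr) := by
  set x := √(b / T) with hx
  have hx2 : x ^ 2 = b / T := Real.sq_sqrt (by positivity)
  have e1 : √(3 * b * ℓ / T) ≤ 2 * ℓ * x := by
    refine Real.sqrt_le_iff.2 ⟨by positivity, ?_⟩
    rw [mul_pow, hx2]
    have : 3 * b * ℓ / T = 3 * ℓ * (b / T) := by ring
    rw [this]
    have : 0 ≤ b / T := by positivity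
    gcongr
    nlinarith
  have e2 : √(b * N / T) = x * √N := by
    rw [hx, ← Real.sqrt_mul (by positivity)]; congr 1; ring
  have e3 : √r ≤ u * √N := by
    rw [← Real.sqrt_sq hu, ← Real.sqrt_mul (sq_nonneg u)]; exact Real.sqrt_le_sqrt hru
  have e4 : x * √r ≤ √N := by
    rw [hx, ← Real.sqrt_mul (by positivity)]; exact Real.sqrt_le_sqrt hbr
  have e5 : 2 * b * u * ℓ / T = 2 * ℓ * u * x ^ 2 := by rw [hx2]; ring
  rw [e2, e5]
  have hx0 : 0 ≤ x := Real.sqrt_nonneg _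
  have h1 : √r * (2 * √(3 * b * ℓ / T) + 2 * ℓ * u * x ^ 2) ≤ 6 * ℓ * u * (x * √N) := by
    calc √r * (2 * √(3 * b * ℓ / T) + 2 * ℓ * u * x ^ 2)
        ≤ √r * (2 * (2 * ℓ * x) + 2 * ℓ * u * x ^ 2) := by gcongr
      _ = 4 * ℓ * x * √r + 2 * ℓ * u * x * (x * √r) := by ring
      _ ≤ 4 * ℓ * x * (u * √N) + 2 * ℓ * u * x * √N := by gcongr
      _ = _ := by ring
  calc _ = L / σr * (√r * (2 * √(3 * b * ℓ / T) + 2 * ℓ * u * x ^ 2)) := by ring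
    _ ≤ L / σr * (6 * ℓ * u * (x * √N)) := by gcongr
    _ = _ := by ring

/-- Here the second term of Bernstein's inequality lacks the factor `u`; the additional `δ` makes up
for it through `hbr`. -/
theorem quadratic_fluctuation_le {b L u ℓ σr N r T δ : ℝ} (hb : 0 ≤ b) (hT : 0 < T) (hL : 0 ≤ L)
    (hu : 0 ≤ u) (hℓ : 1 ≤ ℓ) (hσr : 0 < σr) (hN : 0 ≤ N) (hr : 0 ≤ r) (hδ0 : 0 ≤ δ)
    (hδ : δ ≤ 1 / 64) (hru : r ≤ u ^ 2 * N) (hbr : δ ^ 2 * (b / T) * r ≤ u ^ 2 * N) :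
    √r * (δ * (L * (2 * √(3 * (b * (2 + 2 * ℓ)) * ℓ / T) + 2 * b * ℓ / T))) / σr ≤
      3 * ℓ * u * (L * √(b * N / T) / σr) := by
  set x := √(b / T) with hx
  have hx2 : x ^ 2 = b / T := Real.sq_sqrt (by positivity)
  have e1 : √(3 * (b * (2 + 2 * ℓ)) * ℓ / T) ≤ 4 * ℓ * x := by
    refine Real.sqrt_le_iff.2 ⟨by positivity, ?_⟩
    rw [mul_pow, hx2]
    have : 3 * (b * (2 + 2 * ℓ)) * ℓ / T = 3 * (2 + 2 * ℓ) * ℓ * (b / T) := by ring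
    rw [this]
    have : 0 ≤ b / T := by positivity
    gcongr
    nlinarith
  have e2 : √(b * N / T) = x * √N := by
    rw [hx, ← Real.sqrt_mul (by positivity)]; congr 1; ring
  have e3 : √r ≤ u * √N := by
    rw [← Real.sqrt_sq hu, ← Real.sqrt_mul (sq_nonneg u)]; exact Real.sqrt_le_sqrt hru
  have e4 : δ * x * √r ≤ u * √N := by
    rw [← Real.sqrt_sq hu, ← Real.sqrt_mul (sq_nonneg u), hx, ← Real.sqrt_sq hδ0,
      ← Real.sqrt_mul (sq_nonneg δ), ← Real.sqrt_mul (by positivity)]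
    exact Real.sqrt_le_sqrt hbr
  have e5 : 2 * b * ℓ / T = 2 * ℓ * x ^ 2 := by rw [hx2]; ring
  rw [e2, e5]
  have hx0 : 0 ≤ x := Real.sqrt_nonneg _
  have h1 : √r * (δ * (2 * √(3 * (b * (2 + 2 * ℓ)) * ℓ / T) + 2 * ℓ * x ^ 2)) ≤
      3 * ℓ * u * (x * √N) := by
    calc √r * (δ * (2 * √(3 * (b * (2 + 2 * ℓ)) * ℓ / T) + 2 * ℓ * x ^ 2))
        ≤ √r * (δ * (2 * (4 * ℓ * x) + 2 * ℓ * x ^ 2)) := by gcongr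
      _ = 8 * ℓ * x * δ * √r + 2 * ℓ * x * (δ * x * √r) := by ring
      _ ≤ 8 * ℓ * x * (1 / 64) * (u * √N) + 2 * ℓ * x * (u * √N) := by gcongr
      _ ≤ _ := by
        have : 0 ≤ ℓ * x * (u * √N) := by positivity
        linarith
  calc _ = L / σr * (√r * (δ * (2 * √(3 * (b * (2 + 2 * ℓ)) * ℓ / T) + 2 * ℓ * x ^ 2))) := by ring
    _ ≤ L / σr * (3 * ℓ * u * (x * √N)) := by gcongr
    _ = _ := by ring

/-- Each term of `row_bound` becomes `u` times a relative error. The third-order term contains no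
row of `U`, so there the factor `u` comes from `δ² ≤ u`. -/
theorem RowGood.norm_row_le (hE : IsPerturbedSubspace E U Uh V Vh S Si)
    {b L u ℓ σ₁ σr N T : ℝ} {i : Fin m}
    (h : RowGood E U V u σ₁ ℓ (L * (2 * √(3 * b * ℓ / T) + 2 * b * u * ℓ / T))
      (L * (2 * √(3 * (b * (2 + 2 * ℓ)) * ℓ / T) + 2 * b * ℓ / T)) i)
    (hb : 0 ≤ b) (hT : 0 < T) (hL : 0 ≤ L) (hu : 0 ≤ u) (hℓ : 1 ≤ ℓ) (hN : 0 ≤ N) (hσr : 0 < σr)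
    (hσ : σr ≤ σ₁) (hS : ‖S‖ ≤ σ₁) (hSi : ‖Si‖ ≤ 1 / σr)
    (hUi : √(∑ k, U i k ^ 2) ≤ u) (hκ : σ₁ / σr * (‖E‖ / σr) ^ 2 ≤ 1 / 64)
    (hδ : ‖E‖ / σr ≤ 1 / 64) (hδu : (‖E‖ / σr) ^ 2 ≤ u) (hru : (r : ℝ) ≤ u ^ 2 * N)
    (hbr : b / T * r ≤ N) (hbr' : (‖E‖ / σr) ^ 2 * (b / T) * r ≤ u ^ 2 * N) :
    ‖unitRow i * ((1 - Uh * Uhᵀ) * U)‖ ≤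
      60 * ℓ * (σ₁ / σr) * u * (L * √(b * N / T) / σr + ‖E‖ / σr) := by
  have h0 := hE.row_bound hσr hS hSi hκ hδ (unitRow i) (norm_unitRow_le i)
  have h1 := (norm_unitRow_mul_le i U).trans hUi
  have h2 := sampling_fluctuation_le hb hT hL hu hℓ hσr hN (Nat.cast_nonneg r) hru hbr
  have hδ0 : 0 ≤ ‖E‖ / σr := by positivity
  have h3 := quadratic_fluctuation_le hb hT hL hu hℓ hσr hN (Nat.cast_nonneg r) hδ0 hδ hru hbr'
  obtain ⟨h4, h5⟩ := h
  set D := L * √(b * N / T) / σr with hD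
  have hD0 : 0 ≤ D := by positivity
  set δ := ‖E‖ / σr with hδdef
  set κ := σ₁ / σr with hκdef
  have hκ1 : 1 ≤ κ := (one_le_div hσr).2 hσ
  have h6 : ‖unitRow i * E * V‖ / σr ≤ 6 * ℓ * u * D :=
    (div_le_div_of_nonneg_right h4 hσr.le).trans h2
  have h7 : ‖unitRow i * E * Eᵀ * U‖ / σr ^ 2 ≤
      δ ^ 2 * u + (1 + 2 * ℓ) * (u * κ * δ) + 3 * ℓ * u * D := by
    refine (div_le_div_of_nonneg_right h5 (sq_nonneg σr)).trans ?_
    have : ∀ β : ℝ, (‖E‖ ^ 2 * u + (1 + 2 * ℓ) * (u * σ₁ * ‖E‖) + √r * (‖E‖ * β)) / σr ^ 2 =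
        δ ^ 2 * u + (1 + 2 * ℓ) * (u * κ * δ) + √r * (δ * β) / σr := by
      intro β
      rw [hδdef, hκdef]; field_simp
    rw [this]
    gcongr
  have h8 : δ ^ 2 * u ≤ u * δ := by nlinarith [mul_nonneg hu hδ0]
  have h9 : δ ^ 3 ≤ u * δ := by
    calc δ ^ 3 = δ ^ 2 * δ := by ring
      _ ≤ _ := by gcongr
  have h10 : ‖unitRow i * U‖ * δ ≤ u * δ := by gcongr
  have hA : 0 ≤ u * δ := by positivity
  have hB : u * D * ℓ ≤ u * D * ℓ * κ := le_mul_of_one_le_right (by positivity) hκ1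
  have hC : u * δ ≤ u * δ * κ := le_mul_of_one_le_right hA hκ1
  have hC' : u * δ * κ ≤ u * δ * κ * ℓ := le_mul_of_one_le_right (by positivity) hℓ
  nlinarith

/-- On the event that the exploration estimate is good, the features represent the reward matrix up
to an error that is quadratic in the relative perturbation. -/
theorem misspecification_le {M : Matrix (Fin m) (Fin n) ℝ} {A : Matrix (Fin m) (Fin n) ℝ}
    {W : Matrix (Fin m) (Fin m) ℝ} {Z : Matrix (Fin n) (Fin n) ℝ} (hA : IsFullSVD A W Z)
    (hm : r ≤ m) (hn : r ≤ n) (hU : Uᵀ * U = 1) (hV : Vᵀ * V = 1) (hSSi : S * Si = 1)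
    (hSt : Sᵀ = S) (hM : M = U * S * Vᵀ) (hAE : E = A - M)
    {b L u ℓ σ₁ σr N T : ℝ} {i : Fin m} {j : Fin n}
    (hi : RowGood E U V u σ₁ ℓ (L * (2 * √(3 * b * ℓ / T) + 2 * b * u * ℓ / T))
      (L * (2 * √(3 * (b * (2 + 2 * ℓ)) * ℓ / T) + 2 * b * ℓ / T)) i)
    (hj : RowGood Eᵀ V U u σ₁ ℓ (L * (2 * √(3 * b * ℓ / T) + 2 * b * u * ℓ / T))
      (L * (2 * √(3 * (b * (2 + 2 * ℓ)) * ℓ / T) + 2 * b * ℓ / T)) j)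
    (hb : 0 ≤ b) (hT : 0 < T) (hL : 0 ≤ L) (hu : 0 ≤ u) (hℓ : 1 ≤ ℓ) (hN : 0 ≤ N) (hσr : 0 < σr)
    (hσ : σr ≤ σ₁) (hS : ‖S‖ ≤ σ₁) (hSi : ‖Si‖ ≤ 1 / σr)
    (hUi : √(∑ k, U i k ^ 2) ≤ u) (hVj : √(∑ k, V j k ^ 2) ≤ u)
    (hκ : σ₁ / σr * (‖E‖ / σr) ^ 2 ≤ 1 / 64)
    (hδ : ‖E‖ / σr ≤ 1 / 64) (hδu : (‖E‖ / σr) ^ 2 ≤ u) (hru : (r : ℝ) ≤ u ^ 2 * N)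
    (hbr : b / T * r ≤ N) (hbr' : (‖E‖ / σr) ^ 2 * (b / T) * r ≤ u ^ 2 * N) :
    |M i j - featureParam r M W Z ⬝ᵥ feature r W Z i j| ≤
      7200 * ℓ ^ 2 * (σ₁ * (σ₁ / σr) ^ 2 * u ^ 2) *
        ((L * √(b * N / T) / σr) ^ 2 + (‖E‖ / σr) ^ 2) := by
  have hE : IsPerturbedSubspace E U (leadingCols hm W) V (leadingCols hn Z) S Si :=
    hA.isPerturbedSubspace hm hn hU hV hSSi hSt (by rw [hAE, hM]; abel)
  have h1 := hi.norm_row_le hE hb hT hL hu hℓ hN hσr hσ hS hSi hUi hκ hδ hδu hru hbr hbr'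
  have ht : ‖Eᵀ‖ = ‖E‖ := norm_transpose E
  have h2 := hj.norm_row_le hE.transpose hb hT hL hu hℓ hN hσr hσ hS hSi hVj
    (by rwa [ht]) (by rwa [ht]) (by rwa [ht]) hru hbr (by rwa [ht])
  rw [ht] at h2
  refine (abs_sub_featureParam_le hA.1 hA.2.1 hm hn hM hS i j h1 h2).trans ?_
  set D := L * √(b * N / T) / σr
  set δ := ‖E‖ / σr
  have h3 : (D + δ) ^ 2 ≤ 2 * (D ^ 2 + δ ^ 2) := by nlinarith [sq_nonneg (D - δ)]
  have hσ1 : 0 ≤ σ₁ := hσr.le.trans hσ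
  calc _ = 3600 * ℓ ^ 2 * (σ₁ * (σ₁ / σr) ^ 2 * u ^ 2) * (D + δ) ^ 2 := by ring
    _ ≤ 3600 * ℓ ^ 2 * (σ₁ * (σ₁ / σr) ^ 2 * u ^ 2) * (2 * (D ^ 2 + δ ^ 2)) := by gcongr
    _ = _ := by ring

end RowError

end LowRankBandit

end

noncomputable section

namespace LowRankBandit

open scoped Matrix.Norms.L2Operator

/-! ### The exploration phase as a sampling scheme -/

section IndepTriple

variable {Ω α β γ : Type*} [MeasurableSpace Ω] [MeasurableSpace α] [MeasurableSpace β]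
  [MeasurableSpace γ] {P : Measure Ω} {X : Ω → α} {Y : Ω → β} {Z : Ω → γ}
  {μ : Measure α} {ν : Measure β} {π : Measure γ}
  [IsProbabilityMeasure μ] [IsProbabilityMeasure ν] [IsProbabilityMeasure π]

theorem indepFun_of_map_prod_eq (hX : Measurable X) (hY : Measurable Y)
    (h : P.map (fun ω => (X ω, Y ω)) = μ.prod ν) :
    IndepFun X Y P ∧ P.map X = μ ∧ P.map Y = ν := by
  have h1 : P.map X = μ := by
    have : P.map X = (P.map (fun ω => (X ω, Y ω))).map Prod.fst := by
      rw [Measure.map_map measurable_fst (hX.prodMk hY)]; rfl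
    rw [this, h, Measure.map_fst_prod, measure_univ, one_smul]
  have h2 : P.map Y = ν := by
    have : P.map Y = (P.map (fun ω => (X ω, Y ω))).map Prod.snd := by
      rw [Measure.map_map measurable_snd (hX.prodMk hY)]; rfl
    rw [this, h, Measure.map_snd_prod, measure_univ, one_smul]
  have : IsProbabilityMeasure (P.map X) := h1 ▸ inferInstance
  have hP : IsProbabilityMeasure P :=
    (Measure.isProbabilityMeasure_map_iff hX.aemeasurable).1 this
  refine ⟨?_, h1, h2⟩
  rw [indepFun_iff_map_prod_eq_prod_map_map hX.aemeasurable hY.aemeasurable, h, h1, h2]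

theorem map_assoc_of_map_prod_eq (hX : Measurable X) (hY : Measurable Y) (hZ : Measurable Z)
    (h : P.map (fun ω => (X ω, Y ω, Z ω)) = μ.prod (ν.prod π)) :
    P.map (fun ω => ((X ω, Y ω), Z ω)) = (μ.prod ν).prod π := by
  have h1 := (measurePreserving_prodAssoc μ ν π).symm
  rw [← h1.map_eq, ← h, Measure.map_map h1.measurable (hX.prodMk (hY.prodMk hZ))]
  rfl

theorem map_swap_of_map_prod_eq (hX : Measurable X) (hY : Measurable Y) (hZ : Measurable Z)
    (h : P.map (fun ω => (X ω, Y ω, Z ω)) = μ.prod (ν.prod π)) :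
    P.map (fun ω => (Y ω, X ω, Z ω)) = ν.prod (μ.prod π) := by
  have h1 := (measurePreserving_prodAssoc ν μ π).comp
    (Measure.measurePreserving_swap.prod (MeasurePreserving.id π) :
      MeasurePreserving _ ((μ.prod ν).prod π) _)
  rw [← h1.map_eq, ← map_assoc_of_map_prod_eq hX hY hZ h,
    Measure.map_map h1.measurable ((hX.prodMk hY).prodMk hZ)]
  rfl

end IndepTriple

theorem le_of_orthonormal {m r : ℕ} {U : Matrix (Fin m) (Fin r) ℝ} (hU : Uᵀ * U = 1) : r ≤ m := by
  have h1 : (Uᵀ * U).rank = r := by rw [hU, Matrix.rank_one, Fintype.card_fin]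
  have h2 := Matrix.rank_mul_le_right Uᵀ U
  have h3 := Matrix.rank_le_height U
  omega

theorem sampleErr_transpose {T m n : ℕ} (p : Fin m → ℝ) (q : Fin n → ℝ)
    (M : Matrix (Fin m) (Fin n) ℝ) (c : Fin T → Fin m) (e : Fin T → Fin n) (x : Fin T → ℝ) :
    sampleErr q p Mᵀ e c x = (sampleErr p q M c e x)ᵀ := by
  ext j i
  simp only [sampleErr, Matrix.transpose_apply, Matrix.sub_apply, Matrix.smul_apply,
    Matrix.sum_apply, obsMat_apply, and_comm, mul_comm (q j)]

theorem empiricalMatrix_eq {T m n : ℕ} (ρ : PMF (Fin m)) (M : Matrix (Fin m) (Fin n) ℝ)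
    (c : ℕ → Fin m) (e : ℕ → Fin n) (x : ℕ → ℝ) :
    empiricalMatrix ρ T c e (fun t j => M (c t) j + x t) =
      M + sampleErr (fun i => (ρ i).toReal) (fun _ => (n : ℝ)⁻¹) M (fun t : Fin T => c t)
        (fun t => e t) (fun t => x t) := by
  rw [sampleErr, add_sub_cancel]
  ext i j
  simp only [empiricalMatrix, Matrix.of_apply, Matrix.smul_apply, Matrix.sum_apply, obsMat_apply,
    Finset.sum_range, smul_eq_mul]
  rw [mul_inv, mul_assoc, Finset.mul_sum]
  congr 1
  refine Finset.sum_congr rfl fun t _ => ?_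
  split_ifs with h
  · rw [h.1]; ring
  · rw [mul_zero]

namespace Model

variable {m n r : ℕ} (B : Model m n r) {Ω : Type*} [MeasurableSpace Ω] {P : Measure Ω}
  [IsProbabilityMeasure P] {ctx : ℕ → Ω → Fin m} {expl : ℕ → Ω → Fin n} {ξ : ℕ → Ω → ℝ}

theorem r_le_m (B : Model m n r) : r ≤ m := le_of_orthonormal B.U_orth

theorem r_le_n (B : Model m n r) : r ≤ n := le_of_orthonormal B.V_orth

theorem m_pos (B : Model m n r) : 0 < m := B.r_pos.trans_le B.r_le_m

theorem n_pos (B : Model m n r) : 0 < n := B.r_pos.trans_le B.r_le_n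

theorem toReal_ρ_pos (i : Fin m) : 0 < (B.ρ i).toReal :=
  ENNReal.toReal_pos (B.ρ_pos i) (B.ρ.apply_ne_top i)

variable {B}

theorem Environment.sampling_round (h : B.Environment P ctx expl ξ) (t : ℕ) :
    IndepFun (fun ω => (ctx t ω, expl t ω)) (ξ t) P ∧
      IndepFun (ctx t) (fun ω => (expl t ω, ξ t ω)) P ∧
      IndepFun (expl t) (fun ω => (ctx t ω, ξ t ω)) P ∧
      P.map (ctx t) = B.ρ.toMeasure ∧ P.map (expl t) = uniformOn Set.univ ∧
      P.map (ξ t) = B.ν := by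
  have := B.ν_prob
  have : Nonempty (Fin n) := ⟨⟨0, B.n_pos⟩⟩
  have : IsProbabilityMeasure (uniformOn (Set.univ : Set (Fin n))) :=
    isProbabilityMeasure_uniformOn Set.finite_univ Set.univ_nonempty
  have hc := h.measurable_ctx t
  have he := h.measurable_expl t
  have hξ := h.measurable_noise t
  have h1 := indepFun_of_map_prod_eq hc (he.prodMk hξ) (h.law t)
  have h2 := indepFun_of_map_prod_eq (hc.prodMk he) hξ
    (map_assoc_of_map_prod_eq hc he hξ (h.law t))
  have h3 := indepFun_of_map_prod_eq he (hc.prodMk hξ)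
    (map_swap_of_map_prod_eq hc he hξ (h.law t))
  exact ⟨h2.1, h1.1, h3.1, h1.2.1, h3.2.1, h2.2.2⟩

theorem Environment.subgaussian (h : B.Environment P ctx expl ξ) (t : ℕ) :
    HasSubgaussianMGF (ξ t) (B.σ ^ 2) P := by
  refine (HasSubgaussianMGF.id_map_iff (h.measurable_noise t).aemeasurable).1 ?_
  rw [(h.sampling_round t).2.2.2.2.2]
  exact B.ν_subgaussian

theorem Environment.iIndepFun_noise (h : B.Environment P ctx expl ξ) : iIndepFun ξ P :=
  h.indep.comp (fun _ z => z.2.2) fun _ => measurable_snd.snd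

theorem Environment.sampling (h : B.Environment P ctx expl ξ) (T : ℕ) :
    Sampling P (fun i => (B.ρ i).toReal) (fun _ : Fin n => (n : ℝ)⁻¹) B.σ
      (fun t : Fin T => ctx t) (fun t => expl t) (fun t => ξ t) where
  measurable_row t := h.measurable_ctx t
  measurable_col t := h.measurable_expl t
  measurable_noise t := h.measurable_noise t
  indep := h.indep.precomp (g := fun t : Fin T => (t : ℕ)) Fin.val_injective
  indep_noise t := (h.sampling_round t).1
  indep_row t := (h.sampling_round t).2.1
  indep_col t := (h.sampling_round t).2.2.1
  law_row t i := by
    rw [← map_measureReal_apply (h.measurable_ctx t) (measurableSet_singleton i),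
      (h.sampling_round t).2.2.2.1, Measure.real,
      PMF.toMeasure_apply_singleton _ _ (measurableSet_singleton i)]
  law_col t j := by
    rw [← map_measureReal_apply (h.measurable_expl t) (measurableSet_singleton j),
      (h.sampling_round t).2.2.2.2.1, Measure.real, uniformOn_univ, Measure.count_singleton,
      Fintype.card_fin, ENNReal.toReal_div]
    simp
  row_pos i := B.toReal_ρ_pos i
  col_pos _ := inv_pos.2 (by exact_mod_cast B.n_pos)
  subgaussian t := h.subgaussian t

end Model

end LowRankBandit

end

noncomputable section

namespace LowRankBandit

/-! ### The exploitation phase -/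

section Congr

variable {ι : Type*} [Fintype ι] [DecidableEq ι] {K : ℕ}

theorem supLinUCBState_congr (sel : Finset (Fin K) → Fin K) (lam β d : ℝ) (N : ℕ)
    {x x' : ℕ → Fin K → ι → ℝ} {y y' : ℕ → Fin K → ℝ} {τ : ℕ} (hx : ∀ s < τ, x s = x' s)
    (hy : ∀ s < τ, y s = y' s) :
    supLinUCBState sel lam β d N x y τ = supLinUCBState sel lam β d N x' y' τ := by
  induction τ with
  | zero => rfl
  | succ τ ih =>
    have h := ih (fun s hs => hx s (by omega)) (fun s hs => hy s (by omega))
    simp only [supLinUCBState, h, hx τ (Nat.lt_succ_self τ), hy τ (Nat.lt_succ_self τ)]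

theorem supLinUCBArm_congr (sel : Finset (Fin K) → Fin K) (lam β d : ℝ) (N : ℕ)
    {x x' : ℕ → Fin K → ι → ℝ} {y y' : ℕ → Fin K → ℝ} {τ : ℕ} (hx : ∀ s ≤ τ, x s = x' s)
    (hy : ∀ s ≤ τ, y s = y' s) :
    supLinUCBArm sel lam β d N x y τ = supLinUCBArm sel lam β d N x' y' τ := by
  rw [supLinUCBArm, supLinUCBArm, hx τ le_rfl, supLinUCBState_congr sel lam β d N
    (fun s hs => hx s hs.le) (fun s hs => hy s hs.le)]

end Congr

section Exploit

variable {m n r : ℕ} {M : Matrix (Fin m) (Fin n) ℝ} {sel : Finset (Fin n) → Fin n} {lam β d : ℝ}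
  {N : ℕ}

/-- The regret of SupLinUCB over `N` rounds with the features given by the bases `W` and `Z`, along
the contexts `c` and the noise `x`. -/
def exploitLoss (r : ℕ) (M : Matrix (Fin m) (Fin n) ℝ) (sel : Finset (Fin n) → Fin n)
    (lam β d : ℝ) (N : ℕ) (W : Matrix (Fin m) (Fin m) ℝ) (Z : Matrix (Fin n) (Fin n) ℝ)
    (c : ℕ → Fin m) (x : ℕ → ℝ) : ℝ :=
  ∑ τ ∈ Finset.range N, ((⨆ j, M (c τ) j) - M (c τ) (supLinUCBArm sel lam β d N
    (fun s j => feature r W Z (c s) j) (fun s j => M (c s) j + x s) τ))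

theorem exploitLoss_congr {W : Matrix (Fin m) (Fin m) ℝ} {Z : Matrix (Fin n) (Fin n) ℝ}
    {c c' : ℕ → Fin m} {x x' : ℕ → ℝ} (hc : ∀ s < N, c s = c' s) (hx : ∀ s < N, x s = x' s) :
    exploitLoss r M sel lam β d N W Z c x = exploitLoss r M sel lam β d N W Z c' x' := by
  refine Finset.sum_congr rfl fun τ hτ => ?_
  have hτ := Finset.mem_range.1 hτ
  rw [hc τ hτ, supLinUCBArm_congr sel lam β d N (x' := fun s j => feature r W Z (c' s) j)
    (y' := fun s j => M (c' s) j + x' s)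
    (fun s hs => by rw [hc s (by omega)]) (fun s hs => by rw [hc s (by omega), hx s (by omega)])]

theorem le_iSup_row (M : Matrix (Fin m) (Fin n) ℝ) (i : Fin m) (j : Fin n) :
    M i j ≤ ⨆ j, M i j :=
  le_ciSup (f := fun j => M i j) (Set.finite_range _).bddAbove j

theorem iSup_row_sub_le {Mx : ℝ} (hM : ∀ i j, |M i j| ≤ Mx) (i : Fin m) (j : Fin n) :
    (⨆ j, M i j) - M i j ≤ 2 * Mx := by
  have : Nonempty (Fin n) := ⟨j⟩
  have h1 : ⨆ j, M i j ≤ Mx := ciSup_le fun j => (abs_le.1 (hM i j)).2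
  linarith [(abs_le.1 (hM i j)).1]

theorem exploitLoss_nonneg (W : Matrix (Fin m) (Fin m) ℝ) (Z : Matrix (Fin n) (Fin n) ℝ)
    (c : ℕ → Fin m) (x : ℕ → ℝ) : 0 ≤ exploitLoss r M sel lam β d N W Z c x :=
  Finset.sum_nonneg fun _ _ => sub_nonneg.2 (le_iSup_row M _ _)

theorem exploitLoss_le {Mx : ℝ} (hM : ∀ i j, |M i j| ≤ Mx) (W : Matrix (Fin m) (Fin m) ℝ)
    (Z : Matrix (Fin n) (Fin n) ℝ) (c : ℕ → Fin m) (x : ℕ → ℝ) :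
    exploitLoss r M sel lam β d N W Z c x ≤ N * (2 * Mx) := by
  refine (Finset.sum_le_card_nsmul _ _ _ fun τ _ => iSup_row_sub_le hM _ _).trans ?_
  rw [Finset.card_range, nsmul_eq_mul]

theorem measurable_eval_fin {α : Type*} [MeasurableSpace α] {f : α → Fin m → ℝ}
    (hf : ∀ i, Measurable fun a => f a i) {c : α → Fin m} (hc : Measurable c) :
    Measurable fun a => f a (c a) := by
  have : (fun a => f a (c a)) = fun a => ∑ i, if c a = i then f a i else 0 := by
    ext a; simp
  rw [this]
  exact Finset.measurable_sum _ fun i _ =>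
    Measurable.ite (hc (measurableSet_singleton i)) (hf i) measurable_const

theorem measurable_exploitLoss {α : Type*} [MeasurableSpace α]
    {W : α → Matrix (Fin m) (Fin m) ℝ} {Z : α → Matrix (Fin n) (Fin n) ℝ}
    (hW : ∀ i k, Measurable fun a => W a i k) (hZ : ∀ j k, Measurable fun a => Z a j k)
    {c : α → ℕ → Fin m} (hc : ∀ s, Measurable fun a => c a s) {x : α → ℕ → ℝ}
    (hx : ∀ s, Measurable fun a => x a s) :
    Measurable fun a => exploitLoss r M sel lam β d N (W a) (Z a) (c a) (x a) := by
  refine Finset.measurable_sum _ fun τ _ => Measurable.sub ?_ ?_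
  · exact (measurable_of_countable fun i => ⨆ j, M i j).comp (hc τ)
  · have h1 : Measurable fun a => supLinUCBArm sel lam β d N
        (fun s j => feature r (W a) (Z a) (c a s) j) (fun s j => M (c a s) j + x a s) τ := by
      refine measurable_supLinUCBArm sel lam β d N (fun s j q => ?_) (fun s j => ?_) τ
      · exact (measurable_eval_fin (fun i => hW i _) (hc s)).mul (hZ _ _)
      · exact ((measurable_of_countable fun i => M i j).comp (hc s)).add (hx s)
    exact (measurable_of_countable fun p : Fin m × Fin n => M p.1 p.2).comp ((hc τ).prodMk h1)

variable {Ω : Type*} [MeasurableSpace Ω] {P : Measure Ω} [IsProbabilityMeasure P]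
  {ξ : ℕ → Ω → ℝ} {σ : ℝ≥0}

/-- Contexts and bases are fixed and only the noise is random, so the features form a deterministic
sequence as the analysis of SupLinUCB requires. -/
theorem integral_exploitLoss_le (hn : 0 < n) {W : Matrix (Fin m) (Fin m) ℝ}
    {Z : Matrix (Fin n) (Fin n) ℝ} (hW : Wᵀ * W = 1) (hZ : Zᵀ * Z = 1) (c : ℕ → Fin m)
    {ε s₀ ℓ Mx : ℝ} (hsel : ∀ S : Finset (Fin n), S.Nonempty → sel S ∈ S) (hlam : 0 < lam)
    (hN : 0 < N) (hd : d = Fintype.card (FeatureIndex m n r))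
    (hι : 0 < Fintype.card (FeatureIndex m n r)) (hσ : 0 < σ)
    (hs₀ : 0 ≤ s₀) (hβ : β = σ * (1 + s₀)) (hM : ∀ i j, |M i j| ≤ Mx)
    (hf : ∀ i j, |M i j - featureParam r M W Z ⬝ᵥ feature r W Z i j| ≤ ε)
    (hlamM : lam * (m * n * Mx ^ 2) ≤ (σ : ℝ) ^ 2)
    (hℓ : Real.log (d + N / lam) ≤ ℓ) (hℓ1 : 1 ≤ ℓ)
    (hξ : ∀ t, Measurable (ξ t)) (hind : iIndepFun ξ P)
    (hsub : ∀ t, HasSubgaussianMGF (ξ t) (σ ^ 2) P) :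
    ∫ ω, exploitLoss r M sel lam β d N W Z c (fun s => ξ s ω) ∂P ≤
      8 * d * ℓ * (2 * Mx) + 8 * numLevels d N * β * √(2 * d * ℓ * N) + 2 * β * √(d * N) +
        2 * numLevels d N * N * (ε * (1 + √(2 * d * ℓ))) +
        N * (numLevels d N + 1) * n * (2 * Real.exp (-(s₀ ^ 2 / 2))) * (N * (2 * Mx)) := by
  have : Nonempty (Fin n) := ⟨⟨0, hn⟩⟩
  have h1 := (mul_le_mul_of_nonneg_left
    (featureParam_dotProduct_self_le (r := r) hW hZ hM) hlam.le).trans hlamM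
  have h2 : ∀ s, ∃ j, (⨆ j, M (c s) j) = M (c s) j := fun s =>
    (exists_eq_ciSup_of_finite (f := fun j => M (c s) j)).imp fun j hj => hj.symm
  rw [hd] at hℓ
  exact supLinUCB_regret (x := fun s j => feature r W Z (c s) j) (f := fun s j => M (c s) j)
    (F := fun s => ⨆ j, M (c s) j) (θ := featureParam r M W Z) (ξ := ξ) hsel hlam hN hd hι hσ hs₀ hβ
    (fun s j => feature_dotProduct_self_le hW hZ _ _) (fun s j => hf _ _) h1 h2
    (fun s j => iSup_row_sub_le hM _ _) (fun s j => le_iSup_row M _ _) hℓ hℓ1 hξ hind hsub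

theorem integrable_exploitLoss {W : Matrix (Fin m) (Fin m) ℝ}
    {Z : Matrix (Fin n) (Fin n) ℝ} (c : ℕ → Fin m) {Mx : ℝ} (hM : ∀ i j, |M i j| ≤ Mx)
    (hξ : ∀ t, Measurable (ξ t)) :
    Integrable (fun ω => exploitLoss r M sel lam β d N W Z c (fun s => ξ s ω)) P := by
  have h1 : Measurable fun ω => exploitLoss r M sel lam β d N W Z c (fun s => ξ s ω) :=
    measurable_exploitLoss (W := fun _ => W) (Z := fun _ => Z) (c := fun _ => c)
      (x := fun ω s => ξ s ω) (fun _ _ => measurable_const) (fun _ _ => measurable_const)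
      (fun _ => measurable_const) hξ
  refine Integrable.of_bound h1.aestronglyMeasurable (N * (2 * Mx)) (ae_of_all _ fun ω => ?_)
  rw [Real.norm_of_nonneg (exploitLoss_nonneg _ _ _ _)]
  exact exploitLoss_le hM _ _ _ _

end Exploit

/-- On the good event the bound is linear in `g`, later the squared relative error; therefore its
mean suffices and no uniform bound is needed. -/
theorem lintegral_le_of_good {Ω : Type*} [MeasurableSpace Ω] {P : Measure Ω}
    [IsProbabilityMeasure P] {f g : Ω → ℝ≥0∞} (hg : Measurable g) {bad : Set Ω} {a q G : ℝ≥0∞}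
    (hgood : ∀ ω ∉ bad, f ω ≤ a + q * g ω) (hbad : ∀ ω, f ω ≤ G) :
    ∫⁻ ω, f ω ∂P ≤ a + q * ∫⁻ ω, g ω ∂P + G * P bad := by
  have h1 : ∀ ω, f ω ≤ (a + q * g ω) + bad.indicator (fun _ => G) ω := by
    intro ω
    by_cases hω : ω ∈ bad
    · rw [Set.indicator_of_mem hω]; exact (hbad ω).trans le_add_self
    · exact (hgood ω hω).trans le_self_add
  refine (lintegral_mono h1).trans ?_
  rw [lintegral_add_left (by fun_prop), lintegral_add_left (by fun_prop), lintegral_const,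
    measure_univ, mul_one, lintegral_const_mul _ hg]
  gcongr
  exact lintegral_indicator_const_le _ _

end LowRankBandit

end

noncomputable section

namespace LowRankBandit

/-! ### Separating the noise of the two phases -/

namespace Model

variable {m n r : ℕ} {B : Model m n r} {Ω : Type*} [MeasurableSpace Ω] {P : Measure Ω}
  [IsProbabilityMeasure P] {ctx : ℕ → Ω → Fin m} {expl : ℕ → Ω → Fin n} {ξ : ℕ → Ω → ℝ}

/-- The error of the estimate of the reward matrix after `T₁` rounds of exploration. -/
def exploreErr (B : Model m n r) (T₁ : ℕ) (ctx : ℕ → Ω → Fin m) (expl : ℕ → Ω → Fin n)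
    (ξ : ℕ → Ω → ℝ) (ω : Ω) : Matrix (Fin m) (Fin n) ℝ :=
  sampleErr (fun i => (B.ρ i).toReal) (fun _ => (n : ℝ)⁻¹) B.M (fun t : Fin T₁ => ctx t ω)
    (fun t => expl t ω) (fun t => ξ t ω)

theorem measurable_exploreErr (h : B.Environment P ctx expl ξ) (T₁ : ℕ) (i : Fin m) (j : Fin n) :
    Measurable fun ω => B.exploreErr T₁ ctx expl ξ ω i j := by
  have h1 : Measurable fun ω (t : Fin T₁) => (ctx t ω, expl t ω, ξ t ω) :=
    measurable_pi_lambda _ fun t =>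
      (h.measurable_ctx t).prodMk ((h.measurable_expl t).prodMk (h.measurable_noise t))
  have h2 := measurable_sampleErr (T := T₁) (fun i => (B.ρ i).toReal) (fun _ => (n : ℝ)⁻¹) B.M i j
  simp only [exploreErr]
  have h3 := h2.comp h1
  exact h3

variable {svd : Matrix (Fin m) (Fin n) ℝ → Matrix (Fin m) (Fin m) ℝ × Matrix (Fin n) (Fin n) ℝ}
  {sel : Finset (Fin n) → Fin n} {lam β d : ℝ} {T₁ T₂ : ℕ}

theorem measurable_svd (hsvd : IsSVDRoutine svd) {α : Type*} [MeasurableSpace α]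
    {A : α → Matrix (Fin m) (Fin n) ℝ} (hA : ∀ i j, Measurable fun a => A a i j) :
    (∀ i k, Measurable fun a => (svd (A a)).1 i k) ∧
      ∀ j k, Measurable fun a => (svd (A a)).2 j k := by
  have h1 : Measurable fun a => (fun i j => A a i j : Fin m → Fin n → ℝ) :=
    measurable_pi_lambda _ fun i => measurable_pi_lambda _ fun j => hA i j
  exact ⟨fun i k => (hsvd.2.1 i k).comp h1, fun j k => (hsvd.2.2 j k).comp h1⟩

/-- The contexts and arms of all rounds go together with the noise of the first phase, and the noise
of the second phase stands alone. Zeros in the other phase allow both sequences to be indexed by all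
rounds. -/
theorem Environment.indepFun_split (h : B.Environment P ctx expl ξ) (T₁ T : ℕ) :
    IndepFun (fun ω (t : Fin T) => (ctx t ω, expl t ω, if (t : ℕ) < T₁ then ξ t ω else 0))
      (fun ω (t : Fin T) => if (t : ℕ) < T₁ then 0 else ξ t ω) P := by
  refine indepFun_pi_of_iIndepFun_prod (fun t => ?_) (fun t => ?_) ?_ fun t => ?_
  · refine (h.measurable_ctx t).prodMk ((h.measurable_expl t).prodMk ?_)
    split_ifs
    exacts [h.measurable_noise t, measurable_const]
  · split_ifs
    exacts [measurable_const, h.measurable_noise t]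
  · refine (h.indep.precomp (g := fun t : Fin T => (t : ℕ)) Fin.val_injective).comp
      (fun t z => ((z.1, z.2.1, if (t : ℕ) < T₁ then z.2.2 else 0),
        if (t : ℕ) < T₁ then 0 else z.2.2)) fun t => ?_
    split_ifs
    · exact (measurable_fst.prodMk (measurable_snd.fst.prodMk measurable_snd.snd)).prodMk
        measurable_const
    · exact (measurable_fst.prodMk (measurable_snd.fst.prodMk measurable_const)).prodMk
        measurable_snd.snd
  · by_cases ht : (t : ℕ) < T₁
    · simp only [ht, if_true]
      exact indepFun_const_right _ 0
    · simp only [ht, if_false]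
      exact (h.sampling_round t).1.comp (φ := fun z : Fin m × Fin n => (z.1, z.2, (0 : ℝ)))
        (ψ := id) (by fun_prop) measurable_id

/-- The features depend on the exploration data and the contexts, which are independent of the later
noise. That noise can thus be integrated by itself with the features held fixed. -/
theorem Environment.lintegral_exploitLoss (h : B.Environment P ctx expl ξ)
    (hsvd : IsSVDRoutine svd) (hT₂ : 0 < T₂) :
    ∫⁻ ω, ENNReal.ofReal (exploitLoss r B.M sel lam β d T₂
        (svd (B.M + B.exploreErr T₁ ctx expl ξ ω)).1 (svd (B.M + B.exploreErr T₁ ctx expl ξ ω)).2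
        (fun τ => ctx (T₁ + τ) ω) (fun τ => ξ (T₁ + τ) ω)) ∂P =
      ∫⁻ ω, ∫⁻ ω', ENNReal.ofReal (exploitLoss r B.M sel lam β d T₂
        (svd (B.M + B.exploreErr T₁ ctx expl ξ ω)).1 (svd (B.M + B.exploreErr T₁ ctx expl ξ ω)).2
        (fun τ => ctx (T₁ + τ) ω) (fun τ => ξ (T₁ + τ) ω')) ∂P ∂P := by
  set A : Ω → Fin (T₁ + T₂) → Fin m × Fin n × ℝ := fun ω t =>
    (ctx t ω, expl t ω, if (t : ℕ) < T₁ then ξ t ω else 0) with hA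
  set Y : Ω → Fin (T₁ + T₂) → ℝ := fun ω t => if (t : ℕ) < T₁ then 0 else ξ t ω with hY
  have mA : Measurable A := by
    refine measurable_pi_lambda _ fun t =>
      (h.measurable_ctx t).prodMk ((h.measurable_expl t).prodMk ?_)
    split_ifs
    exacts [h.measurable_noise t, measurable_const]
  have mY : Measurable Y := by
    refine measurable_pi_lambda _ fun t => ?_
    simp only [hY]
    split_ifs
    exacts [measurable_const, h.measurable_noise t]
  -- Late indices are clamped to stay in range; the loss reads only `τ < T₂`, where nothing changes.
  set idx : ℕ → Fin (T₁ + T₂) := fun τ => ⟨T₁ + min τ (T₂ - 1), by omega⟩ with hidx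
  have hidx' : ∀ s < T₂, ((idx s : Fin (T₁ + T₂)) : ℕ) = T₁ + s := fun s hs => by
    simp only [hidx]; omega
  set Eh : (Fin (T₁ + T₂) → Fin m × Fin n × ℝ) → Matrix (Fin m) (Fin n) ℝ := fun z =>
    sampleErr (fun i => (B.ρ i).toReal) (fun _ => (n : ℝ)⁻¹) B.M
      (fun t : Fin T₁ => (z (Fin.castLE (by omega) t)).1)
      (fun t => (z (Fin.castLE (by omega) t)).2.1) (fun t => (z (Fin.castLE (by omega) t)).2.2)
    with hEh
  have hEA : ∀ ω, Eh (A ω) = B.exploreErr T₁ ctx expl ξ ω := by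
    intro ω
    simp only [hEh, hA, exploreErr, Fin.val_castLE, Fin.is_lt, if_true]
  have mE : ∀ i j, Measurable fun z => Eh z i j := fun i j =>
    (measurable_sampleErr (T := T₁) (fun i => (B.ρ i).toReal) (fun _ => (n : ℝ)⁻¹) B.M i j).comp
      (measurable_pi_lambda (fun (z : Fin (T₁ + T₂) → Fin m × Fin n × ℝ) (t : Fin T₁) =>
        z (Fin.castLE (by omega) t)) fun t => measurable_pi_apply _)
  set f : (Fin (T₁ + T₂) → Fin m × Fin n × ℝ) × (Fin (T₁ + T₂) → ℝ) → ℝ≥0∞ := fun p =>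
    ENNReal.ofReal (exploitLoss r B.M sel lam β d T₂ (svd (B.M + Eh p.1)).1
      (svd (B.M + Eh p.1)).2 (fun τ => (p.1 (idx τ)).1) (fun τ => p.2 (idx τ))) with hf
  have mS := measurable_svd hsvd
    (A := fun p : (Fin (T₁ + T₂) → Fin m × Fin n × ℝ) × (Fin (T₁ + T₂) → ℝ) => B.M + Eh p.1)
    (fun i j => by
      simp only [Matrix.add_apply]
      exact measurable_const.add ((mE i j).comp measurable_fst))
  have mf : Measurable f :=
    (measurable_exploitLoss (c := fun p τ => (p.1 (idx τ)).1) (x := fun p τ => p.2 (idx τ))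
      mS.1 mS.2 (fun s => ((measurable_pi_apply _).comp measurable_fst).fst)
      (fun s => (measurable_pi_apply _).comp measurable_snd)).ennreal_ofReal
  have key : ∀ ω ω', f (A ω, Y ω') = ENNReal.ofReal (exploitLoss r B.M sel lam β d T₂
        (svd (B.M + B.exploreErr T₁ ctx expl ξ ω)).1 (svd (B.M + B.exploreErr T₁ ctx expl ξ ω)).2
        (fun τ => ctx (T₁ + τ) ω) (fun τ => ξ (T₁ + τ) ω')) := by
    intro ω ω'
    simp only [hf, hEA]
    congr 1
    refine exploitLoss_congr (fun s hs => ?_) (fun s hs => ?_)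
    · simp only [hA, hidx' s hs]
    · simp only [hY, hidx' s hs]
      rw [if_neg (by omega)]
  have hI : IndepFun A Y P := h.indepFun_split T₁ (T₁ + T₂)
  have := lintegral_of_indepFun hI mA mY mf
  simpa only [key] using this

end Model

end LowRankBandit

end

noncomputable section

namespace LowRankBandit

open scoped Matrix.Norms.L2Operator

/-! ### Quantities of the model -/

section Norms

variable {m n : ℕ}

theorem abs_le_maxNorm (A : Matrix (Fin m) (Fin n) ℝ) (i : Fin m) (j : Fin n) :
    |A i j| ≤ maxNorm A :=
  le_ciSup (f := fun p : Fin m × Fin n => |A p.1 p.2|) (Set.finite_range _).bddAbove (i, j)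

theorem row_le_twoInfNorm (A : Matrix (Fin m) (Fin n) ℝ) (i : Fin m) :
    √(∑ k, A i k ^ 2) ≤ twoInfNorm A :=
  le_ciSup (f := fun i : Fin m => √(∑ k, A i k ^ 2)) (Set.finite_range _).bddAbove i

theorem twoInfNorm_nonneg (A : Matrix (Fin m) (Fin n) ℝ) : 0 ≤ twoInfNorm A :=
  Real.iSup_nonneg fun _ => Real.sqrt_nonneg _

theorem sum_sq_of_orthonormal {A : Matrix (Fin m) (Fin n) ℝ} (hA : Aᵀ * A = 1) :
    ∑ i, ∑ k, A i k ^ 2 = n := by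
  rw [sum_sq_eq_trace, Matrix.trace_mul_comm, hA, Matrix.trace_one, Fintype.card_fin]

theorem le_mul_twoInfNorm_sq {A : Matrix (Fin m) (Fin n) ℝ} (hA : Aᵀ * A = 1) :
    (n : ℝ) ≤ m * twoInfNorm A ^ 2 := by
  rw [← sum_sq_of_orthonormal hA]
  calc ∑ i, ∑ k, A i k ^ 2 ≤ ∑ _i : Fin m, twoInfNorm A ^ 2 := by
        refine Finset.sum_le_sum fun i _ => ?_
        rw [← Real.sq_sqrt (Finset.sum_nonneg fun k _ => sq_nonneg (A i k))]
        exact pow_le_pow_left₀ (Real.sqrt_nonneg _) (row_le_twoInfNorm A i) 2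
    _ = m * twoInfNorm A ^ 2 := by simp

/-- The squared row norms add up to the number of columns, and the largest is at least their
average. -/
theorem one_le_coherence {A : Matrix (Fin m) (Fin n) ℝ} (hA : Aᵀ * A = 1) (hn : 0 < n) :
    1 ≤ √((m : ℝ) / n) * twoInfNorm A := by
  have hn' : (0 : ℝ) < n := by exact_mod_cast hn
  rw [← Real.sqrt_sq (twoInfNorm_nonneg A), ← Real.sqrt_mul (by positivity), Real.one_le_sqrt,
    div_mul_eq_mul_div, one_le_div hn']
  exact le_mul_twoInfNorm_sq hA

theorem twoInfNorm_le {A : Matrix (Fin m) (Fin n) ℝ} (hm : 0 < m) (hn : 0 < n) {μ : ℝ}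
    (h : √((m : ℝ) / n) * twoInfNorm A ≤ μ) : twoInfNorm A ≤ μ * √((n : ℝ) / m) := by
  have hn' : (0 : ℝ) < n := by exact_mod_cast hn
  have hm' : (0 : ℝ) < m := by exact_mod_cast hm
  have h1 : √((n : ℝ) / m) * √((m : ℝ) / n) = 1 := by
    rw [← Real.sqrt_mul (by positivity)]
    have : (n : ℝ) / m * (m / n) = 1 := by field_simp
    rw [this, Real.sqrt_one]
  calc twoInfNorm A = (√((n : ℝ) / m) * √((m : ℝ) / n)) * twoInfNorm A := by rw [h1, one_mul]
    _ = √((m : ℝ) / n) * twoInfNorm A * √((n : ℝ) / m) := by ring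
    _ ≤ _ := by gcongr

end Norms

namespace Model

variable {m n r : ℕ} (B : Model m n r)

/-- The largest singular value of the reward matrix. -/
def sMax : ℝ := B.s ⟨0, B.r_pos⟩

/-- The smallest nonzero singular value of the reward matrix. -/
def sMin : ℝ := B.s ⟨r - 1, Nat.sub_lt B.r_pos Nat.one_pos⟩

theorem sMin_pos : 0 < B.sMin := B.s_pos _

theorem sMin_le_sMax : B.sMin ≤ B.sMax := B.s_anti (Fin.mk_le_mk.2 (Nat.zero_le _))

theorem sMax_pos : 0 < B.sMax := B.s_pos _

theorem one_le_kappa : 1 ≤ B.kappa := (one_le_div B.sMin_pos).2 B.sMin_le_sMax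

theorem norm_diagonal_s_le : ‖Matrix.diagonal B.s‖ ≤ B.sMax := by
  rw [Matrix.l2_opNorm_diagonal]
  refine (pi_norm_le_iff_of_nonneg B.sMax_pos.le).2 fun k => ?_
  rw [Real.norm_of_nonneg (B.s_pos k).le]
  exact B.s_anti (Fin.mk_le_mk.2 (Nat.zero_le _))

theorem norm_diagonal_s_inv_le : ‖Matrix.diagonal fun k => (B.s k)⁻¹‖ ≤ 1 / B.sMin := by
  rw [Matrix.l2_opNorm_diagonal]
  refine (pi_norm_le_iff_of_nonneg (one_div_pos.2 B.sMin_pos).le).2 fun k => ?_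
  rw [Real.norm_of_nonneg (inv_pos.2 (B.s_pos k)).le, one_div]
  refine inv_anti₀ B.sMin_pos (B.s_anti ?_)
  rw [Fin.le_def]
  have := k.2
  simp only
  omega

theorem diagonal_s_mul_inv :
    Matrix.diagonal B.s * Matrix.diagonal (fun k => (B.s k)⁻¹) = 1 := by
  rw [Matrix.diagonal_mul_diagonal, ← Matrix.diagonal_one]
  congr 1
  ext k
  exact mul_inv_cancel₀ (B.s_pos k).ne'

theorem one_le_mu : 1 ≤ B.mu := (one_le_coherence B.U_orth B.r_pos).trans (le_max_left _ _)

theorem twoInfNorm_U_le : twoInfNorm B.U ≤ B.mu * √((r : ℝ) / m) :=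
  twoInfNorm_le B.m_pos B.r_pos (le_max_left _ _)

theorem twoInfNorm_V_le : twoInfNorm B.V ≤ B.mu * √((r : ℝ) / n) :=
  twoInfNorm_le B.n_pos B.r_pos (le_max_right _ _)

/-- A common bound `μ √(r / (m ∧ n))` on the rows of both factors. -/
def rowBound : ℝ := B.mu * √((r : ℝ) / min (m : ℝ) n)

theorem row_U_le (i : Fin m) : √(∑ k, B.U i k ^ 2) ≤ B.rowBound := by
  have hm : (0 : ℝ) < m := by exact_mod_cast B.m_pos
  have hn : (0 : ℝ) < n := by exact_mod_cast B.n_pos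
  have hμ := B.one_le_mu
  refine ((row_le_twoInfNorm B.U i).trans B.twoInfNorm_U_le).trans ?_
  rw [rowBound]
  gcongr
  exact min_le_left _ _

theorem row_V_le (j : Fin n) : √(∑ k, B.V j k ^ 2) ≤ B.rowBound := by
  have hm : (0 : ℝ) < m := by exact_mod_cast B.m_pos
  have hn : (0 : ℝ) < n := by exact_mod_cast B.n_pos
  have hμ := B.one_le_mu
  refine ((row_le_twoInfNorm B.V j).trans B.twoInfNorm_V_le).trans ?_
  rw [rowBound]
  gcongr
  exact min_le_right _ _

/-- An entry is a bilinear form in a row of `U` and a row of `V`. The bound serves later as a lower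
bound on the largest singular value. -/
theorem maxNorm_le : maxNorm B.M ≤ B.sMax * B.mu ^ 2 * r / √(m * n) := by
  have hm : (0 : ℝ) < m := by exact_mod_cast B.m_pos
  have hn : (0 : ℝ) < n := by exact_mod_cast B.n_pos
  have hr : (0 : ℝ) < r := by exact_mod_cast B.r_pos
  have hs := B.sMax_pos
  have hμ := B.one_le_mu
  have : Nonempty (Fin m × Fin n) := ⟨(⟨0, B.m_pos⟩, ⟨0, B.n_pos⟩)⟩
  refine ciSup_le fun p => ?_
  have h1 : B.M p.1 p.2 = ((unitRow p.1 * B.U) * Matrix.diagonal B.s *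
      (unitRow p.2 * B.V)ᵀ) 0 0 := by
    have e1 : (unitRow p.1 * B.U) * Matrix.diagonal B.s * (unitRow p.2 * B.V)ᵀ =
        unitRow p.1 * (unitRow p.2 * B.Mᵀ)ᵀ := by
      rw [B.M_eq]
      simp only [Matrix.transpose_mul, Matrix.transpose_transpose, Matrix.mul_assoc]
    rw [e1, unitRow_mul, Matrix.transpose_apply, unitRow_mul, Matrix.transpose_apply]
  rw [h1]
  refine (abs_apply_le_norm _ 0 0).trans ((Matrix.l2_opNorm_mul _ _).trans ?_)
  rw [norm_transpose]
  have h2 : ‖unitRow p.1 * B.U‖ ≤ B.mu * √((r : ℝ) / m) :=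
    (norm_unitRow_mul_le _ _).trans ((row_le_twoInfNorm _ _).trans B.twoInfNorm_U_le)
  have h3 : ‖unitRow p.2 * B.V‖ ≤ B.mu * √((r : ℝ) / n) :=
    (norm_unitRow_mul_le _ _).trans ((row_le_twoInfNorm _ _).trans B.twoInfNorm_V_le)
  have h4 : √((r : ℝ) / m) * √((r : ℝ) / n) = r / √(m * n) := by
    rw [← Real.sqrt_mul (by positivity), div_mul_div_comm, Real.sqrt_div (by positivity),
      Real.sqrt_mul_self hr.le]
  calc ‖unitRow p.1 * B.U * Matrix.diagonal B.s‖ * ‖unitRow p.2 * B.V‖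
      ≤ (‖unitRow p.1 * B.U‖ * ‖Matrix.diagonal B.s‖) * ‖unitRow p.2 * B.V‖ := by
        gcongr; exact Matrix.l2_opNorm_mul _ _
    _ ≤ (B.mu * √((r : ℝ) / m) * B.sMax) * (B.mu * √((r : ℝ) / n)) := by
        gcongr; exact B.norm_diagonal_s_le
    _ = B.sMax * B.mu ^ 2 * (√((r : ℝ) / m) * √((r : ℝ) / n)) := by ring
    _ = _ := by rw [h4]; ring

theorem maxNorm_pos : 0 < maxNorm B.M := by
  by_contra h
  have h0 : B.M = 0 := by
    ext i j
    exact abs_nonpos_iff.1 ((abs_le_maxNorm B.M i j).trans (not_lt.1 h))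
  have h1 : Matrix.diagonal B.s = B.Uᵀ * B.M * B.V := by
    rw [B.M_eq]
    calc Matrix.diagonal B.s = (B.Uᵀ * B.U) * Matrix.diagonal B.s * (B.Vᵀ * B.V) := by
          rw [B.U_orth, B.V_orth, Matrix.one_mul, Matrix.mul_one]
      _ = _ := by simp only [Matrix.mul_assoc]
  rw [h0, Matrix.mul_zero, Matrix.zero_mul] at h1
  have h2 := congrFun (congrFun h1 ⟨0, B.r_pos⟩) ⟨0, B.r_pos⟩
  rw [Matrix.diagonal_apply_eq] at h2
  exact (B.s_pos _).ne' h2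

theorem rhoMin_le (i : Fin m) : B.rhoMin ≤ (B.ρ i).toReal :=
  ciInf_le (f := fun i => (B.ρ i).toReal) (Set.finite_range _).bddBelow i

theorem rhoMin_pos : 0 < B.rhoMin := by
  have : Nonempty (Fin m) := ⟨⟨0, B.m_pos⟩⟩
  obtain ⟨i, hi⟩ := exists_eq_ciInf_of_finite (f := fun i => (B.ρ i).toReal)
  rw [rhoMin, ← hi]
  exact B.toReal_ρ_pos i

theorem mul_rhoMin_le_one : m * B.rhoMin ≤ 1 := by
  have h1 : ∑ i, (B.ρ i).toReal = 1 := by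
    rw [← ENNReal.toReal_sum fun i _ => B.ρ.apply_ne_top i, ← tsum_fintype (L := .unconditional _),
      B.ρ.tsum_coe, ENNReal.toReal_one]
  rw [← h1]
  calc m * B.rhoMin = ∑ _i : Fin m, B.rhoMin := by simp
    _ ≤ _ := Finset.sum_le_sum fun i _ => B.rhoMin_le i

theorem maxNorm_le_L : maxNorm B.M ≤ B.L := le_max_left _ _

theorem σ_le_L : (B.σ : ℝ) ≤ B.L := le_max_right _ _

theorem σ_pos' : (0 : ℝ) < B.σ := B.σ_pos

theorem L_pos : 0 < B.L := B.maxNorm_pos.trans_le B.maxNorm_le_L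

theorem abs_M_le (i : Fin m) (j : Fin n) : |B.M i j| ≤ maxNorm B.M := abs_le_maxNorm _ _ _

end Model

end LowRankBandit

end

noncomputable section

namespace LowRankBandit

open scoped Matrix.Norms.L2Operator

/-! ### The exploration event -/

namespace Model

variable {m n r : ℕ} (B : Model m n r) {Ω : Type*} [MeasurableSpace Ω] {P : Measure Ω}
  [IsProbabilityMeasure P] {ctx : ℕ → Ω → Fin m} {expl : ℕ → Ω → Fin n} {ξ : ℕ → Ω → ℝ}
  {T₁ : ℕ} {ℓ : ℝ}

/-- The largest inverse propensity `n / ρ_min`. -/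
def weight : ℝ := n / B.rhoMin

/-- The typical size of `‖E‖ / σ_r` for the exploration error `E`. -/
def relErr (T₁ : ℕ) : ℝ := B.L * √(B.weight * (m + n) / T₁) / B.sMin

/-- The size of `(‖E‖ / σ_r)²` that the perturbation bounds tolerate. -/
def errTol : ℝ := √((r : ℝ) / min (m : ℝ) n) / (4096 * B.kappa)

/-- The fluctuation of a row of `E V`. -/
def linFluct (T₁ : ℕ) (ℓ : ℝ) : ℝ :=
  B.L * (2 * √(3 * B.weight * ℓ / T₁) + 2 * B.weight * B.rowBound * ℓ / T₁)

/-- The fluctuation of a row of `E Eᵀ U`, relative to `‖E‖`. -/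
def quadFluct (T₁ : ℕ) (ℓ : ℝ) : ℝ :=
  B.L * (2 * √(3 * (B.weight * (2 + 2 * ℓ)) * ℓ / T₁) + 2 * B.weight * ℓ / T₁)

/-- The event that the exploration estimate is not accurate. -/
def exploreBad (T₁ : ℕ) (ctx : ℕ → Ω → Fin m) (expl : ℕ → Ω → Fin n) (ξ : ℕ → Ω → ℝ) (ℓ : ℝ) :
    Set Ω :=
  {ω | B.errTol ≤ (‖B.exploreErr T₁ ctx expl ξ ω‖ / B.sMin) ^ 2} ∪
    ((⋃ i, {ω | ¬ RowGood (B.exploreErr T₁ ctx expl ξ ω) B.U B.V B.rowBound B.sMax ℓ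
      (B.linFluct T₁ ℓ) (B.quadFluct T₁ ℓ) i}) ∪
    ⋃ j, {ω | ¬ RowGood (B.exploreErr T₁ ctx expl ξ ω)ᵀ B.V B.U B.rowBound B.sMax ℓ
      (B.linFluct T₁ ℓ) (B.quadFluct T₁ ℓ) j})

/-- The logarithmic factor in the second moment of the exploration error. -/
def errLog (m n T₁ : ℕ) : ℝ :=
  48 * (Real.log ((m : ℝ) + n) + 1) * (3 + Real.log ((m : ℝ) + n)) * (70 + 2 * Real.log T₁ ^ 2)

variable {B}

theorem weight_pos (B : Model m n r) : 0 < B.weight :=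
  div_pos (by exact_mod_cast B.n_pos) B.rhoMin_pos

theorem inv_propensity_le (B : Model m n r) (i : Fin m) :
    ((B.ρ i).toReal * (n : ℝ)⁻¹)⁻¹ ≤ B.weight := by
  have hn : (0 : ℝ) < n := by exact_mod_cast B.n_pos
  rw [mul_inv, inv_inv, mul_comm, ← div_eq_mul_inv]
  exact div_le_div_of_nonneg_left hn.le B.rhoMin_pos (B.rhoMin_le i)

theorem sqrt_ratio_le_rowBound (B : Model m n r) : √((r : ℝ) / min (m : ℝ) n) ≤ B.rowBound :=
  le_mul_of_one_le_left (Real.sqrt_nonneg _) B.one_le_mu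

theorem min_pos (B : Model m n r) : (0 : ℝ) < min (m : ℝ) n :=
  lt_min (by exact_mod_cast B.m_pos) (by exact_mod_cast B.n_pos)

theorem r_le_min (B : Model m n r) : (r : ℝ) ≤ min (m : ℝ) n :=
  le_min (by exact_mod_cast B.r_le_m) (by exact_mod_cast B.r_le_n)

theorem one_le_r (B : Model m n r) : (1 : ℝ) ≤ r := by exact_mod_cast B.r_pos

theorem rowBound_pos (B : Model m n r) : 0 < B.rowBound :=
  mul_pos (zero_lt_one.trans_le B.one_le_mu)
    (Real.sqrt_pos.2 (div_pos (zero_lt_one.trans_le B.one_le_r) B.min_pos))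

theorem errTol_pos (B : Model m n r) : 0 < B.errTol :=
  div_pos (Real.sqrt_pos.2 (div_pos (zero_lt_one.trans_le B.one_le_r) B.min_pos))
    (mul_pos (by norm_num) (zero_lt_one.trans_le B.one_le_kappa))

theorem errLog_nonneg (B : Model m n r) (T₁ : ℕ) : 0 ≤ errLog m n T₁ := by
  have hm : (1 : ℝ) ≤ m := by exact_mod_cast B.m_pos
  have : 0 ≤ Real.log ((m : ℝ) + n) := Real.log_nonneg (by linarith [Nat.cast_nonneg (α := ℝ) n])
  unfold errLog
  positivity

/-- The sampling length suffices for the bounds on the exploration error. -/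
structure Enough (B : Model m n r) (T₁ : ℕ) : Prop where
  pos : 0 < T₁
  row : 1 ≤ T₁ * B.rhoMin
  col : (n : ℝ) ≤ T₁
  weight_le : B.weight * √(r * min (m : ℝ) n) ≤ T₁ * (m + n)

theorem Enough.weight_mul_r_le (h : B.Enough T₁) : B.weight * r ≤ T₁ * (m + n) := by
  refine le_trans ?_ h.weight_le
  have := B.weight_pos
  gcongr
  refine Real.le_sqrt_of_sq_le ?_
  rw [sq]
  gcongr
  exact B.r_le_min

theorem Environment.lintegral_relErr_le (henv : B.Environment P ctx expl ξ) (h : B.Enough T₁) :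
    ∫⁻ ω, ENNReal.ofReal ((‖B.exploreErr T₁ ctx expl ξ ω‖ / B.sMin) ^ 2) ∂P ≤
      ENNReal.ofReal (errLog m n T₁ * B.relErr T₁ ^ 2) := by
  have hT : (0 : ℝ) < T₁ := by exact_mod_cast h.pos
  have hw := B.weight_pos
  have hs := B.sMin_pos
  have hbT : B.weight ≤ T₁ * ((m : ℝ) + n) :=
    (le_mul_of_one_le_right hw.le B.one_le_r).trans h.weight_mul_r_le
  have h1 := (henv.sampling T₁).lintegral_norm_sampleErr_le h.pos B.σ_pos B.m_pos B.σ_le_L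
    (fun i j => (B.abs_M_le i j).trans B.maxNorm_le_L) hw (fun i _ => B.inv_propensity_le i) rfl hbT
  have h2 : ∀ ω, ENNReal.ofReal ((‖B.exploreErr T₁ ctx expl ξ ω‖ / B.sMin) ^ 2) =
      ENNReal.ofReal ((B.sMin ^ 2)⁻¹) * ‖B.exploreErr T₁ ctx expl ξ ω‖ₑ ^ 2 := by
    intro ω
    rw [← ofReal_norm, ← ENNReal.ofReal_pow (norm_nonneg _),
      ← ENNReal.ofReal_mul (by positivity)]
    congr 1
    rw [div_pow]; ring
  simp only [h2]
  rw [lintegral_const_mul' _ _ ENNReal.ofReal_ne_top]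
  refine (mul_le_mul_right h1 _).trans ?_
  rw [← ENNReal.ofReal_mul (by positivity)]
  refine ENNReal.ofReal_le_ofReal (le_of_eq ?_)
  rw [relErr, errLog, div_pow, mul_pow, Real.sq_sqrt (by positivity)]
  ring

/-- Only a second moment is available for the operator norm, so Markov's inequality gives a failure
probability of order `1 / T₁` up to logarithms. The `m + n` row events have exponential bounds. -/
theorem Environment.measure_exploreBad_le (henv : B.Environment P ctx expl ξ) (h : B.Enough T₁)
    (hℓ : 0 < ℓ) :
    P (B.exploreBad T₁ ctx expl ξ ℓ) ≤ ENNReal.ofReal (errLog m n T₁ * B.relErr T₁ ^ 2 / B.errTol +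
      (m + n) * ((4 * r + 2) * Real.exp (-ℓ))) := by
  have hT : (0 : ℝ) < T₁ := by exact_mod_cast h.pos
  have htol := B.errTol_pos
  have hm : Measurable fun ω => ‖B.exploreErr T₁ ctx expl ξ ω‖ :=
    measurable_norm_matrix (measurable_exploreErr henv T₁)
  have h1 : P {ω | B.errTol ≤ (‖B.exploreErr T₁ ctx expl ξ ω‖ / B.sMin) ^ 2} ≤
      ENNReal.ofReal (errLog m n T₁ * B.relErr T₁ ^ 2 / B.errTol) := by
    have h2 := mul_meas_ge_le_lintegral (μ := P)
      (((hm.div_const B.sMin).pow_const 2).ennreal_ofReal) (ENNReal.ofReal B.errTol)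
    have h3 : {ω | B.errTol ≤ (‖B.exploreErr T₁ ctx expl ξ ω‖ / B.sMin) ^ 2} =
        {ω | ENNReal.ofReal B.errTol ≤
          ENNReal.ofReal ((‖B.exploreErr T₁ ctx expl ξ ω‖ / B.sMin) ^ 2)} := by
      ext ω
      simp only [Set.mem_ofPred_eq]
      rw [ENNReal.ofReal_le_ofReal_iff (sq_nonneg _)]
    rw [h3, ENNReal.ofReal_div_of_pos htol, ENNReal.le_div_iff_mul_le
      (Or.inl (ENNReal.ofReal_pos.2 htol).ne') (Or.inl ENNReal.ofReal_ne_top), mul_comm]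
    exact h2.trans (henv.lintegral_relErr_le h)
  have hM : ∀ i j, |B.M i j| ≤ B.L := fun i j => (B.abs_M_le i j).trans B.maxNorm_le_L
  have hent : ∀ {k : ℕ} (A : Matrix (Fin k) (Fin r) ℝ) (j : Fin k) (l : Fin r),
      |A j l| ≤ √(∑ l, A j l ^ 2) := by
    intro k A j l
    refine Real.le_sqrt_of_sq_le ?_
    rw [sq_abs]
    exact Finset.single_le_sum (f := fun l => A j l ^ 2) (fun _ _ => sq_nonneg _)
      (Finset.mem_univ l)
  have hrow : ∀ i, P {ω | ¬ RowGood (B.exploreErr T₁ ctx expl ξ ω) B.U B.V B.rowBound B.sMax ℓ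
      (B.linFluct T₁ ℓ) (B.quadFluct T₁ ℓ) i} ≤
      ENNReal.ofReal ((4 * r + 2) * Real.exp (-ℓ)) := by
    intro i
    refine (ENNReal.le_ofReal_iff_toReal_le (measure_ne_top _ _) (by positivity)).2 ?_
    refine (henv.sampling T₁).measure_not_rowGood_le h.pos B.σ_pos B.σ_le_L hM B.weight_pos
      (fun i _ => B.inv_propensity_le i) B.rowBound_pos hℓ B.U_orth B.V_orth B.M_eq
      B.norm_diagonal_s_le (fun j k => (hent B.V j k).trans (B.row_V_le j)) i (B.row_U_le i) ?_
    exact h.row.trans (mul_le_mul_of_nonneg_left (B.rhoMin_le i) hT.le)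
  have hcol : ∀ j, P {ω | ¬ RowGood (B.exploreErr T₁ ctx expl ξ ω)ᵀ B.V B.U B.rowBound B.sMax ℓ
      (B.linFluct T₁ ℓ) (B.quadFluct T₁ ℓ) j} ≤
      ENNReal.ofReal ((4 * r + 2) * Real.exp (-ℓ)) := by
    intro j
    refine (ENNReal.le_ofReal_iff_toReal_le (measure_ne_top _ _) (by positivity)).2 ?_
    simp only [exploreErr, ← sampleErr_transpose]
    have hMt : B.Mᵀ = B.V * Matrix.diagonal B.s * B.Uᵀ := by
      rw [B.M_eq]
      simp only [Matrix.transpose_mul, Matrix.transpose_transpose, Matrix.diagonal_transpose,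
        Matrix.mul_assoc]
    have hn : (0 : ℝ) < n := by exact_mod_cast B.n_pos
    refine (henv.sampling T₁).transpose.measure_not_rowGood_le h.pos B.σ_pos B.σ_le_L
      (fun j i => hM i j) B.weight_pos
      (fun _ i => by rw [mul_comm]; exact B.inv_propensity_le i) B.rowBound_pos hℓ B.V_orth
      B.U_orth hMt B.norm_diagonal_s_le (fun i k => (hent B.U i k).trans (B.row_U_le i)) j
      (B.row_V_le j) ?_
    rw [← div_eq_mul_inv, one_le_div hn]
    exact h.col
  have hU : ∀ {k : ℕ} {S : Fin k → Set Ω}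
      (_ : ∀ i, P (S i) ≤ ENNReal.ofReal ((4 * r + 2) * Real.exp (-ℓ))),
      P (⋃ i, S i) ≤ ENNReal.ofReal (k * ((4 * r + 2) * Real.exp (-ℓ))) := by
    intro k S hS
    refine (measure_iUnion_fintype_le P S).trans ((Finset.sum_le_sum fun i _ => hS i).trans ?_)
    rw [Finset.sum_const, Finset.card_univ, Fintype.card_fin, nsmul_eq_mul,
      ENNReal.ofReal_mul (Nat.cast_nonneg k), ENNReal.ofReal_natCast]
  refine (measure_union_le _ _).trans ?_
  have hH := B.errLog_nonneg T₁
  rw [ENNReal.ofReal_add (by positivity) (by positivity), add_mul,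
    ENNReal.ofReal_add (by positivity) (by positivity)]
  exact add_le_add h1 ((measure_union_le _ _).trans (add_le_add (hU hrow) (hU hcol)))

theorem misspecification_of_good {svd : Matrix (Fin m) (Fin n) ℝ →
      Matrix (Fin m) (Fin m) ℝ × Matrix (Fin n) (Fin n) ℝ} (hsvd : IsSVDRoutine svd)
    (h : B.Enough T₁) (hℓ : 1 ≤ ℓ) {ω : Ω} (hω : ω ∉ B.exploreBad T₁ ctx expl ξ ℓ) (i : Fin m)
    (j : Fin n) :
    |B.M i j - featureParam r B.M (svd (B.M + B.exploreErr T₁ ctx expl ξ ω)).1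
        (svd (B.M + B.exploreErr T₁ ctx expl ξ ω)).2 ⬝ᵥ
      feature r (svd (B.M + B.exploreErr T₁ ctx expl ξ ω)).1
        (svd (B.M + B.exploreErr T₁ ctx expl ξ ω)).2 i j| ≤
      7200 * ℓ ^ 2 * (B.sMax * B.kappa ^ 2 * B.rowBound ^ 2) *
        (B.relErr T₁ ^ 2 + (‖B.exploreErr T₁ ctx expl ξ ω‖ / B.sMin) ^ 2) := by
  simp only [exploreBad, Set.mem_union, Set.mem_iUnion, Set.mem_ofPred_eq, not_or, not_exists,
    not_not, not_le] at hω
  obtain ⟨h1, h2, h3⟩ := hω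
  have hT : (0 : ℝ) < T₁ := by exact_mod_cast h.pos
  have hκ := B.one_le_kappa
  have hk := B.min_pos
  have hr := B.one_le_r
  have hw := B.weight_pos
  set δ := ‖B.exploreErr T₁ ctx expl ξ ω‖ / B.sMin with hδ
  set k := min (m : ℝ) n with hkdef
  have hkm : k ≤ m + n := (min_le_left _ _).trans (by simp)
  have hg1 : √((r : ℝ) / k) ≤ 1 := by
    rw [Real.sqrt_le_one, div_le_one hk]
    exact B.r_le_min
  -- The form of `errTol` serves several conditions: the division by `κ` yields the contraction,
  -- `4096 = 64²` yields `δ ≤ 1 / 64`, and the square root yields `δ² ≤ u`.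
  have hκδ : B.kappa * δ ^ 2 ≤ √((r : ℝ) / k) / 4096 := by
    have h4 : B.kappa * B.errTol = √((r : ℝ) / k) / 4096 := by
      rw [errTol, ← hkdef]; field_simp
    rw [← h4]
    gcongr
  have hδg : δ ^ 2 ≤ √((r : ℝ) / k) / 4096 :=
    (le_mul_of_one_le_left (sq_nonneg δ) hκ).trans hκδ
  have hg0 : 0 ≤ √((r : ℝ) / k) := Real.sqrt_nonneg _
  have hu2 : r / k ≤ B.rowBound ^ 2 := by
    rw [← Real.sq_sqrt (by positivity : (0 : ℝ) ≤ r / k)]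
    exact pow_le_pow_left₀ hg0 B.sqrt_ratio_le_rowBound 2
  have hrN : (r : ℝ) ≤ B.rowBound ^ 2 * (m + n) := by
    calc (r : ℝ) = r / k * k := by field_simp
      _ ≤ _ := by gcongr
  have hδ1 : δ ≤ 1 / 64 := by
    have h4 : δ ^ 2 ≤ (1 / 64) ^ 2 := by
      calc δ ^ 2 ≤ √((r : ℝ) / k) / 4096 := hδg
        _ ≤ 1 / 4096 := by gcongr
        _ = _ := by norm_num
    exact (abs_le_of_sq_le_sq' h4 (by norm_num)).2
  refine misspecification_le (hsvd.1 _) B.r_le_m B.r_le_n B.U_orth B.V_orth B.diagonal_s_mul_inv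
    (Matrix.diagonal_transpose _) B.M_eq (by abel) (h2 i) (h3 j) hw.le hT B.L_pos.le
    B.rowBound_pos.le hℓ (by positivity) B.sMin_pos B.sMin_le_sMax B.norm_diagonal_s_le
    B.norm_diagonal_s_inv_le (B.row_U_le i) (B.row_V_le j) ?_ hδ1 ?_ hrN ?_ ?_
  · calc B.kappa * δ ^ 2 ≤ √((r : ℝ) / k) / 4096 := hκδ
      _ ≤ 1 / 4096 := by gcongr
      _ ≤ _ := by norm_num
  · refine (hδg.trans ?_).trans B.sqrt_ratio_le_rowBound
    linarith
  · rw [div_mul_eq_mul_div, div_le_iff₀ hT, mul_comm _ (T₁ : ℝ)]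
    exact h.weight_mul_r_le
  · have h5 : √((r : ℝ) / k) = r / √(r * k) := by
      rw [eq_div_iff (by positivity), ← Real.sqrt_mul (by positivity)]
      have : (r : ℝ) / k * (r * k) = r * r := by field_simp
      rw [this, Real.sqrt_mul_self (by positivity)]
    have h6 : B.weight / T₁ ≤ (m + n) / √(r * k) := by
      rw [div_le_div_iff₀ hT (by positivity), mul_comm _ (T₁ : ℝ)]
      exact h.weight_le
    calc δ ^ 2 * (B.weight / T₁) * r ≤ √((r : ℝ) / k) * ((m + n) / √(r * k)) * r := by
          gcongr
          linarith
      _ = (r / k) * (m + n) := by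
          rw [h5]
          have h7 : √((r : ℝ) * k) * √(r * k) = r * k := Real.mul_self_sqrt (by positivity)
          have : (r : ℝ) / √(r * k) * ((m + n) / √(r * k)) * r =
            r * r * (m + n) / (√(r * k) * √(r * k)) := by ring
          rw [this, h7]
          field_simp
      _ ≤ B.rowBound ^ 2 * (m + n) := by gcongr

end Model

end LowRankBandit

end

noncomputable section

namespace LowRankBandit

open scoped Matrix.Norms.L2Operator

/-! ### Regret of the two phases -/

namespace Model

variable {m n r : ℕ} {B : Model m n r} {Ω : Type*} [MeasurableSpace Ω] {P : Measure Ω}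
  [IsProbabilityMeasure P] {ctx : ℕ → Ω → Fin m} {expl : ℕ → Ω → Fin n} {ξ : ℕ → Ω → ℝ}
  {svd : Matrix (Fin m) (Fin n) ℝ → Matrix (Fin m) (Fin m) ℝ × Matrix (Fin n) (Fin n) ℝ}
  {sel : Finset (Fin n) → Fin n} {lam β : ℝ} {T₁ T₂ : ℕ}

theorem card_featureIndex_eq_dim (B : Model m n r) :
    dim m n r = Fintype.card (FeatureIndex m n r) := by
  have h := card_featureIndex B.r_le_m B.r_le_n
  have h' : ((Fintype.card (FeatureIndex m n r) : ℤ) : ℝ) = ((r * (m + n) - r ^ 2 : ℤ) : ℝ) := by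
    rw [h]
  push_cast at h'
  rw [dim, h']

theorem card_featureIndex_pos (B : Model m n r) : 0 < Fintype.card (FeatureIndex m n r) :=
  Fintype.card_pos_iff.2 ⟨⟨(⟨0, B.m_pos⟩, ⟨0, B.n_pos⟩), Or.inl B.r_pos⟩⟩

theorem regret_rsRminArm (ω : Ω) :
    B.regret ctx (fun t ω => rsRminArm r B.ρ svd sel lam β T₁ T₂ (fun t => ctx t ω)
        (fun t => expl t ω) (fun t j => B.M (ctx t ω) j + ξ t ω) t) (T₁ + T₂) ω =
      ∑ t ∈ Finset.range T₁, ((⨆ j, B.M (ctx t ω) j) - B.M (ctx t ω) (expl t ω)) +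
      exploitLoss r B.M sel lam β (dim m n r) T₂
        (svd (B.M + B.exploreErr T₁ ctx expl ξ ω)).1 (svd (B.M + B.exploreErr T₁ ctx expl ξ ω)).2
        (fun τ => ctx (T₁ + τ) ω) (fun τ => ξ (T₁ + τ) ω) := by
  rw [regret, Finset.sum_range_add]
  congr 1
  · refine Finset.sum_congr rfl fun t ht => ?_
    rw [rsRminArm, if_pos (Finset.mem_range.1 ht)]
  · refine Finset.sum_congr rfl fun τ _ => ?_
    rw [rsRminArm, if_neg (by omega), empiricalMatrix_eq B.ρ B.M, Nat.add_sub_cancel_left]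
    rfl

theorem measurable_regret (henv : B.Environment P ctx expl ξ) (hsvd : IsSVDRoutine svd) :
    Measurable (B.regret ctx (fun t ω => rsRminArm r B.ρ svd sel lam β T₁ T₂ (fun t => ctx t ω)
        (fun t => expl t ω) (fun t j => B.M (ctx t ω) j + ξ t ω) t) (T₁ + T₂)) := by
  have h1 : Measurable fun ω => exploitLoss r B.M sel lam β (dim m n r) T₂
        (svd (B.M + B.exploreErr T₁ ctx expl ξ ω)).1 (svd (B.M + B.exploreErr T₁ ctx expl ξ ω)).2
        (fun τ => ctx (T₁ + τ) ω) (fun τ => ξ (T₁ + τ) ω) := by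
    have mS := measurable_svd hsvd (A := fun ω => B.M + B.exploreErr T₁ ctx expl ξ ω)
      (fun i j => by
        simp only [Matrix.add_apply]
        exact measurable_const.add (measurable_exploreErr henv T₁ i j))
    exact measurable_exploitLoss (c := fun ω τ => ctx (T₁ + τ) ω) (x := fun ω τ => ξ (T₁ + τ) ω)
      mS.1 mS.2 (fun s => henv.measurable_ctx _) (fun s => henv.measurable_noise _)
  have h2 : Measurable fun ω =>
      ∑ t ∈ Finset.range T₁, ((⨆ j, B.M (ctx t ω) j) - B.M (ctx t ω) (expl t ω)) := by
    refine Finset.measurable_sum _ fun t _ => ?_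
    exact (measurable_of_countable fun p : Fin m × Fin n => (⨆ j, B.M p.1 j) - B.M p.1 p.2).comp
      ((henv.measurable_ctx t).prodMk (henv.measurable_expl t))
  have h3 : B.regret ctx (fun t ω => rsRminArm r B.ρ svd sel lam β T₁ T₂ (fun t => ctx t ω)
        (fun t => expl t ω) (fun t j => B.M (ctx t ω) j + ξ t ω) t) (T₁ + T₂) = _ :=
    funext fun ω => regret_rsRminArm ω
  rw [h3]
  exact h2.add h1

theorem regret_nonneg (a : ℕ → Ω → Fin n) (T : ℕ) (ω : Ω) : 0 ≤ B.regret ctx a T ω :=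
  Finset.sum_nonneg fun _ _ => sub_nonneg.2 (le_iSup_row B.M _ _)

theorem regret_le (a : ℕ → Ω → Fin n) (T : ℕ) (ω : Ω) :
    B.regret ctx a T ω ≤ T * (2 * maxNorm B.M) := by
  refine (Finset.sum_le_card_nsmul _ _ _ fun t _ => iSup_row_sub_le B.abs_M_le _ _).trans ?_
  rw [Finset.card_range, nsmul_eq_mul]

theorem integrable_regret (henv : B.Environment P ctx expl ξ) (hsvd : IsSVDRoutine svd) :
    Integrable (B.regret ctx (fun t ω => rsRminArm r B.ρ svd sel lam β T₁ T₂ (fun t => ctx t ω)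
        (fun t => expl t ω) (fun t j => B.M (ctx t ω) j + ξ t ω) t) (T₁ + T₂)) P := by
  refine Integrable.of_bound (measurable_regret henv hsvd).aestronglyMeasurable
    ((T₁ + T₂ : ℕ) * (2 * maxNorm B.M)) (ae_of_all _ fun ω => ?_)
  rw [Real.norm_of_nonneg (regret_nonneg _ _ _)]
  exact regret_le _ _ _

theorem integral_regret_le (henv : B.Environment P ctx expl ξ) (hsvd : IsSVDRoutine svd)
    (hsel : ∀ S : Finset (Fin n), S.Nonempty → sel S ∈ S) (h : B.Enough T₁) (hT₂ : 0 < T₂)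
    {s₀ ℓ ℓ' d : ℝ} {J : ℕ} (hd : d = dim m n r) (hJ : J = numLevels d T₂) (hℓ : 1 ≤ ℓ)
    (hlam : 0 < lam)
    (hs₀ : 0 ≤ s₀) (hβ : β = B.σ * (1 + s₀))
    (hlamM : lam * (m * n * maxNorm B.M ^ 2) ≤ (B.σ : ℝ) ^ 2)
    (hℓ' : Real.log (d + T₂ / lam) ≤ ℓ') (hℓ'1 : 1 ≤ ℓ') :
    ∫ ω, B.regret ctx (fun t ω => rsRminArm r B.ρ svd sel lam β T₁ T₂ (fun t => ctx t ω)
        (fun t => expl t ω) (fun t j => B.M (ctx t ω) j + ξ t ω) t) (T₁ + T₂) ω ∂P ≤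
      T₁ * (2 * maxNorm B.M) +
      (8 * d * ℓ' * (2 * maxNorm B.M) + 8 * J * β * √(2 * d * ℓ' * T₂) + 2 * β * √(d * T₂) +
        T₂ * (J + 1) * n * (2 * Real.exp (-(s₀ ^ 2 / 2))) * (T₂ * (2 * maxNorm B.M)) +
      2 * J * T₂ * (1 + √(2 * d * ℓ')) * (7200 * ℓ ^ 2 * (B.sMax * B.kappa ^ 2 * B.rowBound ^ 2)) *
        (B.relErr T₁ ^ 2 + errLog m n T₁ * B.relErr T₁ ^ 2) +
      T₂ * (2 * maxNorm B.M) * (errLog m n T₁ * B.relErr T₁ ^ 2 / B.errTol +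
        (m + n) * ((4 * r + 2) * Real.exp (-ℓ)))) := by
  have hMx := B.maxNorm_pos
  have hσ := B.σ_pos'
  have hκ := B.one_le_kappa
  have hu := B.rowBound_pos
  have hs1 := B.sMax_pos
  have hH := B.errLog_nonneg T₁
  have htol := B.errTol_pos
  have hdc : d = Fintype.card (FeatureIndex m n r) := hd.trans B.card_featureIndex_eq_dim
  have hβ0 : 0 ≤ β := by rw [hβ]; positivity
  have hd0 : 0 ≤ d := by rw [hdc]; positivity
  subst hd
  set d := dim m n r with hd
  set R := B.regret ctx (fun t ω => rsRminArm r B.ρ svd sel lam β T₁ T₂ (fun t => ctx t ω)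
        (fun t => expl t ω) (fun t j => B.M (ctx t ω) j + ξ t ω) t) (T₁ + T₂) with hR
  set δ : Ω → ℝ := fun ω => ‖B.exploreErr T₁ ctx expl ξ ω‖ / B.sMin with hδ
  set A := 2 * J * T₂ * (1 + √(2 * d * ℓ')) *
    (7200 * ℓ ^ 2 * (B.sMax * B.kappa ^ 2 * B.rowBound ^ 2)) with hA
  set S := 8 * d * ℓ' * (2 * maxNorm B.M) + 8 * J * β * √(2 * d * ℓ' * T₂) + 2 * β * √(d * T₂) +
        T₂ * (J + 1) * n * (2 * Real.exp (-(s₀ ^ 2 / 2))) * (T₂ * (2 * maxNorm B.M)) with hS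
  have hA0 : 0 ≤ A := by positivity
  have hS0 : 0 ≤ S := by positivity
  set X : Ω → Ω → ℝ := fun ω ω' => exploitLoss r B.M sel lam β d T₂
        (svd (B.M + B.exploreErr T₁ ctx expl ξ ω)).1 (svd (B.M + B.exploreErr T₁ ctx expl ξ ω)).2
        (fun τ => ctx (T₁ + τ) ω) (fun τ => ξ (T₁ + τ) ω') with hX
  have hδm : Measurable δ :=
    (measurable_norm_matrix (measurable_exploreErr henv T₁)).div_const _
  have hXi : ∀ ω, ∫⁻ ω', ENNReal.ofReal (X ω ω') ∂P = ENNReal.ofReal (∫ ω', X ω ω' ∂P) := by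
    intro ω
    refine (ofReal_integral_eq_lintegral_ofReal ?_ (ae_of_all _ fun ω' => ?_)).symm
    · exact integrable_exploitLoss _ B.abs_M_le fun t => henv.measurable_noise _
    · exact exploitLoss_nonneg _ _ _ _
  -- For a fixed outcome of the exploration the misspecification is a number proportional to
  -- `relErr² + δ²`. Integrating over the outcome then requires only the second moment of the error.
  have hXgood : ∀ ω ∉ B.exploreBad T₁ ctx expl ξ ℓ, ∫⁻ ω', ENNReal.ofReal (X ω ω') ∂P ≤
      ENNReal.ofReal (S + A * B.relErr T₁ ^ 2) +
        ENNReal.ofReal A * ENNReal.ofReal (δ ω ^ 2) := by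
    intro ω hω
    rw [hXi, ← ENNReal.ofReal_mul hA0, ← ENNReal.ofReal_add (by positivity) (by positivity)]
    refine ENNReal.ofReal_le_ofReal ?_
    have hfull := hsvd.1 (B.M + B.exploreErr T₁ ctx expl ξ ω)
    have h1 := integral_exploitLoss_le (P := P) (ξ := fun t => ξ (T₁ + t)) (sel := sel) (β := β)
      (N := T₂) B.n_pos hfull.1 hfull.2.1 (fun τ => ctx (T₁ + τ) ω) hsel hlam hT₂ hdc
      B.card_featureIndex_pos B.σ_pos hs₀ hβ B.abs_M_le
      (misspecification_of_good hsvd h hℓ hω) hlamM hℓ' hℓ'1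
      (fun t => henv.measurable_noise _)
      (henv.iIndepFun_noise.precomp (g := fun t => T₁ + t) (add_right_injective T₁))
      (fun t => henv.subgaussian _)
    refine h1.trans (le_of_eq ?_)
    rw [← hJ, hS, hA]
    ring
  have hXbad : ∀ ω, ∫⁻ ω', ENNReal.ofReal (X ω ω') ∂P ≤
      ENNReal.ofReal (T₂ * (2 * maxNorm B.M)) := by
    intro ω
    refine (lintegral_mono fun ω' => ENNReal.ofReal_le_ofReal
      (exploitLoss_le B.abs_M_le _ _ _ _)).trans ?_
    rw [lintegral_const, measure_univ, mul_one]
  have hmain : ∫⁻ ω, ENNReal.ofReal (X ω ω) ∂P ≤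
      ENNReal.ofReal (S + A * (B.relErr T₁ ^ 2 + errLog m n T₁ * B.relErr T₁ ^ 2) +
      T₂ * (2 * maxNorm B.M) * (errLog m n T₁ * B.relErr T₁ ^ 2 / B.errTol +
        (m + n) * ((4 * r + 2) * Real.exp (-ℓ)))) := by
    rw [henv.lintegral_exploitLoss hsvd hT₂]
    refine (lintegral_le_of_good (hδm.pow_const 2).ennreal_ofReal hXgood hXbad).trans ?_
    have e1 := henv.lintegral_relErr_le h
    have e2 := henv.measure_exploreBad_le h (zero_lt_one.trans_le hℓ)
    refine (add_le_add (add_le_add le_rfl (mul_le_mul_right e1 _))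
      (mul_le_mul_right e2 _)).trans ?_
    rw [← ENNReal.ofReal_mul hA0, ← ENNReal.ofReal_mul (by positivity),
      ← ENNReal.ofReal_add (by positivity) (by positivity),
      ← ENNReal.ofReal_add (by positivity) (by positivity)]
    exact ENNReal.ofReal_le_ofReal (le_of_eq (by ring))
  have hRle : ∀ ω, R ω ≤ T₁ * (2 * maxNorm B.M) + X ω ω := by
    intro ω
    rw [hR, regret_rsRminArm]
    gcongr
    refine (Finset.sum_le_card_nsmul _ _ _ fun t _ => iSup_row_sub_le B.abs_M_le _ _).trans ?_
    rw [Finset.card_range, nsmul_eq_mul]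
  have hRi : Integrable R P := integrable_regret henv hsvd
  rw [← ENNReal.ofReal_le_ofReal_iff (by positivity), ofReal_integral_eq_lintegral_ofReal hRi
    (ae_of_all _ fun ω => regret_nonneg _ _ _),
    ENNReal.ofReal_add (by positivity) (by positivity)]
  calc ∫⁻ ω, ENNReal.ofReal (R ω) ∂P
      ≤ ∫⁻ ω, (ENNReal.ofReal (T₁ * (2 * maxNorm B.M)) + ENNReal.ofReal (X ω ω)) ∂P := by
        refine lintegral_mono fun ω => ?_
        rw [← ENNReal.ofReal_add (by positivity) (exploitLoss_nonneg _ _ _ _)]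
        exact ENNReal.ofReal_le_ofReal (hRle ω)
    _ = ENNReal.ofReal (T₁ * (2 * maxNorm B.M)) + ∫⁻ ω, ENNReal.ofReal (X ω ω) ∂P := by
        rw [lintegral_add_left measurable_const, lintegral_const, measure_univ, mul_one]
    _ ≤ _ := by gcongr

end Model

end LowRankBandit

end

/-! ### The rate, the logarithmic factors and the choice of the exploration length. -/

noncomputable section

namespace LowRankBandit

/-! ### The rate -/

namespace Model

variable {m n r : ℕ}

theorem cast_m_pos (B : Model m n r) : (0 : ℝ) < m := by exact_mod_cast B.m_pos

theorem cast_n_pos (B : Model m n r) : (0 : ℝ) < n := by exact_mod_cast B.n_pos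

theorem min_le_sqrt_mul (B : Model m n r) : min (m : ℝ) n ≤ √(m * n) := by
  refine Real.le_sqrt_of_sq_le ?_
  rw [sq]
  exact mul_le_mul (min_le_left _ _) (min_le_right _ _) B.min_pos.le B.cast_m_pos.le

theorem sqrt_mul_le_add (B : Model m n r) : √((m : ℝ) * n) ≤ m + n := by
  have hm := B.cast_m_pos
  have hn := B.cast_n_pos
  refine Real.sqrt_le_iff.2 ⟨by positivity, ?_⟩
  nlinarith

theorem one_le_min (B : Model m n r) : (1 : ℝ) ≤ min (m : ℝ) n := B.one_le_r.trans B.r_le_min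

theorem min_le_add (B : Model m n r) : min (m : ℝ) n ≤ m + n :=
  (min_le_left _ _).trans (by linarith [B.cast_n_pos])

theorem rate_pos (B : Model m n r) : 0 < B.rate := by
  have hm := B.cast_m_pos
  have hn := B.cast_n_pos
  have hr := zero_lt_one.trans_le B.one_le_r
  have hμ := zero_lt_one.trans_le B.one_le_mu
  have hκ := zero_lt_one.trans_le B.one_le_kappa
  have hL := B.L_pos
  have hρ := B.rhoMin_pos
  have hk := B.min_pos
  unfold rate
  positivity

theorem rate_sq (B : Model m n r) : B.rate ^ 2 = B.mu ^ 4 * B.kappa ^ 4 * (r ^ 2 * √r) * B.L ^ 2 *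
    (((m : ℝ) + n) * √((m : ℝ) + n)) * √(m * n) / (m * B.rhoMin * min (m : ℝ) n) := by
  have hm := B.cast_m_pos
  have hn := B.cast_n_pos
  have hr := zero_lt_one.trans_le B.one_le_r
  have hρ := B.rhoMin_pos
  have hk := B.min_pos
  have h1 : ((r : ℝ) ^ (5 / 4 : ℝ)) ^ 2 = r ^ 2 * √r := by
    rw [Real.sqrt_eq_rpow, ← Real.rpow_natCast, ← Real.rpow_natCast, ← Real.rpow_mul hr.le,
      ← Real.rpow_add hr]
    norm_num
  have h2 : (((m : ℝ) + n) ^ (3 / 4 : ℝ)) ^ 2 = ((m : ℝ) + n) * √((m : ℝ) + n) := by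
    rw [Real.sqrt_eq_rpow, ← Real.rpow_natCast, ← Real.rpow_mul (by positivity)]
    nth_rewrite 2 [← Real.rpow_one ((m : ℝ) + n)]
    rw [← Real.rpow_add (by positivity)]
    norm_num
  have h3 : (((m : ℝ) * n) ^ (1 / 4 : ℝ)) ^ 2 = √(m * n) := by
    rw [Real.sqrt_eq_rpow, ← Real.rpow_natCast, ← Real.rpow_mul (by positivity)]
    norm_num
  rw [rate, div_pow, Real.sq_sqrt (by positivity), mul_pow, mul_pow, mul_pow, mul_pow, mul_pow, h1,
    h2, h3]
  ring

/-- A lower bound for the square of the rate in which only the dimensions are kept. -/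
theorem le_rate_sq (B : Model m n r) : √r * ((m : ℝ) + n) * √((m : ℝ) + n) * √(m * n) * B.L ^ 2 * r ^ 2 ≤
    B.rate ^ 2 * (m * B.rhoMin * min (m : ℝ) n) := by
  have hm := B.cast_m_pos
  have hn := B.cast_n_pos
  have hρ := B.rhoMin_pos
  have hk := B.min_pos
  rw [B.rate_sq, div_mul_cancel₀ _ (by positivity)]
  have h1 : 1 ≤ B.mu ^ 4 * B.kappa ^ 4 :=
    one_le_mul_of_one_le_of_one_le (one_le_pow₀ B.one_le_mu) (one_le_pow₀ B.one_le_kappa)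
  calc _ = 1 * (√r * ((m : ℝ) + n) * √((m : ℝ) + n) * √(m * n) * B.L ^ 2 * r ^ 2) := by ring
    _ ≤ (B.mu ^ 4 * B.kappa ^ 4) *
        (√r * ((m : ℝ) + n) * √((m : ℝ) + n) * √(m * n) * B.L ^ 2 * r ^ 2) := by gcongr
    _ = _ := by ring

theorem one_le_sqrt_r (B : Model m n r) : 1 ≤ √(r : ℝ) := by rw [Real.one_le_sqrt]; exact B.one_le_r

theorem one_le_sqrt_add (B : Model m n r) : 1 ≤ √((m : ℝ) + n) := by
  rw [Real.one_le_sqrt]; exact B.one_le_min.trans B.min_le_add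

/-- The rate thereby dominates the cost `L √(d T)` of a well-specified linear bandit, whose
dimension is at most `r (m + n)`. -/
theorem mul_L_sq_le_rate_sq (B : Model m n r) : r * ((m : ℝ) + n) * B.L ^ 2 ≤ B.rate ^ 2 := by
  have hm := B.cast_m_pos
  have hn := B.cast_n_pos
  have hρ := B.rhoMin_pos
  have hk := B.min_pos
  have hr := B.one_le_r
  have h1 := B.le_rate_sq
  have h2 : B.rate ^ 2 * (m * B.rhoMin * min (m : ℝ) n) ≤ B.rate ^ 2 * min (m : ℝ) n := by
    have := B.mul_rhoMin_le_one
    have h4 : m * B.rhoMin * min (m : ℝ) n ≤ 1 * min (m : ℝ) n := by gcongr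
    rw [one_mul] at h4
    gcongr
  have h3 : r * ((m : ℝ) + n) * B.L ^ 2 * min (m : ℝ) n ≤
      √r * ((m : ℝ) + n) * √((m : ℝ) + n) * √(m * n) * B.L ^ 2 * r ^ 2 := by
    calc r * ((m : ℝ) + n) * B.L ^ 2 * min (m : ℝ) n
        = 1 * ((m : ℝ) + n) * 1 * min (m : ℝ) n * B.L ^ 2 * (r * 1) := by ring
      _ ≤ √r * ((m : ℝ) + n) * √((m : ℝ) + n) * √(m * n) * B.L ^ 2 * (r * r) := by
        gcongr
        exacts [B.one_le_sqrt_r, B.one_le_sqrt_add, B.min_le_sqrt_mul]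
      _ = _ := by ring
  exact le_of_mul_le_mul_right (h3.trans (h1.trans h2)) hk

theorem L_mul_sqrt_le_rate (B : Model m n r) : B.L * √(r * ((m : ℝ) + n)) ≤ B.rate := by
  have h := Real.sqrt_le_sqrt B.mul_L_sq_le_rate_sq
  rw [Real.sqrt_sq B.rate_pos.le, Real.sqrt_mul' _ (sq_nonneg _), Real.sqrt_sq B.L_pos.le] at h
  linarith

theorem L_le_rate (B : Model m n r) : B.L ≤ B.rate := by
  refine le_trans (le_mul_of_one_le_right B.L_pos.le ?_) B.L_mul_sqrt_le_rate
  rw [Real.one_le_sqrt]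
  exact one_le_mul_of_one_le_of_one_le B.one_le_r (B.one_le_min.trans B.min_le_add)

/-- The square of the rate exceeds `L²` by enough dimensional factors to imply every requirement on
the sample size. -/
theorem enough_of_rate_sq_le (B : Model m n r) {T₁ : ℕ} (h : B.rate ^ 2 ≤ T₁ * B.L ^ 2) : B.Enough T₁ := by
  have hm := B.cast_m_pos
  have hn := B.cast_n_pos
  have hρ := B.rhoMin_pos
  have hk := B.min_pos
  have hr := B.one_le_r
  have hL := B.L_pos
  have hT : (n : ℝ) ≤ T₁ := by
    have h1 := B.mul_L_sq_le_rate_sq.trans h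
    have h2 := le_of_mul_le_mul_right h1 (by positivity)
    nlinarith
  have hT0 : 0 < T₁ := by
    have : (0 : ℝ) < T₁ := hn.trans_le hT
    exact_mod_cast this
  have h1 : √r * ((m : ℝ) + n) * √((m : ℝ) + n) * √(m * n) * r ^ 2 ≤
      T₁ * (m * B.rhoMin * min (m : ℝ) n) := by
    refine le_of_mul_le_mul_right (?_ : _ * B.L ^ 2 ≤ _ * B.L ^ 2) (by positivity)
    calc _ = √r * ((m : ℝ) + n) * √((m : ℝ) + n) * √(m * n) * B.L ^ 2 * r ^ 2 := by ring
      _ ≤ B.rate ^ 2 * (m * B.rhoMin * min (m : ℝ) n) := B.le_rate_sq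
      _ ≤ (T₁ * B.L ^ 2) * (m * B.rhoMin * min (m : ℝ) n) := by gcongr
      _ = _ := by ring
  have hr2 : (1 : ℝ) ≤ r ^ 2 := one_le_pow₀ hr
  refine ⟨hT0, ?_, hT, ?_⟩
  · have h2 : m * min (m : ℝ) n * 1 ≤ m * min (m : ℝ) n * (T₁ * B.rhoMin) := by
      calc m * min (m : ℝ) n * 1 = 1 * m * 1 * min (m : ℝ) n * 1 := by ring
        _ ≤ √r * ((m : ℝ) + n) * √((m : ℝ) + n) * √(m * n) * r ^ 2 := by
          gcongr
          exacts [B.one_le_sqrt_r, by linarith, B.one_le_sqrt_add, B.min_le_sqrt_mul]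
        _ ≤ _ := h1
        _ = _ := by ring
    exact le_of_mul_le_mul_left h2 (by positivity)
  · rw [weight, div_mul_eq_mul_div, div_le_iff₀ hρ]
    refine le_of_mul_le_mul_right (?_ : _ * (m * min (m : ℝ) n) ≤ _ * (m * min (m : ℝ) n))
      (by positivity)
    have h3 : √(m * n) * √((m : ℝ) * n) = m * n := Real.mul_self_sqrt (by positivity)
    rw [Real.sqrt_mul (by positivity)]
    calc n * (√r * √(min (m : ℝ) n)) * (m * min (m : ℝ) n)
        = √r * min (m : ℝ) n * √(min (m : ℝ) n) * √(m * n) * 1 * √(m * n) := by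
          linear_combination -(√r * min (m : ℝ) n * √(min (m : ℝ) n)) * h3
      _ ≤ √r * ((m : ℝ) + n) * √((m : ℝ) + n) * √(m * n) * r ^ 2 * ((m : ℝ) + n) := by
          gcongr
          exacts [B.min_le_add, B.min_le_add, B.sqrt_mul_le_add]
      _ ≤ T₁ * (m * B.rhoMin * min (m : ℝ) n) * ((m : ℝ) + n) := by gcongr
      _ = _ := by ring

theorem rowBound_sq (B : Model m n r) : B.rowBound ^ 2 = B.mu ^ 2 * (r / min (m : ℝ) n) := by
  have hk := B.min_pos
  rw [rowBound, mul_pow, Real.sq_sqrt (by positivity)]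

theorem relErr_sq (B : Model m n r) (T₁ : ℕ) :
    B.relErr T₁ ^ 2 = B.L ^ 2 * (n / B.rhoMin * (m + n) / T₁) / B.sMin ^ 2 := by
  have hρ := B.rhoMin_pos
  rw [relErr, weight, div_pow, mul_pow, Real.sq_sqrt (by positivity)]

/-- The leading term of the misspecification cost. -/
theorem misspecification_cost_le (B : Model m n r) {T₁ : ℕ} (hT₁ : 0 < T₁) :
    B.sMax * B.kappa ^ 2 * B.rowBound ^ 2 * √(r * ((m : ℝ) + n)) * B.relErr T₁ ^ 2 ≤
      B.rate ^ 2 / (maxNorm B.M * T₁) := by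
  have hm := B.cast_m_pos
  have hn := B.cast_n_pos
  have hρ := B.rhoMin_pos
  have hk := B.min_pos
  have hr := zero_lt_one.trans_le B.one_le_r
  have hL := B.L_pos
  have hs := B.sMin_pos
  have hs1 := B.sMax_pos
  have hμ := zero_lt_one.trans_le B.one_le_mu
  have hMx := B.maxNorm_pos
  have hT : (0 : ℝ) < T₁ := by exact_mod_cast hT₁
  have hκ : B.kappa = B.sMax / B.sMin := rfl
  have hκ0 := zero_lt_one.trans_le B.one_le_kappa
  have hq : 0 < √((m : ℝ) * n) := by positivity
  -- The left side is `κ² / σ₁`, and the bound on the entries of `M` is a lower bound for `σ₁`. This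
  -- introduces `1 / ‖M‖_max` and the factor `√(mn)`.
  have h1 : B.sMax / B.sMin ^ 2 ≤ B.kappa ^ 2 * B.mu ^ 2 * r / (maxNorm B.M * √(m * n)) := by
    have h2 := B.maxNorm_le
    rw [le_div_iff₀ hq] at h2
    rw [div_le_div_iff₀ (by positivity) (by positivity)]
    calc B.sMax * (maxNorm B.M * √(m * n)) ≤ B.sMax * (B.sMax * B.mu ^ 2 * r) := by gcongr
      _ = _ := by rw [hκ]; field_simp
  have h3 : √(m * n) * √((m : ℝ) * n) = m * n := Real.mul_self_sqrt (by positivity)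
  rw [B.rowBound_sq, B.relErr_sq, B.rate_sq, Real.sqrt_mul hr.le]
  calc B.sMax * B.kappa ^ 2 * (B.mu ^ 2 * (r / min (m : ℝ) n)) * (√r * √((m : ℝ) + n)) *
        (B.L ^ 2 * (n / B.rhoMin * (m + n) / T₁) / B.sMin ^ 2)
      = (B.sMax / B.sMin ^ 2) * (B.kappa ^ 2 * (B.mu ^ 2 * (r / min (m : ℝ) n)) *
        (√r * √((m : ℝ) + n)) * (B.L ^ 2 * (n / B.rhoMin * (m + n) / T₁))) := by ring
    _ ≤ (B.kappa ^ 2 * B.mu ^ 2 * r / (maxNorm B.M * √(m * n))) *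
        (B.kappa ^ 2 * (B.mu ^ 2 * (r / min (m : ℝ) n)) *
        (√r * √((m : ℝ) + n)) * (B.L ^ 2 * (n / B.rhoMin * (m + n) / T₁))) := by gcongr
    _ = _ := by
      field_simp
      linear_combination (-1 : ℝ) * h3

/-- The price of a bad round over the threshold of Markov's inequality is of the order of the
misspecification coefficient. Hence the merely polynomial failure probability does not spoil the
rate. -/
theorem maxNorm_div_errTol_le (B : Model m n r) :
    maxNorm B.M / B.errTol ≤
      4096 * (B.sMax * B.kappa ^ 2 * B.rowBound ^ 2 * √(r * ((m : ℝ) + n))) := by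
  have hm := B.cast_m_pos
  have hn := B.cast_n_pos
  have hk := B.min_pos
  have hr := zero_lt_one.trans_le B.one_le_r
  have hs1 := B.sMax_pos
  have hμ := zero_lt_one.trans_le B.one_le_mu
  have hκ1 := B.one_le_kappa
  have hκ0 := zero_lt_one.trans_le hκ1
  have hq : 0 < √((m : ℝ) * n) := by positivity
  set k := min (m : ℝ) n with hkdef
  have hg : 0 < √((r : ℝ) / k) := by positivity
  have h0 : √((r : ℝ) / k) * √(r / k) = r / k := Real.mul_self_sqrt (by positivity)
  have h1 : k * √k ≤ √(m * n) * √((m : ℝ) + n) := by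
    gcongr
    exacts [B.min_le_sqrt_mul, B.min_le_add]
  have h2 : √((r : ℝ) / k) * √k = √r := by
    rw [← Real.sqrt_mul (by positivity), div_mul_cancel₀ _ hk.ne']
  have h3 : r / √(m * n) ≤ √((r : ℝ) / k) * (r / k) * √(r * ((m : ℝ) + n)) := by
    rw [div_le_iff₀ hq, Real.sqrt_mul hr.le, ← h2]
    have h4 : √((r : ℝ) / k) * (r / k) * (√(r / k) * √k * √((m : ℝ) + n)) * √(m * n) =
        (√((r : ℝ) / k) * √(r / k)) * (r / k) * √k * (√(m * n) * √((m : ℝ) + n)) := by ring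
    rw [h4, h0]
    calc (r : ℝ) = r * 1 := by ring
      _ ≤ r * r := by gcongr; exact B.one_le_r
      _ = r / k * (r / k) * √k * (k * √k) := by
        have h5 : √k * √k = k := Real.mul_self_sqrt hk.le
        have h6 : (r : ℝ) / k * (r / k) * √k * (k * √k) = r / k * (r / k) * k * (√k * √k) := by ring
        rw [h6, h5]; field_simp
      _ ≤ r / k * (r / k) * √k * (√(m * n) * √((m : ℝ) + n)) := by gcongr
  rw [errTol, ← hkdef, B.rowBound_sq, ← hkdef, div_div_eq_mul_div, div_le_iff₀ hg]
  calc maxNorm B.M * (4096 * B.kappa)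
      ≤ (B.sMax * B.mu ^ 2 * r / √(m * n)) * (4096 * B.kappa) := by gcongr; exact B.maxNorm_le
    _ = 4096 * B.sMax * B.mu ^ 2 * (B.kappa * 1) * (r / √(m * n)) := by ring
    _ ≤ 4096 * B.sMax * B.mu ^ 2 * (B.kappa * B.kappa) *
        (√((r : ℝ) / k) * (r / k) * √(r * ((m : ℝ) + n))) := by gcongr
    _ = _ := by ring

end Model

end LowRankBandit

end

noncomputable section

namespace LowRankBandit

/-! ### Logarithmic factors -/

namespace Model

variable {m n r T T₁ T₂ : ℕ}

/-- The argument of the logarithm in the regret bound. -/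
def logArg (B : Model m n r) (T : ℕ) : ℝ := 1 + m * n * T * (B.L / B.σ)

/-- Twice the logarithm in the regret bound. -/
def logFactor (B : Model m n r) (T : ℕ) : ℝ := 2 * Real.log (B.logArg T)

theorem one_le_L_div_σ (B : Model m n r) : 1 ≤ B.L / B.σ := (one_le_div B.σ_pos').2 B.σ_le_L

theorem one_le_cast_m (B : Model m n r) : (1 : ℝ) ≤ m := by exact_mod_cast B.m_pos

theorem one_le_cast_n (B : Model m n r) : (1 : ℝ) ≤ n := by exact_mod_cast B.n_pos

theorem one_add_mul_le_logArg (B : Model m n r) : 1 + (m : ℝ) * n * T ≤ B.logArg T := by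
  rw [logArg]
  have := le_mul_of_one_le_right (by positivity : (0 : ℝ) ≤ m * n * T) B.one_le_L_div_σ
  linarith

theorem two_le_logArg (B : Model m n r) (hT : 1 ≤ T) : 2 ≤ B.logArg T := by
  have hT' : (1 : ℝ) ≤ T := by exact_mod_cast hT
  have h1 : (1 : ℝ) ≤ m * n * T := one_le_mul_of_one_le_of_one_le
    (one_le_mul_of_one_le_of_one_le B.one_le_cast_m B.one_le_cast_n) hT'
  linarith [B.one_add_mul_le_logArg (T := T)]

theorem T_le_logArg (B : Model m n r) : (T : ℝ) ≤ B.logArg T := by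
  have h1 := le_mul_of_one_le_left (Nat.cast_nonneg T)
    (one_le_mul_of_one_le_of_one_le B.one_le_cast_m B.one_le_cast_n)
  linarith [B.one_add_mul_le_logArg (T := T)]

theorem n_mul_T_le_logArg (B : Model m n r) : (n : ℝ) * T ≤ B.logArg T := by
  have h1 := le_mul_of_one_le_left (by positivity : (0 : ℝ) ≤ n * T) B.one_le_cast_m
  linarith [B.one_add_mul_le_logArg (T := T)]

theorem add_le_logArg (B : Model m n r) (hT : 1 ≤ T) : (m : ℝ) + n ≤ B.logArg T := by
  have hT' : (1 : ℝ) ≤ T := by exact_mod_cast hT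
  have hm := B.one_le_cast_m
  have hn := B.one_le_cast_n
  have h1 := le_mul_of_one_le_right (by positivity : (0 : ℝ) ≤ m * n) hT'
  nlinarith [B.one_add_mul_le_logArg (T := T)]

theorem r_le_logArg (B : Model m n r) (hT : 1 ≤ T) : (r : ℝ) ≤ B.logArg T :=
  (B.r_le_min.trans B.min_le_add).trans (B.add_le_logArg hT)

theorem L_div_σ_le_logArg (B : Model m n r) (hT : 1 ≤ T) : B.L / B.σ ≤ B.logArg T := by
  have hT' : (1 : ℝ) ≤ T := by exact_mod_cast hT
  have h1 : (1 : ℝ) ≤ m * n * T := one_le_mul_of_one_le_of_one_le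
    (one_le_mul_of_one_le_of_one_le B.one_le_cast_m B.one_le_cast_n) hT'
  have h2 := le_mul_of_one_le_left (zero_le_one.trans B.one_le_L_div_σ) h1
  rw [logArg]
  linarith

/-- The factor `2` in `logFactor` is there for this: `logArg` is at least `2`, and `2 log 2 > 1`. -/
theorem one_le_logFactor (B : Model m n r) (hT : 1 ≤ T) : 1 ≤ B.logFactor T := by
  have h1 : Real.log 2 ≤ Real.log (B.logArg T) := Real.log_le_log (by norm_num) (B.two_le_logArg hT)
  have := Real.log_two_gt_d9
  rw [logFactor]
  linarith

theorem log_le_logFactor (B : Model m n r) (hT : 1 ≤ T) {x : ℝ} (hx : 0 ≤ x) {j : ℕ}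
    (h : x ≤ B.logArg T ^ j) : Real.log x ≤ j * (B.logFactor T / 2) := by
  have hG : 0 ≤ Real.log (B.logArg T) := Real.log_nonneg (by linarith [B.two_le_logArg hT])
  -- At `x = 0` the logarithm has the default value `0`.
  rcases hx.eq_or_lt with rfl | hx
  · rw [Real.log_zero, logFactor]; positivity
  · have := Real.log_le_log hx h
    rw [Real.log_pow] at this
    rw [logFactor]
    linarith

theorem one_le_dim (B : Model m n r) : 1 ≤ dim m n r := by
  rw [B.card_featureIndex_eq_dim]
  exact_mod_cast B.card_featureIndex_pos

theorem dim_le (m n r : ℕ) : dim m n r ≤ r * ((m : ℝ) + n) := by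
  rw [dim]
  linarith [sq_nonneg (r : ℝ)]

theorem errLog_le (B : Model m n r) (hT₁ : 1 ≤ T₁) (hT : T₁ ≤ T) :
    errLog m n T₁ ≤ 27648 * B.logFactor T ^ 4 := by
  have hT1 : 1 ≤ T := hT₁.trans hT
  have hl := B.one_le_logFactor hT1
  have h1 : Real.log ((m : ℝ) + n) ≤ B.logFactor T := by
    have := B.log_le_logFactor hT1 (j := 1) (x := (m : ℝ) + n) (by positivity)
      (by rw [pow_one]; exact B.add_le_logArg hT1)
    push_cast at this
    linarith
  have h0 : 0 ≤ Real.log ((m : ℝ) + n) :=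
    Real.log_nonneg (by linarith [B.one_le_cast_m, B.one_le_cast_n])
  have h2 : Real.log T₁ ≤ B.logFactor T := by
    have hTT : (T₁ : ℝ) ≤ T := by exact_mod_cast hT
    have := B.log_le_logFactor hT1 (j := 1) (Nat.cast_nonneg T₁)
      (by rw [pow_one]; exact hTT.trans B.T_le_logArg)
    push_cast at this
    linarith
  have h3 : 0 ≤ Real.log T₁ := Real.log_nonneg (by exact_mod_cast hT₁)
  set l := B.logFactor T
  have hl2 : 1 ≤ l ^ 2 := one_le_pow₀ hl
  calc errLog m n T₁ ≤ 48 * (l + l) * (3 * l + l) * (70 * l ^ 2 + 2 * l ^ 2) := by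
        rw [errLog]
        gcongr <;> linarith
    _ = _ := by ring

theorem numLevels_le (B : Model m n r) (hT : 1 ≤ T) (hT₂ : T₂ ≤ T) :
    (numLevels (dim m n r) T₂ : ℝ) ≤ 3 * B.logFactor T := by
  have hl := B.one_le_logFactor hT
  have hd := B.one_le_dim
  have hTT : (T₂ : ℝ) ≤ T := by exact_mod_cast hT₂
  have h1 : Real.log (T₂ / dim m n r) ≤ B.logFactor T / 2 := by
    have := B.log_le_logFactor hT (j := 1) (x := T₂ / dim m n r) (by positivity)
      (by rw [pow_one]
          exact (div_le_self (Nat.cast_nonneg _) hd).trans (hTT.trans B.T_le_logArg))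
    push_cast at this
    linarith
  have h2 : Real.logb 2 (T₂ / dim m n r) / 2 ≤ B.logFactor T := by
    have h3 := Real.log_two_gt_d9
    rw [Real.logb, div_div, div_le_iff₀ (by linarith)]
    nlinarith
  have h4 : (⌈Real.logb 2 (T₂ / dim m n r) / 2⌉₊ : ℝ) ≤ B.logFactor T + 1 := by
    have h5 : (⌈Real.logb 2 (T₂ / dim m n r) / 2⌉₊ : ℝ) ≤ ⌈B.logFactor T⌉₊ := by
      exact_mod_cast Nat.ceil_mono h2
    exact h5.trans (Nat.ceil_lt_add_one (by linarith)).le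
  rw [numLevels]
  push_cast
  linarith

theorem regularization_pos (B : Model m n r) : 0 < B.regularization := by
  have := B.cast_m_pos
  have := B.cast_n_pos
  have := B.σ_pos'
  have := B.maxNorm_pos
  unfold regularization
  positivity

theorem regularization_mul (B : Model m n r) :
    B.regularization * (m * n * maxNorm B.M ^ 2) = (B.σ : ℝ) ^ 2 := by
  have := B.cast_m_pos
  have := B.cast_n_pos
  have := B.maxNorm_pos
  rw [regularization, div_mul_cancel₀ _ (by positivity)]

theorem log_design_le (B : Model m n r) (hT : 1 ≤ T) (hT₂ : T₂ ≤ T) :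
    Real.log (dim m n r + T₂ / B.regularization) ≤ 2 * B.logFactor T := by
  have hm := B.cast_m_pos
  have hn := B.cast_n_pos
  have hσ := B.σ_pos'
  have hMx := B.maxNorm_pos
  have hl := B.one_le_logFactor hT
  have hd := B.one_le_dim
  have hG := B.two_le_logArg hT
  have hTT : (T₂ : ℝ) ≤ T := by exact_mod_cast hT₂
  have h1 : dim m n r ≤ B.logArg T ^ 2 := by
    refine (dim_le m n r).trans ?_
    rw [sq]
    exact mul_le_mul (B.r_le_logArg hT) (B.add_le_logArg hT) (by positivity) (by linarith)
  have h2 : T₂ / B.regularization ≤ B.logArg T ^ 2 := by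
    have e : (T₂ : ℝ) / B.regularization = T₂ * (m * n) * (maxNorm B.M / B.σ) ^ 2 := by
      rw [regularization]; field_simp
    rw [e]
    calc T₂ * (m * n) * (maxNorm B.M / B.σ) ^ 2 ≤ T * (m * n) * (B.L / B.σ) ^ 2 := by
          gcongr; exact B.maxNorm_le_L
      _ = (m * n * T * (B.L / B.σ)) * (B.L / B.σ) := by ring
      _ ≤ B.logArg T * B.logArg T := by
          gcongr
          · exact zero_le_one.trans B.one_le_L_div_σ
          · rw [logArg]; linarith
          · exact B.L_div_σ_le_logArg hT
      _ = _ := by ring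
  have h3 : dim m n r + T₂ / B.regularization ≤ B.logArg T ^ 3 := by
    calc _ ≤ 2 * B.logArg T ^ 2 := by linarith
      _ ≤ B.logArg T * B.logArg T ^ 2 := by gcongr
      _ = _ := by ring
  have hreg := B.regularization_pos
  have h4 := B.log_le_logFactor hT (j := 3) (by positivity) h3
  push_cast at h4
  linarith

/-- The confidence radius in the threshold. -/
def radius (m n r T T₂ : ℕ) : ℝ :=
  √(2 * Real.log (T₂ * n * T * max 1 ⌈Real.log (T₂ / dim m n r) / 2⌉₊))

theorem one_le_radius_arg (B : Model m n r) (hT : 1 ≤ T) (hT₂ : 1 ≤ T₂) :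
    (1 : ℝ) ≤ T₂ * n * T ∧ (T₂ : ℝ) * n * T ≤
      T₂ * n * T * max 1 ⌈Real.log (T₂ / dim m n r) / 2⌉₊ := by
  have h1 : (1 : ℝ) ≤ T := by exact_mod_cast hT
  have h2 : (1 : ℝ) ≤ T₂ := by exact_mod_cast hT₂
  exact ⟨one_le_mul_of_one_le_of_one_le (one_le_mul_of_one_le_of_one_le h2 B.one_le_cast_n) h1,
    le_mul_of_one_le_right (by positivity) (by exact_mod_cast le_max_left _ _)⟩

theorem radius_le (B : Model m n r) (hT : 1 ≤ T) (hT₂ : 1 ≤ T₂) (hle : T₂ ≤ T) :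
    radius m n r T T₂ ≤ 2 * B.logFactor T := by
  have hl := B.one_le_logFactor hT
  have hd := B.one_le_dim
  have hG := B.two_le_logArg hT
  have hT' : (1 : ℝ) ≤ T := by exact_mod_cast hT
  have hTT : (T₂ : ℝ) ≤ T := by exact_mod_cast hle
  obtain ⟨h0, h0'⟩ := B.one_le_radius_arg hT hT₂
  have h1 : max 1 ⌈Real.log (T₂ / dim m n r) / 2⌉₊ ≤ T := by
    refine max_le hT ?_
    have h2 : Real.log (T₂ / dim m n r) ≤ T :=
      (Real.log_le_self (by positivity)).trans ((div_le_self (Nat.cast_nonneg _) hd).trans hTT)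
    exact Nat.ceil_le.2 (by linarith)
  have h2 : (T₂ : ℝ) * n * T * max 1 ⌈Real.log (T₂ / dim m n r) / 2⌉₊ ≤ B.logArg T ^ 3 := by
    calc (T₂ : ℝ) * n * T * max 1 ⌈Real.log (T₂ / dim m n r) / 2⌉₊ ≤ T * n * T * T := by gcongr
      _ = (n * T) * T * T := by ring
      _ ≤ B.logArg T * B.logArg T * B.logArg T := by
          gcongr
          exacts [B.n_mul_T_le_logArg, B.T_le_logArg, B.T_le_logArg]
      _ = _ := by ring
  have h3 := B.log_le_logFactor hT (j := 3) (by linarith) h2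
  rw [Nat.cast_ofNat] at h3
  rw [radius]
  refine Real.sqrt_le_iff.2 ⟨by linarith, ?_⟩
  nlinarith

/-- The factors `T₂ * n` pay for the union over rounds and arms; the remaining `1 / T` pays for a
regret of the order of the horizon on failure. -/
theorem exp_radius_le (B : Model m n r) (hT : 1 ≤ T) (hT₂ : 1 ≤ T₂) :
    Real.exp (-(radius m n r T T₂ ^ 2 / 2)) ≤ (T₂ * n * T : ℝ)⁻¹ := by
  obtain ⟨h0, h1⟩ := B.one_le_radius_arg hT hT₂
  have h2 := Real.log_nonneg (h0.trans h1)
  rw [radius, Real.sq_sqrt (by positivity), mul_div_cancel_left₀ _ (by norm_num), Real.exp_neg,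
    Real.exp_log (by linarith)]
  exact inv_anti₀ (by linarith) h1

theorem exp_neg_logFactor_le (B : Model m n r) (hT : 1 ≤ T) :
    T * (((m : ℝ) + n) * ((4 * r + 2) * Real.exp (-(4 * B.logFactor T)))) ≤ 6 := by
  have hG := B.two_le_logArg hT
  -- `4 * logFactor` is eight times the logarithm of `logArg`; a third power would already suffice.
  have h1 : Real.exp (-(4 * B.logFactor T)) = (B.logArg T ^ 8)⁻¹ := by
    rw [logFactor, Real.exp_neg]
    congr 1
    have : 4 * (2 * Real.log (B.logArg T)) = (8 : ℕ) * Real.log (B.logArg T) := by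
      push_cast; ring
    rw [this, Real.exp_nat_mul, Real.exp_log (by linarith)]
  have hr := B.one_le_r
  rw [h1, ← mul_assoc, ← mul_assoc, ← div_eq_mul_inv, div_le_iff₀ (by positivity)]
  calc T * ((m : ℝ) + n) * (4 * r + 2) ≤ B.logArg T * B.logArg T * (6 * B.logArg T) := by
        gcongr
        · exact B.T_le_logArg
        · exact B.add_le_logArg hT
        · linarith [B.r_le_logArg hT]
    _ = 6 * B.logArg T ^ 3 := by ring
    _ ≤ 6 * B.logArg T ^ 8 := by
        gcongr
        · linarith
        · norm_num

theorem log_context_nonneg (B : Model m n r) (hT : 1 ≤ T) :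
    Real.log 2 ≤ Real.log (1 + m * n * T) ∧
      Real.log 2 ≤ Real.log (T * ((m : ℝ) + n) * (B.L ^ 2 / (B.σ : ℝ) ^ 2)) := by
  have hT' : (1 : ℝ) ≤ T := by exact_mod_cast hT
  have hm := B.one_le_cast_m
  have hn := B.one_le_cast_n
  refine ⟨Real.log_le_log (by norm_num) ?_, Real.log_le_log (by norm_num) ?_⟩
  · linarith [one_le_mul_of_one_le_of_one_le (one_le_mul_of_one_le_of_one_le hm hn) hT']
  · have h1 : 1 ≤ B.L ^ 2 / (B.σ : ℝ) ^ 2 := by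
      rw [← div_pow]; exact one_le_pow₀ B.one_le_L_div_σ
    calc (2 : ℝ) = 1 * 2 * 1 := by norm_num
      _ ≤ _ := by gcongr; linarith

/-- The factor by which the exploration length exceeds its leading term. -/
def explorationLog (B : Model m n r) (T : ℕ) : ℝ :=
  4 * (Real.log (1 + m * n * T) ^ (3 / 2 : ℝ) *
    Real.log (T * ((m : ℝ) + n) * (B.L ^ 2 / (B.σ : ℝ) ^ 2)))

theorem explorationLength_eq (B : Model m n r) (T : ℕ) : B.explorationLength 4 T =
    min T ⌈B.rate / maxNorm B.M * √T * B.explorationLog T⌉₊ := by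
  rw [explorationLength, explorationLog]
  congr 2
  ring

theorem one_le_explorationLog (B : Model m n r) (hT : 1 ≤ T) : 1 ≤ B.explorationLog T := by
  obtain ⟨h1, h2⟩ := B.log_context_nonneg hT
  have h3 := Real.log_two_gt_d9
  have h4 := Real.log_two_lt_d9
  -- Since `log 2 < 1`, raising the exponent from `3 / 2` to `2` gives a lower bound. The choice `c
  -- = 4` makes the product exceed `4 · 0.69³ > 1`.
  have h5 : Real.log 2 ^ 2 ≤ Real.log (1 + m * n * T) ^ (3 / 2 : ℝ) := by
    calc Real.log 2 ^ 2 = Real.log 2 ^ (2 : ℝ) := by norm_cast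
      _ ≤ Real.log 2 ^ (3 / 2 : ℝ) :=
        Real.rpow_le_rpow_of_exponent_ge (by linarith) (by linarith) (by norm_num)
      _ ≤ _ := Real.rpow_le_rpow (by linarith) h1 (by norm_num)
  rw [explorationLog]
  have h6 : Real.log 2 ^ 2 * Real.log 2 ≤ Real.log (1 + m * n * T) ^ (3 / 2 : ℝ) *
    Real.log (T * ((m : ℝ) + n) * (B.L ^ 2 / (B.σ : ℝ) ^ 2)) :=
    mul_le_mul h5 h2 (by linarith) ((sq_nonneg _).trans h5)
  have h7 : (0.69 : ℝ) ^ 2 * 0.69 ≤ Real.log 2 ^ 2 * Real.log 2 := by gcongr <;> linarith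
  norm_num at h7
  linarith

theorem explorationLog_le (B : Model m n r) (hT : 1 ≤ T) :
    B.explorationLog T ≤ 8 * B.logFactor T ^ 3 := by
  obtain ⟨h1, h2⟩ := B.log_context_nonneg hT
  have h3 := Real.log_two_gt_d9
  have hl := B.one_le_logFactor hT
  have hG := B.two_le_logArg hT
  have h4 : Real.log (1 + m * n * T) ^ (3 / 2 : ℝ) ≤ B.logFactor T ^ 2 := by
    have h5 : Real.log (1 + m * n * T) ≤ B.logFactor T := by
      have := B.log_le_logFactor hT (j := 1) (x := 1 + m * n * T) (by positivity)
        (by rw [pow_one]; exact B.one_add_mul_le_logArg)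
      push_cast at this
      linarith
    calc Real.log (1 + m * n * T) ^ (3 / 2 : ℝ) ≤ B.logFactor T ^ (3 / 2 : ℝ) :=
          Real.rpow_le_rpow (by linarith) h5 (by norm_num)
      _ ≤ B.logFactor T ^ (2 : ℝ) := Real.rpow_le_rpow_of_exponent_le hl (by norm_num)
      _ = _ := by norm_cast
  have h5 : Real.log (T * ((m : ℝ) + n) * (B.L ^ 2 / (B.σ : ℝ) ^ 2)) ≤ 2 * B.logFactor T := by
    have h6 : T * ((m : ℝ) + n) * (B.L ^ 2 / (B.σ : ℝ) ^ 2) ≤ B.logArg T ^ 4 := by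
      rw [← div_pow]
      have h7 := B.L_div_σ_le_logArg hT
      have h8 := B.one_le_L_div_σ
      calc T * ((m : ℝ) + n) * (B.L / B.σ) ^ 2 ≤ B.logArg T * B.logArg T * B.logArg T ^ 2 := by
            gcongr
            exacts [B.T_le_logArg, B.add_le_logArg hT]
        _ = _ := by ring
    have := B.log_le_logFactor hT (j := 4) (by positivity) h6
    push_cast at this
    linarith
  calc B.explorationLog T ≤ 4 * (B.logFactor T ^ 2 * (2 * B.logFactor T)) := by
        rw [explorationLog]
        gcongr
        linarith
    _ = _ := by ring

end Model

end LowRankBandit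

end

noncomputable section

namespace LowRankBandit

/-! ### The regret bound -/

namespace Model

variable {m n r T : ℕ} {B : Model m n r} {Ω : Type*} [MeasurableSpace Ω] {P : Measure Ω}
  [IsProbabilityMeasure P] {ctx : ℕ → Ω → Fin m} {expl : ℕ → Ω → Fin n} {ξ : ℕ → Ω → ℝ}
  {svd : Matrix (Fin m) (Fin n) ℝ → Matrix (Fin m) (Fin m) ℝ × Matrix (Fin n) (Fin n) ℝ}
  {sel : Finset (Fin n) → Fin n}

theorem explorationLength_le (B : Model m n r) (c : ℝ) (T : ℕ) : B.explorationLength c T ≤ T :=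
  min_le_left _ _

theorem maxNorm_le_rate_mul_sqrt (B : Model m n r) (hT : 1 ≤ T) :
    maxNorm B.M ≤ B.rate * √T := by
  have hT' : (1 : ℝ) ≤ T := by exact_mod_cast hT
  exact (B.maxNorm_le_L.trans B.L_le_rate).trans
    (le_mul_of_one_le_right B.rate_pos.le (Real.one_le_sqrt.2 hT'))

theorem explorationLength_mul_le (B : Model m n r) (hT : 1 ≤ T) :
    B.explorationLength 4 T * (2 * maxNorm B.M) ≤
      18 * B.logFactor T ^ 3 * (B.rate * √T) := by
  have hMx := B.maxNorm_pos
  have hR := B.rate_pos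
  have hlog := B.explorationLog_le hT
  have hlog1 := B.one_le_explorationLog hT
  have hl : 1 ≤ B.logFactor T ^ 3 := one_le_pow₀ (B.one_le_logFactor hT)
  have hQ := B.maxNorm_le_rate_mul_sqrt hT
  have h1 : (B.explorationLength 4 T : ℝ) ≤
      B.rate / maxNorm B.M * √T * (8 * B.logFactor T ^ 3) + 1 := by
    rw [B.explorationLength_eq]
    have h2 : ((min T ⌈B.rate / maxNorm B.M * √T * B.explorationLog T⌉₊ : ℕ) : ℝ) ≤
        ⌈B.rate / maxNorm B.M * √T * B.explorationLog T⌉₊ := by exact_mod_cast min_le_right _ _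
    refine h2.trans ((Nat.ceil_lt_add_one (by positivity)).le.trans ?_)
    gcongr
  calc B.explorationLength 4 T * (2 * maxNorm B.M)
      ≤ (B.rate / maxNorm B.M * √T * (8 * B.logFactor T ^ 3) + 1) * (2 * maxNorm B.M) := by gcongr
    _ = 16 * B.logFactor T ^ 3 * (B.rate * √T) + 2 * maxNorm B.M := by field_simp; ring
    _ ≤ 16 * B.logFactor T ^ 3 * (B.rate * √T) + 2 * (B.logFactor T ^ 3 * (B.rate * √T)) := by
        gcongr
        exact hQ.trans (le_mul_of_one_le_left (by positivity) hl)
    _ = _ := by ring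

/-- Without truncation `T₁` is at least its leading term, which gives the balance. As `T₁` is below
`T`, this in turn forces `R ≤ ‖M‖_max √T`, so the rate is informative here. -/
theorem le_explorationLength (B : Model m n r) (hT : 1 ≤ T) (h : B.explorationLength 4 T < T) :
    B.rate * √T ≤ maxNorm B.M * B.explorationLength 4 T ∧ B.rate ≤ maxNorm B.M * √T ∧
      B.rate ^ 2 ≤ B.explorationLength 4 T * B.L ^ 2 := by
  have hMx := B.maxNorm_pos
  have hR := B.rate_pos
  have hT' : (0 : ℝ) < T := by exact_mod_cast hT
  have hlog1 := B.one_le_explorationLog hT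
  have h0 : B.explorationLength 4 T = ⌈B.rate / maxNorm B.M * √T * B.explorationLog T⌉₊ := by
    rw [B.explorationLength_eq] at h ⊢
    exact min_eq_right (min_lt_iff.1 h |>.resolve_left (lt_irrefl _)).le
  have h1 : B.rate / maxNorm B.M * √T ≤ B.explorationLength 4 T := by
    rw [h0]
    exact (le_mul_of_one_le_right (by positivity) hlog1).trans (Nat.le_ceil _)
  have h2 : B.rate * √T ≤ maxNorm B.M * B.explorationLength 4 T := by
    rw [div_mul_eq_mul_div, div_le_iff₀ hMx] at h1
    linarith
  have h3 : B.rate ≤ maxNorm B.M * √T := by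
    have h4 : (B.explorationLength 4 T : ℝ) ≤ T := by exact_mod_cast h.le
    have h5 : B.rate * √T ≤ maxNorm B.M * √T * √T := by
      rw [mul_assoc, Real.mul_self_sqrt hT'.le]
      exact h2.trans (by gcongr)
    exact le_of_mul_le_mul_right h5 (by positivity)
  refine ⟨h2, h3, ?_⟩
  calc B.rate ^ 2 = B.rate * B.rate := sq _
    _ ≤ B.rate * (maxNorm B.M * √T) := by gcongr
    _ = maxNorm B.M * (B.rate * √T) := by ring
    _ ≤ maxNorm B.M * (maxNorm B.M * B.explorationLength 4 T) := by gcongr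
    _ = B.explorationLength 4 T * maxNorm B.M ^ 2 := by ring
    _ ≤ B.explorationLength 4 T * B.L ^ 2 := by gcongr; exact B.maxNorm_le_L

theorem regret_arm (c : ℝ) :
    B.regret ctx (B.arm c T svd sel ctx expl ξ) T =
      B.regret ctx (fun t ω => rsRminArm r B.ρ svd sel B.regularization
        (B.threshold T (T - B.explorationLength c T)) (B.explorationLength c T)
        (T - B.explorationLength c T) (fun t => ctx t ω) (fun t => expl t ω)
        (fun t j => B.M (ctx t ω) j + ξ t ω) t)
        (B.explorationLength c T + (T - B.explorationLength c T)) := by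
  rw [Nat.add_sub_cancel' (B.explorationLength_le c T)]
  rfl

theorem integrable_regret_arm (henv : B.Environment P ctx expl ξ) (hsvd : IsSVDRoutine svd)
    (c : ℝ) : Integrable (B.regret ctx (B.arm c T svd sel ctx expl ξ) T) P := by
  rw [regret_arm]
  exact integrable_regret henv hsvd

/-- The misspecification term determines the power of the logarithm: one factor from the number of
levels, one from the amplification, two from `ℓ²` and four from `errLog`. The `18` is reserved for
the exploration phase. -/
theorem exploit_cost_le (B : Model m n r) (hT : 1 ≤ T) {T₁ T₂ J : ℕ} (hT₁ : 1 ≤ T₁)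
    (hT₁T : T₁ ≤ T) (hT₂ : 1 ≤ T₂) (hT₂T : T₂ ≤ T)
    (hJ : J = numLevels (dim m n r) T₂)
    (h1 : B.rate * √T ≤ maxNorm B.M * T₁) (h2 : B.rate ≤ maxNorm B.M * √T) :
    8 * dim m n r * (2 * B.logFactor T) * (2 * maxNorm B.M) +
      8 * J * B.threshold T T₂ * √(2 * dim m n r * (2 * B.logFactor T) * T₂) +
      2 * B.threshold T T₂ * √(dim m n r * T₂) +
      T₂ * (J + 1) * n * (2 * Real.exp (-(radius m n r T T₂ ^ 2 / 2))) *
        (T₂ * (2 * maxNorm B.M)) +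
      2 * J * T₂ * (1 + √(2 * dim m n r * (2 * B.logFactor T))) *
        (7200 * (4 * B.logFactor T) ^ 2 * (B.sMax * B.kappa ^ 2 * B.rowBound ^ 2)) *
        (B.relErr T₁ ^ 2 + errLog m n T₁ * B.relErr T₁ ^ 2) +
      T₂ * (2 * maxNorm B.M) * (errLog m n T₁ * B.relErr T₁ ^ 2 / B.errTol +
        (m + n) * ((4 * r + 2) * Real.exp (-(4 * B.logFactor T)))) ≤
      (10 ^ 11 - 18) * B.logFactor T ^ 8 * (B.rate * √T) := by
  have hTr : (1 : ℝ) ≤ T := by exact_mod_cast hT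
  have hTr0 : (0 : ℝ) < T := by linarith
  have hT₁r : (0 : ℝ) < T₁ := by exact_mod_cast hT₁
  have hT₂r : (0 : ℝ) < T₂ := by exact_mod_cast hT₂
  have hT₂T' : (T₂ : ℝ) ≤ T := by exact_mod_cast hT₂T
  have hMx := B.maxNorm_pos
  have hR := B.rate_pos
  have hL := B.L_pos
  have hσ := B.σ_pos'
  have hn := B.cast_n_pos
  have hm := B.cast_m_pos
  have hr := B.one_le_r
  have hl := B.one_le_logFactor hT
  have hJl : (J : ℝ) ≤ 3 * B.logFactor T := by rw [hJ]; exact B.numLevels_le hT hT₂T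
  have hd := dim_le m n r
  have hd1 := B.one_le_dim
  have hrad := B.radius_le hT hT₂ hT₂T
  have hexp := B.exp_radius_le hT hT₂
  have hexp2 := B.exp_neg_logFactor_le hT
  have hH := B.errLog_le hT₁ hT₁T
  have hH0 := B.errLog_nonneg T₁
  have hβ : B.threshold T T₂ ≤ 3 * B.logFactor T * B.L := by
    have : B.threshold T T₂ = B.σ * (1 + radius m n r T T₂) := rfl
    rw [this]
    calc B.σ * (1 + radius m n r T T₂) ≤ B.L * (B.logFactor T + 2 * B.logFactor T) := by
          gcongr
          · exact add_nonneg zero_le_one (Real.sqrt_nonneg _)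
          · exact B.σ_le_L
      _ = _ := by ring
  have hβ0 : 0 ≤ B.threshold T T₂ :=
    mul_nonneg hσ.le (add_nonneg zero_le_one (Real.sqrt_nonneg _))
  have hQM := B.maxNorm_le_rate_mul_sqrt hT
  have hQL : B.L * √(r * ((m : ℝ) + n)) * √T ≤ B.rate * √T := by
    gcongr; exact B.L_mul_sqrt_le_rate
  have hQd : r * ((m : ℝ) + n) * maxNorm B.M ≤ B.rate * √T := by
    have e1 : r * ((m : ℝ) + n) * maxNorm B.M * maxNorm B.M ≤ B.rate * √T * maxNorm B.M := by
      calc r * ((m : ℝ) + n) * maxNorm B.M * maxNorm B.M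
          = r * ((m : ℝ) + n) * maxNorm B.M ^ 2 := by ring
        _ ≤ r * ((m : ℝ) + n) * B.L ^ 2 := by gcongr; exact B.maxNorm_le_L
        _ ≤ B.rate ^ 2 := B.mul_L_sq_le_rate_sq
        _ = B.rate * B.rate := sq _
        _ ≤ B.rate * (maxNorm B.M * √T) := by gcongr
        _ = _ := by ring
    exact le_of_mul_le_mul_right e1 hMx
  have hs1 := B.sMax_pos
  have hκ := zero_lt_one.trans_le B.one_le_kappa
  have hu := B.rowBound_pos
  have htol := B.errTol_pos
  set A := B.sMax * B.kappa ^ 2 * B.rowBound ^ 2 with hA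
  have hA0 : 0 < A := by positivity
  -- The balance of the phases: the cost `T R² / (‖M‖_max T₁)` is at most `R √T` because `‖M‖_max T₁
  -- ≥ R √T`.
  have hW : T * (A * √(r * ((m : ℝ) + n)) * B.relErr T₁ ^ 2) ≤ B.rate * √T := by
    calc T * (A * √(r * ((m : ℝ) + n)) * B.relErr T₁ ^ 2)
        ≤ T * (B.rate ^ 2 / (maxNorm B.M * T₁)) := by
          gcongr; exact B.misspecification_cost_le hT₁
      _ = (B.rate * √T) * ((B.rate * √T) / (maxNorm B.M * T₁)) := by
          have : √(T : ℝ) * √T = T := Real.mul_self_sqrt hTr0.le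
          nth_rewrite 1 [← this]
          ring
      _ ≤ (B.rate * √T) * 1 := by
          gcongr
          exact (div_le_one (by positivity)).2 h1
      _ = _ := mul_one _
  have hMt := B.maxNorm_div_errTol_le
  rw [← hA] at hMt
  set l := B.logFactor T with hldef
  set Q := B.rate * √T with hQ
  set d := dim m n r with hddef
  set β := B.threshold T T₂ with hβdef
  set N := r * ((m : ℝ) + n) with hN
  set W := A * √N * B.relErr T₁ ^ 2 with hWdef
  set Mx := maxNorm B.M with hMxdef
  set H := errLog m n T₁ with hHdef
  have hQ0 : 0 < Q := by positivity
  have hN1 : 1 ≤ N := hd1.trans hd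
  have hsN : 1 ≤ √N := Real.one_le_sqrt.2 hN1
  have hW0 : 0 ≤ W := by positivity
  have hpow : ∀ j ≤ 8, l ^ j ≤ l ^ 8 := fun j hj => pow_le_pow_right₀ hl hj
  have t1 : 8 * d * (2 * l) * (2 * Mx) ≤ 32 * l ^ 8 * Q := by
    calc 8 * d * (2 * l) * (2 * Mx) = 32 * l * (d * Mx) := by ring
      _ ≤ 32 * l ^ 8 * Q := by
        gcongr
        · simpa using hpow 1 (by norm_num)
        · exact (mul_le_mul_of_nonneg_right hd hMx.le).trans hQd
  have t2 : 8 * J * β * √(2 * d * (2 * l) * T₂) ≤ 144 * l ^ 8 * Q := by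
    have e1 : √(2 * d * (2 * l) * T₂) ≤ 2 * l * (√N * √T) := by
      rw [← Real.sqrt_mul (by positivity)]
      refine Real.sqrt_le_iff.2 ⟨by positivity, ?_⟩
      rw [mul_pow, Real.sq_sqrt (by positivity)]
      calc 2 * d * (2 * l) * T₂ = 4 * l * (d * T₂) := by ring
        _ ≤ 4 * l ^ 2 * (N * T) := by
          gcongr
          exact le_self_pow₀ hl (by norm_num)
        _ = _ := by ring
    calc 8 * J * β * √(2 * d * (2 * l) * T₂)
        ≤ 8 * (3 * l) * (3 * l * B.L) * (2 * l * (√N * √T)) := by gcongr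
      _ = 144 * l ^ 3 * (B.L * √N * √T) := by ring
      _ ≤ 144 * l ^ 8 * Q := by
        gcongr
        norm_num
  have t3 : 2 * β * √(d * T₂) ≤ 6 * l ^ 8 * Q := by
    calc 2 * β * √(d * T₂) ≤ 2 * (3 * l * B.L) * √(N * T) := by gcongr
      _ = 6 * l * (B.L * √N * √T) := by rw [Real.sqrt_mul (by positivity)]; ring
      _ ≤ 6 * l ^ 8 * Q := by
        gcongr
        simpa using hpow 1 (by norm_num)
  have t4 : T₂ * (J + 1) * n * (2 * Real.exp (-(radius m n r T T₂ ^ 2 / 2))) *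
        (T₂ * (2 * Mx)) ≤ 16 * l ^ 8 * Q := by
    calc T₂ * (J + 1) * n * (2 * Real.exp (-(radius m n r T T₂ ^ 2 / 2))) * (T₂ * (2 * Mx))
        ≤ T₂ * (3 * l + l) * n * (2 * (T₂ * n * T : ℝ)⁻¹) * (T₂ * (2 * Mx)) := by gcongr
      _ = 16 * l * (T₂ / T) * Mx := by field_simp; ring
      _ ≤ 16 * l ^ 8 * 1 * Q := by
        gcongr
        · simpa using hpow 1 (by norm_num)
        · exact (div_le_one hTr0).2 hT₂T'
      _ = _ := by ring
  have t5 : 2 * J * T₂ * (1 + √(2 * d * (2 * l))) * (7200 * (4 * l) ^ 2 * A) *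
        (B.relErr T₁ ^ 2 + H * B.relErr T₁ ^ 2) ≤ 57332966400 * l ^ 8 * Q := by
    have e1 : 1 + √(2 * d * (2 * l)) ≤ 3 * l * √N := by
      have e2 : √(2 * d * (2 * l)) ≤ 2 * l * √N := by
        refine Real.sqrt_le_iff.2 ⟨by positivity, ?_⟩
        rw [mul_pow, Real.sq_sqrt (by positivity)]
        calc 2 * d * (2 * l) = 4 * l * d := by ring
          _ ≤ 4 * l ^ 2 * N := by
            gcongr
            exact le_self_pow₀ hl (by norm_num)
          _ = _ := by ring
      have e3 : 1 ≤ l * √N := one_le_mul_of_one_le_of_one_le hl hsN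
      linarith
    have e4 : 1 + H ≤ 27649 * l ^ 4 := by
      have := one_le_pow₀ hl (n := 4)
      linarith
    calc 2 * J * T₂ * (1 + √(2 * d * (2 * l))) * (7200 * (4 * l) ^ 2 * A) *
          (B.relErr T₁ ^ 2 + H * B.relErr T₁ ^ 2)
        = 2 * J * T₂ * (1 + √(2 * d * (2 * l))) * (7200 * (4 * l) ^ 2 * A) *
          ((1 + H) * B.relErr T₁ ^ 2) := by ring
      _ ≤ 2 * (3 * l) * T * (3 * l * √N) * (7200 * (4 * l) ^ 2 * A) *
          (27649 * l ^ 4 * B.relErr T₁ ^ 2) := by gcongr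
      _ = 57332966400 * l ^ 8 * (T * W) := by rw [hWdef]; ring
      _ ≤ _ := by gcongr
  have t6 : T₂ * (2 * Mx) * (H * B.relErr T₁ ^ 2 / B.errTol +
        (m + n) * ((4 * r + 2) * Real.exp (-(4 * l)))) ≤ 226492428 * l ^ 8 * Q := by
    have e1 : 0 ≤ ((m : ℝ) + n) * ((4 * r + 2) * Real.exp (-(4 * l))) := by positivity
    calc T₂ * (2 * Mx) * (H * B.relErr T₁ ^ 2 / B.errTol +
          (m + n) * ((4 * r + 2) * Real.exp (-(4 * l))))
        = 2 * T₂ * H * (Mx / B.errTol) * B.relErr T₁ ^ 2 +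
          2 * Mx * (T₂ * ((m + n) * ((4 * r + 2) * Real.exp (-(4 * l))))) := by ring
      _ ≤ 2 * T * (27648 * l ^ 4) * (4096 * (A * √N)) * B.relErr T₁ ^ 2 +
          2 * Q * (T * ((m + n) * ((4 * r + 2) * Real.exp (-(4 * l))))) := by gcongr
      _ ≤ 2 * T * (27648 * l ^ 4) * (4096 * (A * √N)) * B.relErr T₁ ^ 2 + 2 * Q * 6 := by
          gcongr
      _ = 226492416 * l ^ 4 * (T * W) + 12 * l ^ 0 * Q := by rw [hWdef]; ring
      _ ≤ 226492416 * l ^ 8 * Q + 12 * l ^ 8 * Q := by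
          gcongr <;> norm_num
      _ = _ := by ring
  have hlQ : 0 ≤ l ^ 8 * Q := by positivity
  have e0 : (10 ^ 11 - 18) * l ^ 8 * Q = (10 ^ 11 - 18) * (l ^ 8 * Q) := by ring
  rw [e0]
  linarith

theorem integral_regret_arm_le (henv : B.Environment P ctx expl ξ) (hsvd : IsSVDRoutine svd)
    (hsel : ∀ S : Finset (Fin n), S.Nonempty → sel S ∈ S) (hT : 1 ≤ T) :
    ∫ ω, B.regret ctx (B.arm 4 T svd sel ctx expl ξ) T ω ∂P ≤
      10 ^ 11 * B.logFactor T ^ 8 * (B.rate * √T) := by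
  have hphase := B.explorationLength_mul_le hT
  have hl := B.one_le_logFactor hT
  have hR := B.rate_pos
  have hl38 : B.logFactor T ^ 3 ≤ B.logFactor T ^ 8 := pow_le_pow_right₀ hl (by norm_num)
  have hle := B.explorationLength_le 4 T
  have hphase' : B.explorationLength 4 T * (2 * maxNorm B.M) ≤
      18 * B.logFactor T ^ 8 * (B.rate * √T) := hphase.trans (by gcongr)
  -- If exploration fills the horizon, the trivial regret `2 ‖M‖_max` per round is the exploration
  -- cost already bounded.
  rcases hle.eq_or_lt with hT₁ | hT₁
  · calc ∫ ω, B.regret ctx (B.arm 4 T svd sel ctx expl ξ) T ω ∂P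
        ≤ ∫ _ω, T * (2 * maxNorm B.M) ∂P := by
          refine integral_mono (integrable_regret_arm henv hsvd 4) (integrable_const _) fun ω => ?_
          exact regret_le _ _ _
      _ = T * (2 * maxNorm B.M) := by simp
      _ ≤ 18 * B.logFactor T ^ 8 * (B.rate * √T) := by rw [hT₁] at hphase'; exact hphase'
      _ ≤ _ := by gcongr; norm_num
  · obtain ⟨h1, h2, h3⟩ := B.le_explorationLength hT hT₁
    have hen := B.enough_of_rate_sq_le h3
    have hT₂ : 0 < T - B.explorationLength 4 T := by omega
    rw [regret_arm]
    refine (integral_regret_le henv hsvd hsel hen hT₂ (ℓ := 4 * B.logFactor T)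
      (ℓ' := 2 * B.logFactor T) (s₀ := radius m n r T (T - B.explorationLength 4 T)) rfl rfl
      (by linarith) B.regularization_pos (Real.sqrt_nonneg _) rfl B.regularization_mul.le
      (B.log_design_le hT (Nat.sub_le _ _)) (by linarith)).trans ?_
    have h4 := B.exploit_cost_le hT hen.pos hle hT₂ (Nat.sub_le _ _) rfl h1 h2
    refine (add_le_add hphase' h4).trans (le_of_eq ?_)
    ring

theorem rate_le_of_isHomogeneous {h : ℝ} (hh : B.IsHomogeneous h) :
    B.rate ≤ h ^ 7 * B.L * ((m : ℝ) + n) ^ (3 / 4 : ℝ) := by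
  obtain ⟨hr, hκ, hμ, hmn, hnm, hρ⟩ := hh
  have hm := B.cast_m_pos
  have hn := B.cast_n_pos
  have hr1 := B.one_le_r
  have h1 : 1 ≤ h := hr1.trans hr
  have hk := B.min_pos
  have hρ0 := B.rhoMin_pos
  have hL := B.L_pos
  have hμ0 := zero_lt_one.trans_le B.one_le_mu
  have hκ0 := zero_lt_one.trans_le B.one_le_kappa
  have hN : (((m : ℝ) + n) ^ (3 / 4 : ℝ)) ^ 2 = ((m : ℝ) + n) * √((m : ℝ) + n) := by
    rw [Real.sqrt_eq_rpow, ← Real.rpow_natCast, ← Real.rpow_mul (by positivity)]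
    nth_rewrite 2 [← Real.rpow_one ((m : ℝ) + n)]
    rw [← Real.rpow_add (by positivity)]
    norm_num
  refine abs_le_of_sq_le_sq' ?_ (by positivity) |>.2
  rw [mul_pow, mul_pow, hN, B.rate_sq]
  have hsq : √((m : ℝ) * n) ≤ h * min (m : ℝ) n := by
    refine Real.sqrt_le_iff.2 ⟨by positivity, ?_⟩
    have e1 : (m : ℝ) ≤ h * min (m : ℝ) n := by
      rw [mul_min_of_nonneg _ _ (by linarith)]
      exact le_min (le_mul_of_one_le_left hm.le h1) hmn
    have e2 : (n : ℝ) ≤ h * min (m : ℝ) n := by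
      rw [mul_min_of_nonneg _ _ (by linarith)]
      exact le_min hnm (le_mul_of_one_le_left hn.le h1)
    calc (m : ℝ) * n ≤ (h * min (m : ℝ) n) * (h * min (m : ℝ) n) := by gcongr
      _ = _ := by ring
  have hsr : √(r : ℝ) ≤ h := by
    refine (Real.sqrt_le_sqrt hr).trans (Real.sqrt_le_iff.2 ⟨by linarith, ?_⟩)
    nlinarith
  rw [div_le_iff₀ (by positivity)]
  -- Squares are compared. The first four factors give `h ^ 11`, the bound for `√(mn)` and the one
  -- for `m ρ_min` one power each, and one further power is given away to reach the even exponent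
  -- `14`.
  calc B.mu ^ 4 * B.kappa ^ 4 * (r ^ 2 * √r) * B.L ^ 2 *
        (((m : ℝ) + n) * √((m : ℝ) + n)) * √(m * n)
      ≤ h ^ 4 * h ^ 4 * (h ^ 2 * h) * B.L ^ 2 *
        (((m : ℝ) + n) * √((m : ℝ) + n)) * (h * min (m : ℝ) n) := by gcongr
    _ = h ^ 12 * B.L ^ 2 * (((m : ℝ) + n) * √((m : ℝ) + n)) * min (m : ℝ) n * 1 := by ring
    _ ≤ h ^ 13 * B.L ^ 2 * (((m : ℝ) + n) * √((m : ℝ) + n)) * min (m : ℝ) n *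
        (h * (m * B.rhoMin)) := by
      gcongr
      norm_num
    _ = _ := by ring

end Model

end LowRankBandit

end

/-! ### The main theorem. -/

open LowRankBandit in
theorem mainTheorem2 :
    ∃ (c C : ℝ) (Chom : ℝ → ℝ) (p : ℕ), 0 < c ∧ 0 < C ∧
      ∀ (m n r T : ℕ) (_hT : 1 ≤ T) (B : Model m n r)
        (svd : Matrix (Fin m) (Fin n) ℝ → Matrix (Fin m) (Fin m) ℝ × Matrix (Fin n) (Fin n) ℝ)
        (_hsvd : IsSVDRoutine svd)
        (sel : Finset (Fin n) → Fin n) (_hsel : ∀ S : Finset (Fin n), S.Nonempty → sel S ∈ S)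
        (Ω : Type*) [MeasurableSpace Ω] (P : Measure Ω) [IsProbabilityMeasure P]
        (ctx : ℕ → Ω → Fin m) (expl : ℕ → Ω → Fin n) (ξ : ℕ → Ω → ℝ)
        (_henv : B.Environment P ctx expl ξ),
        Integrable (B.regret ctx (B.arm c T svd sel ctx expl ξ) T) P ∧
        ∫ ω, B.regret ctx (B.arm c T svd sel ctx expl ξ) T ω ∂P ≤
          C * B.rate * √T * Real.log (1 + m * n * T * (B.L / B.σ)) ^ p ∧
        ∀ h : ℝ, B.IsHomogeneous h →
          ∫ ω, B.regret ctx (B.arm c T svd sel ctx expl ξ) T ω ∂P ≤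
            Chom h * B.L * ((m : ℝ) + n) ^ (3 / 4 : ℝ) * √T *
              Real.log (1 + m * n * T * (B.L / B.σ)) ^ p := by
  -- The eighth power of `logFactor` is `2 ^ 8` times that of the logarithm, which fixes `p = 8` and
  -- the factor `2 ^ 8`.
  refine ⟨4, 2 ^ 8 * 10 ^ 11, fun h => 2 ^ 8 * 10 ^ 11 * h ^ 7, 8, by norm_num, by norm_num, ?_⟩
  intro m n r T hT B svd hsvd sel hsel Ω _ P _ ctx expl ξ henv
  have hlog : 0 ≤ Real.log (1 + m * n * T * (B.L / B.σ)) :=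
    Real.log_nonneg (one_le_two.trans (B.two_le_logArg hT))
  have h1 : ∫ ω, B.regret ctx (B.arm 4 T svd sel ctx expl ξ) T ω ∂P ≤
      2 ^ 8 * 10 ^ 11 * B.rate * √T * Real.log (1 + m * n * T * (B.L / B.σ)) ^ 8 := by
    refine (Model.integral_regret_arm_le henv hsvd hsel hT).trans (le_of_eq ?_)
    rw [Model.logFactor, Model.logArg]
    ring
  refine ⟨Model.integrable_regret_arm henv hsvd 4, h1, fun h hh => h1.trans ?_⟩
  have h2 := Model.rate_le_of_isHomogeneous hh
  calc 2 ^ 8 * 10 ^ 11 * B.rate * √T * Real.log (1 + m * n * T * (B.L / B.σ)) ^ 8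
      ≤ 2 ^ 8 * 10 ^ 11 * (h ^ 7 * B.L * ((m : ℝ) + n) ^ (3 / 4 : ℝ)) * √T *
        Real.log (1 + m * n * T * (B.L / B.σ)) ^ 8 := by gcongr
    _ = _ := by ring
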